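/- **Setting.** Let $\mathrm{Cob}_\bullet$ be Bar-Natan's dotted cobordism category for crossingless diagrams in a disc with a fixed finite set of endpoints. Its objects are shifted diagrams $c\{m\}$, $m\in\mathbb Z$. Its morphisms $c\{m\}\to c'\{m'\}$ are the formal $\mathbb Z$-linear combinations of dotted cobordisms $f$ of degree $\chi(f)-2\#\mathrm{dots}(f)-N+m'-m=0$, where $2N$ is the number of endpoints, modulo the relations: a sphere without dots is $0$; a sphere with one dot is $1$; two dots on one component give $0$; and cutting a neck replaces a surface by the sum of the two surfaces that carry one additional dot on one of the two ends of the cut neck. **The complex.** Let $B=(\sigma_1\sigma_2\sigma_3)^n$ be the negative braid word on $4$ strands with $3n$ crossings, one in each of the layers $1,\dots,3n$, counted from bottom to top. The $0$-smoothing of a crossing is a cap below a cup, and the $1$-smoothing is two vertical strands. The delooped Bar-Natan complex $\Psi[\![B]\!]$ has as cells the pairs $a=(s,K)$ consisting of a smoothing $s\in\{0,1\}^{3n}$ and a subset $K$ of the set $L$ of loops of the smoothed diagram; the loops in $K$ are called red, the others blue. The summand of $a$ is the smoothed diagram with its loops removed, with quantum shift $\#\{l: s_l=1\}-6n+\#K-\#(L\setminus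 K)$. The matrix elements are those of $\Psi d\Psi^{-1}$. Here $d$ is the hypercube differential: for smoothings that differ only in that layer $l$ changes from $0$ to $1$, it is the saddle with sign $(-1)^{\#\{j<l\,:\,s_j=1\}}$, and otherwise it is $0$. The delooping isomorphism $\Psi$ caps red loops with dotted discs and blue loops with undotted discs; its inverse $\Psi^{-1}$ creates red loops by undotted discs and blue loops by dotted discs. **Morse matchings.** Let $G$ be the directed graph whose vertices are the cells and whose edges are the nonzero matrix elements. A set $M$ of edges of $G$ is a *Morse matching* if $M$ is finite, its edges are pairwise non-adjacent, the matrix element of every edge in $M$ is an isomorphism in $\mathrm{Cob}_\bullet$, and the graph obtained from $G$ by reversing the edges in $M$ has no directed cycles. **The greedy matching.** For an edge $a\to b$ let $i(a\to b)$ be the index of the layer that changes. For a loop $\ell$ let $\max(\ell)$ be the index of the highest layer containing a piece of $\ell$. For an isomorphism edge $a\to b$ let $u(a\to b)$ be the minimum of $\max(\ell)$ over the red loops $\ell$ of $a$ that are merged with another component by $a\to b$ and the blue loops $\ell$ of $b$ that are split off from another component by $a\to b$ (there is at least one such loop). One has $i(a\to b)\le u(a\to b)$. Let $A_{j,k}$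 be the set of isomorphism edges with $i=j$ and $u=k$. Define recursively $M_{j,k}$ as the set of those $(a\to b)\in A_{j,k}$ for which neither $a$ nor $b$ is an end of an edge in any $M_{l,m}$ with $m<k$, or with $m=k$ and $l>j$. The *greedy matching* is $M_{\mathrm{gr}}=\bigcup_{j,k}M_{j,k}$. **Proposition.** For every integer $n\ge 0$, the greedy matching $M_{\mathrm{gr}}$ is a Morse matching on $\Psi[\![(\sigma_1\sigma_2\sigma_3)^n]\!]$. -/

import Mathlib

noncomputable section

namespace BarNatan

/-! ### Crossingless diagrams and dotted cobordisms

A crossingless planar diagram with endpoint set `P` enters only through the set of its connected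
components and the component at which every endpoint lies. A component that carries an endpoint
is an arc, any other component is a loop. -/

structure Diagram (P : Type) where
  comp : Type
  [finite : Finite comp]
  endpt : P → comp

attribute [instance] Diagram.finite

variable {P : Type}

namespace Diagram

def IsLoop (X : Diagram P) (c : X.comp) : Prop := c ∉ Set.range X.endpt

/-- The diagram with all its loops removed. -/
def deloop (X : Diagram P) : Diagram P where
  comp := {c : X.comp // ¬ X.IsLoop c}
  endpt p := ⟨X.endpt p, fun h => h ⟨p, rfl⟩⟩

/-- The number of arcs, that is, half the number of endpoints. -/
def numArcs (X : Diagram P) : ℕ := (Set.range X.endpt).ncard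

/-- Two components of `X` and `Y` are related if they lie on the same circle of the closed
1-manifold `X ∪ (P × [0,1]) ∪ Y`, the boundary of every cobordism from `X` to `Y`. -/
def circles (X Y : Diagram P) : Setoid (X.comp ⊕ Y.comp) :=
  Relation.EqvGen.setoid fun a b => ∃ p, a = Sum.inl (X.endpt p) ∧ b = Sum.inr (Y.endpt p)

end Diagram

/-- A compact oriented dotted surface with boundary `X ∪ (P × [0,1]) ∪ Y`, up to homeomorphism
relative to the boundary (and up to moving dots within a component). `conn` tells which components
of `X` and `Y` lie on the same connected component of the surface; `genus` and `dots` are the genus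
of, and the number of dots on, the connected component on which a component of `X` or `Y` lies;
`closed` lists the pairs (genus, number of dots) of the connected components without boundary. -/
@[ext]
structure Surface (X Y : Diagram P) where
  conn : Setoid (X.comp ⊕ Y.comp)
  wall : ∀ p, conn (Sum.inl (X.endpt p)) (Sum.inr (Y.endpt p))
  genus : X.comp ⊕ Y.comp → ℕ
  genus_congr : ∀ a b, conn a b → genus a = genus b
  dots : X.comp ⊕ Y.comp → ℕ
  dots_congr : ∀ a b, conn a b → dots a = dots b
  closed : Multiset (ℕ × ℕ)

namespace Surface

variable {X Y Z : Diagram P}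

/-- The number of boundary circles that meet the given set of components of `X` and `Y`. -/
def numCircles (X Y : Diagram P) (A : Set (X.comp ⊕ Y.comp)) : ℕ :=
  ((fun a => Quotient.mk (Diagram.circles X Y) a) '' A).ncard

/-- The Euler characteristic `2 - 2g - b` of the connected component on which `a` lies. -/
def chi (S : Surface X Y) (a : X.comp ⊕ Y.comp) : ℤ :=
  2 - 2 * (S.genus a : ℤ) - (numCircles X Y {x | S.conn a x} : ℤ)

/-- The Euler characteristic of the surface. -/
def totalChi (S : Surface X Y) : ℤ :=
  (∑ᶠ q : Quotient S.conn, S.chi q.out) + (S.closed.map fun c => 2 - 2 * (c.1 : ℤ)).sum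

/-- The number of dots on the surface. -/
def totalDots (S : Surface X Y) : ℕ :=
  (∑ᶠ q : Quotient S.conn, S.dots q.out) + (S.closed.map fun c => c.2).sum

/-- The degree of the surface as a morphism `X{m} → Y{m'}`. -/
def degree (S : Surface X Y) (m m' : ℤ) : ℤ :=
  S.totalChi - 2 * (S.totalDots : ℤ) - (X.numArcs : ℤ) + m' - m

/-- The cylinder `X × [0,1]`. -/
def cylinder (X : Diagram P) : Surface X X where
  conn := Setoid.ker (Sum.elim id id)
  wall _ := rfl
  genus _ := 0
  genus_congr _ _ _ := rfl
  dots _ := 0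
  dots_congr _ _ _ := rfl
  closed := 0

/-- The cylinder over the arcs of `X` with a disc capping off every loop of `X`; the components in
`B` carry a dot. -/
def capOff (X : Diagram P) (B : Set X.comp) : Surface X X.deloop where
  conn := Setoid.ker (Sum.elim id Subtype.val)
  wall _ := rfl
  genus _ := 0
  genus_congr _ _ _ := rfl
  dots x := B.indicator 1 (Sum.elim id Subtype.val x : X.comp)
  dots_congr _ _ h := congrArg (B.indicator 1) h
  closed := 0

/-- The surface of `capOff`, upside down. -/
def cupOn (X : Diagram P) (B : Set X.comp) : Surface X.deloop X where
  conn := Setoid.ker (Sum.elim Subtype.val id)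
  wall _ := rfl
  genus _ := 0
  genus_congr _ _ _ := rfl
  dots x := B.indicator 1 (Sum.elim Subtype.val id x : X.comp)
  dots_congr _ _ h := congrArg (B.indicator 1) h
  closed := 0

/-! #### Gluing `S : X → Y` and `T : Y → Z` along `Y` -/

/-- Two components of `X`, `Y`, `Z` are related if they lie on the same connected component of
the surface glued from `S` and `T`. -/
def glue (S : Surface X Y) (T : Surface Y Z) : Setoid (X.comp ⊕ (Y.comp ⊕ Z.comp)) :=
  Relation.EqvGen.setoid fun u v =>
    (∃ a b, S.conn a b ∧ u = Sum.map id Sum.inl a ∧ v = Sum.map id Sum.inl b) ∨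
    (∃ a b, T.conn a b ∧ u = Sum.inr a ∧ v = Sum.inr b)

open Classical in
/-- The number of dots on the connected component of `v` in the glued surface. -/
def glueDots (S : Surface X Y) (T : Surface Y Z) (v : X.comp ⊕ (Y.comp ⊕ Z.comp)) : ℕ :=
  (∑ᶠ q : Quotient S.conn, if glue S T (Sum.map id Sum.inl q.out) v then S.dots q.out else 0) +
  (∑ᶠ q : Quotient T.conn, if glue S T (Sum.inr q.out) v then T.dots q.out else 0)

open Classical in
/-- The Euler characteristic of the connected component of `v` in the glued surface: the sum of
the Euler characteristics of its parts, less that of the part of `Y` along which they are glued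
(`1` for an arc, `0` for a loop). -/
def glueChi (S : Surface X Y) (T : Surface Y Z) (v : X.comp ⊕ (Y.comp ⊕ Z.comp)) : ℤ :=
  (∑ᶠ q : Quotient S.conn, if glue S T (Sum.map id Sum.inl q.out) v then S.chi q.out else 0) +
  (∑ᶠ q : Quotient T.conn, if glue S T (Sum.inr q.out) v then T.chi q.out else 0) -
  ({y : Y.comp | ¬ Y.IsLoop y ∧ glue S T (Sum.inr (Sum.inl y)) v}.ncard : ℤ)

/-- The genus of the connected component of `v` in the glued surface, from `χ = 2 - 2g - b`. -/
def glueGenus (S : Surface X Y) (T : Surface Y Z) (v : X.comp ⊕ (Y.comp ⊕ Z.comp)) : ℕ :=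
  ((2 - (numCircles X Z {x | glue S T (Sum.map id Sum.inr x) v} : ℤ) - glueChi S T v) / 2).toNat

theorem glue_congr (S : Surface X Y) (T : Surface Y Z) {v v' : X.comp ⊕ (Y.comp ⊕ Z.comp)}
    (h : glue S T v v') (u) : glue S T u v ↔ glue S T u v' :=
  ⟨fun k => (glue S T).trans k h, fun k => (glue S T).trans k ((glue S T).symm h)⟩

open Classical in
/-- The composite of `S` and `T` (first `S`, then `T`). -/
def comp (S : Surface X Y) (T : Surface Y Z) : Surface X Z where
  conn := (glue S T).comap (Sum.map id Sum.inr)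
  wall p := (glue S T).trans
    (Relation.EqvGen.rel _ _ (Or.inl ⟨_, _, S.wall p, rfl, rfl⟩))
    (Relation.EqvGen.rel _ _ (Or.inr ⟨_, _, T.wall p, rfl, rfl⟩))
  genus x := glueGenus S T (Sum.map id Sum.inr x)
  genus_congr a b h := by
    simp only [glueGenus, glueChi, glue_congr S T (Setoid.comap_rel _ _ a b |>.1 h)]
  dots x := glueDots S T (Sum.map id Sum.inr x)
  dots_congr a b h := by
    simp only [glueDots, glue_congr S T (Setoid.comap_rel _ _ a b |>.1 h)]
  closed := S.closed + T.closed +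
    ∑ᶠ q : Quotient (glue S T),
      if ∃ x, glue S T (Sum.map id Sum.inr x) q.out then 0
      else {(glueGenus S T q.out, glueDots S T q.out)}

/-! #### Modifications of a surface, used to state the local relations -/

open Classical in
/-- Add `g` handles and `d` dots to the connected component of `a`. -/
def add (S : Surface X Y) (a : X.comp ⊕ Y.comp) (g d : ℕ) : Surface X Y where
  conn := S.conn
  wall := S.wall
  genus x := S.genus x + if S.conn a x then g else 0
  genus_congr x y h := by
    have : S.conn a x ↔ S.conn a y :=
      ⟨fun k => S.conn.trans k h, fun k => S.conn.trans k (S.conn.symm h)⟩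
    simp only [S.genus_congr x y h, this]
  dots x := S.dots x + if S.conn a x then d else 0
  dots_congr x y h := by
    have : S.conn a x ↔ S.conn a y :=
      ⟨fun k => S.conn.trans k h, fun k => S.conn.trans k (S.conn.symm h)⟩
    simp only [S.dots_congr x y h, this]
  closed := S.closed

/-- Add a closed connected component of genus `g` with `d` dots. -/
def addClosed (S : Surface X Y) (g d : ℕ) : Surface X Y :=
  { S with closed := (g, d) ::ₘ S.closed }

open Classical in
/-- Join the two distinct connected components of `a` and `b` by a tube. -/
def tube (S : Surface X Y) (a b : X.comp ⊕ Y.comp) : Surface X Y where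
  conn :=
    { r := fun x y => S.conn x y ∨
        ((S.conn a x ∨ S.conn b x) ∧ (S.conn a y ∨ S.conn b y))
      iseqv :=
        { refl := fun x => Or.inl (S.conn.refl x)
          symm := fun h => h.imp S.conn.symm And.symm
          trans := by
            rintro x y z (h | ⟨h, h'⟩) (k | ⟨k, k'⟩)
            · exact Or.inl (S.conn.trans h k)
            · exact Or.inr ⟨k.imp (fun t => S.conn.trans t (S.conn.symm h))
                (fun t => S.conn.trans t (S.conn.symm h)), k'⟩
            · exact Or.inr ⟨h, h'.imp (fun t => S.conn.trans t k) (fun t => S.conn.trans t k)⟩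
            · exact Or.inr ⟨h, k'⟩ } }
  wall p := Or.inl (S.wall p)
  genus x := if S.conn a x ∨ S.conn b x then S.genus a + S.genus b else S.genus x
  genus_congr x y h := by
    rcases h with h | ⟨h, h'⟩
    · have ha : S.conn a x ↔ S.conn a y :=
        ⟨fun k => S.conn.trans k h, fun k => S.conn.trans k (S.conn.symm h)⟩
      have hb : S.conn b x ↔ S.conn b y :=
        ⟨fun k => S.conn.trans k h, fun k => S.conn.trans k (S.conn.symm h)⟩
      simp only [S.genus_congr x y h, ha, hb]
    · simp only [h, h', if_true]
  dots x := if S.conn a x ∨ S.conn b x then S.dots a + S.dots b else S.dots x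
  dots_congr x y h := by
    rcases h with h | ⟨h, h'⟩
    · have ha : S.conn a x ↔ S.conn a y :=
        ⟨fun k => S.conn.trans k h, fun k => S.conn.trans k (S.conn.symm h)⟩
      have hb : S.conn b x ↔ S.conn b y :=
        ⟨fun k => S.conn.trans k h, fun k => S.conn.trans k (S.conn.symm h)⟩
      simp only [S.dots_congr x y h, ha, hb]
    · simp only [h, h', if_true]
  closed := S.closed

end Surface

/-! ### Formal sums of dotted cobordisms modulo the dotted relations -/

/-- Formal integer combinations of dotted cobordisms from `X` to `Y`. -/
abbrev Hom (X Y : Diagram P) : Type := Surface X Y →₀ ℤ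

/-- The cobordism `S`, as a formal sum. -/
abbrev Surface.toHom {X Y : Diagram P} (S : Surface X Y) : Hom X Y := Finsupp.single S 1

/-- The elements of `Hom X Y` that the dotted relations declare to be zero: a sphere without dots
is `0`, a sphere with one dot is `1`, two dots on a component give `0`, and a neck may be cut at
the price of a dot on either of its ends in turn. The neck is the tube joining two points of
another surface; each of the two points may lie on a component with boundary or on a closed one,
and they may lie on the same component. -/
inductive DottedRelation {X Y : Diagram P} : Hom X Y → Prop
  | sphere (S : Surface X Y) : DottedRelation (S.addClosed 0 0).toHom
  | dottedSphere (S : Surface X Y) : DottedRelation ((S.addClosed 0 1).toHom - S.toHom)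
  | twoDots (S : Surface X Y) (a) : DottedRelation (S.add a 0 2).toHom
  | twoDotsClosed (S : Surface X Y) (g d : ℕ) : DottedRelation (S.addClosed g (d + 2)).toHom
  | neckSelf (S : Surface X Y) (a) :
      DottedRelation ((S.add a 1 0).toHom - ((S.add a 0 1).toHom + (S.add a 0 1).toHom))
  | neck (S : Surface X Y) (a b) (h : ¬ S.conn a b) :
      DottedRelation ((S.tube a b).toHom - ((S.add a 0 1).toHom + (S.add b 0 1).toHom))
  | neckClosed (S : Surface X Y) (a) (g d : ℕ) :
      DottedRelation ((S.add a g d).toHom -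
        (((S.add a 0 1).addClosed g d).toHom + (S.addClosed g (d + 1)).toHom))
  | neckClosedSelf (S : Surface X Y) (g d : ℕ) :
      DottedRelation ((S.addClosed (g + 1) d).toHom -
        ((S.addClosed g (d + 1)).toHom + (S.addClosed g (d + 1)).toHom))
  | neckClosedClosed (S : Surface X Y) (g d g' d' : ℕ) :
      DottedRelation ((S.addClosed (g + g') (d + d')).toHom -
        (((S.addClosed g (d + 1)).addClosed g' d').toHom +
          ((S.addClosed g d).addClosed g' (d' + 1)).toHom))

namespace Hom

variable {X Y Z : Diagram P}

/-- Equality of morphisms of the dotted cobordism category. -/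
def Eqv (f g : Hom X Y) : Prop := f - g ∈ AddSubgroup.closure {r : Hom X Y | DottedRelation r}

/-- The bilinear extension of the gluing of cobordisms (first `f`, then `g`). -/
def comp (f : Hom X Y) (g : Hom Y Z) : Hom X Z :=
  f.sum fun S m => g.sum fun T n => Finsupp.single (S.comp T) (m * n)

/-- `f`, a morphism `X{m} → Y{m'}` of degree `0`, has a two-sided inverse of degree `0`. -/
def IsIsomorphism (m m' : ℤ) (f : Hom X Y) : Prop :=
  (∀ S ∈ f.support, S.degree m m' = 0) ∧
  ∃ g : Hom Y X, (∀ T ∈ g.support, T.degree m' m = 0) ∧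
    Eqv (comp f g) (Surface.cylinder X).toHom ∧ Eqv (comp g f) (Surface.cylinder Y).toHom

end Hom

/-! ### Morse matchings

A based complex is given by its set `V` of cells, by the summand `obj a {shift a}` for every cell
`a`, and by its matrix elements `d a b`. -/

section Morse

variable {V : Type} {obj : V → Diagram P} (shift : V → ℤ) (d : ∀ a b, Hom (obj a) (obj b))

/-- `a → b` is an edge of the graph of the based complex. -/
def IsEdge (a b : V) : Prop := ¬ (d a b).Eqv 0

/-- `a → b` is an edge of the graph in which the edges that belong to `M` are reversed. -/
def MorseStep (M : Set (V × V)) (a b : V) : Prop :=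
  (IsEdge d a b ∧ (a, b) ∉ M) ∨ (b, a) ∈ M

def Adjacent (e f : V × V) : Prop :=
  e.1 = f.1 ∨ e.1 = f.2 ∨ e.2 = f.1 ∨ e.2 = f.2

structure IsMorseMatching (M : Set (V × V)) : Prop where
  edges : ∀ e ∈ M, IsEdge d e.1 e.2
  finite : M.Finite
  matching : ∀ e ∈ M, ∀ f ∈ M, e ≠ f → ¬ Adjacent e f
  iso : ∀ e ∈ M, (d e.1 e.2).IsIsomorphism (shift e.1) (shift e.2)
  acyclic : ∀ a, ¬ Relation.TransGen (MorseStep d M) a a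

end Morse

/-! ### The delooped complex of a negative braid word

`w` is a negative braid word on `r + 1` strands, read from bottom to top; the letter `i` is the
generator crossing the strands in the positions `i` and `i + 1` (counted from `0`). Layer `l`
lies between the levels `l` and `l + 1`. -/

section Braid

variable {r : ℕ} (w : List (Fin r))

/-- The points in which the strands meet the levels `0, …, w.length`. -/
abbrev Point : Type := Fin (w.length + 1) × Fin (r + 1)

/-- The value `true` is the 1-smoothing (two vertical lines), `false` the 0-smoothing (a cap
below a cup). -/
abbrev Smoothing : Type := Fin w.length → Bool

/-- The segments of the smoothed diagram. -/
inductive Segment (s : Smoothing w) : Point w → Point w → Prop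
  | line (l : Fin w.length) (j : Fin (r + 1))
      (h : s l = true ∨ (j ≠ (w.get l).castSucc ∧ j ≠ (w.get l).succ)) :
      Segment s (l.castSucc, j) (l.succ, j)
  | cap (l : Fin w.length) (h : s l = false) :
      Segment s (l.castSucc, (w.get l).castSucc) (l.castSucc, (w.get l).succ)
  | cup (l : Fin w.length) (h : s l = false) :
      Segment s (l.succ, (w.get l).castSucc) (l.succ, (w.get l).succ)

/-- The smoothed diagram; the endpoints are the `r + 1` points at the bottom (`Sum.inl`) and the
`r + 1` points at the top (`Sum.inr`). -/
def smooth (s : Smoothing w) : Diagram (Fin (r + 1) ⊕ Fin (r + 1)) where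
  comp := Quotient (Relation.EqvGen.setoid (Segment w s))
  endpt := Sum.elim (fun j => Quotient.mk _ (0, j)) (fun j => Quotient.mk _ (Fin.last _, j))

/-- The component of the smoothed diagram through a point. -/
def compAt (s : Smoothing w) (v : Point w) : (smooth w s).comp :=
  Quotient.mk (Relation.EqvGen.setoid (Segment w s)) v

/-- `s'` arises from `s` by changing the 0-smoothing of layer `l` to the 1-smoothing. -/
def Raises (s s' : Smoothing w) (l : Fin w.length) : Prop :=
  s l = false ∧ s' = Function.update s l true

/-- For smoothings that differ in one layer, the simplest saddle: the product cobordism outside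
that layer, and a saddle in it, which lies on a single component with the four corners of the
layer. Every component has genus `0`. -/
def saddle (s s' : Smoothing w) : Surface (smooth w s) (smooth w s') where
  conn := Relation.EqvGen.setoid fun a b =>
    ∃ v, a = Sum.inl (compAt w s v) ∧ b = Sum.inr (compAt w s' v)
  wall p := Relation.EqvGen.rel _ _ (by
    rcases p with j | j
    · exact ⟨(0, j), rfl, rfl⟩
    · exact ⟨(Fin.last _, j), rfl, rfl⟩)
  genus _ := 0
  genus_congr _ _ _ := rfl
  dots _ := 0
  dots_congr _ _ _ := rfl
  closed := 0

/-- A cell: a smoothing, with the set of red loops; the other loops are blue. -/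
structure Cell where
  smoothing : Smoothing w
  red : Set (smooth w smoothing).comp
  red_isLoop : ∀ c ∈ red, (smooth w smoothing).IsLoop c

variable {w}

namespace Cell

def blue (a : Cell w) : Set (smooth w a.smoothing).comp :=
  {c | (smooth w a.smoothing).IsLoop c ∧ c ∉ a.red}

/-- The planar diagram of a cell. -/
def obj (a : Cell w) : Diagram (Fin (r + 1) ⊕ Fin (r + 1)) := (smooth w a.smoothing).deloop

/-- The quantum shift of a cell; all `w.length` crossings are negative. -/
def shift (a : Cell w) : ℤ :=
  ((Finset.univ.filter fun l => a.smoothing l = true).card : ℤ) - 2 * (w.length : ℤ) +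
    (a.red.ncard : ℤ) - (a.blue.ncard : ℤ)

/-- The component at `a` of the delooping isomorphism: red loops are capped off by dotted discs,
blue ones by discs without dots. -/
def deloopTo (a : Cell w) : Hom (smooth w a.smoothing) a.obj :=
  (Surface.capOff (smooth w a.smoothing) a.red).toHom

/-- The component at `a` of the inverse of the delooping isomorphism: red loops are created by
discs without dots, blue ones by dotted discs. -/
def deloopFrom (a : Cell w) : Hom a.obj (smooth w a.smoothing) :=
  (Surface.cupOn (smooth w a.smoothing) a.blue).toHom

end Cell

open Classical in
/-- The matrix elements of the hypercube complex. -/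
def hypercubeD (s s' : Smoothing w) : Hom (smooth w s) (smooth w s') :=
  ∑ l, if Raises w s s' l then
    (-1 : ℤ) ^ (Finset.univ.filter fun m => m < l ∧ s m = true).card • (saddle w s s').toHom
  else 0

/-- The matrix elements of the delooped complex. -/
def deloopedD (a b : Cell w) : Hom a.obj b.obj :=
  (a.deloopFrom.comp (hypercubeD a.smoothing b.smoothing)).comp b.deloopTo

/-! ### The greedy matching -/

open Classical in
/-- The highest layer, counted from `1`, that contains a piece of the component `c`. -/
def maxLayer {s : Smoothing w} (c : (smooth w s).comp) : ℕ :=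
  (Finset.univ.filter fun l : Fin w.length =>
    ∃ j, c = compAt w s (l.castSucc, j) ∨ c = compAt w s (l.succ, j)).sup fun l => (l : ℕ) + 1

/-- The red loops of `a` that are merged with another component when layer `l` is changed from the
0-smoothing to the 1-smoothing, that is, when the cap and the cup in layer `l` are fused. -/
def mergedRed (a : Cell w) (l : Fin w.length) : Set (smooth w a.smoothing).comp :=
  {c | c ∈ a.red ∧
    compAt w a.smoothing (l.castSucc, (w.get l).castSucc) ≠
      compAt w a.smoothing (l.succ, (w.get l).castSucc) ∧
    (c = compAt w a.smoothing (l.castSucc, (w.get l).castSucc) ∨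
      c = compAt w a.smoothing (l.succ, (w.get l).castSucc))}

/-- The blue loops of `b` that are split from another component when layer `l` is changed from
the 0-smoothing to the 1-smoothing, which consists of a left and a right vertical line. -/
def splitBlue (b : Cell w) (l : Fin w.length) : Set (smooth w b.smoothing).comp :=
  {c | c ∈ b.blue ∧
    compAt w b.smoothing (l.castSucc, (w.get l).castSucc) ≠
      compAt w b.smoothing (l.castSucc, (w.get l).succ) ∧
    (c = compAt w b.smoothing (l.castSucc, (w.get l).castSucc) ∨
      c = compAt w b.smoothing (l.castSucc, (w.get l).succ))}

/-- The number `u(a → b)` of an isomorphism `a → b` that changes layer `l`. -/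
def uValue (a b : Cell w) (l : Fin w.length) : ℕ :=
  sInf (maxLayer '' mergedRed a l ∪ maxLayer '' splitBlue b l)

/-- The isomorphisms `a → b` among the edges with `i(a → b) = j` and `u(a → b) = k`. -/
def isoEdges (w : List (Fin r)) (j k : ℕ) : Set (Cell w × Cell w) :=
  {e | IsEdge deloopedD e.1 e.2 ∧
    (deloopedD e.1 e.2).IsIsomorphism e.1.shift e.2.shift ∧
    ∃ l : Fin w.length, Raises w e.1.smoothing e.2.smoothing l ∧ (l : ℕ) + 1 = j ∧
      uValue e.1 e.2 l = k}

/-- The set `M_{j,k}`: the edges in `isoEdges w j k` whose two ends are not matched at an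
earlier stage. The stages are run through by increasing `k` and, for given `k`, by decreasing
`j = k, …, 1` (there are no isomorphisms with `j > k`). -/
def greedyStage (w : List (Fin r)) (j k : ℕ) : Set (Cell w × Cell w) :=
  {e | e ∈ isoEdges w j k ∧
    ∀ l m : ℕ, (_h : m < k ∨ (m = k ∧ j < l ∧ l ≤ k)) →
      ∀ f ∈ greedyStage w l m, ¬ Adjacent e f}
termination_by (k, k - j)
decreasing_by
  rcases _h with h | ⟨rfl, h, h'⟩
  · exact Prod.Lex.left _ _ h
  · exact Prod.Lex.right _ (by omega)

/-- The greedy matching. -/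
def greedyMatching (w : List (Fin r)) : Set (Cell w × Cell w) :=
  ⋃ (j : ℕ) (k : ℕ), greedyStage w j k

end Braid

/-- The braid word `(σ₁σ₂σ₃)ⁿ` on four strands. -/
def torusWord (n : ℕ) : List (Fin 3) := (List.replicate n [0, 1, 2]).flatten

end BarNatan

end

/-! On four strands a loop of a smoothing is determined by its highest layer, where a 0-smoothing
caps two strands that are already joined below. So a cell amounts to a sequence of smoothings
together with the set of highest layers of its red loops, and which layers close a loop can be read
off from the planar matchings of the four strands at the successive levels (`topMatching`,
`closings`).

Orienting the strands alternately up and down shows that a saddle merges two components, splits one,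
or replaces two arcs by two arcs (`raise_cases`). Counting dots on the delooped saddle then shows
that every nonzero matrix element either is an isomorphism, which keeps the quantum shift and has
one of four effects on the layers (`IsoMove`), or raises the shift (`isoAt_or_of_isEdge`).

The greedy stages are local: stage `(j, k)` sees cells only up to layer `k`, and it consists of
edges that split off a blue loop with highest layer `k` (for `j < k`) or dissolve a red loop in its
own highest layer (for `j = k`); see `localAt`. Cells that survive the early stages have few
possible shapes (`Critical.not_red`, `Critical.not_joined`, `noNestedClosing`), so for the periodic
word a given `k` leaves almost no choice of `j < k` (`index_zero`, `index_one`, `index_two`).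

A cycle of the reversed graph has constant shift, hence consists of isomorphisms, and it alternates
between an unmatched edge raising a layer `i` and a matched edge, run backwards, lowering a layer
`j`. By `rank_le` this never decreases a rank of the layer, so on a cycle the ranks agree. If `i =
j`, a red loop moves down (`red_of_eq`). Otherwise the layers `3t + 2` and `3t + 3` swap their
smoothings in a direction dictated by two lower layers (`up`, `down`). Taking `t` in increasing
order, each swap turns out to be irreversible, so no cycle is left (`not_cycleStep`). -/

noncomputable section

namespace BarNatan

/-! ### Planar matchings of the four strands at a level -/

/-- The planar partial matchings of four points that can be joined among themselves below a level:
no pairs, one pair of neighbours, the pairs `01` and `23`, the nested pairs `03` and `12`. -/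
inductive TopMatching
  | none | p01 | p12 | p23 | parallel | nested
  deriving DecidableEq

namespace TopMatching

instance : Fintype TopMatching :=
  ⟨{none, p01, p12, p23, parallel, nested}, fun s => by cases s <;> decide⟩

/-- Whether the points `p` and `p + 1` are paired. -/
def joins (p : Fin 3) : TopMatching → Bool
  | none => false
  | p01 => p = 0
  | p12 => p = 1
  | p23 => p = 2
  | parallel => p = 0 ∨ p = 2
  | nested => p = 1

/-- The effect of a 0-smoothing at the positions `p` and `p + 1`. -/
def turn (p : Fin 3) : TopMatching → TopMatching
  | none => ![p01, p12, p23] p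
  | p01 => ![p01, p12, parallel] p
  | p12 => ![p01, p12, p23] p
  | p23 => ![parallel, p12, p23] p
  | parallel => ![parallel, nested, parallel] p
  | nested => ![parallel, nested, parallel] p

/-- Two matchings below a level that differ by a saddle which has not yet split or merged loops. -/
def near : TopMatching → TopMatching → Bool
  | none, s => s ≠ parallel ∧ s ≠ nested
  | s, none => s ≠ parallel ∧ s ≠ nested
  | p01, s => s ≠ nested ∧ s ≠ p23
  | p12, s => s ≠ parallel
  | p23, s => s ≠ nested ∧ s ≠ p01
  | parallel, s => s ≠ p12
  | nested, s => s ≠ p01 ∧ s ≠ p23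

end TopMatching

open TopMatching

/-- The position of the crossing in layer `m`. -/
def pos (m : ℕ) : Fin 3 := ⟨m % 3, Nat.mod_lt _ (by decide)⟩

/-- The matching of the strands below the level `m`, for the smoothing `x`. -/
def topMatching (x : ℕ → Bool) : ℕ → TopMatching
  | 0 => .none
  | m + 1 => if x m then topMatching x m else (topMatching x m).turn (pos m)

/-- The two strands at the crossing of layer `m` are joined below that layer. -/
def JoinedBelow (x : ℕ → Bool) (m : ℕ) : Prop := (topMatching x m).joins (pos m) = true

/-- The layers in which a loop has its highest point. -/
def closings (x : ℕ → Bool) : Set ℕ := {m | x m = false ∧ JoinedBelow x m}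

theorem mem_closings {x : ℕ → Bool} {m : ℕ} :
    m ∈ closings x ↔ x m = false ∧ JoinedBelow x m := Iff.rfl

theorem topMatching_congr {x y : ℕ → Bool} {m : ℕ} (h : ∀ i < m, x i = y i) :
    topMatching x m = topMatching y m := by
  induction m with
  | zero => rfl
  | succ m ih =>
    simp only [topMatching, ih fun i hi => h i (by omega), h m (by omega)]

theorem joinedBelow_congr {x y : ℕ → Bool} {m : ℕ} (h : ∀ i < m, x i = y i) :
    JoinedBelow x m ↔ JoinedBelow y m := by
  rw [JoinedBelow, JoinedBelow, topMatching_congr h]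

theorem mem_closings_congr {x y : ℕ → Bool} {m : ℕ} (h : ∀ i ≤ m, x i = y i) :
    m ∈ closings x ↔ m ∈ closings y := by
  rw [mem_closings, mem_closings, h m le_rfl, joinedBelow_congr fun i hi => h i hi.le]

theorem topMatching_congr_from {x y : ℕ → Bool} {m n : ℕ} (hmn : m ≤ n)
    (h0 : topMatching x m = topMatching y m) (h : ∀ i, m ≤ i → i < n → x i = y i) :
    topMatching x n = topMatching y n := by
  induction n, hmn using Nat.le_induction with
  | base => exact h0
  | succ n hn ih =>
    simp only [topMatching, ih fun i hi hi' => h i hi (by omega), h n hn (by omega)]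

theorem turn_of_joins : ∀ (p : Fin 3) (s : TopMatching), s.joins p = true → s.turn p = s := by
  decide

/-- A cap and a cup at strands that are joined below split off a loop and leave the matching above
as it was (`turn_of_joins`). Putting vertical lines there removes that loop and is invisible to all
higher layers. -/
theorem closings_raise_of_mem {x : ℕ → Bool} {k : ℕ} (hk : k ∈ closings x) :
    closings (Function.update x k true) = closings x \ {k} := by
  set y := Function.update x k true with hy
  have hne : ∀ i, i ≠ k → y i = x i := fun i hi => Function.update_of_ne hi _ _
  have hyk : y k = true := Function.update_self _ _ _
  have h0 : topMatching y k = topMatching x k := topMatching_congr fun i hi => hne i hi.ne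
  have h1 : topMatching y (k + 1) = topMatching x (k + 1) := by
    simp only [topMatching, hyk, hk.1, h0, if_true]
    simpa using (turn_of_joins _ _ hk.2).symm
  ext m
  rcases lt_trichotomy m k with h | rfl | h
  · rw [mem_closings_congr (y := x) fun i hi => hne i (by omega)]
    simp [h.ne]
  · simp [mem_closings, hyk]
  · have : topMatching y m = topMatching x m :=
      topMatching_congr_from (by omega) h1 fun i hi _ => hne i (by omega)
    simp [mem_closings, JoinedBelow, this, hne m (by omega), show m ≠ k by omega]

theorem near_turn_left : ∀ (p : Fin 3) (s : TopMatching),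
    s.joins p = false → near (s.turn p) s = true := by decide

/-- As long as a cap closes a loop in both diagrams or in neither, they stay one saddle apart. Once
it closes a loop in exactly one of them, the matchings above coincide, and equal higher layers
cannot make them differ again. -/
theorem near_turn : ∀ (p : Fin 3) (s t : TopMatching), near s t = true →
    (s.joins p = t.joins p → near (s.turn p) (t.turn p) = true) ∧
      (s.joins p ≠ t.joins p → s.turn p = t.turn p) := by decide

/-- If a raised layer changes the set of closings, it changes it by one element, and the matching
above that closing is unchanged. -/
theorem closings_raise_aux {x : ℕ → Bool} {j : ℕ} (hj : x j = false) (m : ℕ) (hm : j < m) :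
    ((∀ i < m, i ∈ closings x ↔ i ∈ closings (Function.update x j true)) ∧
        near (topMatching x m) (topMatching (Function.update x j true) m) = true) ∨
      (topMatching x m = topMatching (Function.update x j true) m ∧
        ∃ k < m, ¬ (k ∈ closings x ↔ k ∈ closings (Function.update x j true)) ∧
          ∀ i < m, i ≠ k → (i ∈ closings x ↔ i ∈ closings (Function.update x j true))) := by
  set y := Function.update x j true with hy
  have hne : ∀ i, i ≠ j → y i = x i := fun i hi => Function.update_of_ne hi _ _
  have hyj : y j = true := Function.update_self _ _ _
  have hlow : ∀ i < j, (i ∈ closings x ↔ i ∈ closings y) := fun i hi =>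
    mem_closings_congr fun l hl => (hne l (by omega)).symm
  induction m, hm using Nat.le_induction with
  | base =>
    have h0 : topMatching y j = topMatching x j := topMatching_congr fun i hi => hne i hi.ne
    have hjy : j ∉ closings y := by simp [mem_closings, hyj]
    -- If the strands at layer `j` are already joined, the raise deletes the loop closed there and
    -- the matchings above agree at once; otherwise they are `near`.
    by_cases hc : (topMatching x j).joins (pos j) = true
    · right
      refine ⟨by simp [topMatching, hyj, hj, h0, turn_of_joins _ _ hc], j, by omega, ?_, ?_⟩
      · simp [hjy, mem_closings, hj, JoinedBelow, hc]
      · intro i hi hij; exact hlow i (by omega)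
    · left
      refine ⟨fun i hi => ?_, ?_⟩
      · rcases (show i < j ∨ i = j by omega) with h | rfl
        · exact hlow i h
        · simp [hjy, mem_closings, JoinedBelow, hc]
      · simpa [topMatching, hyj, hj, h0] using near_turn_left _ _ (by simpa using hc)
  | succ m hm ih =>
    have hym : y m = x m := hne m (by omega)
    rcases ih with ⟨h1, h2⟩ | ⟨h1, k, hk, h2, h3⟩
    · cases hxm : x m with
      | true =>
        left
        refine ⟨fun i hi => ?_, by simpa [topMatching, hym, hxm] using h2⟩
        rcases (show i < m ∨ i = m by omega) with h | rfl
        · exact h1 i h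
        · simp [mem_closings, hym, hxm]
      | false =>
        obtain ⟨t1, t2⟩ := near_turn (pos m) _ _ h2
        by_cases hc : (topMatching x m).joins (pos m) = (topMatching y m).joins (pos m)
        · left
          refine ⟨fun i hi => ?_, by simpa [topMatching, hym, hxm] using t1 hc⟩
          rcases (show i < m ∨ i = m by omega) with h | rfl
          · exact h1 i h
          · simp [mem_closings, hym, hxm, JoinedBelow, hc]
        · right
          refine ⟨by simpa [topMatching, hym, hxm] using t2 hc, m, by omega, ?_, ?_⟩
          · simp only [mem_closings, hym, hxm, JoinedBelow, true_and]
            intro h; exact hc (Bool.eq_iff_iff.2 h)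
          · intro i hi hik; exact h1 i (by omega)
    · right
      refine ⟨by simp [topMatching, hym, h1], k, by omega, h2, fun i hi hik => ?_⟩
      rcases (show i < m ∨ i = m by omega) with h | rfl
      · exact h3 i h hik
      · simp [mem_closings, hym, JoinedBelow, h1]

theorem closings_raise_of_new {x : ℕ → Bool} {j k : ℕ} (hj : x j = false)
    (hk : k ∈ closings (Function.update x j true)) (hk' : k ∉ closings x) :
    closings (Function.update x j true) = insert k (closings x) := by
  ext m
  -- The bound lies above `j`, `k` and `m`, so the dichotomy applies to all three layers.
  rcases closings_raise_aux hj (j + k + m + 1) (by omega) with ⟨h, -⟩ | ⟨-, l, -, -, h⟩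
  · exact absurd ((h k (by omega)).2 hk) hk'
  · have hl : k = l := by
      by_contra hkl; exact hk' ((h k (by omega) hkl).2 hk)
    by_cases hm : m = k
    · simp [hm, hk]
    · rw [← h m (by omega) (hl ▸ hm)]; simp [hm]

theorem lt_of_new_closing {x : ℕ → Bool} {j k : ℕ}
    (hk : k ∈ closings (Function.update x j true)) (hk' : k ∉ closings x) : j < k := by
  by_contra! h
  rcases h.lt_or_eq with h | rfl
  · exact hk' ((mem_closings_congr fun i hi => Function.update_of_ne (by omega) _ _).1 hk)
  · simp [mem_closings] at hk

theorem le_of_lost_closing {x : ℕ → Bool} {j k : ℕ}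
    (hk : k ∈ closings x) (hk' : k ∉ closings (Function.update x j true)) : j ≤ k := by
  by_contra! h
  exact hk' ((mem_closings_congr fun i hi => Function.update_of_ne (by omega) _ _).2 hk)

end BarNatan

end

noncomputable section

namespace BarNatan

open TopMatching

theorem closings_raise_of_lost {x : ℕ → Bool} {j k : ℕ} (hj : x j = false)
    (hk : k ∈ closings x) (hk' : k ∉ closings (Function.update x j true)) :
    closings (Function.update x j true) = closings x \ {k} := by
  ext m
  rcases closings_raise_aux hj (j + k + m + 1) (by omega) with ⟨h, -⟩ | ⟨-, l, -, -, h⟩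
  · exact absurd ((h k (by omega)).1 hk) hk'
  · have hl : k = l := by
      by_contra hkl; exact hk' ((h k (by omega) hkl).1 hk)
    by_cases hm : m = k
    · simp [hm, hk']
    · rw [← h m (by omega) (hl ▸ hm)]; simp [hm]

theorem update_lower {x : ℕ → Bool} {j : ℕ} (hj : x j = true) :
    Function.update (Function.update x j false) j true = x := by
  rw [Function.update_idem, ← hj, Function.update_eq_self]

theorem update_raise {x : ℕ → Bool} {j : ℕ} (hj : x j = false) :
    Function.update (Function.update x j true) j false = x := by
  rw [Function.update_idem, ← hj, Function.update_eq_self]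

/-! ### Greedy matchings as a combinatorial model on sequences with red layers -/

/-- The effect of an isomorphism that changes layer `i`, with value `k` of `u`, on the smoothing
and on the set of highest layers of red loops. Either a new blue loop appears, or a red loop
disappears, or a red loop turns blue when it is merged with a lower blue loop or when a lower red
loop is split from it. -/
def IsoMove (x y : ℕ → Bool) (R S : Set ℕ) (i k : ℕ) : Prop :=
  x i = false ∧ y = Function.update x i true ∧
    ((k ∉ closings x ∧ k ∈ closings y ∧ S = R) ∨
      (k ∈ R ∧ k ∉ closings y ∧ S = R \ {k}) ∨
      (k ∈ R ∧ k ∈ closings y ∧ S = R \ {k} ∧ ∃ m < k, m ∈ closings x ∧ m ∉ R ∧ m ∉ closings y) ∨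
      (k ∈ R ∧ k ∈ closings y ∧ ∃ m < k, m ∉ closings x ∧ m ∈ closings y ∧
        S = insert m (R \ {k})))

/-- The stage `(l, m)` precedes the stage `(j, k)`. -/
def Earlier (l m j k : ℕ) : Prop := m < k ∨ (m = k ∧ j < l ∧ l ≤ k)

/-- The combinatorial content of a greedy matching on a delooped complex. -/
structure MatchingModel (V : Type) where
  bit : V → ℕ → Bool
  red : V → Set ℕ
  len : ℕ
  bit_of_le : ∀ a m, len ≤ m → bit a m = true
  red_sub : ∀ a, red a ⊆ closings (bit a)
  ext : ∀ a b, bit a = bit b → red a = red b → a = b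
  exists_cell : ∀ x R, (∀ m, len ≤ m → x m = true) → R ⊆ closings x → ∃ a, bit a = x ∧ red a = R
  iso : ℕ → ℕ → V → V → Prop
  iso_move : ∀ {j k a b}, iso j k a b → IsoMove (bit a) (bit b) (red a) (red b) j k
  -- Only two families of isomorphisms have to be known to exist: those that split off a new blue
  -- loop, and those that dissolve a red loop in its own highest layer. No others end up in the
  -- matching.
  iso_add : ∀ {j k a b}, bit a j = false → bit b = Function.update (bit a) j true →
    k ∉ closings (bit a) → k ∈ closings (bit b) → red b = red a → iso j k a b
  iso_remove : ∀ {k a b}, k ∈ red a → bit b = Function.update (bit a) k true →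
    red b = red a \ {k} → iso k k a b
  mat : ℕ → ℕ → V → V → Prop
  mat_iso : ∀ {j k a b}, mat j k a b → iso j k a b
  mat_early : ∀ {j k a b l m c d}, mat j k a b → mat l m c d → Earlier l m j k →
    ¬ Adjacent (a, b) (c, d)
  iso_mat : ∀ {j k a b}, iso j k a b →
    mat j k a b ∨ ∃ l m c d, Earlier l m j k ∧ mat l m c d ∧ Adjacent (a, b) (c, d)

/-- The new or lost closing lies in layer `i` or above. In the last two forms it is `m`, which is
below `k`. -/
theorem IsoMove.le {x y : ℕ → Bool} {R S : Set ℕ} {i k : ℕ} (h : IsoMove x y R S i k)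
    (hR : R ⊆ closings x) : i ≤ k := by
  obtain ⟨h0, rfl, h | h | ⟨-, -, -, m, hm, h1, -, h2⟩ | ⟨-, -, m, hm, h1, h2, -⟩⟩ := h
  · exact (lt_of_new_closing h.2.1 h.1).le
  · exact le_of_lost_closing (hR h.1) h.2.1
  · exact (le_of_lost_closing h1 h2).trans hm.le
  · exact (lt_of_new_closing h2 h1).le.trans hm.le

namespace MatchingModel

variable {V : Type} (G : MatchingModel V)

abbrev cl (a : V) : Set ℕ := closings (G.bit a)

/-- The relation in which locality is stated: stages with second index `k` do not distinguish cells
related by `Agree (k + 1)`. -/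
def Agree (m : ℕ) (a b : V) : Prop :=
  (∀ i < m, G.bit a i = G.bit b i) ∧ ∀ i < m, (i ∈ G.red a ↔ i ∈ G.red b)

def Matched (j k : ℕ) (a : V) : Prop := ∃ b, G.mat j k a b ∨ G.mat j k b a

variable {G}

theorem Agree.symm {m : ℕ} {a b : V} (h : G.Agree m a b) : G.Agree m b a :=
  ⟨fun i hi => (h.1 i hi).symm, fun i hi => (h.2 i hi).symm⟩

theorem Agree.mono {m n : ℕ} {a b : V} (h : G.Agree n a b) (hmn : m ≤ n) : G.Agree m a b :=
  ⟨fun i hi => h.1 i (by omega), fun i hi => h.2 i (by omega)⟩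

theorem Agree.mem_cl {m k : ℕ} {a b : V} (h : G.Agree m a b) (hk : k < m) :
    k ∈ G.cl a ↔ k ∈ G.cl b :=
  mem_closings_congr fun i hi => h.1 i (by omega)

theorem lt_len {a : V} {k : ℕ} (h : G.bit a k = false) : k < G.len := by
  by_contra! h'
  simp [G.bit_of_le a k h'] at h

theorem le_of_mat {j k : ℕ} {a b : V} (h : G.mat j k a b) : j ≤ k :=
  (G.iso_move (G.mat_iso h)).le (G.red_sub a)

theorem exists_raise {a : V} {j : ℕ} {R : Set ℕ}
    (hR : R ⊆ closings (Function.update (G.bit a) j true)) :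
    ∃ b, G.bit b = Function.update (G.bit a) j true ∧ G.red b = R := by
  refine G.exists_cell _ _ (fun m hm => ?_) hR
  by_cases h : m = j
  · simp [h]
  · rw [Function.update_of_ne h, G.bit_of_le a m hm]

theorem exists_lower {a : V} {j : ℕ} (hj : j < G.len) {R : Set ℕ}
    (hR : R ⊆ closings (Function.update (G.bit a) j false)) :
    ∃ b, G.bit b = Function.update (G.bit a) j false ∧ G.red b = R := by
  refine G.exists_cell _ _ (fun m hm => ?_) hR
  rw [Function.update_of_ne (by omega), G.bit_of_le a m hm]

/-- The two kinds of matched edges. -/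
def Adds (j k : ℕ) (a b : V) : Prop :=
  G.bit a j = false ∧ G.bit b = Function.update (G.bit a) j true ∧ j < k ∧
    k ∉ G.cl a ∧ k ∈ G.cl b ∧ G.red b = G.red a

/-- The red loop is dissolved in its own highest layer. The redundant index `j = k` gives both kinds
of edges the same shape. -/
def Removes (j k : ℕ) (a b : V) : Prop :=
  G.bit a j = false ∧ G.bit b = Function.update (G.bit a) j true ∧ j = k ∧
    k ∈ G.red a ∧ G.red b = G.red a \ {k}

/-- Whether layer `k` is a closing depends on the layers up to `k` only, so the same raise at `a'`
splits off the same loop, whatever lies above. -/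
theorem Adds.exists_left {j k : ℕ} {a b a' : V} (h : G.Adds j k a b) (ha : G.Agree (k + 1) a a') :
    ∃ b', G.Agree (k + 1) b b' ∧ G.Adds j k a' b' := by
  obtain ⟨h1, h2, h3, h4, h5, h6⟩ := h
  have e1 : G.bit a' j = false := by rw [← ha.1 j (by omega), h1]
  have e2 : ∀ i < k + 1, G.bit b i = Function.update (G.bit a') j true i := fun i hi => by
    rw [h2, Function.update_apply, Function.update_apply, ha.1 i hi]
  have e3 : k ∈ closings (Function.update (G.bit a') j true) :=
    (mem_closings_congr fun i hi => e2 i (by omega)).1 h5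
  have e4 : k ∉ G.cl a' := fun h => h4 ((ha.mem_cl (by omega)).2 h)
  obtain ⟨b', hb, hb'⟩ := G.exists_raise (a := a') (j := j) (R := G.red a') (by
    rw [closings_raise_of_new e1 e3 e4]
    exact (G.red_sub a').trans (Set.subset_insert _ _))
  refine ⟨b', ⟨fun i hi => hb ▸ e2 i hi, fun i hi => ?_⟩, e1, hb, h3, e4, by rw [cl, hb]; exact e3, hb'⟩
  rw [h6, hb', ha.2 i hi]

theorem Adds.exists_right {j k : ℕ} {a b b' : V} (h : G.Adds j k a b)
    (hb : G.Agree (k + 1) b b') : ∃ a', G.Agree (k + 1) a a' ∧ G.Adds j k a' b' := by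
  obtain ⟨h1, h2, h3, h4, h5, h6⟩ := h
  have e0 : G.bit b' j = true := by rw [← hb.1 j (by omega), h2, Function.update_self]
  have e2 : ∀ i < k + 1, G.bit a i = Function.update (G.bit b') j false i := fun i hi => by
    rw [Function.update_apply, ← hb.1 i hi, h2, Function.update_apply]
    split <;> simp_all
  have e3 : k ∈ G.cl b' := (hb.mem_cl (by omega)).1 h5
  have e4 : k ∉ closings (Function.update (G.bit b') j false) := fun h =>
    h4 ((mem_closings_congr fun i hi => e2 i (by omega)).2 h)
  have e5 := closings_raise_of_new (x := Function.update (G.bit b') j false) (j := j) (k := k)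
    (by simp) (by rwa [update_lower e0]) e4
  rw [update_lower e0] at e5
  -- The new loop is blue. Lowering layer `j` removes only the closing `k`, so every red loop
  -- survives.
  have hk' : k ∉ G.red b' := by
    rw [← hb.2 k (by omega), h6]; exact fun h => h4 (G.red_sub a h)
  have hj : j < G.len := G.lt_len h1
  obtain ⟨a', ha, ha'⟩ := G.exists_lower (a := b') hj (R := G.red b') (by
    intro m hm
    have := G.red_sub b' hm
    rw [e5] at this
    rcases this with rfl | h
    · exact absurd hm hk'
    · exact h)
  refine ⟨a', ⟨fun i hi => ha ▸ e2 i hi, fun i hi => ?_⟩, by rw [ha]; simp, ?_, h3, by rw [cl, ha]; exact e4, e3,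
    ha'.symm⟩
  · rw [← h6, ha', hb.2 i hi]
  · rw [ha, update_lower e0]

theorem Removes.exists_left {j k : ℕ} {a b a' : V} (h : G.Removes j k a b)
    (ha : G.Agree (k + 1) a a') : ∃ b', G.Agree (k + 1) b b' ∧ G.Removes j k a' b' := by
  obtain ⟨h1, h2, rfl, h4, h5⟩ := h
  have e1 : G.bit a' j = false := by rw [← ha.1 j (by omega), h1]
  have e4 : j ∈ G.red a' := (ha.2 j (by omega)).1 h4
  obtain ⟨b', hb, hb'⟩ := G.exists_raise (a := a') (j := j) (R := G.red a' \ {j}) (by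
    rw [closings_raise_of_mem (G.red_sub a' e4)]
    exact Set.sdiff_subset_sdiff_left (G.red_sub a'))
  refine ⟨b', ⟨fun i hi => ?_, fun i hi => ?_⟩, e1, hb, rfl, e4, hb'⟩
  · rw [hb, h2, Function.update_apply, Function.update_apply, ha.1 i hi]
  · simp [h5, hb', ha.2 i hi]

theorem Removes.joined {j k : ℕ} {a b : V} (h : G.Removes j k a b) :
    JoinedBelow (G.bit b) k := by
  obtain ⟨h1, h2, rfl, h4, h5⟩ := h
  rw [h2, joinedBelow_congr (y := G.bit a) fun i hi => Function.update_of_ne hi.ne _ _]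
  exact (G.red_sub a h4).2

/-- Over joined strands, replacing the vertical lines in layer `k` by a cap and a cup creates a
loop; colouring it red gives the source. -/
theorem exists_removes {k : ℕ} {b : V} (hk : k < G.len) (hb : G.bit b k = true)
    (hj : JoinedBelow (G.bit b) k) : ∃ a, G.Removes k k a b := by
  have e3 : k ∈ closings (Function.update (G.bit b) k false) := by
    refine ⟨by simp, ?_⟩
    rwa [joinedBelow_congr (y := G.bit b) fun i hi => Function.update_of_ne hi.ne _ _]
  have e4 := closings_raise_of_mem e3
  rw [update_lower hb] at e4
  have hkb : k ∉ G.red b := fun h => by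
    have := (G.red_sub b h).1; simp [hb] at this
  obtain ⟨a, ha, ha'⟩ := G.exists_lower (a := b) hk (R := insert k (G.red b)) (by
    rintro m (rfl | hm)
    · exact e3
    · have := G.red_sub b hm
      rw [e4] at this
      exact this.1)
  refine ⟨a, by rw [ha]; simp, by rw [ha, update_lower hb], rfl, by simp [ha'], ?_⟩
  rw [ha']; ext m; simp only [Set.mem_sdiff, Set.mem_insert_iff, Set.mem_singleton_iff]
  constructor
  · rintro h; exact ⟨Or.inr h, fun e => hkb (e ▸ h)⟩
  · rintro ⟨rfl | h, h'⟩
    · exact absurd rfl h'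
    · exact h

theorem Removes.exists_right {j k : ℕ} {a b b' : V} (h : G.Removes j k a b)
    (hb : G.Agree (k + 1) b b') : ∃ a', G.Agree (k + 1) a a' ∧ G.Removes j k a' b' := by
  have hj := h.joined
  obtain ⟨h1, h2, rfl, h4, h5⟩ := h
  have e0 : G.bit b' j = true := by rw [← hb.1 j (by omega), h2, Function.update_self]
  rw [joinedBelow_congr fun i hi => hb.1 i (by omega)] at hj
  obtain ⟨a', ha⟩ := G.exists_removes (G.lt_len h1) e0 hj
  refine ⟨a', ⟨fun i hi => ?_, fun i hi => ?_⟩, ha⟩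
  · by_cases hij : i = j
    · rw [hij, h1, ha.1]
    · have := hb.1 i hi
      rwa [h2, ha.2.1, Function.update_of_ne hij, Function.update_of_ne hij] at this
  · by_cases hij : i = j
    · simp [hij, h4, ha.2.2.2.1]
    · have := hb.2 i hi
      simpa [h5, ha.2.2.2.2, hij] using this

theorem Adds.iso {j k : ℕ} {a b : V} (h : G.Adds j k a b) : G.iso j k a b :=
  G.iso_add h.1 h.2.1 h.2.2.2.1 h.2.2.2.2.1 h.2.2.2.2.2

theorem Removes.iso {j k : ℕ} {a b : V} (h : G.Removes j k a b) : G.iso j k a b := by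
  obtain ⟨h1, h2, rfl, h4, h5⟩ := h
  exact G.iso_remove h4 h2 h5

theorem Removes.agree {j k : ℕ} {a b : V} (h : G.Removes j k a b) : G.Agree k a b := by
  obtain ⟨h1, h2, rfl, h4, h5⟩ := h
  refine ⟨fun i hi => by rw [h2, Function.update_of_ne hi.ne], fun i hi => by simp [h5, hi.ne]⟩

theorem exists_removes_right {k : ℕ} {a : V} (h : k ∈ G.red a) : ∃ b, G.Removes k k a b := by
  have h1 := (G.red_sub a h).1
  obtain ⟨b, hb, hb'⟩ := G.exists_raise (a := a) (j := k) (R := G.red a \ {k}) (by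
    rw [closings_raise_of_mem (G.red_sub a h)]
    exact Set.sdiff_subset_sdiff_left (G.red_sub a))
  exact ⟨b, h1, hb, rfl, h, hb'⟩

theorem adjacent_iff {a b c d : V} :
    Adjacent (a, b) (c, d) ↔ a = c ∨ a = d ∨ b = c ∨ b = d := Iff.rfl

theorem Matched.of_adjacent {l m : ℕ} {a b c d : V} (h : G.mat l m c d)
    (had : Adjacent (a, b) (c, d)) : G.Matched l m a ∨ G.Matched l m b := by
  rcases adjacent_iff.1 had with rfl | rfl | rfl | rfl
  · exact Or.inl ⟨d, Or.inl h⟩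
  · exact Or.inl ⟨c, Or.inr h⟩
  · exact Or.inr ⟨d, Or.inl h⟩
  · exact Or.inr ⟨c, Or.inr h⟩

theorem not_matched_left {j k l m : ℕ} {a b : V} (h : G.mat j k a b) (he : Earlier l m j k) :
    ¬ G.Matched l m a := by
  rintro ⟨c, hc | hc⟩
  · exact G.mat_early h hc he (Or.inl rfl)
  · exact G.mat_early h hc he (Or.inr (Or.inl rfl))

theorem not_matched_right {j k l m : ℕ} {a b : V} (h : G.mat j k a b) (he : Earlier l m j k) :
    ¬ G.Matched l m b := by
  rintro ⟨c, hc | hc⟩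
  · exact G.mat_early h hc he (Or.inr (Or.inr (Or.inl rfl)))
  · exact G.mat_early h hc he (Or.inr (Or.inr (Or.inr rfl)))

/-! ### Locality of the stages and the shape of matched edges -/

variable (G) in
/-- The edges of the stage `(j, k)` are of the two standard kinds, and they only depend on what
the cells look like up to layer `k`. -/
structure LocalAt (j k : ℕ) : Prop where
  kind : ∀ {a b}, G.mat j k a b → G.Adds j k a b ∨ G.Removes j k a b
  left : ∀ {a b a'}, G.mat j k a b → G.Agree (k + 1) a a' →
    ∃ b', G.Agree (k + 1) b b' ∧ G.mat j k a' b'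
  right : ∀ {a b b'}, G.mat j k a b → G.Agree (k + 1) b b' →
    ∃ a', G.Agree (k + 1) a a' ∧ G.mat j k a' b'

theorem LocalAt.matched {j k : ℕ} (h : G.LocalAt j k) {a a' : V} (ha : G.Agree (k + 1) a a')
    (hm : G.Matched j k a) : G.Matched j k a' := by
  obtain ⟨b, hb | hb⟩ := hm
  · obtain ⟨b', -, hb'⟩ := h.left hb ha
    exact ⟨b', Or.inl hb'⟩
  · obtain ⟨b', -, hb'⟩ := h.right hb ha
    exact ⟨b', Or.inr hb'⟩

/-- Suppose the loop at `k` is red in the source. Dissolving it is an isomorphism of stage `(k, k)`,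
the first stage with second index `k`, and its ends agree below `k`. By locality of the lower stages
neither end is taken before, so this edge is matched, and the given one must belong to stage `(k,
k)` too. Then layer `k` has the 1-smoothing in the target, which excludes the two forms in which `k`
remains a closing. -/
theorem mat_kind_of_local {j k : ℕ} (H : ∀ m < k, ∀ l, G.LocalAt l m) {a b : V}
    (h : G.mat j k a b) : G.Adds j k a b ∨ G.Removes j k a b := by
  have hjk := G.le_of_mat h
  obtain ⟨h0, h1, hc⟩ := G.iso_move (G.mat_iso h)
  have key : k ∈ G.red a → j = k := by
    intro hk
    by_contra hne
    obtain ⟨c, hc⟩ := G.exists_removes_right hk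
    rcases G.iso_mat hc.iso with h' | ⟨l, m, d, e, he, hm, had⟩
    · exact not_matched_left h (Or.inr ⟨rfl, by omega, le_rfl⟩) ⟨c, Or.inl h'⟩
    · have hmk : m < k := by rcases he with he | he <;> omega
      rcases Matched.of_adjacent hm had with h' | h'
      · exact not_matched_left h (Or.inl hmk) h'
      · exact not_matched_left h (Or.inl hmk)
          ((H m hmk l).matched (hc.agree.symm.mono (by omega)) h')
  have hb : G.bit b j = true := by rw [h1, Function.update_self]
  rcases hc with ⟨h2, h3, h4⟩ | ⟨h2, h3, h4⟩ | ⟨h2, h3, -⟩ | ⟨h2, h3, -⟩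
  · refine Or.inl ⟨h0, h1, ?_, h2, h3, h4⟩
    rw [h1] at h3; exact lt_of_new_closing h3 h2
  · exact Or.inr ⟨h0, h1, key h2, h2, h4⟩
  · obtain rfl := key h2
    simp [mem_closings, hb] at h3
  · obtain rfl := key h2
    simp [mem_closings, hb] at h3

/-- The nested inductions on `k` and on `k - j` follow the order of the stages. An edge is copied to
a cell that agrees with one of its ends up to layer `k`; were the copy blocked by an earlier edge,
locality of that earlier stage would block the original as well. -/
theorem localAt (j k : ℕ) : G.LocalAt j k := by
  induction k using Nat.strong_induction_on generalizing j with
  | _ k IH =>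
  have H : ∀ m < k, ∀ l, G.LocalAt l m := fun m hm l => IH m hm l
  generalize hd : k - j = d
  induction d using Nat.strong_induction_on generalizing j with
  | _ d IHd =>
  have H' : ∀ l m, Earlier l m j k → G.LocalAt l m := by
    rintro l m (h | ⟨rfl, h, h'⟩)
    · exact H m h l
    · exact IHd (m - l) (by omega) l rfl
  have Hk : ∀ l m, Earlier l m j k → m + 1 ≤ k + 1 := by
    rintro l m (h | ⟨rfl, h, h'⟩) <;> omega
  have step : ∀ {a b a' b' : V}, G.mat j k a b → G.Agree (k + 1) a a' → G.Agree (k + 1) b b' →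
      G.iso j k a' b' → G.mat j k a' b' := by
    intro a b a' b' h ha hb hi
    rcases G.iso_mat hi with h' | ⟨l, m, d, e, he, hm, had⟩
    · exact h'
    · rcases Matched.of_adjacent hm had with h' | h'
      · exact absurd ((H' l m he).matched (ha.symm.mono (Hk l m he)) h') (not_matched_left h he)
      · exact absurd ((H' l m he).matched (hb.symm.mono (Hk l m he)) h') (not_matched_right h he)
  refine ⟨fun h => mat_kind_of_local H h, fun {a b a'} h ha => ?_, fun {a b b'} h hb => ?_⟩
  · rcases mat_kind_of_local H h with h' | h'
    · obtain ⟨b', hb, hb'⟩ := h'.exists_left ha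
      exact ⟨b', hb, step h ha hb hb'.iso⟩
    · obtain ⟨b', hb, hb'⟩ := h'.exists_left ha
      exact ⟨b', hb, step h ha hb hb'.iso⟩
  · rcases mat_kind_of_local H h with h' | h'
    · obtain ⟨a', ha, ha'⟩ := h'.exists_right hb
      exact ⟨a', ha, step h ha hb ha'.iso⟩
    · obtain ⟨a', ha, ha'⟩ := h'.exists_right hb
      exact ⟨a', ha, step h ha hb ha'.iso⟩

theorem mat_kind {j k : ℕ} {a b : V} (h : G.mat j k a b) : G.Adds j k a b ∨ G.Removes j k a b :=
  (localAt j k).kind h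

theorem mat_adds {j k : ℕ} {a b : V} (h : G.mat j k a b) (hjk : j < k) : G.Adds j k a b :=
  (mat_kind h).resolve_right fun h' => by have := h'.2.2.1; omega

theorem mat_removes {k : ℕ} {a b : V} (h : G.mat k k a b) : G.Removes k k a b :=
  (mat_kind h).resolve_left fun h' => by have := h'.2.2.1; omega

theorem Adds.left_unique {j k : ℕ} {a a' b : V} (h : G.Adds j k a b) (h' : G.Adds j k a' b) :
    a = a' := by
  refine G.ext _ _ ?_ (h.2.2.2.2.2.symm.trans h'.2.2.2.2.2)
  rw [← update_raise h.1, ← update_raise h'.1, ← h.2.1, ← h'.2.1]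

theorem Adds.right_unique {j k : ℕ} {a b b' : V} (h : G.Adds j k a b) (h' : G.Adds j k a b') :
    b = b' :=
  G.ext _ _ (h.2.1.trans h'.2.1.symm) (h.2.2.2.2.2.trans h'.2.2.2.2.2.symm)

theorem Removes.left_unique {j k : ℕ} {a a' b : V} (h : G.Removes j k a b)
    (h' : G.Removes j k a' b) : a = a' := by
  refine G.ext _ _ ?_ ?_
  · rw [← update_raise h.1, ← update_raise h'.1, ← h.2.1, ← h'.2.1]
  · have := h.2.2.2.2.symm.trans h'.2.2.2.2
    ext m
    by_cases hm : m = k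
    · simp [hm, h.2.2.2.1, h'.2.2.2.1]
    · simpa [hm] using Set.ext_iff.1 this m

theorem Removes.right_unique {j k : ℕ} {a b b' : V} (h : G.Removes j k a b)
    (h' : G.Removes j k a b') : b = b' :=
  G.ext _ _ (h.2.1.trans h'.2.1.symm) (h.2.2.2.2.trans h'.2.2.2.2.symm)

/-- Stages with `j ≤ k` are linearly ordered by `Earlier`, and the later of two adjacent edges would
have been rejected. -/
theorem stage_eq {j k l m : ℕ} {a b c d : V} (h : G.mat j k a b) (h' : G.mat l m c d)
    (had : Adjacent (a, b) (c, d)) : j = l ∧ k = m := by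
  have h1 := G.le_of_mat h
  have h2 := G.le_of_mat h'
  by_contra hne
  have had' : Adjacent (c, d) (a, b) := by
    rcases adjacent_iff.1 had with rfl | rfl | rfl | rfl <;> simp [Adjacent]
  by_cases he : Earlier l m j k
  · exact G.mat_early h h' he had
  · refine G.mat_early h' h ?_ had'
    simp only [Earlier] at he ⊢
    omega

/-- All edges of one stage are of the same kind, decided by `j < k` or `j = k`, and an edge of
either kind is determined by each of its ends. -/
theorem source_unique {j k l m : ℕ} {a b c : V} (h : G.mat j k a b) (h' : G.mat l m a c) :
    j = l ∧ k = m ∧ b = c := by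
  obtain ⟨rfl, rfl⟩ := stage_eq h h' (Or.inl rfl)
  refine ⟨rfl, rfl, ?_⟩
  rcases mat_kind h with h1 | h1
  · exact h1.right_unique (mat_adds h' h1.2.2.1)
  · obtain rfl := h1.2.2.1
    exact h1.right_unique (mat_removes h')

theorem target_unique {j k l m : ℕ} {a b c : V} (h : G.mat j k a b) (h' : G.mat l m c b) :
    j = l ∧ k = m ∧ a = c := by
  obtain ⟨rfl, rfl⟩ := stage_eq h h' (Or.inr (Or.inr (Or.inr rfl)))
  refine ⟨rfl, rfl, ?_⟩
  rcases mat_kind h with h1 | h1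
  · exact h1.left_unique (mat_adds h' h1.2.2.1)
  · obtain rfl := h1.2.2.1
    exact h1.left_unique (mat_removes h')

/-- Both edges would belong to one stage `(j, k)`, so layer `j` of `b` would have the 1-smoothing
because of the first and the 0-smoothing because of the second. -/
theorem not_source_of_target {j k l m : ℕ} {a b c : V} (h : G.mat j k a b)
    (h' : G.mat l m b c) : False := by
  obtain ⟨rfl, rfl⟩ := stage_eq h h' (Or.inr (Or.inr (Or.inl rfl)))
  have h1 := (G.iso_move (G.mat_iso h)).2.1
  have h2 := (G.iso_move (G.mat_iso h')).1
  rw [h1, Function.update_self] at h2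
  cases h2

/-! ### Cells that survive the early stages -/

variable (G) in
/-- The cell `a` is not matched at the stages `(j, m)` with `m < k`. -/
def Critical (k : ℕ) (a : V) : Prop := ∀ m < k, ∀ j, ¬ G.Matched j m a

theorem Critical.mono {k l : ℕ} {a : V} (h : G.Critical l a) (hkl : k ≤ l) : G.Critical k a :=
  fun m hm => h m (by omega)

theorem Critical.congr {k : ℕ} {a b : V} (h : G.Critical k a) (hab : G.Agree k a b) :
    G.Critical k b := fun m hm j hj =>
  h m hm j ((localAt j m).matched (hab.symm.mono (by omega)) hj)

theorem Critical.succ {k : ℕ} {a : V} (h : G.Critical k a) (h' : ∀ j, ¬ G.Matched j k a) :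
    G.Critical (k + 1) a := fun m hm => by
  rcases (show m < k ∨ m = k by omega) with h1 | rfl
  · exact h m h1
  · exact h'

theorem critical_left {j k : ℕ} {a b : V} (h : G.mat j k a b) : G.Critical k a :=
  fun _ hm _ => not_matched_left h (Or.inl hm)

theorem critical_right {j k : ℕ} {a b : V} (h : G.mat j k a b) : G.Critical k b :=
  fun _ hm _ => not_matched_right h (Or.inl hm)

/-- A cell matched at a stage `(l, k)` and with the 1-smoothing in layer `k` is a target. -/
theorem Matched.of_true {l k : ℕ} {a : V} (h : G.Matched l k a) (ha : G.bit a k = true) :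
    l = k ∧ ∃ c, G.Removes k k c a ∧ JoinedBelow (G.bit a) k := by
  obtain ⟨b, hb | hb⟩ := h
  · rcases mat_kind hb with h1 | h1
    · have := h1.2.2.2.2.1.1
      rw [h1.2.1, Function.update_of_ne h1.2.2.1.ne', ha] at this
      cases this
    · have := (G.red_sub a h1.2.2.2.1).1
      rw [ha] at this
      cases this
  · rcases mat_kind hb with h1 | h1
    · have := h1.2.2.2.2.1.1
      rw [ha] at this
      cases this
    · obtain rfl := h1.2.2.1
      exact ⟨rfl, b, h1, h1.joined⟩

/-- A cell matched at a stage `(l, k)` whose strands are not joined below layer `k` is the source of an edge that splits off such a loop. -/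
theorem Matched.of_not_joined {l k : ℕ} {a : V} (h : G.Matched l k a)
    (ha : ¬ JoinedBelow (G.bit a) k) :
    ∃ b, G.mat l k a b ∧ G.Adds l k a b := by
  obtain ⟨b, hb | hb⟩ := h
  · rcases mat_kind hb with h1 | h1
    · exact ⟨b, hb, h1⟩
    · exact absurd (G.red_sub a h1.2.2.2.1).2 ha
  · rcases mat_kind hb with h1 | h1
    · exact absurd h1.2.2.2.2.1.2 ha
    · exact absurd h1.joined ha

/-- Otherwise the edge that dissolves the red loop in layer `k` would have been available at stage
`(k, k)`: nothing else with second index `k` comes before it, and its other end agrees with `a`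
below `k`, hence is as free as `a`. -/
theorem Critical.not_red {k : ℕ} {a : V} (h : G.Critical (k + 1) a) : k ∉ G.red a := by
  intro hk
  obtain ⟨c, hc⟩ := G.exists_removes_right hk
  rcases G.iso_mat hc.iso with h' | ⟨l, m, d, e, he, hm, had⟩
  · exact h k (by omega) k ⟨c, Or.inl h'⟩
  · have hmk : m < k := by rcases he with he | he <;> omega
    rcases Matched.of_adjacent hm had with h' | h'
    · exact h m (by omega) l h'
    · exact (h.mono (by omega)).congr hc.agree m hmk l h'

/-- The same argument for targets: over joined strands, the 1-smoothing in layer `k` is the result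
of dissolving a red loop there. -/
theorem Critical.not_joined {k : ℕ} {b : V} (h : G.Critical (k + 1) b) (hk : k < G.len)
    (hb : G.bit b k = true) : ¬ JoinedBelow (G.bit b) k := by
  intro hj
  obtain ⟨a, ha⟩ := G.exists_removes hk hb hj
  rcases G.iso_mat ha.iso with h' | ⟨l, m, d, e, he, hm, had⟩
  · exact h k (by omega) k ⟨a, Or.inr h'⟩
  · have hmk : m < k := by rcases he with he | he <;> omega
    rcases Matched.of_adjacent hm had with h' | h'
    · exact (h.mono (by omega)).congr ha.agree.symm m hmk l h'
    · exact h m (by omega) l h'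

/-- If both ends of an edge that splits off a loop with highest layer `k` are still available at
the stages with second index `k`, then one of them is matched there. -/
theorem Adds.matched {j k : ℕ} {a b : V} (h : G.Adds j k a b) (ha : G.Critical k a)
    (hb : G.Critical k b) :
    ∃ l, j ≤ l ∧ l < k ∧ ((∃ c, G.mat l k a c) ∨ ∃ c, G.mat l k c b) := by
  have hak : G.bit a k = false := by
    have := h.2.2.2.2.1.1
    rwa [h.2.1, Function.update_of_ne h.2.2.1.ne'] at this
  have hkb : k ∉ G.red b := by
    rw [h.2.2.2.2.2]; exact fun h' => h.2.2.2.1 (G.red_sub a h')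
  rcases G.iso_mat h.iso with h' | ⟨l, m, d, e, he, hm, had⟩
  · exact ⟨j, le_rfl, h.2.2.1, Or.inl ⟨b, h'⟩⟩
  rcases he with he | ⟨rfl, he, he'⟩
  · rcases Matched.of_adjacent hm had with h' | h'
    · exact absurd h' (ha m he l)
    · exact absurd h' (hb m he l)
  -- A blocking edge with the same `k` can meet this one only source to source or target to target:
  -- layer `k` has the 0-smoothing at both ends, and it is a closing only at `b`, where the loop is
  -- blue.
  rcases adjacent_iff.1 had with rfl | rfl | rfl | rfl
  · rcases mat_kind hm with h1 | h1
    · exact ⟨l, he.le, h1.2.2.1, Or.inl ⟨e, hm⟩⟩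
    · exact absurd (G.red_sub a h1.2.2.2.1) h.2.2.2.1
  · rcases mat_kind hm with h1 | h1
    · exact absurd h1.2.2.2.2.1 h.2.2.2.1
    · have := h1.2.1
      obtain rfl := h1.2.2.1
      rw [this, Function.update_self] at hak
      cases hak
  · rcases mat_kind hm with h1 | h1
    · exact absurd h.2.2.2.2.1 h1.2.2.2.1
    · exact absurd h1.2.2.2.1 hkb
  · rcases mat_kind hm with h1 | h1
    · exact ⟨l, he.le, h1.2.2.1, Or.inr ⟨d, hm⟩⟩
    · have h2 := h1.2.1
      have h3 := h.2.2.2.2.1.1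
      obtain rfl := h1.2.2.1
      rw [h2, Function.update_self] at h3
      cases h3

theorem exists_adds_right {j k : ℕ} {a : V} (hj : G.bit a j = false)
    (hk : k ∈ closings (Function.update (G.bit a) j true)) (hk' : k ∉ G.cl a) :
    ∃ b, G.Adds j k a b := by
  obtain ⟨b, hb, hb'⟩ := G.exists_raise (a := a) (j := j) (R := G.red a) (by
    rw [closings_raise_of_new hj hk hk']
    exact (G.red_sub a).trans (Set.subset_insert _ _))
  exact ⟨b, hj, hb, lt_of_new_closing hk hk', hk', by rw [cl, hb]; exact hk, hb'⟩

theorem exists_adds_left {j k : ℕ} {b : V} (hl : j < G.len) (hj : G.bit b j = true)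
    (hk : k ∈ G.cl b) (hr : k ∉ G.red b)
    (hk' : k ∉ closings (Function.update (G.bit b) j false)) : ∃ a, G.Adds j k a b := by
  have e5 := closings_raise_of_new (x := Function.update (G.bit b) j false) (j := j) (k := k)
    (by simp) (by rwa [update_lower hj]) hk'
  rw [update_lower hj] at e5
  obtain ⟨a, ha, ha'⟩ := G.exists_lower (a := b) hl (R := G.red b) (by
    intro m hm
    have := G.red_sub b hm
    rw [e5] at this
    rcases this with rfl | h
    · exact absurd hm hr
    · exact h)
  refine ⟨a, by rw [ha]; simp, by rw [ha, update_lower hj], ?_, by rw [cl, ha]; exact hk', hk, ha'.symm⟩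
  refine lt_of_new_closing (x := Function.update (G.bit b) j false) (j := j) ?_ hk'
  rwa [update_lower hj]

theorem Adds.agree {j k : ℕ} {a b : V} (h : G.Adds j k a b) : G.Agree j a b :=
  ⟨fun i hi => by rw [h.2.1, Function.update_of_ne hi.ne], fun i hi => by rw [h.2.2.2.2.2]⟩

/-- No cell is left over which could have a loop split off by a change in the highest layer below
that of the loop. -/
theorem Critical.not_split_top {u : ℕ} {c : V} (h : G.Critical (u + 2) c)
    (h0 : G.bit c u = false) (h1 : G.bit c (u + 1) = false)
    (hz : JoinedBelow (Function.update (G.bit c) u true) (u + 1))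
    (hc : ¬ JoinedBelow (G.bit c) (u + 1)) (hu : ¬ JoinedBelow (G.bit c) u) : False := by
  obtain ⟨z, hz⟩ := G.exists_adds_right (a := c) (k := u + 1) h0
    ⟨by rw [Function.update_of_ne (by omega)]; exact h1, hz⟩ (fun h => hc h.2)
  have hzu : G.bit z u = true := by rw [hz.2.1, Function.update_self]
  -- A match of `z` with second index `u` would make it the target of an edge that dissolves a loop
  -- in layer `u`, whose strands are not joined.
  have hcz : G.Critical (u + 1) z := by
    refine ((h.mono (by omega)).congr hz.agree).succ fun j hj => ?_
    obtain ⟨-, -, -, h3⟩ := hj.of_true hzu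
    exact hu ((joinedBelow_congr fun i hi => hz.agree.1 i hi).2 h3)
  -- The first index can only be `u`, and a matched edge into `z` at that stage starts at `c`; so
  -- `c` is matched either way.
  obtain ⟨l, hl, hl', ⟨e, he⟩ | ⟨e, he⟩⟩ := hz.matched (h.mono (by omega)) hcz
  · exact h (u + 1) (by omega) l ⟨e, Or.inl he⟩
  · obtain rfl : l = u := by omega
    obtain rfl := (mat_adds he (by omega)).left_unique hz
    exact h (l + 1) (by omega) l ⟨z, Or.inl he⟩

end MatchingModel

end BarNatan

end

/-! ### Critical cells for the periodic word -/

noncomputable section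

namespace BarNatan

open TopMatching

namespace TopMatching

/-- The effect of a layer with a crossing at position `p`; `true` is the 1-smoothing. -/
def step (p : Fin 3) (b : Bool) (s : TopMatching) : TopMatching := if b then s else s.turn p

end TopMatching

theorem topMatching_succ (x : ℕ → Bool) (m : ℕ) :
    topMatching x (m + 1) = step (pos m) (x m) (topMatching x m) := rfl

theorem pos_zero (t : ℕ) : pos (3 * t) = 0 := by simp [pos]
theorem pos_one (t : ℕ) : pos (3 * t + 1) = 1 := by simp [pos, Nat.add_mod]
theorem pos_two (t : ℕ) : pos (3 * t + 2) = 2 := by simp [pos, Nat.add_mod]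

section

variable (x : ℕ → Bool) (t : ℕ)

theorem topMatching_one :
    topMatching x (3 * t + 1) = step 0 (x (3 * t)) (topMatching x (3 * t)) := by
  rw [topMatching_succ, pos_zero]

theorem topMatching_two :
    topMatching x (3 * t + 2) = step 1 (x (3 * t + 1)) (topMatching x (3 * t + 1)) := by
  rw [topMatching_succ, pos_one]

theorem topMatching_three :
    topMatching x (3 * t + 3) = step 2 (x (3 * t + 2)) (topMatching x (3 * t + 2)) := by
  rw [topMatching_succ, pos_two]

theorem topMatching_four :
    topMatching x (3 * t + 4) = step 0 (x (3 * t + 3)) (topMatching x (3 * t + 3)) :=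
  topMatching_one x (t + 1)

theorem topMatching_five :
    topMatching x (3 * t + 5) = step 1 (x (3 * t + 4)) (topMatching x (3 * t + 4)) :=
  topMatching_two x (t + 1)

theorem joinedBelow_zero :
    JoinedBelow x (3 * t) ↔ (topMatching x (3 * t)).joins 0 = true := by
  rw [JoinedBelow, pos_zero]

theorem joinedBelow_one :
    JoinedBelow x (3 * t + 1) ↔ (topMatching x (3 * t + 1)).joins 1 = true := by
  rw [JoinedBelow, pos_one]

theorem joinedBelow_two :
    JoinedBelow x (3 * t + 2) ↔ (topMatching x (3 * t + 2)).joins 2 = true := by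
  rw [JoinedBelow, pos_two]

theorem joinedBelow_three :
    JoinedBelow x (3 * t + 3) ↔ (topMatching x (3 * t + 3)).joins 0 = true :=
  joinedBelow_zero x (t + 1)

theorem joinedBelow_four :
    JoinedBelow x (3 * t + 4) ↔ (topMatching x (3 * t + 4)).joins 1 = true :=
  joinedBelow_one x (t + 1)

theorem joinedBelow_five :
    JoinedBelow x (3 * t + 5) ↔ (topMatching x (3 * t + 5)).joins 2 = true :=
  joinedBelow_two x (t + 1)

end

/-! The finite checks on matchings that enter the analysis of the critical cells. -/

theorem joins_zero_cases : ∀ (s : TopMatching) (b0 b1 b2 : Bool),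
    (step 2 b2 (step 1 b1 (step 0 b0 s))).joins 0 = true →
    (b1 = true ∧ b0 = false) ∨ (b0 = true ∧ s.joins 0 = true) ∨
      (b1 = true ∧ (step 0 b0 s).joins 1 = true) ∨
      (b1 = false ∧ b2 = false ∧ step 0 b0 s = parallel) ∨
      (b1 = false ∧ step 0 b0 s = nested) := by decide

theorem joins_one_cases : ∀ (s : TopMatching) (b1 b2 b3 : Bool),
    (step 0 b3 (step 2 b2 (step 1 b1 s))).joins 1 = true →
    b3 = true ∧ b2 = true ∧ (b1 = false ∨ (b1 = true ∧ s.joins 1 = true)) := by decide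

theorem joins_two_cases : ∀ (s : TopMatching) (b2 b3 b4 : Bool),
    (step 1 b4 (step 0 b3 (step 2 b2 s))).joins 2 = true →
    b4 = true ∧ (b2 = false ∨ (b2 = true ∧ s.joins 2 = true) ∨
      (b2 = true ∧ b3 = false ∧ s = nested)) := by decide

theorem step_zero_eq_nested : ∀ (s : TopMatching) (b : Bool),
    step 0 b s = nested → b = true ∧ s = nested := by decide

theorem step_two_eq_nested : ∀ (s : TopMatching) (b : Bool),
    step 2 b s = nested → b = true ∧ s = nested := by decide

theorem step_one_eq_nested : ∀ (s : TopMatching) (b : Bool),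
    step 1 b s = nested → (b = true ∧ s = nested) ∨ (b = false ∧ (s = parallel ∨ s = nested)) := by
  decide

theorem step_zero_eq_parallel : ∀ (s : TopMatching) (b : Bool),
    step 0 b s = parallel → b = false ∨ (b = true ∧ s.joins 0 = true) := by decide

theorem turn_zero_cases : ∀ s : TopMatching, step 0 false s = p01 ∨ step 0 false s = parallel := by
  decide

namespace MatchingModel

variable {V : Type} {G : MatchingModel V}

theorem Critical.not_joined' {k l : ℕ} {b : V} (h : G.Critical l b) (hl : l ≤ G.len) (hk : k < l)
    (hb : G.bit b k = true) : ¬ JoinedBelow (G.bit b) k :=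
  (h.mono hk).not_joined (by omega) hb

variable (G) in
/-- No critical cell has a loop at a `σ₂`-crossing above a nested matching. -/
def NoNestedClosing (t : ℕ) : Prop := ∀ b, G.Critical (3 * t + 2) b → G.bit b (3 * t + 1) = false →
  topMatching (G.bit b) (3 * t + 1) ≠ nested

/-- `joins_zero_cases` lists the ways in which the two left strands can be joined. All but the
claimed one contain a 1-smoothing over joined strands, a loop that can be split off by the layer
just below its top, or a loop closed above a nested matching. -/
theorem Critical.bits_zero_of {t : ℕ} (H : G.NoNestedClosing t) {b : V}
    (h : G.Critical (3 * t + 3) b) (hl : 3 * t + 3 ≤ G.len)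
    (hj : JoinedBelow (G.bit b) (3 * t + 3)) :
    G.bit b (3 * t + 1) = true ∧ G.bit b (3 * t) = false := by
  rw [joinedBelow_three, topMatching_three, topMatching_two, topMatching_one] at hj
  rcases joins_zero_cases _ _ _ _ hj with h1 | ⟨h1, h2⟩ | ⟨h1, h2⟩ | ⟨h1, h2, h3⟩ | ⟨h1, h2⟩
  · exact h1
  · exact absurd ((joinedBelow_zero _ _).2 h2) (h.not_joined' hl (by omega) h1)
  · rw [← topMatching_one] at h2
    exact absurd ((joinedBelow_one _ _).2 h2) (h.not_joined' hl (by omega) h1)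
  · rw [← topMatching_one] at h3
    -- Over a parallel matching, vertical lines in layer `3t + 1` would let the 0-smoothing in layer
    -- `3t + 2` close a loop.
    refine (h.not_split_top (u := 3 * t + 1) h1 h2 ?_ ?_ ?_).elim
    · rw [joinedBelow_two, topMatching_two, Function.update_self,
        topMatching_congr (y := G.bit b) fun i hi => Function.update_of_ne (by omega) _ _, h3]
      decide
    · rw [joinedBelow_two, topMatching_two, h1, h3]; decide
    · rw [joinedBelow_one, h3]; decide
  · rw [← topMatching_one] at h2
    exact absurd h2 (H b (h.mono (by omega)) h1)

/-- Going down from the nested matching, the layers `3s + 3` and `3s + 2` must have 1-smoothings,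
and layer `3s + 1` must have a 0-smoothing over a parallel matching. Lowering layer `3s + 3` gives a
cell `y` from which the loop at `3s + 4` is split off to give `b`. If `y` is still free for second
index `3s + 4`, then `b` is matched there; if not, the partner of `y` has a shape that critical
cells cannot have. -/
theorem noNestedClosing (t : ℕ) : G.NoNestedClosing t := by
  induction t with
  | zero =>
    intro b _ _ hn
    rw [topMatching_one] at hn
    have := (step_zero_eq_nested _ _ hn).2
    simp [topMatching] at this
  | succ s ih =>
    intro b h hv hn
    rw [show 3 * (s + 1) + 1 = 3 * s + 4 by ring] at hv hn
    rw [show 3 * (s + 1) + 2 = 3 * s + 5 by ring] at h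
    have hl : 3 * s + 4 < G.len := G.lt_len hv
    have hn4 := hn
    rw [topMatching_four] at hn
    obtain ⟨h3, hn⟩ := step_zero_eq_nested _ _ hn
    have hn3 := hn
    rw [topMatching_three] at hn
    obtain ⟨h2, hn⟩ := step_two_eq_nested _ _ hn
    rw [topMatching_two] at hn
    obtain ⟨h1, hn⟩ | ⟨h1, hn | hn⟩ := step_one_eq_nested _ _ hn
    · exact h.not_joined' (by omega) (by omega) h1 ((joinedBelow_one _ _).2 (by rw [hn]; decide))
    swap
    · exact ih b (h.mono (by omega)) h1 hn
    have hlow : topMatching (Function.update (G.bit b) (3 * s + 3) false) (3 * s + 3) = nested := by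
      rw [topMatching_congr (y := G.bit b) fun i hi => Function.update_of_ne (by omega) _ _, hn3]
    obtain ⟨y, hy⟩ := G.exists_adds_left (j := 3 * s + 3) (k := 3 * s + 4) (b := b) (by omega) h3
      ⟨hv, (joinedBelow_four _ _).2 (by rw [hn4]; decide)⟩ h.not_red (by
        rw [mem_closings, joinedBelow_four, topMatching_four, hlow, Function.update_self]
        rintro ⟨-, h⟩; revert h; decide)
    have hyb : G.bit y = Function.update (G.bit b) (3 * s + 3) false := by
      rw [hy.2.1, update_raise hy.1]
    have hnot : ∀ l, ¬ ∃ c, G.mat l (3 * s + 4) c b := fun l ⟨c, hc⟩ =>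
      h (3 * s + 4) (by omega) l ⟨c, Or.inr hc⟩
    have hy3 : G.Critical (3 * s + 3) y := (h.mono (by omega)).congr hy.agree.symm
    by_cases hcy : ∀ j, ¬ G.Matched j (3 * s + 3) y
    · obtain ⟨l, hl, hl', ⟨c, hc⟩ | hc⟩ := hy.matched (hy3.succ hcy) (h.mono (by omega))
      · obtain rfl : l = 3 * s + 3 := by omega
        obtain rfl := (mat_adds hc (by omega)).right_unique hy
        exact hnot _ ⟨y, hc⟩
      · exact hnot _ hc
    -- A partner `w` of `y` at second index `3s + 3` must have the 1-smoothing in layer `3s + 1`.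
    -- Its 1-smoothing in layer `3s + 2` then lies over strands joined by the parallel matching.
    · push Not at hcy
      obtain ⟨j, hj⟩ := hcy
      obtain ⟨w, hw, hyw⟩ := hj.of_not_joined (by
        rw [joinedBelow_three, hyb, hlow]; decide)
      obtain ⟨hw1, -⟩ := (critical_right hw).bits_zero_of ih (by omega) hyw.2.2.2.2.1.2
      have hj1 : j = 3 * s + 1 := by
        by_contra hne
        rw [hyw.2.1, Function.update_of_ne (by omega), hyb, Function.update_of_ne (by omega),
          h1] at hw1
        cases hw1
      subst hj1
      have hwlow : topMatching (G.bit w) (3 * s + 1) = parallel := by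
        rw [topMatching_congr (y := G.bit b) fun i hi => by
          rw [hyw.2.1, Function.update_of_ne (by omega), hyb, Function.update_of_ne (by omega)], hn]
      refine (critical_right hw).not_joined' (k := 3 * s + 2) (by omega) (by omega) ?_ ?_
      · rw [hyw.2.1, Function.update_of_ne (by omega), hyb, Function.update_of_ne (by omega), h2]
      · rw [joinedBelow_two, topMatching_two, hw1, hwlow]; decide

theorem Critical.bits_zero {t : ℕ} {b : V} (h : G.Critical (3 * t + 3) b) (hl : 3 * t + 3 ≤ G.len)
    (hj : JoinedBelow (G.bit b) (3 * t + 3)) :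
    G.bit b (3 * t + 1) = true ∧ G.bit b (3 * t) = false :=
  h.bits_zero_of (noNestedClosing t) hl hj

theorem Critical.bits_one {t : ℕ} {b : V} (h : G.Critical (3 * t + 4) b) (hl : 3 * t + 4 ≤ G.len)
    (hj : JoinedBelow (G.bit b) (3 * t + 4)) :
    G.bit b (3 * t + 3) = true ∧ G.bit b (3 * t + 2) = true ∧ G.bit b (3 * t + 1) = false := by
  rw [joinedBelow_four, topMatching_four, topMatching_three, topMatching_two] at hj
  obtain ⟨h3, h2, h1 | ⟨h1, h0⟩⟩ := joins_one_cases _ _ _ _ hj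
  · exact ⟨h3, h2, h1⟩
  · exact absurd ((joinedBelow_one _ _).2 h0) (h.not_joined' hl (by omega) h1)

theorem Adds.bit_right {j k : ℕ} {a b : V} (h : G.Adds j k a b) : G.bit b j = true := by
  rw [h.2.1, Function.update_self]

theorem Adds.bit_ne {j k i : ℕ} {a b : V} (h : G.Adds j k a b) (hi : i ≠ j) :
    G.bit a i = G.bit b i := by
  rw [h.2.1, Function.update_of_ne hi]

theorem Adds.bit_top {j k : ℕ} {a b : V} (h : G.Adds j k a b) :
    G.bit a k = false ∧ G.bit b k = false :=
  ⟨(h.bit_ne h.2.2.1.ne').trans h.2.2.2.2.1.1, h.2.2.2.2.1.1⟩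

theorem Adds.not_joined {j k : ℕ} {a b : V} (h : G.Adds j k a b) : ¬ JoinedBelow (G.bit a) k :=
  fun h' => h.2.2.2.1 ⟨h.bit_top.1, h'⟩

theorem Adds.joined {j k : ℕ} {a b : V} (h : G.Adds j k a b) : JoinedBelow (G.bit b) k :=
  h.2.2.2.2.1.2

theorem Adds.bit_ne_of_false {j k i : ℕ} {a b : V} (h : G.Adds j k a b)
    (hi : G.bit b i = false) : G.bit a i = false := by
  rw [h.bit_ne, hi]
  rintro rfl
  rw [h.bit_right] at hi
  cases hi

/-- By `Critical.bits_zero` the target has a 0-smoothing in layer `3t` and vertical lines in layer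
`3t + 1`, and this alone joins the left strands at layer `3t + 3`. The source lacks the pattern, and
undoing a raise can destroy it only in layer `3t + 1`. -/
theorem index_zero {t j : ℕ} {a b : V} (h : G.mat j (3 * t + 3) a b) (hj : j < 3 * t + 3) :
    j = 3 * t + 1 ∧ G.bit b (3 * t + 1) = true ∧ G.bit b (3 * t) = false := by
  have hab := mat_adds h hj
  have hl := G.lt_len hab.bit_top.2
  obtain ⟨h1, h0⟩ := (critical_right h).bits_zero hl.le hab.joined
  refine ⟨?_, h1, h0⟩
  by_contra hne
  refine hab.not_joined ?_
  rw [joinedBelow_three, topMatching_three, topMatching_two, topMatching_one,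
    hab.bit_ne_of_false h0, hab.bit_ne (Ne.symm hne), h1]
  generalize topMatching (G.bit a) (3 * t) = s
  generalize G.bit a (3 * t + 2) = c
  revert s c; decide

/-- Here the joining pattern is a 0-smoothing in layer `3t + 1` followed by vertical lines in the
layers `3t + 2` and `3t + 3`, so either of the latter may be the raised one. -/
theorem index_one {t j : ℕ} {a b : V} (h : G.mat j (3 * t + 4) a b) (hj : j < 3 * t + 4) :
    (j = 3 * t + 2 ∨ j = 3 * t + 3) ∧ G.bit b (3 * t + 3) = true ∧
      G.bit b (3 * t + 2) = true ∧ G.bit b (3 * t + 1) = false := by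
  have hab := mat_adds h hj
  have hl := G.lt_len hab.bit_top.2
  obtain ⟨h3, h2, h1⟩ := (critical_right h).bits_one hl.le hab.joined
  refine ⟨?_, h3, h2, h1⟩
  by_contra! hne
  refine hab.not_joined ?_
  rw [joinedBelow_four, topMatching_four, topMatching_three, topMatching_two,
    hab.bit_ne_of_false h1, hab.bit_ne hne.1.symm, hab.bit_ne hne.2.symm, h2, h3]
  generalize topMatching (G.bit a) (3 * t + 1) = s
  revert s; decide

/-- If layer `3t + 4` is not the raised one, the finite check leaves only a nested matching turned
by the 0-smoothing in layer `3t + 3`, with the raise below layer `3t`. But then a raise of layer `3t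
+ 1` splits off from `a` a loop with the lower top `3t + 3`, so `a` would have been matched earlier.
-/
theorem index_two {t j : ℕ} {a b : V} (h : G.mat j (3 * t + 5) a b) (hj : j < 3 * t + 5) :
    j = 3 * t + 4 ∧ G.bit b (3 * t + 4) = true := by
  have hab := mat_adds h hj
  have hl := G.lt_len hab.bit_top.2
  have hcb := critical_right h
  have hj2 := hab.joined
  rw [joinedBelow_five, topMatching_five, topMatching_four, topMatching_three] at hj2
  obtain ⟨h4, hc⟩ := joins_two_cases _ _ _ _ hj2
  refine ⟨?_, h4⟩
  by_contra hne
  have ha4 : G.bit a (3 * t + 4) = true := by rw [hab.bit_ne (Ne.symm hne), h4]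
  have hna := hab.not_joined
  rw [joinedBelow_five, topMatching_five, topMatching_four, topMatching_three, ha4] at hna
  rcases hc with h2 | ⟨h2, h1⟩ | ⟨h2, h3, h1⟩
  · refine hna ?_
    rw [hab.bit_ne_of_false h2]
    generalize topMatching (G.bit a) (3 * t + 2) = s
    generalize G.bit a (3 * t + 3) = c
    revert s c; decide
  · exact hcb.not_joined' hl.le (by omega) h2 ((joinedBelow_two _ _).2 h1)
  have ha3 := hab.bit_ne_of_false h3
  have hn2 := h1
  rw [topMatching_two] at h1
  obtain ⟨h1, hn⟩ | ⟨h1, hn | hn⟩ := step_one_eq_nested _ _ h1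
  · exact hcb.not_joined' hl.le (by omega) h1 ((joinedBelow_one _ _).2 (by rw [hn]; decide))
  swap
  · exact noNestedClosing t b (hcb.mono (by omega)) h1 hn
  have hp := hn
  rw [topMatching_one] at hn
  obtain h0 | ⟨h0, hn⟩ := step_zero_eq_parallel _ _ hn
  swap
  · exact hcb.not_joined' hl.le (by omega) h0 ((joinedBelow_zero _ _).2 hn)
  have hjne : ∀ i, G.bit b i = false → i ≠ j := by
    rintro i hi rfl
    rw [hab.bit_right] at hi; cases hi
  by_cases hj2 : j = 3 * t + 2
  · subst hj2
    refine hna ?_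
    rw [hab.1, ha3, topMatching_congr (y := G.bit b) fun i hi => hab.bit_ne (by omega), hn2]
    decide
  have hj0 : j < 3 * t := by
    have := hjne _ h0
    have := hjne _ h1
    have := hjne _ h3
    omega
  have ha2 : G.bit a (3 * t + 2) = true := by rw [hab.bit_ne (by omega), h2]
  have ha1 := hab.bit_ne_of_false h1
  have ha0 := hab.bit_ne_of_false h0
  have hcase := turn_zero_cases (topMatching (G.bit a) (3 * t))
  rw [← ha0, ← topMatching_one] at hcase
  rw [topMatching_two, ha1, ha2, ha3] at hna
  rcases hcase with hc | hc
  swap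
  · rw [hc] at hna; exact hna (by decide)
  -- Vertical lines in layer `3t + 1` keep the left strands joined up to the 0-smoothing in layer
  -- `3t + 3`, which then closes a loop.
  have hup : topMatching (Function.update (G.bit a) (3 * t + 1) true) (3 * t + 2) = p01 := by
    rw [topMatching_two, Function.update_self,
      topMatching_congr (y := G.bit a) fun i hi => Function.update_of_ne (by omega) _ _, hc]
    decide
  obtain ⟨z, hz⟩ := G.exists_adds_right (a := a) (j := 3 * t + 1) (k := 3 * t + 3) ha1 (by
      rw [mem_closings, joinedBelow_three, topMatching_three, hup,
        Function.update_of_ne (by omega), Function.update_of_ne (by omega), ha3, ha2]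
      decide) (by
      rw [mem_closings, joinedBelow_three, topMatching_three, topMatching_two, hc, ha1, ha2]
      rintro ⟨-, h⟩; revert h; decide)
  have hca := critical_left h
  -- Below layer `3t + 1` the cell `z` looks like `a`; in the layers `3t + 1` and `3t + 2` it has
  -- 1-smoothings over strands that are not joined, so it is not matched at those second indices
  -- either.
  have hcz : G.Critical (3 * t + 3) z := by
    refine (((hca.mono (by omega)).congr hz.agree).succ fun l hl => ?_).succ fun l hl => ?_
    · obtain ⟨-, -, -, h5⟩ := hl.of_true hz.bit_right
      rw [joinedBelow_one, topMatching_congr (y := G.bit a) fun i hi => (hz.bit_ne (by omega)).symm,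
        hc] at h5
      exact absurd h5 (by decide)
    · obtain ⟨-, -, -, h5⟩ := hl.of_true (by rw [← hz.bit_ne (by omega), ha2])
      rw [joinedBelow_two, hz.2.1, hup] at h5
      exact absurd h5 (by decide)
  obtain ⟨l, hl, hl', ⟨c, hm⟩ | ⟨c, hm⟩⟩ := hz.matched (hca.mono (by omega)) hcz
  · exact hca _ (by omega) l ⟨c, Or.inl hm⟩
  · obtain ⟨rfl, -⟩ := index_zero hm hl'
    obtain rfl := (mat_adds hm hl').left_unique hz
    exact hca _ (by omega) _ ⟨z, Or.inl hm⟩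

/-- No strands are joined at level `0`, and the first three crossings are in different positions, so
none of them caps strands joined below. -/
theorem not_adds_low {j k : ℕ} {a b : V} (hk : k < 3) : ¬ G.Adds j k a b := by
  intro h
  have hj := h.joined
  interval_cases k
  · simp [JoinedBelow, topMatching, joins] at hj
  · rw [show (1 : ℕ) = 3 * 0 + 1 from rfl, joinedBelow_one, topMatching_one] at hj
    rw [show topMatching (G.bit b) (3 * 0) = .none from rfl] at hj
    generalize G.bit b (3 * 0) = c at hj
    revert hj; revert c; decide
  · rw [show (2 : ℕ) = 3 * 0 + 2 from rfl, joinedBelow_two, topMatching_two, topMatching_one] at hj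
    rw [show topMatching (G.bit b) (3 * 0) = .none from rfl] at hj
    generalize G.bit b (3 * 0) = c at hj
    generalize G.bit b (3 * 0 + 1) = d at hj
    revert hj; revert c d; decide

end MatchingModel

end BarNatan

end

/-! ### Zigzags of the matching and their potentials -/

noncomputable section

namespace BarNatan

open TopMatching

/-- A monotone function is constant along a cycle. Used repeatedly, this discards all steps on which
some potential is strict. -/
theorem transGen_cycle_of_monotone {V A : Type} [PartialOrder A] {R S : V → V → Prop}
    (f : V → A) (h : ∀ x y, R x y → f x ≤ f y) (h' : ∀ x y, R x y → f x = f y → S x y) {a : V}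
    (ha : Relation.TransGen R a a) : Relation.TransGen S a a := by
  have key : ∀ b, Relation.TransGen R a b → f a ≤ f b ∧ (f b ≤ f a → Relation.TransGen S a b) := by
    intro b hb
    induction hb with
    | single hab => exact ⟨h _ _ hab, fun hb => .single (h' _ _ hab ((h _ _ hab).antisymm hb))⟩
    | tail _ hbc ih =>
      have := h _ _ hbc
      refine ⟨ih.1.trans this, fun hc => (ih.2 (this.trans hc)).tail (h' _ _ hbc ?_)⟩
      exact this.antisymm (hc.trans ih.1)
  exact (key a ha).2 le_rfl

theorem transGen_cycle_pred {V : Type} {R : V → V → Prop} {a : V}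
    (ha : Relation.TransGen R a a) : Relation.TransGen (fun x y => R x y ∧ ∃ z, R z x) a a := by
  obtain ⟨c, hc⟩ : ∃ c, R c a := by
    cases ha with
    | single h => exact ⟨_, h⟩
    | tail _ h => exact ⟨_, h⟩
  have key : ∀ b, Relation.TransGen R a b →
      Relation.TransGen (fun x y => R x y ∧ ∃ z, R z x) a b ∧ ∃ z, R z b := by
    intro b hb
    induction hb with
    | single hab => exact ⟨.single ⟨hab, c, hc⟩, _, hab⟩
    | tail _ hbc ih => exact ⟨ih.1.tail ⟨hbc, ih.2⟩, _, hbc⟩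
  exact (key a ha).1

/-- The sum of the weights of the layers below `n` in which `x` is true. -/
def weight (n : ℕ) (f : ℕ → ℕ) (x : ℕ → Bool) : ℕ := ∑ m ∈ Finset.range n, if x m then f m else 0

theorem weight_update {n : ℕ} (f : ℕ → ℕ) {x : ℕ → Bool} {i : ℕ} (hi : i < n) (hx : x i = false) :
    weight n f (Function.update x i true) = weight n f x + f i := by
  rw [weight, weight, ← Finset.add_sum_erase _ _ (Finset.mem_range.2 hi),
    ← Finset.add_sum_erase (Finset.range n) (fun m => if x m = true then f m else 0)
      (Finset.mem_range.2 hi)]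
  simp only [Function.update_self, hx, if_true, Bool.false_eq_true, if_false]
  rw [zero_add, add_comm]
  congr 1
  refine Finset.sum_congr rfl fun m hm => ?_
  rw [Function.update_of_ne (Finset.ne_of_mem_erase hm)]

open Classical in
/-- The sum of the elements of `R` below `n`. -/
def sumBelow (n : ℕ) (R : Set ℕ) : ℕ := weight n id fun m => decide (m ∈ R)

theorem sumBelow_insert {n i : ℕ} {R : Set ℕ} (hi : i < n) (hR : i ∉ R) :
    sumBelow n (insert i R) = sumBelow n R + i := by
  classical
  have : (fun m => decide (m ∈ insert i R)) =
      Function.update (fun m => decide (m ∈ R)) i true := by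
    ext m
    by_cases h : m = i
    · subst h; simp
    · simp [h]
  have h := weight_update id (x := fun m => decide (m ∈ R)) hi (by simpa using hR)
  rw [← this] at h
  simpa [sumBelow] using h

/-- `ρ (3t + 2) = ρ (3t + 3)`, and otherwise `ρ` is strictly increasing. -/
def layerRank (l : ℕ) : ℕ := 2 * (l + 1) / 3

namespace MatchingModel

variable {V : Type} (G : MatchingModel V)

/-- The edge `a → b` is not matched, but `a` is the source of a matched edge, and `b` is the target
of the matched edge `a' → b`. -/
structure Zigzag (i j u : ℕ) (a b a' : V) : Prop where
  iso : ∃ U, G.iso i U a b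
  not_mat : ∀ l m, ¬ G.mat l m a b
  source : ∃ l m c, G.mat l m a c
  mat : G.mat j u a' b

variable {G}

theorem iso_bits {i U : ℕ} {a b : V} (h : G.iso i U a b) :
    G.bit a i = false ∧ G.bit b = Function.update (G.bit a) i true :=
  ⟨(G.iso_move h).1, (G.iso_move h).2.1⟩

/-- All loops that appear, disappear or change colour have their highest layer in layer `i` or
above. -/
theorem iso_agree {i U : ℕ} {a b : V} (h : G.iso i U a b) : G.Agree i a b := by
  obtain ⟨h0, h1, h⟩ := G.iso_move h
  refine ⟨fun m hm => by rw [h1, Function.update_of_ne hm.ne], fun m hm => ?_⟩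
  rcases h with ⟨-, -, h⟩ | ⟨h2, h3, h⟩ | ⟨h2, h3, h, l, hl, h4, h5, h6⟩ |
    ⟨h2, h3, l, hl, h4, h5, h⟩
  · rw [h]
  · rw [h1] at h3
    have := le_of_lost_closing (G.red_sub a h2) h3
    rw [h]; simp [show m ≠ U by omega]
  · rw [h1] at h6
    have := le_of_lost_closing h4 h6
    rw [h]; simp [show m ≠ U by omega]
  · rw [h1] at h5
    have := lt_of_new_closing h5 h4
    rw [h]; simp [show m ≠ U by omega, show m ≠ l by omega]

theorem mat_bits {j u : ℕ} {a b : V} (h : G.mat j u a b) :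
    G.bit a j = false ∧ G.bit b = Function.update (G.bit a) j true := iso_bits (G.mat_iso h)

namespace Zigzag

variable {i j u : ℕ} {a b a' : V}

theorem agree (h : G.Zigzag i j u a b a') : G.Agree i a b := by
  obtain ⟨U, hU⟩ := h.iso
  exact iso_agree hU

theorem bit_left (h : G.Zigzag i j u a b a') : G.bit a i = false := by
  obtain ⟨U, hU⟩ := h.iso
  exact (iso_bits hU).1

theorem bit_eq (h : G.Zigzag i j u a b a') : G.bit b = Function.update (G.bit a) i true := by
  obtain ⟨U, hU⟩ := h.iso
  exact (iso_bits hU).2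

theorem bit_ne (h : G.Zigzag i j u a b a') {l : ℕ} (hl : l ≠ i) : G.bit a l = G.bit b l := by
  rw [h.bit_eq, Function.update_of_ne hl]

theorem bit_right (h : G.Zigzag i j u a b a') : G.bit b i = true := by
  rw [h.bit_eq, Function.update_self]

theorem joined_iff (h : G.Zigzag i j u a b a') {m : ℕ} (hm : m ≤ i) :
    JoinedBelow (G.bit a) m ↔ JoinedBelow (G.bit b) m :=
  joinedBelow_congr fun l hl => h.bit_ne (by omega)

/-- Below layer `i` the cells `a` and `b` look alike, so a match of `a` at a second index below `i`
would by locality make `b` a source, whereas it is a target. -/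
theorem le_source (h : G.Zigzag i j u a b a') {l m : ℕ} {c : V} (hc : G.mat l m a c) : i ≤ m := by
  by_contra! hm
  obtain ⟨d, -, hd⟩ := (localAt l m).left hc (h.agree.mono (by omega))
  exact not_source_of_target h.mat hd

theorem le_target (h : G.Zigzag i j u a b a') : i ≤ u := by
  by_contra! hm
  obtain ⟨d, -, hd⟩ := (localAt j u).right h.mat (h.agree.symm.mono (by omega))
  obtain ⟨l, m, c, hc⟩ := h.source
  exact not_source_of_target hd hc

/-- An unmatched isomorphism of stage `(i, i)` is blocked at a second index below `i`, but both ends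
are matched at second indices at least `i`. -/
theorem iso_ne (h : G.Zigzag i j u a b a') : ¬ G.iso i i a b := by
  intro hi
  rcases G.iso_mat hi with h' | ⟨l, m, d, e, he, hm, had⟩
  · exact h.not_mat _ _ h'
  have hmi : m < i := by rcases he with he | he <;> omega
  obtain ⟨l', m', c, hc⟩ := h.source
  have h1 := h.le_source hc
  have h2 := h.le_target
  rcases adjacent_iff.1 had with rfl | rfl | rfl | rfl
  · have := source_unique hm hc; omega
  · exact not_source_of_target hm hc
  · exact not_source_of_target h.mat hm
  · have := target_unique hm h.mat; omega

/-- An edge that splits off a loop which is blue in the target does not change the red loops. -/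
theorem red_eq_of_new (h : G.Zigzag i j u a b a') {k : ℕ} (hk : k ∉ G.cl a) (hk' : k ∈ G.cl b)
    (hr : k ∉ G.red b) : G.red b = G.red a := by
  obtain ⟨U, hU⟩ := h.iso
  obtain ⟨h0, h1, h'⟩ := G.iso_move hU
  have hcl : closings (G.bit b) = insert k (closings (G.bit a)) := by
    rw [h1]; exact closings_raise_of_new h0 (by rw [← h1]; exact hk') hk
  rcases h' with ⟨-, -, h'⟩ | ⟨h2, h3, -⟩ | ⟨h2, h3, -, l, hl, h4, h5, h6⟩ |
    ⟨h2, h3, l, hl, h4, h5, h'⟩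
  · exact h'
  · exact absurd (by rw [hcl]; exact Or.inr (G.red_sub a h2)) h3
  · exact absurd (by rw [hcl]; exact Or.inr h4) h6
  · rw [hcl] at h5
    obtain rfl := h5.resolve_right h4
    exact absurd (by rw [h']; exact Or.inl rfl) hr

theorem adds_of_new (h : G.Zigzag i j u a b a') {k : ℕ} (hk : k ∉ G.cl a) (hk' : k ∈ G.cl b)
    (hr : k ∉ G.red b) : G.Adds i k a b := by
  refine ⟨h.bit_left, h.bit_eq, ?_, hk, hk', h.red_eq_of_new hk hk' hr⟩
  refine lt_of_new_closing (x := G.bit a) ?_ hk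
  rw [← h.bit_eq]; exact hk'

theorem critical (h : G.Zigzag i j u a b a') {k : ℕ} (hk : ∀ l m c, G.mat l m a c → k ≤ m) :
    G.Critical k a := by
  obtain ⟨l, m, c, hc⟩ := h.source
  exact (critical_left hc).mono (hk l m c hc)

end Zigzag

theorem Adds.not_red {j k : ℕ} {a b : V} (h : G.Adds j k a b) : k ∉ G.red b := by
  rw [h.2.2.2.2.2]; exact fun h' => h.2.2.2.1 (G.red_sub a h')

theorem index_two' {t j : ℕ} {a b : V} (h : G.mat j (3 * t + 2) a b) (hj : j < 3 * t + 2) :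
    j = 3 * t + 1 ∧ G.bit b (3 * t + 1) = true := by
  rcases t with _ | t
  · exact absurd (mat_adds h hj) (not_adds_low (by omega))
  · exact index_two h (by omega)

theorem step_zero_false : ∀ s : TopMatching,
    step 0 false s = p01 ∨ step 0 false s = parallel := by decide

theorem step_one_false : ∀ s : TopMatching,
    step 1 false s = p12 ∨ step 1 false s = nested := by decide

namespace Zigzag

variable {t u : ℕ} {a b a' : V}

/-- In this configuration `a` has a 1-smoothing in layer `3t + 1`, a 0-smoothing in layer `3t + 2`
and a blue loop closed in layer `3t + 3`. That loop too can be split off by a raise of layer `3t +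
1`, from a cell `y` that looks like `a'` below layer `3t + 2`. Both ends of `y → a` are free at
second index `3t + 3`, so `a` would be matched there, although it is matched only later. -/
theorem not_two_one (h : G.Zigzag (3 * t + 2) (3 * t + 1) (3 * t + 3) a b a') : False := by
  have hab := mat_adds h.mat (by omega)
  obtain ⟨-, b1, b0⟩ := index_zero h.mat (by omega)
  have b3 := hab.bit_top.2
  have hl := G.lt_len b3
  have b2 := h.bit_right
  have hcb := critical_right h.mat
  have a2 := h.bit_left
  have a1 : G.bit a (3 * t + 1) = true := by rw [h.bit_ne (by omega), b1]
  have a0 : G.bit a (3 * t) = false := by rw [h.bit_ne (by omega), b0]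
  have a3 : G.bit a (3 * t + 3) = false := by rw [h.bit_ne (by omega), b3]
  have hj2 : ¬ JoinedBelow (G.bit a) (3 * t + 2) := by
    rw [h.joined_iff le_rfl]; exact hcb.not_joined' (by omega) (by omega) b2
  -- A red loop would have to turn blue along `a → b`, which needs a lower loop to appear or
  -- disappear. This could only be in layer `3t + 2`, where the strands are not joined.
  have hred : 3 * t + 3 ∉ G.red a := by
    intro hr
    have hr' := hab.not_red
    have hc := hab.2.2.2.2.1
    obtain ⟨U, hU⟩ := h.iso
    obtain ⟨h0, h1, h'⟩ := G.iso_move hU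
    rcases h' with ⟨-, -, h'⟩ | ⟨h2, h3, h'⟩ | ⟨h2, h3, h', l, hl, h4, h5, h6⟩ |
      ⟨h2, h3, l, hl, h4, h5, h'⟩
    · exact hr' (by rw [h']; exact hr)
    all_goals
      have hUu : U = 3 * t + 3 := by
        by_contra hne
        refine hr' ?_
        rw [h']
        first | exact ⟨hr, Ne.symm hne⟩ | exact Or.inr ⟨hr, Ne.symm hne⟩
      subst hUu
    · exact h3 hc
    · rw [h1] at h6
      have := le_of_lost_closing h4 h6
      obtain rfl : l = 3 * t + 2 := by omega
      exact hj2 h4.2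
    · rw [h1] at h5
      have := lt_of_new_closing h5 h4
      omega
  -- At second index `3t + 2` or `3t + 3`, a matched edge from `a` would raise layer `3t + 1`, which
  -- already has the 1-smoothing, or dissolve a red loop that `a` does not have.
  have hca : G.Critical (3 * t + 4) a := by
    refine h.critical fun l m c hm => ?_
    have := h.le_source hm
    by_contra! hlt
    rcases (show m = 3 * t + 2 ∨ m = 3 * t + 3 by omega) with rfl | rfl
    · rcases mat_kind hm with h1 | h1
      · obtain ⟨rfl, -⟩ := index_two' hm h1.2.2.1
        rw [h1.1] at a1; cases a1
      · exact hj2 (G.red_sub a h1.2.2.2.1).2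
    · rcases mat_kind hm with h1 | h1
      · obtain ⟨rfl, -⟩ := index_zero hm h1.2.2.1
        rw [h1.1] at a1; cases a1
      · exact hred h1.2.2.2.1
  have t1 : topMatching (G.bit a) (3 * t + 1) = p01 := by
    have h1 := step_zero_false (topMatching (G.bit a) (3 * t))
    rw [← a0, ← topMatching_one] at h1
    refine h1.resolve_right fun h1 => hj2 ?_
    rw [joinedBelow_two, topMatching_two, a1, h1]; decide
  have t1' : topMatching (Function.update (G.bit a) (3 * t + 1) false) (3 * t + 1) = p01 := by
    rw [← t1]; exact topMatching_congr fun i hi => Function.update_of_ne (by omega) _ _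
  obtain ⟨y, hy⟩ := G.exists_adds_left (j := 3 * t + 1) (k := 3 * t + 3) (b := a) (by omega) a1
    ⟨a3, by
      rw [joinedBelow_three, topMatching_three, topMatching_two, t1, a1, a2]; decide⟩ hred (by
      rw [mem_closings, joinedBelow_three, topMatching_three, topMatching_two, t1',
        Function.update_self, Function.update_of_ne (by omega), Function.update_of_ne (by omega), a2]
      rintro ⟨-, h⟩; revert h; decide)
  have hya : G.bit y = Function.update (G.bit a) (3 * t + 1) false := by
    rw [hy.2.1, update_raise hy.1]
  have hay : G.Agree (3 * t + 2) a' y := by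
    refine ⟨fun m hm => ?_, fun m hm => ?_⟩
    · by_cases hm1 : m = 3 * t + 1
      · rw [hm1, hab.1, hy.1]
      · rw [hab.bit_ne hm1, hy.bit_ne hm1, h.bit_ne (by omega)]
    · rw [← hab.2.2.2.2.2, ← hy.2.2.2.2.2]
      exact (h.agree.2 m hm).symm
  have hcy : G.Critical (3 * t + 3) y := by
    refine (((critical_left h.mat).mono (by omega)).congr hay).succ fun l hl => ?_
    obtain ⟨w, hw, hyw⟩ := hl.of_not_joined (by
      rw [hya, joinedBelow_two, topMatching_two, t1', Function.update_self]; decide)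
    obtain ⟨rfl, w1⟩ := index_two' hw hyw.2.2.1
    refine hj2 ?_
    rw [joinedBelow_congr (y := G.bit w)]
    · exact hyw.joined
    · intro m hm
      by_cases hm1 : m = 3 * t + 1
      · rw [hm1, w1, a1]
      · rw [← hyw.bit_ne hm1, hy.bit_ne hm1]
  obtain ⟨l, hl, hl', ⟨c, hm⟩ | ⟨c, hm⟩⟩ := hy.matched hcy (hca.mono (by omega))
  · obtain ⟨rfl, -⟩ := index_zero hm hl'
    obtain rfl := (mat_adds hm hl').right_unique hy
    exact hca _ (by omega) _ ⟨y, Or.inr hm⟩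
  · exact hca _ (by omega) l ⟨c, Or.inr hm⟩

/-- For `j < i` the index lemmas give `j` in terms of `u`, and `i` lies strictly between them,
because `b` has the 0-smoothing in layer `u` and the 1-smoothing in layer `i`. Two pairs remain, of
which `not_two_one` excludes the one that decreases the rank. For `i < j` the rank is monotone. -/
theorem rank_le {i j : ℕ} (h : G.Zigzag i j u a b a') :
    layerRank i ≤ layerRank j ∧
      (layerRank i = layerRank j → i = j ∨
        (∃ t, i = 3 * t + 3 ∧ j = 3 * t + 2 ∧ u = 3 * t + 4) ∨
        (∃ t, i = 3 * t + 2 ∧ j = 3 * t + 3 ∧ (u = 3 * t + 3 ∨ u = 3 * t + 4))) := by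
  have hiu := h.le_target
  have hju := G.le_of_mat h.mat
  simp only [layerRank]
  rcases lt_trichotomy j i with hji | rfl | hij
  · have hab := mat_adds h.mat (by omega)
    have hui : u ≠ i := by
      rintro rfl
      have := hab.bit_top.2
      rw [h.bit_right] at this; cases this
    have hu3 : 3 ≤ u := by
      by_contra! hu; exact not_adds_low hu hab
    obtain ⟨t, rfl | rfl | rfl⟩ : ∃ t, u = 3 * t + 3 ∨ u = 3 * t + 4 ∨ u = 3 * t + 5 :=
      ⟨(u - 3) / 3, by omega⟩
    · obtain ⟨rfl, -⟩ := index_zero h.mat (by omega)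
      obtain rfl : i = 3 * t + 2 := by omega
      exact h.not_two_one.elim
    · obtain ⟨h1, -⟩ := index_one h.mat (by omega)
      exact ⟨by omega, fun _ => Or.inr (Or.inl ⟨t, by omega⟩)⟩
    · obtain ⟨h1, -⟩ := index_two h.mat (by omega)
      omega
  · exact ⟨le_rfl, fun _ => Or.inl rfl⟩
  · refine ⟨by omega, fun hr => Or.inr (Or.inr ?_)⟩
    obtain ⟨t, rfl, rfl⟩ : ∃ t, i = 3 * t + 2 ∧ j = 3 * t + 3 := by
      obtain ⟨g, rfl | rfl | rfl⟩ : ∃ g, i = 3 * g ∨ i = 3 * g + 1 ∨ i = 3 * g + 2 :=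
        ⟨i / 3, by omega⟩
      · omega
      · omega
      · exact ⟨g, rfl, by omega⟩
    refine ⟨t, rfl, rfl, ?_⟩
    by_contra! hne
    have hab := mat_adds h.mat (by omega)
    obtain ⟨s, rfl | rfl | rfl⟩ : ∃ s, u = 3 * s + 3 ∨ u = 3 * s + 4 ∨ u = 3 * s + 5 :=
      ⟨(u - 3) / 3, by omega⟩
    · obtain ⟨h1, -⟩ := index_zero h.mat (by omega)
      omega
    · obtain ⟨h1, -⟩ := index_one h.mat (by omega)
      omega
    · obtain ⟨h1, -⟩ := index_two h.mat (by omega)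
      omega

/-- The bits that decide in which direction the bits of the layers `3t + 2` and `3t + 3` can be
swapped. -/
def SwapState (x : ℕ → Bool) (t : ℕ) : Prop :=
  x (3 * t) = false ∧ (1 ≤ t → x (3 * t - 1) = true)

/-- The edge `a → b` itself splits off the loop at `3t + 4` and is not matched, so `a` was taken
before, at stage `(3t + 1, 3t + 3)`. The shape of its partner `w` gives the 0-smoothing in layer
`3t`; a 0-smoothing in layer `3t - 1` as well would put joined strands under the 1-smoothing of `w`
in layer `3t + 2`. -/
theorem up (h : G.Zigzag (3 * t + 3) (3 * t + 2) (3 * t + 4) a b a') :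
    G.red b = G.red a ∧ SwapState (G.bit a) t := by
  have hab := mat_adds h.mat (by omega)
  obtain ⟨-, b3, b2, b1⟩ := index_one h.mat (by omega)
  have b4 := hab.bit_top.2
  have hl := G.lt_len b4
  have a3 := h.bit_left
  have a2 : G.bit a (3 * t + 2) = true := by rw [h.bit_ne (by omega), b2]
  have a1 : G.bit a (3 * t + 1) = false := by rw [h.bit_ne (by omega), b1]
  have a4 : G.bit a (3 * t + 4) = false := by rw [h.bit_ne (by omega), b4]
  have ht := step_one_false (topMatching (G.bit a) (3 * t + 1))
  rw [← a1, ← topMatching_two] at ht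
  have hnew : 3 * t + 4 ∉ G.cl a := by
    rw [mem_closings, joinedBelow_four, topMatching_four, topMatching_three, a2, a3]
    rintro ⟨-, h⟩; revert h
    rcases ht with ht | ht <;> rw [ht] <;> decide
  have had := h.adds_of_new hnew hab.2.2.2.2.1 hab.not_red
  refine ⟨had.2.2.2.2.2, ?_⟩
  obtain ⟨l, m, w, hw⟩ := h.source
  have hm := h.le_source hw
  obtain rfl : m = 3 * t + 3 := by
    by_contra hne
    obtain ⟨l', h1, h2, ⟨c, hc⟩ | ⟨c, hc⟩⟩ :=
      had.matched ((critical_left hw).mono (by omega)) (critical_right h.mat)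
    · obtain rfl : l' = 3 * t + 3 := by omega
      obtain rfl := (mat_adds hc h2).right_unique had
      exact h.not_mat _ _ hc
    · have := target_unique hc h.mat
      omega
  have hlt : l < 3 * t + 3 := by
    rcases mat_kind hw with h1 | h1
    · exact h1.2.2.1
    · have := (G.red_sub a h1.2.2.2.1).2
      rw [joinedBelow_three, topMatching_three, a2] at this
      revert this
      rcases ht with ht | ht <;> rw [ht] <;> simp +decide
  have haw := mat_adds hw hlt
  obtain ⟨rfl, w1, w0⟩ := index_zero hw hlt
  refine ⟨haw.bit_ne_of_false w0, fun ht1 => ?_⟩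
  by_contra hne
  obtain ⟨s, rfl⟩ : ∃ s, t = s + 1 := ⟨t - 1, by omega⟩
  have hw' : G.bit w (3 * s + 2) = false := by
    rw [← haw.bit_ne (by omega)]; simpa [show 3 * (s + 1) - 1 = 3 * s + 2 by omega] using hne
  refine (critical_right hw).not_joined' (k := 3 * (s + 1) + 2) (by omega) (by omega) ?_ ?_
  · rw [← haw.bit_ne (by omega), a2]
  · rw [joinedBelow_two, topMatching_two, topMatching_one, w1, w0,
      show 3 * (s + 1) = 3 * s + 3 by ring, topMatching_three, hw']
    generalize topMatching (G.bit w) (3 * s + 2) = x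
    revert x; decide

/-- The left strands of `a` are joined below layer `3t + 3`, where `a` has the 1-smoothing. Such a
cell does not survive second index `3t + 3`, but `a` is matched only later. -/
theorem not_down_equal (h : G.Zigzag (3 * t + 2) (3 * t + 3) (3 * t + 3) a b a') : False := by
  have hab := mat_removes h.mat
  have hl := G.lt_len hab.1
  have hcb := critical_right h.mat
  obtain ⟨b1, b0⟩ := hcb.bits_zero hl.le hab.joined
  have b2 := h.bit_right
  have b3 := (mat_bits h.mat).2
  have a3 : G.bit a (3 * t + 3) = true := by
    rw [h.bit_ne (by omega), b3, Function.update_self]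
  have a2 := h.bit_left
  have a1 : G.bit a (3 * t + 1) = true := by rw [h.bit_ne (by omega), b1]
  have a0 : G.bit a (3 * t) = false := by rw [h.bit_ne (by omega), b0]
  have hj2 : ¬ JoinedBelow (G.bit a) (3 * t + 2) := by
    rw [h.joined_iff le_rfl]; exact hcb.not_joined' (by omega) (by omega) b2
  have t1 : topMatching (G.bit a) (3 * t + 1) = p01 := by
    have h1 := step_zero_false (topMatching (G.bit a) (3 * t))
    rw [← a0, ← topMatching_one] at h1
    refine h1.resolve_right fun h1 => hj2 ?_
    rw [joinedBelow_two, topMatching_two, a1, h1]; decide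
  have hca : G.Critical (3 * t + 4) a := by
    refine h.critical fun l m c hm => ?_
    have := h.le_source hm
    by_contra! hlt
    rcases (show m = 3 * t + 2 ∨ m = 3 * t + 3 by omega) with rfl | rfl
    · rcases mat_kind hm with h1 | h1
      · obtain ⟨rfl, -⟩ := index_two' hm h1.2.2.1
        rw [h1.1] at a1; cases a1
      · exact hj2 (G.red_sub a h1.2.2.2.1).2
    · rcases mat_kind hm with h1 | h1
      · have := h1.bit_top.1
        rw [a3] at this; cases this
      · have := (G.red_sub a h1.2.2.2.1).1
        rw [a3] at this; cases this
  refine hca.not_joined (k := 3 * t + 3) hl a3 ?_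
  rw [joinedBelow_three, topMatching_three, topMatching_two, t1, a1, a2]
  decide

/-- In the excluded state the matching of `a'` at level `3t + 1` is `p01`, so a raise of layer `3t +
1` would split off a loop with top `3t + 3`. Both ends of that edge are free then, and `a'` would be
matched at second index `3t + 3` instead of `3t + 4`. -/
theorem down (h : G.Zigzag (3 * t + 2) (3 * t + 3) (3 * t + 4) a b a') :
    G.red b = G.red a ∧ ¬ SwapState (G.bit a) t := by
  have hab := mat_adds h.mat (by omega)
  obtain ⟨-, b3, b2, b1⟩ := index_one h.mat (by omega)
  have b4 := hab.bit_top.2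
  have hl := G.lt_len b4
  have a2 := h.bit_left
  have a1 : G.bit a (3 * t + 1) = false := by rw [h.bit_ne (by omega), b1]
  have a3 : G.bit a (3 * t + 3) = true := by rw [h.bit_ne (by omega), b3]
  have ht := step_one_false (topMatching (G.bit a) (3 * t + 1))
  rw [← a1, ← topMatching_two] at ht
  have hnew : 3 * t + 4 ∉ G.cl a := by
    rw [mem_closings, joinedBelow_four, topMatching_four, topMatching_three, a2, a3]
    rintro ⟨-, h⟩; revert h
    rcases ht with ht | ht <;> rw [ht] <;> decide
  refine ⟨h.red_eq_of_new hnew hab.2.2.2.2.1 hab.not_red, ?_⟩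
  rintro ⟨hs0, hs⟩
  have hlow : ∀ m < 3 * t + 2, G.bit a' m = G.bit a m := fun m hm => by
    rw [hab.bit_ne (by omega), h.bit_ne (by omega)]
  have c0 : G.bit a' (3 * t) = false := by rw [hlow _ (by omega), hs0]
  have c1 : G.bit a' (3 * t + 1) = false := by rw [hlow _ (by omega), a1]
  have c2 : G.bit a' (3 * t + 2) = true := by rw [hab.bit_ne (by omega), b2]
  have c3 := hab.1
  have hca := critical_left h.mat
  -- Over a nested matching, a raise of layer `3t` would split off the loop closed in the next
  -- layer.
  have hnest : topMatching (G.bit a') (3 * t) = nested → False := by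
    intro hn
    refine (hca.mono (by omega)).not_split_top (u := 3 * t) c0 c1 ?_ ?_ ?_
    · rw [joinedBelow_one, topMatching_one, Function.update_self,
        topMatching_congr (y := G.bit a') fun i hi => Function.update_of_ne (by omega) _ _, hn]
      decide
    · rw [joinedBelow_one, topMatching_one, c0, hn]; decide
    · rw [joinedBelow_zero, hn]; decide
  have t1 : topMatching (G.bit a') (3 * t + 1) = p01 := by
    rcases t with _ | s
    · rw [topMatching_one, c0]; rfl
    -- The 1-smoothing in layer `3s + 2` forbids that the right strands are joined. Together with
    -- `hnest` this leaves only matchings that the 0-smoothing in layer `3t` turns into `p01`.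
    · have hs' : G.bit a' (3 * s + 2) = true := by
        rw [hlow _ (by omega)]; exact hs (by omega)
      have hj := hca.not_joined' (k := 3 * s + 2) (by omega) (by omega) hs'
      rw [joinedBelow_two] at hj
      have e : topMatching (G.bit a') (3 * (s + 1)) = topMatching (G.bit a') (3 * s + 2) := by
        rw [show 3 * (s + 1) = 3 * s + 3 by ring, topMatching_three, hs']; rfl
      rw [← e] at hj
      rw [topMatching_one, c0]
      revert hj hnest
      generalize topMatching (G.bit a') (3 * (s + 1)) = x
      revert x; decide
  have t2 : topMatching (Function.update (G.bit a') (3 * t + 1) true) (3 * t + 2) = p01 := by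
    rw [topMatching_two, Function.update_self,
      topMatching_congr (y := G.bit a') fun i hi => Function.update_of_ne (by omega) _ _, t1]
    rfl
  obtain ⟨z, hz⟩ := G.exists_adds_right (a := a') (j := 3 * t + 1) (k := 3 * t + 3) c1 (by
      rw [mem_closings, joinedBelow_three, topMatching_three, t2,
        Function.update_of_ne (by omega), Function.update_of_ne (by omega), c3, c2]
      decide) (by
      rw [mem_closings, joinedBelow_three, topMatching_three, topMatching_two, t1, c1, c2]
      rintro ⟨-, h⟩; revert h; decide)
  have hcz : G.Critical (3 * t + 3) z := by
    refine (((hca.mono (by omega)).congr hz.agree).succ fun l hl => ?_).succ fun l hl => ?_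
    · obtain ⟨-, -, -, h5⟩ := hl.of_true hz.bit_right
      rw [joinedBelow_one,
        topMatching_congr (y := G.bit a') fun i hi => (hz.bit_ne (by omega)).symm, t1] at h5
      exact absurd h5 (by decide)
    · obtain ⟨-, -, -, h5⟩ := hl.of_true (by rw [← hz.bit_ne (by omega), c2])
      rw [joinedBelow_two, hz.2.1, t2] at h5
      exact absurd h5 (by decide)
  obtain ⟨l, hl, hl', ⟨c, hm⟩ | ⟨c, hm⟩⟩ := hz.matched (hca.mono (by omega)) hcz
  · exact hca _ (by omega) l ⟨c, Or.inl hm⟩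
  · obtain ⟨rfl, -⟩ := index_zero hm hl'
    obtain rfl := (mat_adds hm hl').left_unique hz
    exact hca _ (by omega) _ ⟨z, Or.inl hm⟩

/-- Raising and lowering the same layer returns to the same smoothing. If the matched edge adds a
loop, both edges keep the red loops and would coincide. So it dissolves a red loop at `i`, and `a →
b` must merge the loop at `i`, blue in `a`, with a higher red loop `U`: from `a` to `a'` a red mark
moves from `U` down to `i`. -/
theorem red_of_eq {i : ℕ} (h : G.Zigzag i i u a b a') :
    sumBelow G.len (G.red a') < sumBelow G.len (G.red a) := by
  have hbits : G.bit a = G.bit a' := by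
    rw [← update_raise h.bit_left, ← h.bit_eq, (mat_bits h.mat).2, update_raise (mat_bits h.mat).1]
  rcases mat_kind h.mat with h1 | h1
  · refine absurd h.mat ?_
    have h2 := h.red_eq_of_new (k := u) (by rw [cl, hbits]; exact h1.2.2.2.1) h1.2.2.2.2.1 h1.not_red
    obtain rfl := G.ext _ _ hbits (h2.symm.trans h1.2.2.2.2.2)
    exact h.not_mat _ _
  · obtain rfl := h1.2.2.1
    have hi : i ∈ G.cl a := by rw [cl, hbits]; exact G.red_sub _ h1.2.2.2.1
    have hcl : closings (G.bit b) = closings (G.bit a) \ {i} := by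
      rw [h.bit_eq]; exact closings_raise_of_mem hi
    obtain ⟨U, hU⟩ := h.iso
    obtain ⟨-, -, h'⟩ := G.iso_move hU
    rcases h' with ⟨h2, h3, -⟩ | ⟨h2, h3, -⟩ | ⟨h2, h3, h', m, hm, h4, h5, h6⟩ |
      ⟨h2, h3, m, hm, h4, h5, h'⟩
    · rw [hcl] at h3; exact absurd h3.1 h2
    · have : U = i := by
        by_contra hne
        exact h3 (by rw [hcl]; exact ⟨G.red_sub a h2, hne⟩)
      subst this
      exact absurd hU h.iso_ne
    · have : m = i := by
        by_contra hne
        exact h6 (by rw [hcl]; exact ⟨h4, hne⟩)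
      subst this
      have e1 : G.red a' = insert m (G.red b) := by
        rw [h1.2.2.2.2, Set.insert_sdiff_singleton, Set.insert_eq_of_mem h1.2.2.2.1]
      have e2 : G.red a = insert U (G.red b) := by
        rw [h', Set.insert_sdiff_singleton, Set.insert_eq_of_mem h2]
      have hmb : m ∉ G.red b := by rw [h1.2.2.2.2]; simp
      have hUb : U ∉ G.red b := by rw [h']; simp
      rw [e1, e2, sumBelow_insert (G.lt_len h.bit_left) hmb,
        sumBelow_insert (G.lt_len (G.red_sub a h2).1) hUb]
      omega
    · rw [hcl] at h5; exact absurd h5.1 h4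

end Zigzag

end MatchingModel

end BarNatan

end

/-! ### Absence of directed cycles -/

noncomputable section

namespace BarNatan

namespace MatchingModel

variable {V : Type} (G : MatchingModel V)

/-- A step along an isomorphism that is not matched, or backwards along a matched edge. -/
def Step (x y : V) : Prop :=
  ((∃ i U, G.iso i U x y) ∧ ∀ l m, ¬ G.mat l m x y) ∨ ∃ j u, G.mat j u y x

def IsTarget (x : V) : Prop := ∃ j u a, G.mat j u a x

open Classical in
/-- The other end of the matched edge with target `x`; a cell that is not a target is kept. -/
def src (x : V) : V := if h : ∃ a j u, G.mat j u a x then h.choose else x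

/-- A step in a cycle: an edge from a source to a target, or backwards along a matched edge. -/
def CycleStep (D : ℕ → ℕ → ℕ → V → V → V → Prop) (x y : V) : Prop :=
  (∃ i j u a', D i j u x y a' ∧ G.Zigzag i j u x y a') ∨ ∃ j u, G.mat j u y x

variable {G}

theorem src_of_mat {j u : ℕ} {a b : V} (h : G.mat j u a b) : G.src b = a := by
  have h' : ∃ a j u, G.mat j u a b := ⟨a, j, u, h⟩
  rw [src, dif_pos h']
  obtain ⟨l, m, h2⟩ := h'.choose_spec
  exact (target_unique h2 h).2.2

theorem src_of_source {j u : ℕ} {a b : V} (h : G.mat j u a b) : G.src a = a := by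
  rw [src, dif_neg]
  rintro ⟨c, l, m, h'⟩
  exact not_source_of_target h' h

theorem Zigzag.src_left {i j u : ℕ} {a b a' : V} (h : G.Zigzag i j u a b a') : G.src a = a := by
  obtain ⟨l, m, c, hc⟩ := h.source
  exact src_of_source hc

theorem src_eq_of_mat {j u : ℕ} {a b : V} (h : G.mat j u a b) : G.src b = G.src a :=
  (src_of_mat h).trans (src_of_source h).symm

/-- A function of the sources which does not decrease along the zigzags of a cycle is constant. -/
theorem CycleStep.refine {A : Type} [PartialOrder A] {D D' : ℕ → ℕ → ℕ → V → V → V → Prop}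
    (f : V → A)
    (h : ∀ i j u a b a', D i j u a b a' → G.Zigzag i j u a b a' →
      f a ≤ f a' ∧ (f a = f a' → D' i j u a b a')) {a : V}
    (ha : Relation.TransGen (G.CycleStep D) a a) : Relation.TransGen (G.CycleStep D') a a := by
  refine transGen_cycle_of_monotone (fun x => f (G.src x)) ?_ ?_ ha
  · rintro x y (⟨i, j, u, a', hD, hz⟩ | ⟨j, u, hm⟩)
    · rw [hz.src_left, src_of_mat hz.mat]
      exact (h _ _ _ _ _ _ hD hz).1
    · rw [src_eq_of_mat hm]
  · rintro x y (⟨i, j, u, a', hD, hz⟩ | ⟨j, u, hm⟩) hxy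
    · rw [hz.src_left, src_of_mat hz.mat] at hxy
      exact Or.inl ⟨i, j, u, a', (h _ _ _ _ _ _ hD hz).2 hxy, hz⟩
    · exact Or.inr ⟨j, u, hm⟩

variable (G) in
/-- The number of layers with the 1-smoothing. -/
def ones (x : V) : ℕ := weight G.len (fun _ => 1) (G.bit x)

theorem ones_of_bits {i : ℕ} {a b : V} (h : G.bit a i = false)
    (h' : G.bit b = Function.update (G.bit a) i true) : G.ones b = G.ones a + 1 := by
  rw [ones, ones, h', weight_update _ (G.lt_len h) h]

-- The number of 1-smoothings, less one at targets, never decreases: a forward step adds a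
-- 1-smoothing, and a backward step leads from a target to a source. On a cycle it is constant, so
-- every forward step leads from a non-target to a target. The step before it ends at a non-target
-- and thus is backward, hence forward steps start at sources.
open Classical in
theorem cycleStep_of_step {a : V} (ha : Relation.TransGen G.Step a a) :
    Relation.TransGen (G.CycleStep fun _ _ _ _ _ _ => True) a a := by
  have h1 : Relation.TransGen (fun x y => G.Step x y ∧
      ((∃ j u, G.mat j u y x) ∨ (G.IsTarget y ∧ ¬ G.IsTarget x))) a a := by
    refine transGen_cycle_of_monotone
      (fun x => (G.ones x : ℤ) - if G.IsTarget x then 1 else 0) ?_ ?_ ha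
    · rintro x y (⟨⟨i, U, h⟩, -⟩ | ⟨j, u, h⟩)
      · have := ones_of_bits (iso_bits h).1 (iso_bits h).2
        split_ifs <;> omega
      · have := ones_of_bits (mat_bits h).1 (mat_bits h).2
        rw [if_pos (show G.IsTarget x from ⟨j, u, y, h⟩),
          if_neg (show ¬ G.IsTarget y from fun ⟨_, _, _, h'⟩ => not_source_of_target h' h)]
        omega
    · rintro x y hs hxy
      refine ⟨hs, ?_⟩
      rcases hs with (⟨⟨i, U, h⟩, -⟩ | h)
      · right
        have := ones_of_bits (iso_bits h).1 (iso_bits h).2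
        split_ifs at hxy with h1 h2 h2
        · omega
        · omega
        · exact ⟨h2, h1⟩
        · omega
      · exact Or.inl h
  refine Relation.TransGen.mono ?_ _ _ (transGen_cycle_pred h1)
  rintro x y ⟨⟨hs, h | ⟨⟨j, u, a', hm⟩, hx⟩⟩, z, hz, hz'⟩
  · exact Or.inr h
  rcases hs with (⟨h, hn⟩ | h)
  · obtain ⟨i, U, hi⟩ := h
    refine Or.inl ⟨i, j, u, a', trivial, ⟨U, hi⟩, hn, ?_, hm⟩
    rcases hz' with ⟨l, m, h⟩ | ⟨h, -⟩
    · exact ⟨l, m, z, h⟩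
    · exact absurd h hx
  · exact Or.inr h

/-- Without zigzags only backward steps are left, and each loses a 1-smoothing. -/
theorem not_cycleStep_false {a : V} :
    ¬ Relation.TransGen (G.CycleStep fun _ _ _ _ _ _ => False) a a := by
  intro h
  have key : ∀ b, Relation.TransGen (G.CycleStep fun _ _ _ _ _ _ => False) a b →
      G.ones b < G.ones a := by
    intro b hb
    have step : ∀ x y, G.CycleStep (fun _ _ _ _ _ _ => False) x y → G.ones y < G.ones x := by
      rintro x y (⟨i, j, u, a', h, -⟩ | ⟨j, u, h⟩)
      · exact h.elim
      · have := ones_of_bits (mat_bits h).1 (mat_bits h).2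
        omega
    induction hb with
    | single h => exact step _ _ h
    | tail _ h ih => exact (step _ _ h).trans ih
  exact (key a h).false

open Zigzag in
/-- The layers `3t + 2` and `3t + 3` swap their smoothings, for some `t ≥ t₀`. -/
def Swap (t₀ : ℕ) (i j _u : ℕ) (a _b _a' : V) : Prop :=
  ∃ t, t₀ ≤ t ∧ ((i = 3 * t + 3 ∧ j = 3 * t + 2 ∧ SwapState (G.bit a) t) ∨
    (i = 3 * t + 2 ∧ j = 3 * t + 3 ∧ ¬ SwapState (G.bit a) t))

theorem Zigzag.bit_other {i j u l : ℕ} {a b a' : V} (h : G.Zigzag i j u a b a') (hi : l ≠ i)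
    (hj : l ≠ j) : G.bit a' l = G.bit a l := by
  rw [h.bit_ne hi, (mat_bits h.mat).2, Function.update_of_ne hj]

theorem Zigzag.bit_old {i j u : ℕ} {a b a' : V} (h : G.Zigzag i j u a b a') (hij : i ≠ j) :
    G.bit a' i = true := by
  rw [← h.bit_right, (mat_bits h.mat).2, Function.update_of_ne hij]

-- `SwapState` at `t₀` reads the layers `3t₀` and `3t₀ - 1`, which swaps with `t ≥ t₀` leave alone.
-- The state dictates the direction of a swap at `t₀`, after which layer `3t₀ + 3` agrees with the
-- state and no second swap is possible; the potential is this agreement.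
open Classical Zigzag in
theorem CycleStep.swap_succ {t₀ : ℕ} {a : V}
    (ha : Relation.TransGen (G.CycleStep (G.Swap t₀)) a a) :
    Relation.TransGen (G.CycleStep (G.Swap (t₀ + 1))) a a := by
  refine CycleStep.refine (fun x => if SwapState (G.bit x) t₀ = (G.bit x (3 * t₀ + 3) = true)
    then 1 else 0) ?_ ha
  rintro i j u a b a' ⟨t, ht, h⟩ hz
  have hstate : SwapState (G.bit a') t₀ ↔ SwapState (G.bit a) t₀ := by
    have h0 : G.bit a' (3 * t₀) = G.bit a (3 * t₀) := hz.bit_other (by omega) (by omega)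
    have h1 : 1 ≤ t₀ → G.bit a' (3 * t₀ - 1) = G.bit a (3 * t₀ - 1) := fun h1 =>
      hz.bit_other (by omega) (by omega)
    simp only [SwapState, h0]
    refine and_congr_right fun _ => forall_congr' fun h2 => by rw [h1 h2]
  rcases ht.lt_or_eq with ht | rfl
  · have h3 : G.bit a' (3 * t₀ + 3) = G.bit a (3 * t₀ + 3) := hz.bit_other (by omega) (by omega)
    rw [propext hstate, h3]
    exact ⟨le_rfl, fun _ => ⟨t, ht, h⟩⟩
  · rw [propext hstate]
    rcases h with ⟨rfl, rfl, h⟩ | ⟨rfl, rfl, h⟩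
    · have h1 := hz.bit_left
      have h2 := hz.bit_old (by omega)
      simp [h, h1, h2]
    · have h1 : G.bit a (3 * t₀ + 3) = true := by
        rw [hz.bit_ne (by omega), (mat_bits hz.mat).2, Function.update_self]
      have h2 := (mat_bits hz.mat).1
      simp [h, h1, h2]

-- Three potentials act in turn: a weighted number of 1-smoothings forces equal ranks, the sum of
-- the red layers then leaves only swaps of the layers `3t + 2` and `3t + 3`, and the states
-- eliminate the swaps from the bottom up.
open Classical Zigzag in
theorem not_cycleStep {a : V} :
    ¬ Relation.TransGen (G.CycleStep fun _ _ _ _ _ _ => True) a a := by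
  intro ha
  have h1 : Relation.TransGen (G.CycleStep fun i j u _ _ _ => layerRank i = layerRank j) a a := by
    -- A zigzag changes this weight by `2 ^ layerRank i - 2 ^ layerRank j`, which is never positive;
    -- hence the reversed order.
    refine CycleStep.refine
      (fun x => (OrderDual.toDual (weight G.len (fun l => 2 ^ layerRank l) (G.bit x)))) ?_ ha
    rintro i j u a b a' - hz
    have e1 := weight_update (n := G.len) (fun l => 2 ^ layerRank l) (G.lt_len hz.bit_left) hz.bit_left
    rw [← hz.bit_eq, (mat_bits hz.mat).2,
      weight_update _ (G.lt_len (mat_bits hz.mat).1) (mat_bits hz.mat).1] at e1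
    have hr := Nat.pow_le_pow_right (n := 2) (by omega) hz.rank_le.1
    refine ⟨?_, fun h => ?_⟩
    · rw [OrderDual.toDual_le_toDual]; omega
    · have h := OrderDual.toDual.injective h
      exact Nat.pow_right_injective le_rfl (show 2 ^ layerRank i = 2 ^ layerRank j by omega)
  have hred : ∀ {i j u : ℕ} {a b a' : V}, G.Zigzag i j u a b a' → layerRank i = layerRank j →
      (i = j ∧ sumBelow G.len (G.red a') < sumBelow G.len (G.red a)) ∨
        (G.red a' = G.red a ∧ G.Swap 0 i j u a b a') := by
    intro i j u a b a' hz hr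
    rcases hz.rank_le.2 hr with rfl | ⟨t, rfl, rfl, rfl⟩ | ⟨t, rfl, rfl, rfl | rfl⟩
    · exact Or.inl ⟨rfl, hz.red_of_eq⟩
    · have h1 := (mat_adds hz.mat (by omega)).2.2.2.2.2
      exact Or.inr ⟨by rw [← h1, hz.up.1], t, by omega, Or.inl ⟨rfl, rfl, hz.up.2⟩⟩
    · exact hz.not_down_equal.elim
    · have h1 := (mat_adds hz.mat (by omega)).2.2.2.2.2
      exact Or.inr ⟨by rw [← h1, hz.down.1], t, by omega, Or.inr ⟨rfl, rfl, hz.down.2⟩⟩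
  have h2 : Relation.TransGen (G.CycleStep (G.Swap 0)) a a := by
    refine CycleStep.refine (fun x => OrderDual.toDual (sumBelow G.len (G.red x))) ?_ h1
    intro i j u a b a' hr hz
    rcases hred hz hr with ⟨rfl, h⟩ | ⟨h, h'⟩
    · exact ⟨OrderDual.toDual_le_toDual.2 h.le,
        fun e => absurd (OrderDual.toDual.injective e) h.ne'⟩
    · exact ⟨by rw [h], fun _ => h'⟩
  have h3 : ∀ t, Relation.TransGen (G.CycleStep (G.Swap t)) a a := by
    intro t
    induction t with
    | zero => exact h2
    | succ t ih => exact CycleStep.swap_succ ih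
  -- A swap with `t ≥ G.len` would act above the highest layer.
  refine not_cycleStep_false (G := G) (a := a) (CycleStep.refine (fun _ => 0) ?_ (h3 G.len))
  rintro i j u a b a' ⟨t, ht, h⟩ hz
  have := G.lt_len hz.bit_left
  omega

/-- The shift never decreases along the reversed graph, so on a cycle it is constant and every edge
is an isomorphism. -/
theorem acyclic (shift : V → ℤ) (E : V → V → Prop) (hE : ∀ a b, E a b → shift a ≤ shift b)
    (hiso : ∀ a b, E a b → shift a = shift b → ∃ i U, G.iso i U a b)
    (hmat : ∀ j u a b, G.mat j u a b → shift a = shift b) (a : V) :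
    ¬ Relation.TransGen (fun x y => (E x y ∧ ∀ l m, ¬ G.mat l m x y) ∨ ∃ j u, G.mat j u y x) a a := by
  intro ha
  refine not_cycleStep (G := G) (cycleStep_of_step (a := a) (transGen_cycle_of_monotone shift ?_ ?_ ha))
  · rintro x y (⟨h, -⟩ | ⟨j, u, h⟩)
    · exact hE _ _ h
    · exact (hmat _ _ _ _ h).ge
  · rintro x y (⟨h, h'⟩ | h) hxy
    · exact Or.inl ⟨hiso _ _ h hxy, h'⟩
    · exact Or.inr h

end MatchingModel

end BarNatan

end

noncomputable section

namespace BarNatan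

variable {P : Type}

/-! ### Gluing discs to a surface -/

theorem finsum_quotient_out {α M : Type} [AddCommMonoid M] (r : Setoid α) (f : α → M)
    [DecidablePred fun p : α × α => r p.1 p.2] (hf : ∀ a b, r a b → f a = f b) (v : α) :
    (∑ᶠ q : Quotient r, if (fun p : α × α => r p.1 p.2) (q.out, v) then f q.out else 0) = f v := by
  rw [finsum_eq_single _ (Quotient.mk r v)]
  · rw [if_pos (Quotient.mk_out v)]
    exact hf _ _ (Quotient.mk_out v)
  · intro q hq
    rw [if_neg]
    intro h
    exact hq (by rw [← Quotient.out_eq q]; exact Quotient.sound h)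

theorem finsum_quotient_congr {α β M : Type} [AddCommMonoid M] (r : Setoid α) (r' : Setoid β)
    (e : α → β) (he : ∀ a b, r a b ↔ r' (e a) (e b)) (hs : ∀ b, ∃ a, r' (e a) b) (f : β → M)
    (hf : ∀ a b, r' a b → f a = f b) :
    ∑ᶠ q : Quotient r, f (e q.out) = ∑ᶠ q : Quotient r', f q.out := by
  refine finsum_eq_of_bijective (Quotient.map e fun a b h => (he a b).1 h) ⟨?_, ?_⟩ ?_
  · rintro ⟨a⟩ ⟨b⟩ h
    exact Quotient.sound ((he a b).2 (Quotient.exact h))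
  · rintro ⟨b⟩
    obtain ⟨a, ha⟩ := hs b
    exact ⟨Quotient.mk r a, Quotient.sound ha⟩
  · intro q
    refine hf _ _ ?_
    conv_rhs => rw [← Quotient.out_eq q]
    exact r'.symm (Quotient.mk_out (s := r') _)

/-- `ι` identifies `X` with the arcs of `Y`. -/
structure IsArcEmbedding {X Y : Diagram P} (ι : X.comp → Y.comp) : Prop where
  inj : Function.Injective ι
  endpt : ∀ p, ι (X.endpt p) = Y.endpt p
  range : ∀ y, (∃ x, ι x = y) ↔ ¬ Y.IsLoop y

namespace IsArcEmbedding

variable {X Y Z : Diagram P} {ι : X.comp → Y.comp} (h : IsArcEmbedding ι)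

include h

theorem exists_endpt (x : X.comp) : ∃ p, X.endpt p = x := by
  have := (h.range (ι x)).1 ⟨x, rfl⟩
  simp only [Diagram.IsLoop, not_not] at this
  obtain ⟨p, hp⟩ := this
  exact ⟨p, h.inj ((h.endpt p).trans hp)⟩

theorem circles_cases {a b : Y.comp ⊕ Z.comp} (hab : Diagram.circles Y Z a b) :
    a = b ∨ ∃ x x', a = Sum.map ι id x ∧ b = Sum.map ι id x' ∧ Diagram.circles X Z x x' := by
  induction hab with
  | rel a b hab =>
    obtain ⟨p, rfl, rfl⟩ := hab
    exact Or.inr ⟨Sum.inl (X.endpt p), Sum.inr (Z.endpt p), by simp [h.endpt], rfl,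
      Relation.EqvGen.rel _ _ ⟨p, rfl, rfl⟩⟩
  | refl a => exact Or.inl rfl
  | symm a b _ ih =>
    rcases ih with rfl | ⟨x, x', h1, h2, h3⟩
    · exact Or.inl rfl
    · exact Or.inr ⟨x', x, h2, h1, (Diagram.circles X Z).symm h3⟩
  | trans a b c _ _ ih ih' =>
    rcases ih with rfl | ⟨x, x', h1, h2, h3⟩
    · exact ih'
    rcases ih' with rfl | ⟨y, y', h1', h2', h3'⟩
    · exact Or.inr ⟨x, x', h1, h2, h3⟩
    obtain rfl := Sum.map_injective.2 ⟨h.inj, Function.injective_id⟩ (h2.symm.trans h1')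
    exact Or.inr ⟨x, y', h1, h2', (Diagram.circles X Z).trans h3 h3'⟩

theorem circles_map {x x' : X.comp ⊕ Z.comp} :
    Diagram.circles Y Z (Sum.map ι id x) (Sum.map ι id x') ↔ Diagram.circles X Z x x' := by
  have hinj := Sum.map_injective.2 ⟨h.inj, Function.injective_id (α := Z.comp)⟩
  constructor
  · intro hx
    rcases h.circles_cases hx with hx | ⟨y, y', h1, h2, h3⟩
    · rw [hinj hx]
    · rwa [hinj h1, hinj h2]
  · intro hx
    induction hx with
    | rel a b hab =>
      obtain ⟨p, rfl, rfl⟩ := hab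
      exact Relation.EqvGen.rel _ _ ⟨p, by simp [h.endpt], rfl⟩
    | refl a => exact (Diagram.circles Y Z).refl _
    | symm a b _ ih => exact (Diagram.circles Y Z).symm ih
    | trans a b c _ _ ih ih' => exact (Diagram.circles Y Z).trans ih ih'

theorem circles_loop {y : Y.comp} (hy : Y.IsLoop y) {b : Y.comp ⊕ Z.comp}
    (hb : Diagram.circles Y Z (Sum.inl y) b) : Sum.inl y = b := by
  rcases h.circles_cases hb with hb | ⟨x | x, x', h1, -⟩
  · exact hb
  · simp only [Sum.map_inl, Sum.inl.injEq] at h1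
    exact absurd hy ((h.range y).1 ⟨x, h1.symm⟩)
  · simp at h1

/-- A loop of `Y` carries no endpoint and is a circle by itself; all other circles run through arcs,
which `ι` identifies with the components of `X`. This counts the boundary circles lost by capping
off loops. -/
theorem numCircles_eq (A : Set (Y.comp ⊕ Z.comp)) :
    Surface.numCircles Y Z A =
      Surface.numCircles X Z {x | Sum.map ι id x ∈ A} + {y | Y.IsLoop y ∧ Sum.inl y ∈ A}.ncard := by
  let f : Quotient (Diagram.circles X Z) → Quotient (Diagram.circles Y Z) :=
    Quotient.map (Sum.map ι id) fun _ _ => h.circles_map.2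
  have hf : Function.Injective f := by
    rintro ⟨a⟩ ⟨b⟩ hab
    exact Quotient.sound (h.circles_map.1 (Quotient.exact hab))
  let g : Y.comp → Quotient (Diagram.circles Y Z) := fun y => Quotient.mk _ (Sum.inl y)
  have hu : (fun a => Quotient.mk (Diagram.circles Y Z) a) '' A =
      f '' ((fun a => Quotient.mk (Diagram.circles X Z) a) '' {x | Sum.map ι id x ∈ A}) ∪
        g '' {y | Y.IsLoop y ∧ Sum.inl y ∈ A} := by
    ext q
    constructor
    · rintro ⟨y | z, ha, rfl⟩
      · by_cases hy : Y.IsLoop y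
        · exact Or.inr ⟨y, ⟨hy, ha⟩, rfl⟩
        · obtain ⟨x, rfl⟩ := (h.range y).2 hy
          exact Or.inl ⟨_, ⟨Sum.inl x, ha, rfl⟩, rfl⟩
      · exact Or.inl ⟨_, ⟨Sum.inr z, ha, rfl⟩, rfl⟩
    · rintro (⟨_, ⟨x, ha, rfl⟩, rfl⟩ | ⟨y, ⟨-, ha⟩, rfl⟩)
      · exact ⟨_, ha, rfl⟩
      · exact ⟨_, ha, rfl⟩
  have hd : Disjoint
      (f '' ((fun a => Quotient.mk (Diagram.circles X Z) a) '' {x | Sum.map ι id x ∈ A}))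
      (g '' {y | Y.IsLoop y ∧ Sum.inl y ∈ A}) := by
    rw [Set.disjoint_left]
    rintro _ ⟨_, ⟨x, -, rfl⟩, rfl⟩ ⟨y, ⟨hy, -⟩, hxy⟩
    have := h.circles_loop hy (Quotient.exact hxy)
    rcases x with x | x
    · simp only [Sum.map_inl, Sum.inl.injEq] at this
      exact (h.range y).1 ⟨x, this.symm⟩ hy
    · simp at this
  have hg : Set.InjOn g {y | Y.IsLoop y ∧ Sum.inl y ∈ A} := by
    rintro y ⟨hy, -⟩ y' - hyy
    exact Sum.inl_injective (h.circles_loop hy (Quotient.exact hyy))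
  rw [Surface.numCircles, hu, Set.ncard_union_eq hd (Set.toFinite _) (Set.toFinite _),
    Set.ncard_image_of_injective _ hf, hg.ncard_image]
  rfl

end IsArcEmbedding

namespace Surface

variable {X Y Z : Diagram P} {ι : X.comp → Y.comp}

/-- The cylinder over the arcs of `Y`, with discs, and with `B y` dots on the component of `y`. -/
def discs (h : IsArcEmbedding ι) (B : Y.comp → ℕ) : Surface X Y where
  conn := Setoid.ker (Sum.elim ι id)
  wall p := h.endpt p
  genus _ := 0
  genus_congr _ _ _ := rfl
  dots x := B (Sum.elim ι id x)
  dots_congr _ _ h := congrArg B h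
  closed := 0

theorem discs_conn (h : IsArcEmbedding ι) (B : Y.comp → ℕ) {a b : X.comp ⊕ Y.comp} :
    (discs h B).conn a b ↔ Sum.elim ι id a = Sum.elim ι id b := Iff.rfl

theorem discs_chi (h : IsArcEmbedding ι) (B : Y.comp → ℕ) (a : X.comp ⊕ Y.comp) :
    (discs h B).chi a = 1 := by
  have : numCircles X Y {x | (discs h B).conn a x} = 1 := by
    rw [numCircles, Set.ncard_eq_one]
    refine ⟨Quotient.mk _ a, ?_⟩
    ext q
    constructor
    · rintro ⟨b, hb, rfl⟩
      refine Quotient.sound ?_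
      have key : ∀ x, Diagram.circles X Y (Sum.inl x) (Sum.inr (ι x)) := fun x => by
        obtain ⟨p, rfl⟩ := h.exists_endpt x
        exact Relation.EqvGen.rel _ _ ⟨p, rfl, by rw [h.endpt]⟩
      have key' : ∀ x, Diagram.circles X Y x (Sum.inr (Sum.elim ι id x)) := by
        rintro (x | x)
        · exact key x
        · exact (Diagram.circles X Y).refl _
      have hb' := (discs_conn h B).1 hb
      have h1 := key' a
      rw [hb'] at h1
      exact (Diagram.circles X Y).trans (key' b) ((Diagram.circles X Y).symm h1)
    · rintro rfl
      exact ⟨a, (discs h B).conn.refl a, rfl⟩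
  simp [chi, this, discs]

/-- The bijection between the components of `discs` and those of `Y`. -/
theorem discs_out_sum {M : Type} [AddCommMonoid M] (h : IsArcEmbedding ι) (B : Y.comp → ℕ)
    (f : Y.comp → M) :
    ∑ᶠ q : Quotient (discs h B).conn, f (Sum.elim ι id q.out) = ∑ᶠ y, f y := by
  refine finsum_eq_of_bijective
    (Quotient.lift (s := (discs h B).conn) (Sum.elim ι id) fun _ _ h => h) ⟨?_, ?_⟩ ?_
  · rintro ⟨a⟩ ⟨b⟩ hab
    exact Quotient.sound hab
  · intro y
    exact ⟨Quotient.mk _ (Sum.inr y), rfl⟩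
  · intro q
    conv_rhs => rw [← Quotient.out_eq q]
    rfl

section left

variable (h : IsArcEmbedding ι) (B : Y.comp → ℕ) (T : Surface Y Z)

/-- The discs and strips correspond to the components of `Y`, so gluing them on creates no
connection that `T` does not have. -/
theorem glue_discs {u v : X.comp ⊕ (Y.comp ⊕ Z.comp)} :
    glue (discs h B) T u v ↔
      T.conn (Sum.elim (Sum.inl ∘ ι) id u) (Sum.elim (Sum.inl ∘ ι) id v) := by
  have hS : ∀ a : X.comp ⊕ Y.comp, Sum.elim (Sum.inl ∘ ι) id (Sum.map id Sum.inl a) =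
      (Sum.inl (Sum.elim ι id a) : Y.comp ⊕ Z.comp) := by rintro (a | a) <;> rfl
  constructor
  · intro huv
    induction huv with
    | rel u v huv =>
      rcases huv with ⟨a, b, hab, rfl, rfl⟩ | ⟨a, b, hab, rfl, rfl⟩
      · rw [hS, hS, (discs_conn h B).1 hab]
      · exact hab
    | refl u => exact T.conn.refl _
    | symm u v _ ih => exact T.conn.symm ih
    | trans u v w _ _ ih ih' => exact T.conn.trans ih ih'
  · intro huv
    have key : ∀ w : X.comp ⊕ (Y.comp ⊕ Z.comp), glue (discs h B) T w
        (Sum.inr (Sum.elim (Sum.inl ∘ ι) id w)) := by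
      rintro (x | y)
      · exact Relation.EqvGen.rel _ _ (Or.inl ⟨Sum.inl x, Sum.inr (ι x), rfl, rfl, rfl⟩)
      · exact (glue (discs h B) T).refl _
    exact (glue (discs h B) T).trans (key u) ((glue (discs h B) T).trans
      (Relation.EqvGen.rel _ _ (Or.inr ⟨_, _, huv, rfl, rfl⟩)) ((glue (discs h B) T).symm (key v)))

open Classical in
/-- The number of dots that `discs` contributes to the component of `z`. -/
def dotsAt (B : Y.comp → ℕ) (T : Surface Y Z) (z : Y.comp ⊕ Z.comp) : ℕ :=
  ∑ᶠ y, if T.conn (Sum.inl y) z then B y else 0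

theorem dotsAt_congr (B : Y.comp → ℕ) (T : Surface Y Z) {z z' : Y.comp ⊕ Z.comp}
    (hz : T.conn z z') : dotsAt B T z = dotsAt B T z' := by
  have : ∀ y, T.conn (Sum.inl y) z ↔ T.conn (Sum.inl y) z' := fun y =>
    ⟨fun k => T.conn.trans k hz, fun k => T.conn.trans k (T.conn.symm hz)⟩
  classical exact finsum_congr fun y => if_congr (this y) rfl rfl

open Classical in
theorem glueDots_discs (v : X.comp ⊕ (Y.comp ⊕ Z.comp)) :
    glueDots (discs h B) T v = dotsAt B T (Sum.elim (Sum.inl ∘ ι) id v) +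
      T.dots (Sum.elim (Sum.inl ∘ ι) id v) := by
  have hS : ∀ a : X.comp ⊕ Y.comp, Sum.elim (Sum.inl ∘ ι) id (Sum.map id Sum.inl a) =
      (Sum.inl (Sum.elim ι id a) : Y.comp ⊕ Z.comp) := by rintro (a | a) <;> rfl
  rw [glueDots]
  congr 1
  · simp only [glue_discs, hS]
    exact discs_out_sum h B fun y =>
      if T.conn (Sum.inl y) (Sum.elim (Sum.inl ∘ ι) id v) then B y else 0
  · simp only [glue_discs]
    exact finsum_quotient_out T.conn T.dots T.dots_congr _

theorem chi_congr (T : Surface Y Z) {a b : Y.comp ⊕ Z.comp} (hab : T.conn a b) :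
    T.chi a = T.chi b := by
  have : {x | T.conn a x} = {x | T.conn b x} := by
    ext x
    exact ⟨fun k => T.conn.trans (T.conn.symm hab) k, fun k => T.conn.trans hab k⟩
  rw [chi, chi, T.genus_congr a b hab, this]

-- A strip over an arc contributes `1`, which the gluing along that arc subtracts again; a disc on a
-- loop contributes `1` without correction.
open Classical in
theorem glueChi_discs (v : X.comp ⊕ (Y.comp ⊕ Z.comp)) :
    glueChi (discs h B) T v = T.chi (Sum.elim (Sum.inl ∘ ι) id v) +
      ({y | Y.IsLoop y ∧ T.conn (Sum.elim (Sum.inl ∘ ι) id v) (Sum.inl y)}.ncard : ℤ) := by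
  have hS : ∀ a : X.comp ⊕ Y.comp, Sum.elim (Sum.inl ∘ ι) id (Sum.map id Sum.inl a) =
      (Sum.inl (Sum.elim ι id a) : Y.comp ⊕ Z.comp) := by rintro (a | a) <;> rfl
  set z : Y.comp ⊕ Z.comp := Sum.elim (Sum.inl ∘ ι) id v with hz
  have hsymm : ∀ y, T.conn (Sum.inl y) z ↔ T.conn z (Sum.inl y) := fun y =>
    ⟨T.conn.symm, T.conn.symm⟩
  have h1 : (∑ᶠ q : Quotient (discs h B).conn,
      if glue (discs h B) T (Sum.map id Sum.inl q.out) v then (discs h B).chi q.out else 0) =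
      ({y : Y.comp | T.conn z (Sum.inl y)}.ncard : ℤ) := by
    simp only [glue_discs, hS, discs_chi, ← hz, hsymm]
    rw [discs_out_sum h B fun y => if T.conn z (Sum.inl y) then (1 : ℤ) else 0]
    have : Fintype Y.comp := Fintype.ofFinite _
    rw [finsum_eq_sum_of_fintype, Finset.sum_boole, Set.ncard_eq_toFinset_card']
    simp
  have h2 : (∑ᶠ q : Quotient T.conn,
      if glue (discs h B) T (Sum.inr q.out) v then T.chi q.out else 0) = T.chi z := by
    simp only [glue_discs]
    exact finsum_quotient_out T.conn T.chi (fun a b => T.chi_congr) _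
  have h3 : {y : Y.comp | ¬ Y.IsLoop y ∧ glue (discs h B) T (Sum.inr (Sum.inl y)) v} =
      {y : Y.comp | ¬ Y.IsLoop y ∧ T.conn z (Sum.inl y)} := by
    ext y
    simp only [glue_discs, ← hz, Set.mem_ofPred_eq, Sum.elim_inr, id, hsymm]
  have h4 : {y : Y.comp | T.conn z (Sum.inl y)}.ncard =
      {y : Y.comp | Y.IsLoop y ∧ T.conn z (Sum.inl y)}.ncard +
        {y : Y.comp | ¬ Y.IsLoop y ∧ T.conn z (Sum.inl y)}.ncard := by
    rw [← Set.ncard_union_eq _ (Set.toFinite _) (Set.toFinite _)]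
    · congr 1; ext y; simp only [Set.mem_union, Set.mem_ofPred_eq]; tauto
    · rw [Set.disjoint_left]; rintro y ⟨h1, -⟩ ⟨h2, -⟩; exact h2 h1
  rw [glueChi, h1, h2, h3, h4]
  push_cast
  ring

/-- Capping off a loop raises the Euler characteristic by one and lowers the number of boundary
circles by one. -/
theorem glueGenus_discs (v : X.comp ⊕ (Y.comp ⊕ Z.comp)) :
    glueGenus (discs h B) T v = T.genus (Sum.elim (Sum.inl ∘ ι) id v) := by
  have hm : ∀ x : X.comp ⊕ Z.comp, Sum.elim (Sum.inl ∘ ι) id (Sum.map id Sum.inr x) =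
      (Sum.map ι id x : Y.comp ⊕ Z.comp) := by rintro (a | a) <;> rfl
  set z : Y.comp ⊕ Z.comp := Sum.elim (Sum.inl ∘ ι) id v with hz
  have h1 : {x : X.comp ⊕ Z.comp | glue (discs h B) T (Sum.map id Sum.inr x) v} =
      {x | Sum.map ι id x ∈ {x | T.conn z x}} := by
    ext x
    simp only [glue_discs, ← hz, hm, Set.mem_ofPred_eq]
    exact ⟨T.conn.symm, T.conn.symm⟩
  have h2 := h.numCircles_eq {x | T.conn z x}
  rw [glueGenus, glueChi_discs, ← hz, h1, chi, h2]
  simp only [Set.mem_ofPred_eq]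
  push_cast
  generalize (numCircles X Z _ : ℤ) = c
  generalize (Set.ncard _ : ℤ) = c'
  rw [show 2 - c - (2 - 2 * (T.genus z : ℤ) - (c + c') + c') = 2 * (T.genus z : ℤ) by ring]
  simp

theorem comp_discs_conn {a b : X.comp ⊕ Z.comp} :
    ((discs h B).comp T).conn a b ↔ T.conn (Sum.map ι id a) (Sum.map ι id b) := by
  have hm : ∀ x : X.comp ⊕ Z.comp, Sum.elim (Sum.inl ∘ ι) id (Sum.map id Sum.inr x) =
      (Sum.map ι id x : Y.comp ⊕ Z.comp) := by rintro (a | a) <;> rfl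
  rw [← hm, ← hm]
  exact glue_discs h B T

theorem comp_discs_genus (a : X.comp ⊕ Z.comp) :
    ((discs h B).comp T).genus a = T.genus (Sum.map ι id a) := by
  refine (glueGenus_discs h B T _).trans ?_
  rcases a with a | a <;> rfl

theorem comp_discs_dots (a : X.comp ⊕ Z.comp) :
    ((discs h B).comp T).dots a = dotsAt B T (Sum.map ι id a) + T.dots (Sum.map ι id a) := by
  refine (glueDots_discs h B T _).trans ?_
  rcases a with a | a <;> rfl

open Classical in
theorem comp_discs_closed :
    ((discs h B).comp T).closed = T.closed + ∑ᶠ q : Quotient T.conn,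
      if ∃ x : X.comp ⊕ Z.comp, T.conn (Sum.map ι id x) q.out then 0
      else {(T.genus q.out, dotsAt B T q.out + T.dots q.out)} := by
  have hm : ∀ x : X.comp ⊕ Z.comp, Sum.elim (Sum.inl ∘ ι) id (Sum.map id Sum.inr x) =
      (Sum.map ι id x : Y.comp ⊕ Z.comp) := by rintro (a | a) <;> rfl
  have h0 : ((discs h B).comp T).closed = 0 + T.closed + ∑ᶠ q : Quotient (glue (discs h B) T),
      if ∃ x, glue (discs h B) T (Sum.map id Sum.inr x) q.out then 0
      else {(glueGenus (discs h B) T q.out, glueDots (discs h B) T q.out)} := rfl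
  rw [h0, zero_add]
  congr 1
  simp only [glue_discs, hm, glueGenus_discs, glueDots_discs]
  refine finsum_quotient_congr (glue (discs h B) T) T.conn (Sum.elim (Sum.inl ∘ ι) id)
    (fun a b => glue_discs h B T) (fun b => ⟨Sum.inr b, T.conn.refl _⟩)
    (fun z => if ∃ x : X.comp ⊕ Z.comp, T.conn (Sum.map ι id x) z then (0 : Multiset (ℕ × ℕ))
      else {(T.genus z, dotsAt B T z + T.dots z)}) ?_
  intro a b hab
  have : (∃ x : X.comp ⊕ Z.comp, T.conn (Sum.map ι id x) a) ↔
      ∃ x : X.comp ⊕ Z.comp, T.conn (Sum.map ι id x) b :=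
    exists_congr fun x => ⟨fun k => T.conn.trans k hab, fun k => T.conn.trans k (T.conn.symm hab)⟩
  simp only [this, T.genus_congr a b hab, T.dots_congr a b hab, dotsAt_congr B T hab]

end left

end Surface

end BarNatan

end

noncomputable section

namespace BarNatan

variable {P : Type}

/-! ### Turning cobordisms upside down -/

theorem circles_swap {X Y : Diagram P} {a b : X.comp ⊕ Y.comp} (h : Diagram.circles X Y a b) :
    Diagram.circles Y X a.swap b.swap := by
  induction h with
  | rel a b h =>
    obtain ⟨p, rfl, rfl⟩ := h
    exact (Diagram.circles Y X).symm (Relation.EqvGen.rel _ _ ⟨p, rfl, rfl⟩)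
  | refl a => exact (Diagram.circles Y X).refl _
  | symm a b _ ih => exact (Diagram.circles Y X).symm ih
  | trans a b c _ _ ih ih' => exact (Diagram.circles Y X).trans ih ih'

theorem circles_swap_iff {X Y : Diagram P} {a b : X.comp ⊕ Y.comp} :
    Diagram.circles Y X a.swap b.swap ↔ Diagram.circles X Y a b :=
  ⟨fun h => by simpa using circles_swap h, circles_swap⟩

namespace Surface

variable {X Y Z : Diagram P}

theorem numCircles_swap (A : Set (X.comp ⊕ Y.comp)) :
    numCircles Y X {a | a.swap ∈ A} = numCircles X Y A := by
  let f : Quotient (Diagram.circles X Y) → Quotient (Diagram.circles Y X) :=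
    Quotient.map Sum.swap fun _ _ => circles_swap
  have hf : Function.Injective f := by
    rintro ⟨a⟩ ⟨b⟩ hab
    exact Quotient.sound (circles_swap_iff.1 (Quotient.exact hab))
  rw [numCircles, numCircles, ← Set.ncard_image_of_injective _ hf]
  congr 1
  ext q
  constructor
  · rintro ⟨a, ha, rfl⟩
    exact ⟨_, ⟨a.swap, ha, rfl⟩, by simp [f]⟩
  · rintro ⟨_, ⟨a, ha, rfl⟩, rfl⟩
    exact ⟨a.swap, by simpa using ha, rfl⟩

/-- The surface `S`, upside down. -/
def flip (S : Surface X Y) : Surface Y X where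
  conn := S.conn.comap Sum.swap
  wall p := S.conn.symm (S.wall p)
  genus a := S.genus a.swap
  genus_congr _ _ h := S.genus_congr _ _ h
  dots a := S.dots a.swap
  dots_congr _ _ h := S.dots_congr _ _ h
  closed := S.closed

theorem flip_conn (S : Surface X Y) {a b : Y.comp ⊕ X.comp} :
    S.flip.conn a b ↔ S.conn a.swap b.swap := Iff.rfl

theorem flip_chi (S : Surface X Y) (a : Y.comp ⊕ X.comp) : S.flip.chi a = S.chi a.swap := by
  rw [chi, chi, ← numCircles_swap {x | S.conn a.swap x}]
  rfl

/-- Turning the union of `X`, `Y`, `Z` upside down. -/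
def turnOver : X.comp ⊕ (Y.comp ⊕ Z.comp) → Z.comp ⊕ (Y.comp ⊕ X.comp) :=
  Sum.elim (Sum.inr ∘ Sum.inr) (Sum.elim (Sum.inr ∘ Sum.inl) Sum.inl)

theorem turnOver_turnOver (v : X.comp ⊕ (Y.comp ⊕ Z.comp)) : turnOver (turnOver v) = v := by
  rcases v with a | a | a <;> rfl

theorem turnOver_left (a : X.comp ⊕ Y.comp) :
    (turnOver (Sum.map id Sum.inl a) : Z.comp ⊕ (Y.comp ⊕ X.comp)) = Sum.inr a.swap := by
  rcases a with a | a <;> rfl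

theorem turnOver_right (a : Y.comp ⊕ Z.comp) :
    (turnOver (Sum.inr a) : Z.comp ⊕ (Y.comp ⊕ X.comp)) = Sum.map id Sum.inl a.swap := by
  rcases a with a | a <;> rfl

theorem turnOver_outer (a : X.comp ⊕ Z.comp) :
    (turnOver (Sum.map id Sum.inr a) : Z.comp ⊕ (Y.comp ⊕ X.comp)) =
      Sum.map id Sum.inr a.swap := by
  rcases a with a | a <;> rfl

theorem glue_turnOver {S : Surface X Y} {T : Surface Y Z} {u v : X.comp ⊕ (Y.comp ⊕ Z.comp)}
    (h : glue S T u v) : glue T.flip S.flip (turnOver u) (turnOver v) := by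
  induction h with
  | rel u v h =>
    rcases h with ⟨a, b, h, rfl, rfl⟩ | ⟨a, b, h, rfl, rfl⟩
    · rw [turnOver_left, turnOver_left]
      exact Relation.EqvGen.rel _ _ (Or.inr ⟨_, _, by simpa [flip_conn] using h, rfl, rfl⟩)
    · rw [turnOver_right, turnOver_right]
      exact Relation.EqvGen.rel _ _ (Or.inl ⟨_, _, by simpa [flip_conn] using h, rfl, rfl⟩)
  | refl a => exact (glue T.flip S.flip).refl _
  | symm a b _ ih => exact (glue T.flip S.flip).symm ih
  | trans a b c _ _ ih ih' => exact (glue T.flip S.flip).trans ih ih'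

theorem flip_flip (S : Surface X Y) : S.flip.flip = S := by
  ext
  · simp [flip_conn]
  · simp [flip]
  · simp [flip]
  · rfl

theorem glue_turnOver_iff {S : Surface X Y} {T : Surface Y Z}
    {u v : X.comp ⊕ (Y.comp ⊕ Z.comp)} :
    glue T.flip S.flip (turnOver u) (turnOver v) ↔ glue S T u v :=
  ⟨fun h => by
    have := glue_turnOver h
    rwa [turnOver_turnOver, turnOver_turnOver, flip_flip, flip_flip] at this, glue_turnOver⟩

/-- A sum over the components of the lower part of a glued surface. -/
theorem glue_flip_sum {M : Type} [AddCommMonoid M] (S : Surface X Y)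
    (f : X.comp ⊕ Y.comp → M) (hf : ∀ a b, S.conn a b → f a = f b) :
    ∑ᶠ q : Quotient S.flip.conn, f q.out.swap = ∑ᶠ q : Quotient S.conn, f q.out :=
  finsum_quotient_congr _ S.conn Sum.swap (fun _ _ => S.flip_conn)
    (fun b => ⟨b.swap, by rw [Sum.swap_swap]⟩) f hf

theorem glue_left_congr (S : Surface X Y) (T : Surface Y Z) (v) {a b : X.comp ⊕ Y.comp}
    (h : S.conn a b) : glue S T (Sum.map id Sum.inl a) v ↔ glue S T (Sum.map id Sum.inl b) v := by
  have : glue S T (Sum.map id Sum.inl a) (Sum.map id Sum.inl b) :=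
    Relation.EqvGen.rel _ _ (Or.inl ⟨a, b, h, rfl, rfl⟩)
  exact ⟨(glue S T).trans ((glue S T).symm this), (glue S T).trans this⟩

theorem glue_right_congr (S : Surface X Y) (T : Surface Y Z) (v) {a b : Y.comp ⊕ Z.comp}
    (h : T.conn a b) : glue S T (Sum.inr a) v ↔ glue S T (Sum.inr b) v := by
  have : glue S T (Sum.inr a) (Sum.inr b) :=
    Relation.EqvGen.rel _ _ (Or.inr ⟨a, b, h, rfl, rfl⟩)
  exact ⟨(glue S T).trans ((glue S T).symm this), (glue S T).trans this⟩

open Classical in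
theorem glue_flip_left {M : Type} [AddCommMonoid M] (S : Surface X Y) (T : Surface Y Z)
    (f : X.comp ⊕ Y.comp → M) (hf : ∀ a b, S.conn a b → f a = f b) (v) :
    (∑ᶠ q : Quotient S.flip.conn,
      if glue T.flip S.flip (Sum.inr q.out) (turnOver v) then f q.out.swap else 0) =
      ∑ᶠ q : Quotient S.conn, if glue S T (Sum.map id Sum.inl q.out) v then f q.out else 0 := by
  rw [← glue_flip_sum S fun a => if glue S T (Sum.map id Sum.inl a) v then f a else 0]
  · refine finsum_congr fun q => if_congr ?_ rfl rfl
    rw [← glue_turnOver_iff (S := S) (T := T), turnOver_left, Sum.swap_swap]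
  · intro a b h
    rw [hf a b h]
    exact if_congr (glue_left_congr S T v h) rfl rfl

open Classical in
theorem glue_flip_right {M : Type} [AddCommMonoid M] (S : Surface X Y) (T : Surface Y Z)
    (f : Y.comp ⊕ Z.comp → M) (hf : ∀ a b, T.conn a b → f a = f b) (v) :
    (∑ᶠ q : Quotient T.flip.conn,
      if glue T.flip S.flip (Sum.map id Sum.inl q.out) (turnOver v) then f q.out.swap else 0) =
      ∑ᶠ q : Quotient T.conn, if glue S T (Sum.inr q.out) v then f q.out else 0 := by
  rw [← glue_flip_sum T fun a => if glue S T (Sum.inr a) v then f a else 0]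
  · refine finsum_congr fun q => if_congr ?_ rfl rfl
    rw [← glue_turnOver_iff (S := S) (T := T), turnOver_right, Sum.swap_swap]
  · intro a b h
    rw [hf a b h]
    exact if_congr (glue_right_congr S T v h) rfl rfl

theorem glueDots_flip (S : Surface X Y) (T : Surface Y Z) (v) :
    glueDots T.flip S.flip (turnOver v) = glueDots S T v := by
  rw [glueDots, glueDots, add_comm]
  exact congrArg₂ (· + ·) (glue_flip_left S T S.dots S.dots_congr v)
    (glue_flip_right S T T.dots T.dots_congr v)

theorem glueChi_flip (S : Surface X Y) (T : Surface Y Z) (v) :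
    glueChi T.flip S.flip (turnOver v) = glueChi S T v := by
  rw [glueChi, glueChi, add_comm]
  simp only [flip_chi]
  refine congrArg₂ (· - ·) (congrArg₂ (· + ·) (glue_flip_left S T S.chi (fun a b => S.chi_congr) v)
    (glue_flip_right S T T.chi (fun a b => T.chi_congr) v)) ?_
  congr 2
  ext y
  refine and_congr_right fun _ => ?_
  rw [← glue_turnOver_iff (S := S) (T := T)]
  rfl

theorem glueGenus_flip (S : Surface X Y) (T : Surface Y Z) (v) :
    glueGenus T.flip S.flip (turnOver v) = glueGenus S T v := by
  rw [glueGenus, glueGenus, glueChi_flip,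
    ← numCircles_swap {x | glue S T (Sum.map id Sum.inr x) v}]
  have : {x | glue T.flip S.flip (Sum.map id Sum.inr x) (turnOver v)} =
      {a : Z.comp ⊕ X.comp | a.swap ∈ {x | glue S T (Sum.map id Sum.inr x) v}} := by
    ext x
    simp only [Set.mem_ofPred_eq]
    rw [← glue_turnOver_iff (S := S) (T := T), turnOver_outer, Sum.swap_swap]
  rw [this]

/-- Results on discs glued below a surface thereby become results on discs glued above it. -/
theorem flip_comp (S : Surface X Y) (T : Surface Y Z) : (S.comp T).flip = T.flip.comp S.flip := by
  have hs : ∀ a : Z.comp ⊕ X.comp, (Sum.map id Sum.inr a : Z.comp ⊕ (Y.comp ⊕ X.comp)) =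
      turnOver (Sum.map id Sum.inr a.swap) := fun a => by rw [turnOver_outer, Sum.swap_swap]
  refine Surface.ext ?_ ?_ ?_ ?_
  · ext a b
    change glue S T _ _ ↔ glue T.flip S.flip _ _
    rw [hs, hs, glue_turnOver_iff]
  · ext a
    change glueGenus S T _ = glueGenus T.flip S.flip _
    rw [hs, glueGenus_flip]
  · ext a
    change glueDots S T _ = glueDots T.flip S.flip _
    rw [hs, glueDots_flip]
  · classical
    change S.closed + T.closed + _ = T.closed + S.closed + _
    rw [add_comm S.closed]
    congr 1
    rw [← finsum_quotient_congr (glue S T) (glue T.flip S.flip) turnOver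
      (fun a b => glue_turnOver_iff.symm)
      (fun b => ⟨turnOver b, by rw [turnOver_turnOver]⟩)
      (fun v => if ∃ x, glue T.flip S.flip (Sum.map id Sum.inr x) v then (0 : Multiset (ℕ × ℕ))
        else {(glueGenus T.flip S.flip v, glueDots T.flip S.flip v)})]
    · refine finsum_congr fun q => ?_
      rw [glueGenus_flip, glueDots_flip]
      refine if_congr ⟨?_, ?_⟩ rfl rfl
      · rintro ⟨x, hx⟩
        exact ⟨x.swap, by rwa [hs, Sum.swap_swap, glue_turnOver_iff]⟩
      · rintro ⟨x, hx⟩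
        exact ⟨x.swap, by rwa [hs, glue_turnOver_iff] at hx⟩
    · intro u v h
      simp only [glueGenus, glueChi, glueDots, glue_congr _ _ h]

section right

variable {ι : X.comp → Y.comp} (h : IsArcEmbedding ι) (B : Y.comp → ℕ) (T : Surface Z Y)

theorem comp_flip_discs : T.comp (discs h B).flip = ((discs h B).comp T.flip).flip := by
  rw [flip_comp, flip_flip]

theorem swap_map {α β γ δ : Type} (f : α → β) (g : γ → δ) (a : γ ⊕ α) :
    (Sum.map f g a.swap).swap = Sum.map g f a := by
  rcases a with a | a <;> rfl

theorem comp_flip_discs_conn {a b : Z.comp ⊕ X.comp} :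
    (T.comp (discs h B).flip).conn a b ↔ T.conn (Sum.map id ι a) (Sum.map id ι b) := by
  rw [comp_flip_discs, flip_conn, comp_discs_conn, flip_conn, swap_map, swap_map]

theorem comp_flip_discs_genus (a : Z.comp ⊕ X.comp) :
    (T.comp (discs h B).flip).genus a = T.genus (Sum.map id ι a) := by
  rw [comp_flip_discs]
  change ((discs h B).comp T.flip).genus a.swap = _
  rw [comp_discs_genus]
  change T.genus _ = _
  rw [swap_map]

theorem comp_flip_discs_dots (a : Z.comp ⊕ X.comp) :
    (T.comp (discs h B).flip).dots a =
      dotsAt B T.flip (Sum.map id ι a).swap + T.dots (Sum.map id ι a) := by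
  rw [comp_flip_discs]
  change ((discs h B).comp T.flip).dots a.swap = _
  rw [comp_discs_dots]
  change _ + T.dots _ = _
  rw [swap_map, ← swap_map ι id, Sum.swap_swap]

open Classical in
theorem comp_flip_discs_closed :
    (T.comp (discs h B).flip).closed = T.closed + ∑ᶠ q : Quotient T.conn,
      if ∃ x : Z.comp ⊕ X.comp, T.conn (Sum.map id ι x) q.out then 0
      else {(T.genus q.out, dotsAt B T.flip q.out.swap + T.dots q.out)} := by
  rw [comp_flip_discs]
  change ((discs h B).comp T.flip).closed = _
  rw [comp_discs_closed]
  congr 1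
  rw [← glue_flip_sum T fun z => if ∃ x : Z.comp ⊕ X.comp, T.conn (Sum.map id ι x) z then
    (0 : Multiset (ℕ × ℕ)) else {(T.genus z, dotsAt B T.flip z.swap + T.dots z)}]
  · refine finsum_congr fun q => ?_
    rw [Sum.swap_swap]
    refine if_congr ⟨?_, ?_⟩ rfl rfl
    · rintro ⟨x, hx⟩
      rw [flip_conn] at hx
      exact ⟨x.swap, by rwa [← swap_map, Sum.swap_swap]⟩
    · rintro ⟨x, hx⟩
      exact ⟨x.swap, by rwa [flip_conn, swap_map]⟩
  · intro a b hab
    have : (∃ x : Z.comp ⊕ X.comp, T.conn (Sum.map id ι x) a) ↔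
        ∃ x : Z.comp ⊕ X.comp, T.conn (Sum.map id ι x) b := exists_congr fun x =>
      ⟨fun k => T.conn.trans k hab, fun k => T.conn.trans k (T.conn.symm hab)⟩
    simp only [this, T.genus_congr a b hab, T.dots_congr a b hab,
      dotsAt_congr B T.flip (z := a.swap) (z' := b.swap) (by simpa [flip_conn] using hab)]

end right

end Surface

end BarNatan

end

noncomputable section

namespace BarNatan

variable {P : Type}

/-! ### Isomorphisms given by single surfaces -/

namespace Surface

variable {X Y Z : Diagram P}

theorem circles_le (S : Surface X Y) : Diagram.circles X Y ≤ S.conn := by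
  intro a b h
  induction h with
  | rel a b h =>
    obtain ⟨p, rfl, rfl⟩ := h
    exact S.wall p
  | refl a => exact S.conn.refl _
  | symm a b _ ih => exact S.conn.symm ih
  | trans a b c _ _ ih ih' => exact S.conn.trans ih ih'

/-- The value of a closed surface of genus `c.1` with `c.2` dots. -/
def closedValue (c : ℕ × ℕ) : ℤ := if c = (0, 1) then 1 else if c = (1, 0) then 2 else 0

/-- The surface consists of discs without dots that bound the circles, and of closed surfaces. -/
def IsMinimal (S : Surface X Y) : Prop :=
  S.conn = Diagram.circles X Y ∧ (∀ a, S.genus a = 0) ∧ ∀ a, S.dots a = 0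

open Classical in
/-- The coefficient of the discs without dots in a surface. -/
def coefficient (S : Surface X Y) : ℤ :=
  if S.IsMinimal then (S.closed.map closedValue).prod else 0

theorem coefficient_of_dots {S : Surface X Y} (a) (h : S.dots a ≠ 0) : S.coefficient = 0 :=
  if_neg fun h' => h (h'.2.2 a)

theorem coefficient_of_genus {S : Surface X Y} (a) (h : S.genus a ≠ 0) : S.coefficient = 0 :=
  if_neg fun h' => h (h'.2.1 a)

theorem coefficient_addClosed (S : Surface X Y) (g d : ℕ) :
    (S.addClosed g d).coefficient = closedValue (g, d) * S.coefficient := by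
  classical
  have h : (S.addClosed g d).closed = (g, d) ::ₘ S.closed := rfl
  rw [coefficient, coefficient, h, Multiset.map_cons, Multiset.prod_cons, mul_ite, mul_zero]
  exact if_congr Iff.rfl rfl rfl

theorem coefficient_add_dot (S : Surface X Y) (a) (d : ℕ) :
    (S.add a 0 (d + 1)).coefficient = 0 :=
  coefficient_of_dots a (by simp [add])

/-- Both sides vanish unless `g = d = 0`. The factor has this form because the neck relation trades
the added piece for a closed surface with one more dot. -/
theorem coefficient_add (S : Surface X Y) (a) (g d : ℕ) :
    (S.add a g d).coefficient = closedValue (g, d + 1) * S.coefficient := by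
  rcases d with _ | d
  · rcases g with _ | g
    · have : S.add a 0 0 = S := 
        Surface.ext rfl (by funext x; simp [add]) (by funext x; simp [add]) rfl
      simp [this, closedValue]
    · rw [coefficient_of_genus a (by simp [add])]
      simp [closedValue]
  · rw [coefficient_of_dots a (by simp [add])]
    simp [closedValue]

/-- The tube connects `a` and `b`, which lie on different circles because `S` does not connect them;
so some component bounds more than one circle. -/
theorem coefficient_tube (S : Surface X Y) (a b) (h : ¬ S.conn a b) :
    (S.tube a b).coefficient = 0 := by
  refine if_neg fun h' => h ?_
  have hab : (S.tube a b).conn a b :=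
    Or.inr ⟨Or.inl (S.conn.refl _), Or.inr (S.conn.refl _)⟩
  rw [h'.1] at hab
  exact S.circles_le hab

theorem closedValue_handle (g d : ℕ) : closedValue (g + 1, d) = 2 * closedValue (g, d + 1) := by
  rcases g with _ | g <;> rcases d with _ | d <;> simp [closedValue]

theorem closedValue_neck (g d g' d' : ℕ) :
    closedValue (g + g', d + d') = closedValue (g, d + 1) * closedValue (g', d') +
      closedValue (g, d) * closedValue (g', d' + 1) := by
  rcases g with _ | _ | g <;> rcases d with _ | _ | d <;> rcases g' with _ | _ | g' <;>
    rcases d' with _ | _ | d' <;> simp [closedValue] <;> omega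

end Surface

namespace Hom

variable {X Y Z : Diagram P}

/-- The linear extension of `Surface.coefficient`. -/
def coefficient : Hom X Y →ₗ[ℤ] ℤ := Finsupp.linearCombination ℤ Surface.coefficient

theorem coefficient_single (S : Surface X Y) (m : ℤ) :
    coefficient (Finsupp.single S m) = m * S.coefficient := by
  simp [coefficient]

theorem coefficient_toHom (S : Surface X Y) : coefficient S.toHom = S.coefficient := by
  simp [coefficient]

/-- Thus `coefficient` descends to the dotted category. It is the invariant that shows morphisms to
be nonzero and restricts which surfaces can be invertible. -/
theorem coefficient_relation {r : Hom X Y} (h : DottedRelation r) : coefficient r = 0 := by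
  cases h with
  | sphere S => simp [coefficient_toHom, Surface.coefficient_addClosed, Surface.closedValue]
  | dottedSphere S => simp [coefficient_toHom, Surface.coefficient_addClosed, Surface.closedValue]
  | twoDots S a => simp [coefficient_toHom, Surface.coefficient_add_dot S a 1]
  | twoDotsClosed S g d =>
    simp [coefficient_toHom, Surface.coefficient_addClosed, Surface.closedValue]
  | neckSelf S a =>
    simp [coefficient_toHom, Surface.coefficient_add, Surface.closedValue]
  | neck S a b h =>
    simp [coefficient_toHom, Surface.coefficient_tube S a b h, Surface.coefficient_add,
      Surface.closedValue]
  | neckClosed S a g d =>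
    simp [coefficient_toHom, Surface.coefficient_addClosed, Surface.coefficient_add,
      Surface.closedValue]
  | neckClosedSelf S g d =>
    simp [coefficient_toHom, Surface.coefficient_addClosed, Surface.closedValue_handle]
    ring
  | neckClosedClosed S g d g' d' =>
    simp [coefficient_toHom, Surface.coefficient_addClosed, Surface.closedValue_neck g d g' d']
    ring

theorem Eqv.coefficient_eq {f g : Hom X Y} (h : f.Eqv g) : coefficient f = coefficient g := by
  have : AddSubgroup.closure {r : Hom X Y | DottedRelation r} ≤
      (coefficient (X := X) (Y := Y)).toAddMonoidHom.ker := by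
    rw [AddSubgroup.closure_le]
    exact fun r hr => coefficient_relation hr
  have := this h
  rw [AddMonoidHom.mem_ker] at this
  simpa [sub_eq_zero] using this

theorem Eqv.refl (f : Hom X Y) : f.Eqv f := by simp [Eqv, zero_mem]

theorem Eqv.trans {f g h : Hom X Y} (hfg : f.Eqv g) (hgh : g.Eqv h) : f.Eqv h := by
  have := add_mem (show f - g ∈ AddSubgroup.closure _ from hfg) hgh
  rwa [sub_add_sub_cancel] at this

theorem comp_single (S : Surface X Y) (T : Surface Y Z) (m n : ℤ) :
    comp (Finsupp.single S m) (Finsupp.single T n) = Finsupp.single (S.comp T) (m * n) := by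
  rw [comp, Finsupp.sum_single_index, Finsupp.sum_single_index]
  · simp
  · rw [Finsupp.sum_single_index] <;> simp

/-- A nonzero surface can have no closed components of genus `0` except spheres with one dot. -/
theorem dots_eq_one_of_not_eqv {S : Surface X Y} {m : ℤ}
    (h : ¬ Eqv (Finsupp.single S m : Hom X Y) 0) {d : ℕ} (hd : (0, d) ∈ S.closed) : d = 1 := by
  by_contra hne
  refine h ?_
  let S' : Surface X Y := { S with closed := S.closed.erase (0, d) }
  have hS : S = S'.addClosed 0 d := by
    ext
    · rfl
    · rfl
    · rfl
    · simp only [Surface.addClosed, S', Multiset.cons_erase hd]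
  have hr : DottedRelation S.toHom := by
    rcases d with _ | _ | d
    · rw [hS]; exact DottedRelation.sphere S'
    · exact absurd rfl hne
    · rw [hS]; exact DottedRelation.twoDotsClosed S' 0 d
  have := AddSubgroup.zsmul_mem _ (AddSubgroup.subset_closure (show S.toHom ∈ _ from hr)) m
  rw [Finsupp.smul_single, smul_eq_mul, mul_one] at this
  rwa [Eqv, sub_zero]

theorem isMinimal_cylinder (hX : ∀ x, ¬ X.IsLoop x) : (Surface.cylinder X).IsMinimal := by
  refine ⟨le_antisymm ?_ (Surface.circles_le _), fun _ => rfl, fun _ => rfl⟩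
  have key : ∀ x, Diagram.circles X X (Sum.inl x) (Sum.inr x) := fun x => by
    have := hX x
    simp only [Diagram.IsLoop, not_not] at this
    obtain ⟨p, rfl⟩ := this
    exact Relation.EqvGen.rel _ _ ⟨p, rfl, rfl⟩
  have key' : ∀ a : X.comp ⊕ X.comp, Diagram.circles X X a (Sum.inr (Sum.elim id id a)) := by
    rintro (x | x)
    · exact key x
    · exact (Diagram.circles X X).refl _
  intro a b hab
  have hab' : Sum.elim id id a = Sum.elim id id b := hab
  have h1 := key' a
  rw [hab'] at h1
  exact (Diagram.circles X X).trans h1 ((Diagram.circles X X).symm (key' b))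

theorem coefficient_cylinder (hX : ∀ x, ¬ X.IsLoop x) :
    (Surface.cylinder X).coefficient = 1 := by
  rw [Surface.coefficient, if_pos (isMinimal_cylinder hX)]
  simp [Surface.cylinder]

theorem dots_le_comp (S : Surface X Y) (T : Surface Y Z) (x : X.comp) :
    S.dots (Sum.inl x) ≤ (S.comp T).dots (Sum.inl x) := by
  classical
  change _ ≤ Surface.glueDots S T (Sum.inl x)
  rw [Surface.glueDots]
  refine le_add_right ?_
  have hq := finsum_quotient_out S.conn
    (fun a => if Surface.glue S T (Sum.map id Sum.inl a) (Sum.inl x) then S.dots a else 0)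
    (fun a b h => by
      rw [S.dots_congr a b h]
      exact if_congr (Surface.glue_left_congr S T _ h) rfl rfl) (Sum.inl x)
  rw [if_pos (show Surface.glue S T (Sum.map id Sum.inl (Sum.inl x)) (Sum.inl x) from
    (Surface.glue S T).refl _)] at hq
  rw [← hq]
  have : Fintype (Quotient S.conn) := Fintype.ofFinite _
  rw [finsum_eq_sum_of_fintype, finsum_eq_sum_of_fintype]
  refine Finset.sum_le_sum fun q _ => ?_
  dsimp only
  split_ifs <;> simp

theorem comp_conn_left (S : Surface X Y) (T : Surface Y Z) {x x' : X.comp}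
    (h : S.conn (Sum.inl x) (Sum.inl x')) : (S.comp T).conn (Sum.inl x) (Sum.inl x') :=
  Relation.EqvGen.rel _ _ (Or.inl ⟨Sum.inl x, Sum.inl x', h, rfl, rfl⟩)

/-- The cylinder has coefficient `1`, so some term `T` of the inverse makes the composite a union of
undotted discs bounding the circles and closed components. Dots and connections at the lower end of
`S` persist in the composite, so `S` has no dots there and connects no two different arcs. -/
theorem IsIsomorphism.single {S : Surface X Y} {m m' : ℤ} {c : ℤ} (hX : ∀ x, ¬ X.IsLoop x)
    (h : IsIsomorphism m m' (Finsupp.single S c : Hom X Y)) (x x' : X.comp) :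
    S.dots (Sum.inl x) = 0 ∧ (S.conn (Sum.inl x) (Sum.inl x') → x = x') := by
  obtain ⟨-, g, -, hg, -⟩ := h
  have h1 := hg.coefficient_eq
  rw [coefficient_toHom, coefficient_cylinder hX] at h1
  obtain ⟨T, hT⟩ : ∃ T : Surface Y X, (S.comp T).coefficient ≠ 0 := by
    by_contra! hT
    have : coefficient (comp (Finsupp.single S c) g) = 0 := by
      rw [comp, Finsupp.sum_single_index]
      · rw [Finsupp.sum, map_sum]
        refine Finset.sum_eq_zero fun T _ => ?_
        rw [coefficient_single, hT, mul_zero]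
      · simp
    omega
  have hmin : (S.comp T).IsMinimal := by
    by_contra hn
    exact hT (if_neg hn)
  refine ⟨?_, fun hx => ?_⟩
  · have := dots_le_comp S T x
    rw [hmin.2.2] at this
    omega
  · have := comp_conn_left S T hx
    rw [hmin.1, ← (isMinimal_cylinder hX).1] at this
    exact this

end Hom

end BarNatan

end

/-! ### Single surfaces that are isomorphisms -/

noncomputable section

namespace BarNatan

variable {P : Type}

namespace Surface

variable {X Y Z : Diagram P}

/-- The surface with its closed components replaced by those in `C`. -/
def withClosed (S : Surface X Y) (C : Multiset (ℕ × ℕ)) : Surface X Y := { S with closed := C }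

end Surface

namespace Hom

variable {X Y Z : Diagram P}

theorem eqv_withClosed (S : Surface X Y) (C : Multiset (ℕ × ℕ)) (hC : ∀ c ∈ C, c = (0, 1)) :
    Eqv (S.withClosed C).toHom (S.withClosed 0).toHom := by
  induction C using Multiset.induction with
  | empty => exact Eqv.refl _
  | cons c C ih =>
    refine Eqv.trans ?_ (ih fun c hc => hC c (Multiset.mem_cons_of_mem hc))
    obtain rfl := hC c (Multiset.mem_cons_self _ _)
    exact AddSubgroup.subset_closure (DottedRelation.dottedSphere (S.withClosed C))

end Hom

namespace IsArcEmbedding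

variable {X Y : Diagram P} {ι : X.comp → Y.comp}

/-- Each arc of `X` carries an endpoint, and the wall over it leads to an arc of `Y`. The hypotheses
make that arc unique and the resulting map injective. -/
theorem exists_of_surface {S : Surface X Y} (hX : ∀ x, ¬ X.IsLoop x) (hY : ∀ y, ¬ Y.IsLoop y)
    (h1 : ∀ x x', S.conn (Sum.inl x) (Sum.inl x') → x = x')
    (h2 : ∀ y y', S.conn (Sum.inr y) (Sum.inr y') → y = y') :
    ∃ ι : X.comp → Y.comp, IsArcEmbedding ι ∧ S.conn = Setoid.ker (Sum.elim ι id) := by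
  simp only [Diagram.IsLoop, not_not] at hX hY
  choose p hp using hX
  have hw : ∀ x, S.conn (Sum.inl x) (Sum.inr (Y.endpt (p x))) := fun x => by
    have := S.wall (p x)
    rwa [hp] at this
  have he : ∀ q, Y.endpt (p (X.endpt q)) = Y.endpt q := fun q =>
    h2 _ _ (S.conn.trans (S.conn.symm (hw _)) (S.wall q))
  have hinj : Function.Injective fun x => Y.endpt (p x) := fun x x' h =>
    h1 _ _ (S.conn.trans (hw x) (by
      rw [show Y.endpt (p x) = Y.endpt (p x') from h]; exact S.conn.symm (hw x')))
  refine ⟨fun x => Y.endpt (p x), ⟨hinj, he, fun y => ?_⟩, ?_⟩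
  · obtain ⟨q, rfl⟩ := hY y
    simp only [Diagram.IsLoop, not_not]
    exact ⟨fun _ => ⟨q, rfl⟩, fun _ => ⟨X.endpt q, he q⟩⟩
  · have key : ∀ a, S.conn a (Sum.inr (Sum.elim (fun x => Y.endpt (p x)) id a)) := by
      rintro (x | y)
      · exact hw x
      · exact S.conn.refl _
    ext a b
    refine ⟨fun h => h2 _ _ (S.conn.trans (S.conn.symm (key a)) (S.conn.trans h (key b))),
      fun h => ?_⟩
    have h' : Sum.elim (fun x => Y.endpt (p x)) id a = Sum.elim (fun x => Y.endpt (p x)) id b := h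
    have := key a
    rw [h'] at this
    exact S.conn.trans this (S.conn.symm (key b))

end IsArcEmbedding

namespace Surface

variable {X Y : Diagram P} {ι : X.comp → Y.comp} {κ : Y.comp → X.comp}

theorem degree_discs (h : IsArcEmbedding ι) (hι : Function.Surjective ι) {C : Multiset (ℕ × ℕ)}
    (hC : ∀ c ∈ C, c = (0, 1)) (m m' : ℤ) :
    ((discs h 0).withClosed C).degree m m' = m' - m := by
  have h1 : (C.map fun c => 2 - 2 * (c.1 : ℤ)).sum = 2 * ((C.map fun c => c.2).sum : ℕ) := by
    rw [Multiset.eq_replicate_card.2 hC]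
    simp [mul_comm]
  have h2 : (∑ᶠ q : Quotient (discs h 0).conn, ((discs h 0).withClosed C).chi q.out) =
      (Nat.card Y.comp : ℤ) := by
    have : ∀ a, ((discs h 0).withClosed C).chi a = 1 := discs_chi h 0
    simp only [this]
    rw [discs_out_sum h 0 fun _ => (1 : ℤ)]
    have : Fintype Y.comp := Fintype.ofFinite _
    rw [finsum_eq_sum_of_fintype]
    simp
  have h3 : X.numArcs = Nat.card Y.comp := by
    rw [Diagram.numArcs, Set.range_eq_univ.2 h.exists_endpt, Set.ncard_univ]
    exact Nat.card_eq_of_bijective ι ⟨h.inj, hι⟩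
  have h4 : ((discs h 0).withClosed C).totalChi = Nat.card Y.comp +
      2 * ((C.map fun c => c.2).sum : ℕ) := by
    rw [← h1, ← h2]; rfl
  have h5 : ((discs h 0).withClosed C).totalDots = (C.map fun c => c.2).sum := by
    have : ((discs h 0).withClosed C).totalDots =
      (∑ᶠ q : Quotient (discs h 0).conn, 0) + (C.map fun c => c.2).sum := rfl
    rw [this, finsum_zero, zero_add]
  rw [degree, h4, h5, h3]
  ring

theorem discs_eq_flip (h : IsArcEmbedding ι) (k : IsArcEmbedding κ) (hκ : ∀ x, κ (ι x) = x) :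
    discs k 0 = (discs h 0).flip := by
  refine Surface.ext ?_ rfl rfl rfl
  ext a b
  rw [flip_conn, discs_conn, discs_conn]
  have key : ∀ a, Sum.elim κ id a = κ (Sum.elim ι id a.swap) := by
    rintro (a | a) <;> simp [hκ]
  rw [key, key, k.inj.eq_iff]

theorem dotsAt_zero (T : Surface X Y) (z) : dotsAt 0 T z = 0 := by
  simp [dotsAt]

theorem discs_comp_withClosed (h : IsArcEmbedding ι) (k : IsArcEmbedding κ)
    (hι : ∀ y, ι (κ y) = y) (C : Multiset (ℕ × ℕ)) :
    (discs k 0).comp ((discs h 0).withClosed C) = (cylinder Y).withClosed C := by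
  classical
  have key : ∀ a : Y.comp ⊕ Y.comp, Sum.elim ι id (Sum.map κ id a) = Sum.elim id id a := by
    rintro (a | a) <;> simp [hι]
  refine Surface.ext ?_ ?_ ?_ ?_
  · ext a b
    rw [comp_discs_conn]
    change Sum.elim ι id _ = Sum.elim ι id _ ↔ Sum.elim id id a = Sum.elim id id b
    rw [key, key]
  · ext a
    rw [comp_discs_genus]
    rfl
  · ext a
    rw [comp_discs_dots, dotsAt_zero]
    rfl
  · rw [comp_discs_closed]
    refine (congrArg (C + ·) ?_).trans (add_zero C)
    refine finsum_eq_zero_of_forall_eq_zero fun q => if_pos ⟨Sum.inr (Sum.elim ι id q.out), ?_⟩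
    change Sum.elim ι id _ = Sum.elim ι id _
    rfl

theorem withClosed_comp_discs (h : IsArcEmbedding ι) (k : IsArcEmbedding κ)
    (hκ : ∀ x, κ (ι x) = x) (C : Multiset (ℕ × ℕ)) :
    ((discs h 0).withClosed C).comp (discs k 0) = (cylinder X).withClosed C := by
  classical
  rw [discs_eq_flip h k hκ]
  have key : ∀ a : X.comp ⊕ X.comp, Sum.elim ι id (Sum.map id ι a) = ι (Sum.elim id id a) := by
    rintro (a | a) <;> simp
  refine Surface.ext ?_ ?_ ?_ ?_
  · ext a b
    rw [comp_flip_discs_conn]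
    change Sum.elim ι id _ = Sum.elim ι id _ ↔ Sum.elim id id a = Sum.elim id id b
    rw [key, key, h.inj.eq_iff]
  · ext a
    rw [comp_flip_discs_genus]
    rfl
  · ext a
    rw [comp_flip_discs_dots, dotsAt_zero]
    rfl
  · rw [comp_flip_discs_closed]
    refine (congrArg (C + ·) ?_).trans (add_zero C)
    refine finsum_eq_zero_of_forall_eq_zero fun q => if_pos ?_
    have hsurj : ∀ y, ∃ x, ι x = y := fun y => by
      obtain ⟨p, rfl⟩ := k.exists_endpt y
      exact ⟨_, h.endpt p⟩
    obtain ⟨x, hx⟩ := hsurj (Sum.elim ι id q.out)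
    exact ⟨Sum.inl x, hx⟩

end Surface

namespace Hom

variable {X Y : Diagram P}

/-- A surface that consists of discs without dots, each of which bounds one arc of `X` and one of
`Y`, and of spheres with one dot, is a nonzero isomorphism. -/
theorem isIsomorphism_single {S : Surface X Y} (hX : ∀ x, ¬ X.IsLoop x) (hY : ∀ y, ¬ Y.IsLoop y)
    (h1 : ∀ x x', S.conn (Sum.inl x) (Sum.inl x') → x = x')
    (h2 : ∀ y y', S.conn (Sum.inr y) (Sum.inr y') → y = y')
    (hg : ∀ a, S.genus a = 0) (hd : ∀ x, S.dots (Sum.inl x) = 0)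
    (hC : ∀ c ∈ S.closed, c = (0, 1)) {c : ℤ} (hc : c * c = 1) (m : ℤ) :
    ¬ Eqv (Finsupp.single S c) 0 ∧ IsIsomorphism m m (Finsupp.single S c) := by
  obtain ⟨ι, h, hconn⟩ := IsArcEmbedding.exists_of_surface hX hY h1 h2
  obtain ⟨κ, k, hconn'⟩ := IsArcEmbedding.exists_of_surface (S := S.flip) hY hX h2 h1
  have hκ : ∀ x, κ (ι x) = x := fun x => by
    obtain ⟨p, rfl⟩ := h.exists_endpt x
    rw [h.endpt, k.endpt]
  have hι : ∀ y, ι (κ y) = y := fun y => by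
    obtain ⟨p, rfl⟩ := k.exists_endpt y
    rw [k.endpt, h.endpt]
  have hS : S = (Surface.discs h 0).withClosed S.closed := by
    refine Surface.ext hconn (funext hg) (funext ?_) rfl
    rintro (x | y)
    · exact hd x
    · rw [← hι y, ← S.dots_congr (Sum.inl (κ y)), hd]
      · rfl
      · rw [hconn]; rfl
  generalize S.closed = C at hS hC
  subst hS
  have hc0 : c ≠ 0 := by rintro rfl; simp at hc
  have hcirc : (Surface.discs h 0).conn = Diagram.circles X Y := by
    refine le_antisymm ?_ (Surface.circles_le _)
    have key : ∀ a, Diagram.circles X Y a (Sum.inr (Sum.elim ι id a)) := by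
      rintro (x | y)
      · obtain ⟨p, rfl⟩ := h.exists_endpt x
        exact Relation.EqvGen.rel _ _ ⟨p, rfl, by rw [Sum.elim_inl, h.endpt]⟩
      · exact (Diagram.circles X Y).refl _
    intro a b hab
    have h3 := key a
    rw [(Surface.discs_conn h 0).1 hab] at h3
    exact (Diagram.circles X Y).trans h3 ((Diagram.circles X Y).symm (key b))
  -- The inverse is the same surface upside down and without its spheres, with the same coefficient,
  -- since `c * c = 1`.
  refine ⟨fun h0 => ?_, ?_, Finsupp.single (Surface.discs k 0) c, ?_, ?_, ?_⟩
  · have := h0.coefficient_eq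
    rw [coefficient_single, map_zero, Surface.coefficient,
      if_pos ⟨hcirc, fun _ => rfl, fun _ => rfl⟩] at this
    have hp : (((Surface.discs h 0).withClosed C).closed.map Surface.closedValue).prod = 1 := by
      refine Multiset.prod_eq_one fun v hv => ?_
      obtain ⟨b, hb, rfl⟩ := Multiset.mem_map.1 hv
      rw [hC b hb]; rfl
    rw [hp, mul_one] at this
    exact hc0 this
  · intro T hT
    rw [Finsupp.support_single _ hc0, Finset.mem_singleton] at hT
    rw [hT, Surface.degree_discs h (fun y => ⟨κ y, hι y⟩) hC, sub_self]
  · intro T hT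
    rw [Finsupp.support_single _ hc0, Finset.mem_singleton] at hT
    rw [hT]
    have := Surface.degree_discs k (fun x => ⟨ι x, hκ x⟩) (C := 0) (by simp) m m
    rwa [sub_self] at this
  · rw [comp_single, hc, Surface.withClosed_comp_discs h k hκ]
    exact eqv_withClosed (Surface.cylinder X) C hC
  · rw [comp_single, hc, Surface.discs_comp_withClosed h k hι]
    exact eqv_withClosed (Surface.cylinder Y) C hC

end Hom

end BarNatan

end

/-! ### The matrix elements of the delooped complex -/

noncomputable section

namespace BarNatan

variable {P : Type}

namespace Diagram

theorem isArcEmbedding_val (X : Diagram P) :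
    IsArcEmbedding (X := X.deloop) (Y := X) (fun c => c.1) where
  inj := Subtype.val_injective
  endpt _ := rfl
  range y := ⟨fun ⟨x, hx⟩ => hx ▸ x.2, fun hy => ⟨⟨y, hy⟩, rfl⟩⟩

theorem deloop_not_isLoop (X : Diagram P) (c : X.deloop.comp) : ¬ X.deloop.IsLoop c := by
  obtain ⟨p, hp⟩ := X.isArcEmbedding_val.exists_endpt c
  exact fun h => h ⟨p, hp⟩

end Diagram

namespace Surface

variable {X Y Z : Diagram P}

theorem cupOn_eq (X : Diagram P) (B : Set X.comp) :
    cupOn X B = discs X.isArcEmbedding_val (B.indicator 1) := rfl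

theorem capOff_eq (X : Diagram P) (B : Set X.comp) :
    capOff X B = (discs X.isArcEmbedding_val (B.indicator 1)).flip := by
  have key : ∀ a : X.comp ⊕ X.deloop.comp, Sum.elim id Subtype.val a =
      Sum.elim (fun c : X.deloop.comp => c.1) id a.swap := by rintro (a | a) <;> rfl
  refine Surface.ext ?_ rfl ?_ rfl
  · ext a b
    rw [flip_conn, discs_conn, ← key, ← key]
    rfl
  · ext a
    exact congrArg (B.indicator 1) (key a)

theorem dotsAt_indicator (B : Set Y.comp) (T : Surface Y Z) (z : Y.comp ⊕ Z.comp) :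
    dotsAt (B.indicator 1) T z = {y | y ∈ B ∧ T.conn (Sum.inl y) z}.ncard := by
  classical
  have : Fintype Y.comp := Fintype.ofFinite _
  have hs : {y | y ∈ B ∧ T.conn (Sum.inl y) z}.toFinset =
      Finset.univ.filter fun y => y ∈ B ∧ T.conn (Sum.inl y) z := by ext; simp
  rw [dotsAt, finsum_eq_sum_of_fintype, Set.ncard_eq_toFinset_card', hs, Finset.card_eq_sum_ones,
    ← Finset.sum_filter_add_sum_filter_not Finset.univ
    (fun y => y ∈ B ∧ T.conn (Sum.inl y) z), add_comm, Finset.sum_eq_zero, zero_add]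
  · refine Finset.sum_congr rfl fun y hy => ?_
    rw [Finset.mem_filter] at hy
    rw [if_pos hy.2.2, Set.indicator_of_mem hy.2.1]
    rfl
  · intro y hy
    rw [Finset.mem_filter] at hy
    split_ifs with h
    · exact Set.indicator_of_notMem (fun hB => hy.2 ⟨hB, h⟩) _
    · rfl

end Surface

section Braid

variable {r : ℕ} {w : List (Fin r)}

theorem Raises.unique {s s' : Smoothing w} {l m : Fin w.length} (h : Raises w s s' l)
    (h' : Raises w s s' m) : m = l := by
  by_contra hne
  have := h'.2
  rw [h.2] at this
  have := congrFun this m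
  rw [Function.update_self, Function.update_of_ne hne, h'.1] at this
  cases this

/-- The surface underlying a matrix element. -/
def cellSurface (a b : Cell w) : Surface a.obj b.obj :=
  ((Surface.cupOn (smooth w a.smoothing) a.blue).comp (saddle w a.smoothing b.smoothing)).comp
    (Surface.capOff (smooth w b.smoothing) b.red)

/-- At most one layer can be raised between two given smoothings, so the hypercube differential
contributes one signed saddle. -/
theorem deloopedD_eq {a b : Cell w} {l : Fin w.length} (h : Raises w a.smoothing b.smoothing l) :
    ∃ c : ℤ, c * c = 1 ∧ deloopedD a b = Finsupp.single (cellSurface a b) c := by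
  classical
  let e := (Finset.univ.filter fun m => m < l ∧ a.smoothing m = true).card
  have h1 : hypercubeD a.smoothing b.smoothing =
      Finsupp.single (saddle w a.smoothing b.smoothing) ((-1 : ℤ) ^ e) := by
    rw [hypercubeD, Finset.sum_eq_single l]
    · rw [if_pos h, Finsupp.smul_single, smul_eq_mul, mul_one]
    · intro m _ hm
      exact if_neg fun h' => hm (h.unique h')
    · intro hl; exact absurd (Finset.mem_univ l) hl
  refine ⟨(-1) ^ e, by rw [← mul_pow]; simp, ?_⟩
  rw [deloopedD, h1]
  refine (congrArg (fun f => Hom.comp f b.deloopTo) (Hom.comp_single _ _ 1 _)).trans ?_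
  refine (Hom.comp_single _ _ _ 1).trans ?_
  rw [one_mul, mul_one]
  rfl

theorem exists_raises_of_isEdge {a b : Cell w} (h : IsEdge deloopedD a b) :
    ∃ l, Raises w a.smoothing b.smoothing l := by
  by_contra! hn
  refine h ?_
  have : deloopedD a b = 0 := by
    rw [deloopedD, hypercubeD, Finset.sum_eq_zero fun l _ => if_neg (hn l), Hom.comp, Hom.comp]
    simp
  rw [this]
  exact Hom.Eqv.refl 0

/-- The components of two smoothings that lie on the same component of the saddle. -/
abbrev SaddleConn (a b : Cell w)
    (x y : (smooth w a.smoothing).comp ⊕ (smooth w b.smoothing).comp) : Prop :=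
  (saddle w a.smoothing b.smoothing).conn x y

/-- The number of dots on a component of the saddle with the loops capped off. -/
def dotCount (a b : Cell w) (z : (smooth w a.smoothing).comp ⊕ (smooth w b.smoothing).comp) : ℕ :=
  {x | x ∈ a.blue ∧ SaddleConn a b (Sum.inl x) z}.ncard +
    {y | y ∈ b.red ∧ SaddleConn a b (Sum.inr y) z}.ncard

/-- A component of the saddle that contains no arcs. -/
def NoArcs (a b : Cell w) (z : (smooth w a.smoothing).comp ⊕ (smooth w b.smoothing).comp) : Prop :=
  ∀ p, ¬ SaddleConn a b (Sum.inl ((smooth w a.smoothing).endpt p)) z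

theorem dotCount_congr {a b : Cell w}
    {z z' : (smooth w a.smoothing).comp ⊕ (smooth w b.smoothing).comp} (h : SaddleConn a b z z') :
    dotCount a b z = dotCount a b z' := by
  have : ∀ x, SaddleConn a b x z ↔ SaddleConn a b x z' := fun x =>
    ⟨fun k => Setoid.trans' _ k h, fun k => Setoid.trans' _ k (Setoid.symm' _ h)⟩
  simp only [dotCount, this]

/-- The inclusion of the arcs of one diagram. -/
abbrev arcIncl (a : Cell w) (c : a.obj.comp) : (smooth w a.smoothing).comp := c.1

/-- The inclusion of the arcs. -/
def arcs (a b : Cell w) (x : a.obj.comp ⊕ b.obj.comp) :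
    (smooth w a.smoothing).comp ⊕ (smooth w b.smoothing).comp :=
  Sum.map (arcIncl a) (arcIncl b) x

theorem noArcs_iff {a b : Cell w}
    {z : (smooth w a.smoothing).comp ⊕ (smooth w b.smoothing).comp} :
    NoArcs a b z ↔ ¬ ∃ x, SaddleConn a b (arcs a b x) z := by
  constructor
  · rintro h ⟨⟨c, hc⟩ | ⟨c, hc⟩, hx⟩
    · simp only [Diagram.IsLoop, not_not] at hc
      obtain ⟨p, rfl⟩ := hc
      exact h p hx
    · simp only [Diagram.IsLoop, not_not] at hc
      obtain ⟨p, rfl⟩ := hc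
      exact h p (Setoid.trans' _ ((saddle w a.smoothing b.smoothing).wall p) hx)
  · intro h p hp
    exact h ⟨Sum.inl (a.obj.endpt p), hp⟩

namespace cellSurface

variable (a b : Cell w)

theorem conn_iff {x y : a.obj.comp ⊕ b.obj.comp} :
    (cellSurface a b).conn x y ↔ SaddleConn a b (arcs a b x) (arcs a b y) := by
  have key : ∀ x : a.obj.comp ⊕ b.obj.comp,
      Sum.map (arcIncl a) id (Sum.map id (arcIncl b) x) = arcs a b x := by
    rintro (x | x) <;> rfl
  rw [cellSurface, Surface.cupOn_eq, Surface.capOff_eq]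
  refine (Surface.comp_flip_discs_conn _ _ _).trans ?_
  refine (Surface.comp_discs_conn _ _ _).trans ?_
  rw [← key, ← key]
  rfl

theorem genus_eq (x : a.obj.comp ⊕ b.obj.comp) : (cellSurface a b).genus x = 0 := by
  rw [cellSurface, Surface.cupOn_eq, Surface.capOff_eq]
  refine (Surface.comp_flip_discs_genus _ _ _ _).trans ?_
  exact (Surface.comp_discs_genus _ _ _ _)

/-- The saddle with the loops at its lower end capped off. -/
def lower : Surface a.obj (smooth w b.smoothing) :=
  (Surface.cupOn (smooth w a.smoothing) a.blue).comp (saddle w a.smoothing b.smoothing)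

theorem lower_conn {x y : a.obj.comp ⊕ (smooth w b.smoothing).comp} :
    (lower a b).conn x y ↔
      SaddleConn a b (Sum.map (arcIncl a) id x) (Sum.map (arcIncl a) id y) :=
  Surface.comp_discs_conn (smooth w a.smoothing).isArcEmbedding_val (a.blue.indicator 1)
    (saddle w a.smoothing b.smoothing)

theorem lower_dots (x : a.obj.comp ⊕ (smooth w b.smoothing).comp) :
    (lower a b).dots x = {y | y ∈ a.blue ∧
      SaddleConn a b (Sum.inl y) (Sum.map (arcIncl a) id x)}.ncard := by
  refine (Surface.comp_discs_dots (smooth w a.smoothing).isArcEmbedding_val (a.blue.indicator 1)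
    (saddle w a.smoothing b.smoothing) x).trans ?_
  rw [Surface.dotsAt_indicator]
  rfl

theorem lower_genus (x : a.obj.comp ⊕ (smooth w b.smoothing).comp) :
    (lower a b).genus x = 0 :=
  Surface.comp_discs_genus (smooth w a.smoothing).isArcEmbedding_val (a.blue.indicator 1)
    (saddle w a.smoothing b.smoothing) x

/-- Consequently capping off the lower loops closes no component; closed components arise only from
the discs on top. -/
theorem exists_upper (z : (smooth w a.smoothing).comp ⊕ (smooth w b.smoothing).comp) :
    ∃ y, SaddleConn a b (Sum.inr y) z := by
  rcases z with x | y
  · obtain ⟨v, rfl⟩ := Quotient.exists_rep x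
    exact ⟨compAt w b.smoothing v, Setoid.symm' _ (Relation.EqvGen.rel _ _ ⟨v, rfl, rfl⟩)⟩
  · exact ⟨y, Setoid.refl' _ _⟩

theorem lower_closed : (lower a b).closed = 0 := by
  classical
  refine (Surface.comp_discs_closed (smooth w a.smoothing).isArcEmbedding_val
    (a.blue.indicator 1) (saddle w a.smoothing b.smoothing)).trans ?_
  refine (zero_add _).trans (finsum_eq_zero_of_forall_eq_zero fun q => if_pos ?_)
  obtain ⟨y, hy⟩ := exists_upper a b q.out
  exact ⟨Sum.inr y, hy⟩

theorem dotsAt_add (x : a.obj.comp ⊕ (smooth w b.smoothing).comp) :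
    Surface.dotsAt (b.red.indicator 1) (lower a b).flip x.swap + (lower a b).dots x =
      dotCount a b (Sum.map (arcIncl a) id x) := by
  rw [Surface.dotsAt_indicator, lower_dots, dotCount, add_comm]
  congr 2
  ext y
  refine and_congr_right fun _ => ?_
  rw [Surface.flip_conn, Sum.swap_swap]
  exact lower_conn a b

theorem dots_eq (x : a.obj.comp ⊕ b.obj.comp) :
    (cellSurface a b).dots x = dotCount a b (arcs a b x) := by
  rw [cellSurface, Surface.capOff_eq]
  refine (Surface.comp_flip_discs_dots _ _ _ _).trans ?_
  refine (dotsAt_add a b _).trans ?_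
  rcases x with x | x <;> rfl

theorem mem_closed {c : ℕ × ℕ} :
    c ∈ (cellSurface a b).closed ↔ ∃ z, NoArcs a b z ∧ c = (0, dotCount a b z) := by
  classical
  have h1 := Surface.comp_flip_discs_closed (smooth w b.smoothing).isArcEmbedding_val
    (b.red.indicator 1) (lower a b)
  rw [lower_closed, zero_add, ← Surface.capOff_eq] at h1
  have h2 : (cellSurface a b).closed = _ := h1
  have key : ∀ x : a.obj.comp ⊕ b.obj.comp,
      Sum.map (arcIncl a) id (Sum.map id (arcIncl b) x) = arcs a b x := by
    rintro (x | x) <;> rfl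
  have hno : ∀ q : a.obj.comp ⊕ (smooth w b.smoothing).comp,
      (∃ x, (lower a b).conn (Sum.map id (arcIncl b) x) q) ↔
        ¬ NoArcs a b (Sum.map (arcIncl a) id q) := by
    intro q
    rw [noArcs_iff, not_not]
    refine exists_congr fun x => ?_
    rw [← key]
    exact lower_conn a b
  have : Fintype (Quotient (lower a b).conn) := Fintype.ofFinite _
  rw [h2, finsum_eq_sum_of_fintype, Multiset.mem_sum]
  simp only [dotsAt_add, lower_genus]
  constructor
  · rintro ⟨q, -, hq⟩
    split_ifs at hq with h
    · simp at hq
    · exact ⟨_, not_not.1 fun h' => h ((hno _).2 h'), by simpa using hq⟩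
  · rintro ⟨z, hz, rfl⟩
    obtain ⟨y, hy⟩ := exists_upper a b z
    have hq : SaddleConn a b
        (Sum.map (arcIncl a) id (Quotient.mk (lower a b).conn (Sum.inr y)).out) z :=
      Setoid.trans' _ ((lower_conn a b).1 (Quotient.mk_out (s := (lower a b).conn) (Sum.inr y))) hy
    refine ⟨Quotient.mk _ (Sum.inr y), Finset.mem_univ _, ?_⟩
    rw [if_neg, dotCount_congr hq]
    · simp
    · exact fun h => (hno _).1 h fun p hp => hz p (Setoid.trans' _ hp hq)

end cellSurface

/-- A component of the saddle without arcs becomes a sphere, and the element vanishes unless that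
sphere has exactly one dot. -/
theorem dotCount_of_isEdge {a b : Cell w} (h : IsEdge deloopedD a b)
    {z : (smooth w a.smoothing).comp ⊕ (smooth w b.smoothing).comp} (hz : NoArcs a b z) :
    dotCount a b z = 1 := by
  obtain ⟨l, hl⟩ := exists_raises_of_isEdge h
  obtain ⟨c, -, hc⟩ := deloopedD_eq hl
  rw [IsEdge, hc] at h
  exact Hom.dots_eq_one_of_not_eqv h ((cellSurface.mem_closed a b).2 ⟨z, hz, rfl⟩)

theorem arcs_of_isIsomorphism {a b : Cell w} {m m' : ℤ} {l : Fin w.length}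
    (hl : Raises w a.smoothing b.smoothing l) (h : (deloopedD a b).IsIsomorphism m m') :
    (∀ p, dotCount a b (Sum.inl ((smooth w a.smoothing).endpt p)) = 0) ∧
      ∀ p q, SaddleConn a b (Sum.inl ((smooth w a.smoothing).endpt p))
        (Sum.inl ((smooth w a.smoothing).endpt q)) →
        (smooth w a.smoothing).endpt p = (smooth w a.smoothing).endpt q := by
  obtain ⟨c, -, hc⟩ := deloopedD_eq hl
  rw [hc] at h
  have h' := fun p q => Hom.IsIsomorphism.single (smooth w a.smoothing).deloop_not_isLoop h
    (a.obj.endpt p) (a.obj.endpt q)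
  refine ⟨fun p => ?_, fun p q hpq => ?_⟩
  · exact (cellSurface.dots_eq a b _).symm.trans (h' p p).1
  · exact congrArg Subtype.val ((h' p q).2 ((cellSurface.conn_iff a b).2 hpq))

/-- The surface then consists of spheres with one dot and of undotted discs with one arc at either
end. The shift `m` is arbitrary because only the equality of the two shifts matters. -/
theorem isIsomorphism_of_arcs {a b : Cell w} {l : Fin w.length}
    (hl : Raises w a.smoothing b.smoothing l)
    (h0 : ∀ z, NoArcs a b z → dotCount a b z = 1)
    (h1 : ∀ p, dotCount a b (Sum.inl ((smooth w a.smoothing).endpt p)) = 0)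
    (h2 : ∀ p q, SaddleConn a b (Sum.inl ((smooth w a.smoothing).endpt p))
        (Sum.inl ((smooth w a.smoothing).endpt q)) →
        (smooth w a.smoothing).endpt p = (smooth w a.smoothing).endpt q)
    (h3 : ∀ p q, SaddleConn a b (Sum.inr ((smooth w b.smoothing).endpt p))
        (Sum.inr ((smooth w b.smoothing).endpt q)) →
        (smooth w b.smoothing).endpt p = (smooth w b.smoothing).endpt q) (m : ℤ) :
    IsEdge deloopedD a b ∧ (deloopedD a b).IsIsomorphism m m := by
  obtain ⟨c, hc, hd⟩ := deloopedD_eq hl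
  rw [IsEdge, hd]
  have ha : ∀ x : a.obj.comp, ∃ p, a.obj.endpt p = x :=
    (smooth w a.smoothing).isArcEmbedding_val.exists_endpt
  have hb : ∀ x : b.obj.comp, ∃ p, b.obj.endpt p = x :=
    (smooth w b.smoothing).isArcEmbedding_val.exists_endpt
  refine Hom.isIsomorphism_single (smooth w a.smoothing).deloop_not_isLoop
    (smooth w b.smoothing).deloop_not_isLoop ?_ ?_ (cellSurface.genus_eq a b) ?_ ?_ hc m
  · intro x y hxy
    obtain ⟨p, rfl⟩ := ha x
    obtain ⟨q, rfl⟩ := ha y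
    exact Subtype.ext (h2 p q ((cellSurface.conn_iff a b).1 hxy))
  · intro x y hxy
    obtain ⟨p, rfl⟩ := hb x
    obtain ⟨q, rfl⟩ := hb y
    exact Subtype.ext (h3 p q ((cellSurface.conn_iff a b).1 hxy))
  · intro x
    obtain ⟨p, rfl⟩ := ha x
    exact (cellSurface.dots_eq a b _).trans (h1 p)
  · intro c hc
    obtain ⟨z, hz, rfl⟩ := (cellSurface.mem_closed a b).1 hc
    rw [h0 z hz]

end Braid

end BarNatan

end

noncomputable section

namespace BarNatan

/-! ### Relations with unique successors and predecessors -/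

section Flow

variable {α : Type} {N : α → α → Prop}

/-- A partial injection decomposes its domain into paths and cycles. -/
theorem eqvGen_comparable (hr : Relator.RightUnique N) (hl : Relator.LeftUnique N) {u v : α}
    (h : Relation.EqvGen N u v) : Relation.ReflTransGen N u v ∨ Relation.ReflTransGen N v u := by
  have hl' : Relator.RightUnique (Function.swap N) := fun a b c h h' => hl h h'
  induction h with
  | rel u v h => exact Or.inl (.single h)
  | refl u => exact Or.inl .refl
  | symm u v _ ih => exact ih.symm
  | trans u v w _ _ ih ih' =>
    rcases ih with h | h <;> rcases ih' with h' | h'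
    · exact Or.inl (h.trans h')
    · have := Relation.ReflTransGen.total_of_right_unique hl'
        (Relation.reflTransGen_swap.2 h) (Relation.reflTransGen_swap.2 h')
      exact (this.imp Relation.reflTransGen_swap.1 Relation.reflTransGen_swap.1).symm
    · exact Relation.ReflTransGen.total_of_right_unique hr h h'
    · exact Or.inr (h'.trans h)

theorem eq_of_sinks (hr : Relator.RightUnique N) (hl : Relator.LeftUnique N) {u v : α}
    (h : Relation.EqvGen N u v) (hu : ∀ z, ¬ N u z) (hv : ∀ z, ¬ N v z) : u = v := by
  rcases eqvGen_comparable hr hl h with h | h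
  · rcases h.cases_head with h | ⟨z, h, -⟩
    · exact h
    · exact absurd h (hu z)
  · rcases h.cases_head with h | ⟨z, h, -⟩
    · exact h.symm
    · exact absurd h (hv z)

theorem eq_of_sources (hr : Relator.RightUnique N) (hl : Relator.LeftUnique N) {u v : α}
    (h : Relation.EqvGen N u v) (hu : ∀ z, ¬ N z u) (hv : ∀ z, ¬ N z v) : u = v := by
  rcases eqvGen_comparable hr hl h with h | h
  · rcases h.cases_tail with h | ⟨z, -, h⟩
    · exact h.symm
    · exact absurd h (hv z)
  · rcases h.cases_tail with h | ⟨z, -, h⟩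
    · exact h
    · exact absurd h (hu z)

/-- Predecessors are followed back from the sink. If they never ended, finiteness would produce a
repetition, and uniqueness of successors would move it forward until the sink itself had a
successor. -/
theorem exists_source_of_sink [Finite α] (hr : Relator.RightUnique N) {u : α}
    (hu : ∀ z, ¬ N u z) : ∃ y, Relation.EqvGen N y u ∧ ∀ z, ¬ N z y := by
  by_contra! h
  choose! f hf using h
  have hmem : ∀ n, Relation.EqvGen N (f^[n] u) u := by
    intro n
    induction n with
    | zero => exact .refl _
    | succ n ih =>
      rw [Function.iterate_succ_apply']
      exact .trans _ _ _ (.rel _ _ (hf _ ih)) ih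
  have hstep : ∀ n, N (f^[n + 1] u) (f^[n] u) := fun n => by
    rw [Function.iterate_succ_apply']; exact hf _ (hmem n)
  have key : ∀ m n, f^[m] u = f^[m + n + 1] u → False := by
    intro m
    induction m with
    | zero =>
      intro n h
      have := hstep n
      rw [show 0 + n + 1 = n + 1 by ring] at h
      rw [← h] at this
      exact hu _ this
    | succ m ih =>
      intro n h
      refine ih n ?_
      have h2 := hstep (m + n + 1)
      rw [show m + n + 1 + 1 = m + 1 + n + 1 by ring, ← h] at h2
      exact hr (hstep m) h2
  obtain ⟨m, n, hmn, heq⟩ := Finite.exists_ne_map_eq_of_infinite fun n => f^[n] u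
  rcases lt_or_gt_of_ne hmn with h | h
  · exact key m (n - m - 1) (by rw [show m + (n - m - 1) + 1 = n by omega]; exact heq)
  · exact key n (m - n - 1) (by rw [show n + (m - n - 1) + 1 = m by omega]; exact heq.symm)

/-- The equivalence relation generated by `E` and two further pairs. -/
def joinPairs (E : Setoid α) (x y x' y' : α) : Setoid α :=
  Relation.EqvGen.setoid fun u v => E u v ∨ (u = x ∧ v = y) ∨ (u = x' ∧ v = y')

theorem joinPairs_mem {E : Setoid α} {x y x' y' : α} (T : Set α)
    (hE : ∀ u v, E u v → u ∈ T → v ∈ T) (h : x ∈ T ↔ y ∈ T) (h' : x' ∈ T ↔ y' ∈ T) {u v : α}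
    (huv : joinPairs E x y x' y' u v) : u ∈ T ↔ v ∈ T := by
  induction huv with
  | rel u v huv =>
    rcases huv with huv | ⟨rfl, rfl⟩ | ⟨rfl, rfl⟩
    · exact ⟨hE _ _ huv, hE _ _ (E.symm huv)⟩
    · exact h
    · exact h'
  | refl u => exact Iff.rfl
  | symm u v _ ih => exact ih.symm
  | trans u v w _ _ ih ih' => exact ih.trans ih'

theorem joinPairs_of {E : Setoid α} (x y x' y' : α) {u v : α} (h : E u v) :
    joinPairs E x y x' y' u v := Relation.EqvGen.rel _ _ (Or.inl h)

theorem joinPairs_left {E : Setoid α} (x y x' y' : α) : joinPairs E x y x' y' x y :=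
  Relation.EqvGen.rel _ _ (Or.inr (Or.inl ⟨rfl, rfl⟩))

theorem joinPairs_right {E : Setoid α} (x y x' y' : α) : joinPairs E x y x' y' x' y' :=
  Relation.EqvGen.rel _ _ (Or.inr (Or.inr ⟨rfl, rfl⟩))

/-- The union of the classes of `x` and `y` contains the first additional pair and misses both
points of the second, so it remains a union of classes. -/
theorem not_joinPairs {E : Setoid α} {x y x' y' : α} (h1 : ¬ E x x') (h2 : ¬ E y y')
    (h3 : ¬ E x y') (h4 : ¬ E x' y) : ¬ joinPairs E x y x' y' x x' := by
  intro h
  have hT := joinPairs_mem {u | E x u ∨ E y u} (fun u v huv hu =>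
    hu.imp (fun k => E.trans k huv) (fun k => E.trans k huv))
    ⟨fun _ => Or.inr (E.refl y), fun _ => Or.inl (E.refl x)⟩
    ⟨fun k => k.elim (fun k => absurd k h1) (fun k => absurd (E.symm k) h4),
      fun k => k.elim (fun k => absurd k h3) (fun k => absurd k h2)⟩ h
  exact (hT.1 (Or.inl (E.refl x))).elim h1 fun k => h4 (E.symm k)

/-- A class which contains `x` and `y`, but not `x'` and `y'`, is not changed. -/
theorem joinPairs_class {E : Setoid α} {x y x' y' : α} (h1 : ¬ E x x') (h2 : ¬ E x y')
    (h3 : E x y) {u : α} (hu : joinPairs E x y x' y' x u) : E x u :=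
  (joinPairs_mem {u | E x u} (fun _ _ huv hu => E.trans hu huv) ⟨fun _ => h3, fun _ => E.refl x⟩
    ⟨fun k => absurd k h1, fun k => absurd k h2⟩ hu).1 (E.refl x)

theorem joinPairs_swap {E : Setoid α} {x y x' y' u v : α} (h : joinPairs E x y x' y' u v) :
    joinPairs E x' y' x y u v := by
  refine Relation.EqvGen.mono ?_ _ _ h
  rintro u v (h | h | h)
  · exact Or.inl h
  · exact Or.inr (Or.inr h)
  · exact Or.inr (Or.inl h)

end Flow

/-! ### Orientation of the smoothed diagrams -/

section Braid

variable {r : ℕ} (w : List (Fin r))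

/-- The strands in the even positions are oriented upwards. -/
def Upwards (j : Fin (r + 1)) : Prop := (j : ℕ) % 2 = 0

instance (j : Fin (r + 1)) : Decidable (Upwards j) := inferInstanceAs (Decidable (_ = _))

/-- The level at which the strand in position `j` enters layer `l`. -/
def entry (l : Fin w.length) (j : Fin (r + 1)) : Fin (w.length + 1) :=
  if Upwards j then l.castSucc else l.succ

/-- The level at which the strand in position `j` leaves layer `l`. -/
def exit (l : Fin w.length) (j : Fin (r + 1)) : Fin (w.length + 1) :=
  if Upwards j then l.succ else l.castSucc

/-- The position in which the strand that enters layer `l` in position `j` leaves that layer. -/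
def through (s : Smoothing w) (l : Fin w.length) : Equiv.Perm (Fin (r + 1)) :=
  if s l then 1 else Equiv.swap (w.get l).castSucc (w.get l).succ

/-- The oriented segments of the smoothed diagram, for the strands in `A`. -/
def Flow (s : Smoothing w) (A : Set (Fin w.length × Fin (r + 1))) (u v : Point w) : Prop :=
  ∃ l j, (l, j) ∈ A ∧ u = (entry w l j, j) ∧ v = (exit w l (through w s l j), through w s l j)

/-- The points that are connected by the segments of the strands in `A`. -/
def flowConn (s : Smoothing w) (A : Set (Fin w.length × Fin (r + 1))) : Setoid (Point w) :=
  Relation.EqvGen.setoid (Flow w s A)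

variable {w}

theorem entry_injective {l l' : Fin w.length} {j : Fin (r + 1)} (h : entry w l j = entry w l' j) :
    l = l' := by
  unfold entry at h
  split_ifs at h
  · exact Fin.castSucc_injective _ h
  · exact Fin.succ_injective _ h

theorem exit_injective {l l' : Fin w.length} {j : Fin (r + 1)} (h : exit w l j = exit w l' j) :
    l = l' := by
  unfold exit at h
  split_ifs at h
  · exact Fin.succ_injective _ h
  · exact Fin.castSucc_injective _ h

/-- The direction of the strand at a point tells on which side the layer lies that it enters there,
so at most one oriented segment starts at the point. -/
theorem flow_rightUnique (s : Smoothing w) (A) : Relator.RightUnique (Flow w s A) := by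
  rintro _ _ _ ⟨l, j, -, rfl, rfl⟩ ⟨l', j', -, h, rfl⟩
  obtain ⟨h1, rfl⟩ := Prod.ext_iff.1 h
  obtain rfl := entry_injective h1
  rfl

theorem flow_leftUnique (s : Smoothing w) (A) : Relator.LeftUnique (Flow w s A) := by
  rintro _ _ _ ⟨l, j, -, rfl, rfl⟩ ⟨l', j', -, rfl, h⟩
  obtain ⟨h1, h2⟩ := Prod.ext_iff.1 h
  dsimp only at h1 h2
  rw [← h2] at h1
  obtain rfl := exit_injective h1
  rw [(through w s l).injective h2]

/-- Neighbouring strands run in opposite directions. This is why caps and cups respect the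
orientation just as vertical lines do, and every smoothing is coherently oriented. -/
theorem upwards_succ (i : Fin r) : Upwards i.succ ↔ ¬ Upwards i.castSucc := by
  simp only [Upwards, Fin.val_succ, Fin.val_castSucc]
  omega

theorem through_of_true {s : Smoothing w} {l : Fin w.length} (h : s l = true) (j) :
    through w s l j = j := by simp [through, h]

theorem through_of_ne {s : Smoothing w} {l : Fin w.length} {j : Fin (r + 1)}
    (h : j ≠ (w.get l).castSucc ∧ j ≠ (w.get l).succ) : through w s l j = j := by
  unfold through
  split_ifs
  · rfl
  · exact Equiv.swap_apply_of_ne_of_ne h.1 h.2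

theorem through_left {s : Smoothing w} {l : Fin w.length} (h : s l = false) :
    through w s l (w.get l).castSucc = (w.get l).succ := by simp [through, h]

theorem through_right {s : Smoothing w} {l : Fin w.length} (h : s l = false) :
    through w s l (w.get l).succ = (w.get l).castSucc := by simp [through, h]

theorem through_mem {s : Smoothing w} {l : Fin w.length} {j : Fin (r + 1)} :
    (through w s l j = (w.get l).castSucc ∨ through w s l j = (w.get l).succ) ↔
      j = (w.get l).castSucc ∨ j = (w.get l).succ := by
  cases h : s l with
  | true => rw [through_of_true h]
  | false =>
    rw [← (through w s l).injective.eq_iff (a := j), ← (through w s l).injective.eq_iff (a := j),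
      through_left h, through_right h, or_comm]

section conn

variable {s : Smoothing w} {A : Set (Fin w.length × Fin (r + 1))} {l : Fin w.length}

theorem flowConn_line {j : Fin (r + 1)}
    (h : s l = true ∨ (j ≠ (w.get l).castSucc ∧ j ≠ (w.get l).succ)) (hA : (l, j) ∈ A) :
    flowConn w s A (l.castSucc, j) (l.succ, j) := by
  have hj : through w s l j = j := h.elim (fun h => through_of_true h j) through_of_ne
  have hf : flowConn w s A (entry w l j, j) (exit w l j, j) :=
    Relation.EqvGen.rel _ _ ⟨l, j, hA, rfl, by rw [hj]⟩
  unfold entry exit at hf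
  split_ifs at hf
  · exact hf
  · exact (flowConn w s A).symm hf

theorem flowConn_turn (h : s l = false) (hA : (l, (w.get l).castSucc) ∈ A)
    (hA' : (l, (w.get l).succ) ∈ A) :
    flowConn w s A (l.castSucc, (w.get l).castSucc) (l.castSucc, (w.get l).succ) ∧
      flowConn w s A (l.succ, (w.get l).castSucc) (l.succ, (w.get l).succ) := by
  have h1 : flowConn w s A (entry w l (w.get l).castSucc, (w.get l).castSucc)
      (exit w l (w.get l).succ, (w.get l).succ) :=
    Relation.EqvGen.rel _ _ ⟨l, _, hA, rfl, by rw [through_left h]⟩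
  have h2 : flowConn w s A (entry w l (w.get l).succ, (w.get l).succ)
      (exit w l (w.get l).castSucc, (w.get l).castSucc) :=
    Relation.EqvGen.rel _ _ ⟨l, _, hA', rfl, by rw [through_right h]⟩
  simp only [entry, exit, upwards_succ] at h1 h2
  by_cases hu : Upwards (w.get l).castSucc
  · simp only [hu, not_true_eq_false, if_true, if_false] at h1 h2
    exact ⟨h1, (flowConn w s A).symm h2⟩
  · simp only [hu, not_false_eq_true, if_true, if_false] at h1 h2
    exact ⟨(flowConn w s A).symm h2, h1⟩

theorem flowConn_of_segment {u v : Point w} (h : Segment w s u v)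
    (hA : ∀ l j, (u = (l.castSucc, j) ∨ u = (l.succ, j)) → ∀ j, (l, j) ∈ A) :
    flowConn w s A u v := by
  cases h with
  | line l j h => exact flowConn_line h (hA l j (Or.inl rfl) _)
  | cap l h => exact (flowConn_turn h (hA l _ (Or.inl rfl) _) (hA l _ (Or.inl rfl) _)).1
  | cup l h => exact (flowConn_turn h (hA l _ (Or.inr rfl) _) (hA l _ (Or.inr rfl) _)).2

theorem compAt_eq_iff {u v : Point w} : compAt w s u = compAt w s v ↔
    Relation.EqvGen.setoid (Segment w s) u v := Quotient.eq

theorem compAt_line {j : Fin (r + 1)}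
    (h : s l = true ∨ (j ≠ (w.get l).castSucc ∧ j ≠ (w.get l).succ)) :
    compAt w s (l.castSucc, j) = compAt w s (l.succ, j) :=
  compAt_eq_iff.2 (Relation.EqvGen.rel _ _ (.line l j h))

theorem compAt_cap (h : s l = false) : compAt w s (l.castSucc, (w.get l).castSucc) =
    compAt w s (l.castSucc, (w.get l).succ) :=
  compAt_eq_iff.2 (Relation.EqvGen.rel _ _ (.cap l h))

theorem compAt_cup (h : s l = false) : compAt w s (l.succ, (w.get l).castSucc) =
    compAt w s (l.succ, (w.get l).succ) :=
  compAt_eq_iff.2 (Relation.EqvGen.rel _ _ (.cup l h))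

theorem compAt_entry_exit (j : Fin (r + 1)) : compAt w s (entry w l j, j) =
    compAt w s (exit w l (through w s l j), through w s l j) := by
  by_cases h : s l = true ∨ (j ≠ (w.get l).castSucc ∧ j ≠ (w.get l).succ)
  · have hj : through w s l j = j := h.elim (fun h => through_of_true h j) through_of_ne
    rw [hj]
    unfold entry exit
    split_ifs
    · exact compAt_line h
    · exact (compAt_line h).symm
  · push Not at h
    obtain ⟨h0, h1⟩ := h
    have h0 : s l = false := by simpa using h0
    by_cases hj : j = (w.get l).castSucc
    · subst hj
      rw [through_left h0]
      unfold entry exit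
      simp only [upwards_succ]
      by_cases hu : Upwards (w.get l).castSucc
      · simp only [hu, not_true_eq_false, if_true, if_false]
        exact compAt_cap h0
      · simp only [hu, not_false_eq_true, if_true, if_false]
        exact compAt_cup h0
    · obtain rfl := h1 hj
      rw [through_right h0]
      unfold entry exit
      simp only [upwards_succ]
      by_cases hu : Upwards (w.get l).castSucc
      · simp only [hu, not_true_eq_false, if_true, if_false]
        exact (compAt_cup h0).symm
      · simp only [hu, not_false_eq_true, if_true, if_false]
        exact (compAt_cap h0).symm

theorem compAt_eq_of_flowConn {u v : Point w} (h : flowConn w s A u v) :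
    compAt w s u = compAt w s v := by
  induction h with
  | rel u v h =>
    obtain ⟨l, j, -, rfl, rfl⟩ := h
    exact compAt_entry_exit j
  | refl u => rfl
  | symm u v _ ih => exact ih.symm
  | trans u v w _ _ ih ih' => exact ih.trans ih'

/-- A set of points that is closed under the segments contains all of a component or nothing. -/
theorem mem_iff_of_compAt_eq (T : Set (Point w))
    (hT : ∀ u v, Segment w s u v → (u ∈ T ↔ v ∈ T)) {u v : Point w}
    (h : compAt w s u = compAt w s v) : u ∈ T ↔ v ∈ T := by
  have h' := compAt_eq_iff.1 h
  clear h
  induction h' with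
  | rel u v h => exact hT u v h
  | refl u => exact Iff.rfl
  | symm u v _ ih => exact ih.symm
  | trans u v w _ _ ih ih' => exact ih.trans ih'

theorem compAt_eq_iff_flowConn {u v : Point w} :
    compAt w s u = compAt w s v ↔ flowConn w s Set.univ u v := by
  refine ⟨fun h => ?_, compAt_eq_of_flowConn⟩
  have hT := mem_iff_of_compAt_eq {v | flowConn w s Set.univ u v} (fun a b hab => ?_) h
  · exact hT.1 ((flowConn w s Set.univ).refl u)
  · have hab := flowConn_of_segment (A := Set.univ) hab fun _ _ _ _ => trivial
    exact ⟨fun k => (flowConn w s Set.univ).trans k hab,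
      fun k => (flowConn w s Set.univ).trans k ((flowConn w s Set.univ).symm hab)⟩

end conn

end Braid

end BarNatan

end

/-! ### How a saddle changes the components -/

noncomputable section

namespace BarNatan

section Braid

variable {r : ℕ} {w : List (Fin r)}

variable (w) in
/-- The position of an endpoint of the smoothed diagrams. -/
def endPoint : Fin (r + 1) ⊕ Fin (r + 1) → Point w :=
  Sum.elim (fun j => (0, j)) (fun j => (Fin.last _, j))

theorem endpt_eq (s : Smoothing w) (p) : (smooth w s).endpt p = compAt w s (endPoint w p) := by
  rcases p with p | p <;> rfl

theorem isLoop_iff {s : Smoothing w} {v : Point w} :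
    (smooth w s).IsLoop (compAt w s v) ↔ ∀ p, compAt w s (endPoint w p) ≠ compAt w s v := by
  simp only [Diagram.IsLoop, Set.mem_range, not_exists, endpt_eq]

theorem endPoint_ends (s : Smoothing w) (p) : (∀ v, ¬ Flow w s Set.univ (endPoint w p) v) ∨
    ∀ v, ¬ Flow w s Set.univ v (endPoint w p) := by
  rcases p with j | j <;> by_cases hj : Upwards j
  · right
    rintro v ⟨l, k, -, -, h⟩
    obtain ⟨h1, h2⟩ := Prod.ext_iff.1 h
    simp only [endPoint, Sum.elim_inl] at h1 h2
    rw [← h2, exit, if_pos hj] at h1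
    exact (Fin.succ_ne_zero l) h1.symm
  · left
    rintro v ⟨l, k, -, h, -⟩
    obtain ⟨h1, h2⟩ := Prod.ext_iff.1 h
    simp only [endPoint, Sum.elim_inl] at h1 h2
    rw [← h2, entry, if_neg hj] at h1
    exact (Fin.succ_ne_zero l) h1.symm
  · left
    rintro v ⟨l, k, -, h, -⟩
    obtain ⟨h1, h2⟩ := Prod.ext_iff.1 h
    simp only [endPoint, Sum.elim_inr] at h1 h2
    rw [← h2, entry, if_pos hj] at h1
    exact (Fin.castSucc_ne_last l) h1.symm
  · right
    rintro v ⟨l, k, -, -, h⟩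
    obtain ⟨h1, h2⟩ := Prod.ext_iff.1 h
    simp only [endPoint, Sum.elim_inr] at h1 h2
    rw [← h2, exit, if_neg hj] at h1
    exact (Fin.castSucc_ne_last l) h1.symm

/-- The strands that do not meet the crossing in layer `l`. -/
def awayFrom (l : Fin w.length) : Set (Fin w.length × Fin (r + 1)) :=
  {x | x.1 = l → x.2 ≠ (w.get l).castSucc ∧ x.2 ≠ (w.get l).succ}

section raise

variable (s : Smoothing w) (l : Fin w.length)

theorem through_raise {m : Fin w.length} {j : Fin (r + 1)} (h : (m, j) ∈ awayFrom l) :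
    through w (Function.update s l true) m j = through w s m j := by
  by_cases hm : m = l
  · subst hm
    rw [through_of_ne (h rfl), through_of_ne (h rfl)]
  · simp only [through, Function.update_of_ne hm]

theorem flow_raise : Flow w (Function.update s l true) (awayFrom l) = Flow w s (awayFrom l) := by
  ext u v
  constructor <;> rintro ⟨m, j, h, rfl, rfl⟩ <;>
    exact ⟨m, j, h, rfl, by rw [through_raise s l h]⟩

/-- Only the two strands through the crossing depend on `s l`. Comparing the two smoothings thus
means adding two different pairings to one and the same relation. -/
theorem flowConn_eq_joinPairs : flowConn w s Set.univ = joinPairs (flowConn w s (awayFrom l))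
    (entry w l (w.get l).castSucc, (w.get l).castSucc)
    (exit w l (through w s l (w.get l).castSucc), through w s l (w.get l).castSucc)
    (entry w l (w.get l).succ, (w.get l).succ)
    (exit w l (through w s l (w.get l).succ), through w s l (w.get l).succ) := by
  apply le_antisymm
  · intro u v h
    induction h with
    | rel u v h =>
      obtain ⟨m, j, -, rfl, rfl⟩ := h
      by_cases hA : (m, j) ∈ awayFrom l
      · exact joinPairs_of _ _ _ _ (Relation.EqvGen.rel _ _ ⟨m, j, hA, rfl, rfl⟩)
      · simp only [awayFrom, Set.mem_ofPred_eq, not_forall, not_and_or, not_not] at hA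
        obtain ⟨rfl, rfl | rfl⟩ := hA
        · exact joinPairs_left _ _ _ _
        · exact joinPairs_right _ _ _ _
    | refl u => exact Setoid.refl' _ u
    | symm u v _ ih => exact Setoid.symm' _ ih
    | trans u v w _ _ ih ih' => exact Setoid.trans' _ ih ih'
  · intro u v h
    induction h with
    | rel u v h =>
      rcases h with h | ⟨rfl, rfl⟩ | ⟨rfl, rfl⟩
      · refine Relation.EqvGen.mono ?_ _ _ h
        rintro u v ⟨m, j, -, h⟩
        exact ⟨m, j, trivial, h⟩
      · exact Relation.EqvGen.rel _ _ ⟨l, _, trivial, rfl, rfl⟩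
      · exact Relation.EqvGen.rel _ _ ⟨l, _, trivial, rfl, rfl⟩
    | refl u => exact Setoid.refl' _ u
    | symm u v _ ih => exact Setoid.symm' _ ih
    | trans u v w _ _ ih ih' => exact Setoid.trans' _ ih ih'

theorem entry_sink {j : Fin (r + 1)} (hj : j = (w.get l).castSucc ∨ j = (w.get l).succ) (v) :
    ¬ Flow w s (awayFrom l) (entry w l j, j) v := by
  rintro ⟨m, k, hA, h, -⟩
  obtain ⟨h1, rfl⟩ := Prod.ext_iff.1 h
  obtain rfl := entry_injective h1
  have := hA rfl
  exact hj.elim this.1 this.2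

theorem exit_source {j : Fin (r + 1)} (hj : j = (w.get l).castSucc ∨ j = (w.get l).succ) (v) :
    ¬ Flow w s (awayFrom l) v (exit w l j, j) := by
  rintro ⟨m, k, hA, -, h⟩
  obtain ⟨h1, h2⟩ := Prod.ext_iff.1 h
  dsimp only at h1 h2
  rw [← h2] at h1
  obtain rfl := exit_injective h1
  rw [h2] at hj
  have := hA rfl
  exact (through_mem.1 hj).elim this.1 this.2

/-- A point without predecessors away from layer `l` is an endpoint or at the crossing. -/
theorem source_cases {y : Point w} (hy : ∀ z, ¬ Flow w s (awayFrom l) z y) :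
    (∃ p, y = endPoint w p) ∨ ∃ j, (j = (w.get l).castSucc ∨ j = (w.get l).succ) ∧
      y = (exit w l j, j) := by
  obtain ⟨k, j⟩ := y
  have key : ∀ m, k = exit w m j → m = l ∧ (j = (w.get l).castSucc ∨ j = (w.get l).succ) := by
    rintro m rfl
    by_contra hne
    have hA : (m, (through w s m).symm j) ∈ awayFrom l := by
      rintro h
      dsimp only at h ⊢
      subst h
      by_contra hj
      rw [← not_or, not_not, ← through_mem (s := s), Equiv.apply_symm_apply] at hj
      exact hne ⟨rfl, hj⟩
    exact hy _ ⟨m, _, hA, rfl, by rw [Equiv.apply_symm_apply]⟩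
  by_cases hj : Upwards j
  · rcases Fin.eq_zero_or_eq_succ k with rfl | ⟨m, rfl⟩
    · exact Or.inl ⟨Sum.inl j, rfl⟩
    · obtain ⟨rfl, hj'⟩ := key m (by rw [exit, if_pos hj])
      exact Or.inr ⟨j, hj', by rw [exit, if_pos hj]⟩
  · rcases Fin.eq_castSucc_or_eq_last k with ⟨m, rfl⟩ | rfl
    · obtain ⟨rfl, hj'⟩ := key m (by rw [exit, if_neg hj])
      exact Or.inr ⟨j, hj', by rw [exit, if_neg hj]⟩
    · exact Or.inl ⟨Sum.inr j, rfl⟩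

variable {s l}

/-- A strand that leaves and enters the crossing is closed to a loop by it. -/
theorem isLoop_of_conn {x y x' y' : Point w} (h : flowConn w s (awayFrom l) x y)
    (h1 : ¬ flowConn w s (awayFrom l) x x') (h2 : ¬ flowConn w s (awayFrom l) x y')
    (hs : flowConn w s Set.univ = joinPairs (flowConn w s (awayFrom l)) x y x' y')
    (hx : ∀ z, ¬ Flow w s (awayFrom l) x z) (hy : ∀ z, ¬ Flow w s (awayFrom l) z y)
    (hxy : Flow w s Set.univ x y) :
    (smooth w s).IsLoop (compAt w s x) := by
  rw [isLoop_iff]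
  intro p hp
  have hp' := compAt_eq_iff_flowConn.1 hp.symm
  rw [hs] at hp'
  have hc := joinPairs_class h1 h2 h hp'
  have hsub : ∀ u v, Flow w s (awayFrom l) u v → Flow w s Set.univ u v := by
    rintro u v ⟨m, j, -, h⟩; exact ⟨m, j, trivial, h⟩
  rcases endPoint_ends s p with he | he
  · have := eq_of_sinks (flow_rightUnique s _) (flow_leftUnique s _) hc hx
      fun z hz => he z (hsub _ _ hz)
    subst this
    exact he _ hxy
  · have := eq_of_sources (flow_rightUnique s _) (flow_leftUnique s _)
      ((flowConn w s (awayFrom l)).trans ((flowConn w s (awayFrom l)).symm h) hc) hy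
      fun z hz => he z (hsub _ _ hz)
    subst this
    exact he _ hxy

/-- A strand that enters the crossing, but does not come from it, comes from an endpoint. -/
theorem not_isLoop_of_not_conn {j : Fin (r + 1)}
    (hj : j = (w.get l).castSucc ∨ j = (w.get l).succ)
    (h1 : ¬ flowConn w s (awayFrom l) (entry w l j, j)
      (exit w l (w.get l).castSucc, (w.get l).castSucc))
    (h2 : ¬ flowConn w s (awayFrom l) (entry w l j, j) (exit w l (w.get l).succ, (w.get l).succ)) :
    ¬ (smooth w s).IsLoop (compAt w s (entry w l j, j)) := by
  -- Traced back outside the crossing, the strand starts at an endpoint or at an exit of the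
  -- crossing, and the latter is excluded.
  obtain ⟨y, hy, hy'⟩ := exists_source_of_sink (flow_rightUnique s _) (entry_sink s l hj)
  have hy : flowConn w s (awayFrom l) y (entry w l j, j) := hy
  rw [isLoop_iff]
  push Not
  rcases source_cases s l hy' with ⟨p, rfl⟩ | ⟨k, rfl | rfl, rfl⟩
  · exact ⟨p, compAt_eq_of_flowConn hy⟩
  · exact absurd ((flowConn w s _).symm hy) h1
  · exact absurd ((flowConn w s _).symm hy) h2

end raise

/-- The effect of a change from the 0-smoothing to the 1-smoothing. -/
theorem raise_cases {s s' : Smoothing w} {l : Fin w.length} (h : Raises w s s' l) :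
    (compAt w s (l.castSucc, (w.get l).castSucc) ≠ compAt w s (l.succ, (w.get l).castSucc) ∧
      compAt w s' (l.castSucc, (w.get l).castSucc) = compAt w s' (l.castSucc, (w.get l).succ) ∧
      ((smooth w s).IsLoop (compAt w s (l.castSucc, (w.get l).castSucc)) ∨
        (smooth w s).IsLoop (compAt w s (l.succ, (w.get l).castSucc)))) ∨
    (compAt w s (l.castSucc, (w.get l).castSucc) = compAt w s (l.succ, (w.get l).castSucc) ∧
      compAt w s' (l.castSucc, (w.get l).castSucc) ≠ compAt w s' (l.castSucc, (w.get l).succ) ∧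
      ((smooth w s').IsLoop (compAt w s' (l.castSucc, (w.get l).castSucc)) ∨
        (smooth w s').IsLoop (compAt w s' (l.castSucc, (w.get l).succ)))) ∨
    (compAt w s (l.castSucc, (w.get l).castSucc) ≠ compAt w s (l.succ, (w.get l).castSucc) ∧
      compAt w s' (l.castSucc, (w.get l).castSucc) ≠ compAt w s' (l.castSucc, (w.get l).succ) ∧
      ¬ (smooth w s).IsLoop (compAt w s (l.castSucc, (w.get l).castSucc)) ∧
      ¬ (smooth w s).IsLoop (compAt w s (l.succ, (w.get l).castSucc)) ∧
      ¬ (smooth w s').IsLoop (compAt w s' (l.castSucc, (w.get l).castSucc)) ∧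
      ¬ (smooth w s').IsLoop (compAt w s' (l.castSucc, (w.get l).succ))) := by
  obtain ⟨h0, rfl⟩ := h
  set s' := Function.update s l true with hs'
  have h0' : s' l = true := Function.update_self _ _ _
  set i := (w.get l).castSucc with hi
  set i' := (w.get l).succ with hi'
  have hii : i ≠ i' := by
    rw [hi, hi']; exact (Fin.castSucc_lt_succ).ne
  -- The two strands enter the crossing at `x`, `x'` and leave it at `y`, `y'`. The 0-smoothing
  -- joins `x` to `y'` and `x'` to `y`, the 1-smoothing `x` to `y` and `x'` to `y'`; `E` is the
  -- connection outside.
  let E := flowConn w s (awayFrom l)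
  let x : Point w := (entry w l i, i)
  let x' : Point w := (entry w l i', i')
  let y : Point w := (exit w l i, i)
  let y' : Point w := (exit w l i', i')
  have hE' : flowConn w s' (awayFrom l) = E := by
    simp only [flowConn, E, hs', flow_raise]
  have hs : flowConn w s Set.univ = joinPairs E x y' x' y := by
    rw [flowConn_eq_joinPairs s l, through_left h0, through_right h0]
  have hst : flowConn w s' Set.univ = joinPairs E x y x' y' := by
    rw [flowConn_eq_joinPairs s' l, through_of_true h0', through_of_true h0', hE']
  have hx : ∀ z, ¬ Flow w s (awayFrom l) x z := entry_sink s l (Or.inl rfl)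
  have hx' : ∀ z, ¬ Flow w s (awayFrom l) x' z := entry_sink s l (Or.inr rfl)
  have hy : ∀ z, ¬ Flow w s (awayFrom l) z y := exit_source s l (Or.inl rfl)
  have hy' : ∀ z, ¬ Flow w s (awayFrom l) z y' := exit_source s l (Or.inr rfl)
  have hfl := flow_raise s l
  -- Two entries, or two exits, are never connected outside the crossing. Here the orientation rules
  -- out a saddle from one component to one component.
  have exx : ¬ E x x' := fun k => hii (congrArg Prod.snd
    (eq_of_sinks (flow_rightUnique s _) (flow_leftUnique s _) k hx hx'))
  have eyy : ¬ E y y' := fun k => hii (congrArg Prod.snd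
    (eq_of_sources (flow_rightUnique s _) (flow_leftUnique s _) k hy hy'))
  have f1 : Flow w s Set.univ x y' := ⟨l, i, trivial, rfl, by rw [through_left h0]⟩
  have f2 : Flow w s Set.univ x' y := ⟨l, i', trivial, rfl, by rw [through_right h0]⟩
  have f3 : Flow w s' Set.univ x y := ⟨l, i, trivial, rfl, by rw [through_of_true h0']⟩
  have f4 : Flow w s' Set.univ x' y' := ⟨l, i', trivial, rfl, by rw [through_of_true h0']⟩
  have loop1 : E x y' → ¬ E x y → (smooth w s).IsLoop (compAt w s x) := fun k k' =>
    isLoop_of_conn k exx k' hs hx hy' f1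
  have loop2 : E x' y → ¬ E x' y' → (smooth w s).IsLoop (compAt w s x') := fun k k' =>
    isLoop_of_conn k (fun h => exx (E.symm h)) k'
      (hs.trans (Setoid.ext fun _ _ => ⟨joinPairs_swap, joinPairs_swap⟩)) hx' hy f2
  have loop3 : E x y → ¬ E x y' → (smooth w s').IsLoop (compAt w s' x) := fun k k' =>
    isLoop_of_conn (x' := x') (y' := y') (by rwa [hE']) (by rwa [hE']) (by rwa [hE'])
      (by rwa [hE']) (by rwa [hfl]) (by rwa [hfl]) f3
  have loop4 : E x' y' → ¬ E x' y → (smooth w s').IsLoop (compAt w s' x') := fun k k' =>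
    isLoop_of_conn (by rwa [hE']) (x' := x) (y' := y) (by rw [hE']; exact fun h => exx (E.symm h))
      (by rwa [hE'])
      (by rw [hE']; exact hst.trans (Setoid.ext fun _ _ => ⟨joinPairs_swap, joinPairs_swap⟩))
      (by rwa [hfl]) (by rwa [hfl]) f4
  have hneq : ¬ E x y → ¬ E x' y' → compAt w s x ≠ compAt w s x' := fun k k' h => by
    rw [compAt_eq_iff_flowConn, hs] at h
    exact not_joinPairs exx (fun h => eyy (E.symm h)) k k' h
  have hneq' : ¬ E x y' → ¬ E x' y → compAt w s' x ≠ compAt w s' x' := fun k k' h => by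
    rw [compAt_eq_iff_flowConn, hst] at h
    exact not_joinPairs exx eyy k k' h
  have c1 : compAt w s x = compAt w s y' :=
    compAt_eq_iff_flowConn.2 (Relation.EqvGen.rel _ _ f1)
  have c2 : compAt w s x' = compAt w s y :=
    compAt_eq_iff_flowConn.2 (Relation.EqvGen.rel _ _ f2)
  have c3 : compAt w s' x = compAt w s' y :=
    compAt_eq_iff_flowConn.2 (Relation.EqvGen.rel _ _ f3)
  have c4 : compAt w s' x' = compAt w s' y' :=
    compAt_eq_iff_flowConn.2 (Relation.EqvGen.rel _ _ f4)
  have e1 : ∀ {u v}, E u v → compAt w s u = compAt w s v := fun k => compAt_eq_of_flowConn k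
  have e2 : ∀ {u v}, E u v → compAt w s' u = compAt w s' v := fun k =>
    compAt_eq_of_flowConn (A := awayFrom l) (by rwa [hE'])
  have excl1 : E x y → ¬ E x y' := fun k k' => eyy (E.trans (E.symm k) k')
  have excl2 : E x' y' → ¬ E x' y := fun k k' => eyy (E.trans (E.symm k') k)
  have excl3 : E x y → ¬ E x' y := fun k k' => exx (E.trans k (E.symm k'))
  have excl4 : E x' y' → ¬ E x y' := fun k k' => exx (E.trans k' (E.symm k))
  have main : (compAt w s x ≠ compAt w s x' ∧ compAt w s' x = compAt w s' x' ∧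
      ((smooth w s).IsLoop (compAt w s x) ∨ (smooth w s).IsLoop (compAt w s x'))) ∨
    (compAt w s x = compAt w s x' ∧ compAt w s' x ≠ compAt w s' x' ∧
      ((smooth w s').IsLoop (compAt w s' x) ∨ (smooth w s').IsLoop (compAt w s' x'))) ∨
    (compAt w s x ≠ compAt w s x' ∧ compAt w s' x ≠ compAt w s' x' ∧
      ¬ (smooth w s).IsLoop (compAt w s x) ∧ ¬ (smooth w s).IsLoop (compAt w s x') ∧
      ¬ (smooth w s').IsLoop (compAt w s' x) ∧ ¬ (smooth w s').IsLoop (compAt w s' x')) := by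
    -- Outside the crossing an entry is connected to an exit or to an endpoint. `A` or `B` gives a
    -- split with a new loop, `C` or `D` a merge involving a loop; otherwise both entries come from
    -- endpoints and all components at the crossing are arcs.
    by_cases A : E x y
    · exact Or.inr (Or.inl ⟨(e1 A).trans c2.symm, hneq' (excl1 A) (excl3 A),
        Or.inl (loop3 A (excl1 A))⟩)
    by_cases B : E x' y'
    · exact Or.inr (Or.inl ⟨c1.trans (e1 B).symm, hneq' (excl4 B) (excl2 B),
        Or.inr (loop4 B (excl2 B))⟩)
    by_cases C : E x y'
    · exact Or.inl ⟨hneq A B, (e2 C).trans c4.symm, Or.inl (loop1 C A)⟩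
    by_cases D : E x' y
    · exact Or.inl ⟨hneq A B, c3.trans (e2 D).symm, Or.inr (loop2 D B)⟩
    exact Or.inr (Or.inr ⟨hneq A B, hneq' C D, not_isLoop_of_not_conn (Or.inl rfl) A C,
      not_isLoop_of_not_conn (Or.inr rfl) D B,
      not_isLoop_of_not_conn (Or.inl rfl) (by rwa [hE']) (by rwa [hE']),
      not_isLoop_of_not_conn (Or.inr rfl) (by rwa [hE']) (by rwa [hE'])⟩)
  have line1 : compAt w s' (l.castSucc, i) = compAt w s' (l.succ, i) := compAt_line (Or.inl h0')
  have line2 : compAt w s' (l.castSucc, i') = compAt w s' (l.succ, i') := compAt_line (Or.inl h0')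
  -- The entries are opposite corners. One of them is moved along the cap or the cup, or along a
  -- vertical line, to the corners in the statement.
  by_cases hu : Upwards i
  · have hu' : ¬ Upwards i' := fun k => (upwards_succ _).1 k hu
    have g1 : x = (l.castSucc, i) := by simp only [x, entry, if_pos hu]
    have g2 : x' = (l.succ, i') := by simp only [x', entry, if_neg hu']
    rw [g1, g2, ← compAt_cup h0, ← line2] at main
    exact main
  · have hu' : Upwards i' := (upwards_succ _).2 hu
    have g1 : x = (l.succ, i) := by simp only [x, entry, if_neg hu]
    have g2 : x' = (l.castSucc, i') := by simp only [x', entry, if_pos hu']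
    rw [g1, g2, ← compAt_cap h0, ← line1] at main
    rcases main with ⟨m1, m2, m3⟩ | ⟨m1, m2, m3⟩ | ⟨m1, m2, m3, m4, m5⟩
    · exact Or.inl ⟨m1.symm, m2, m3.symm⟩
    · exact Or.inr (Or.inl ⟨m1.symm, m2, m3⟩)
    · exact Or.inr (Or.inr ⟨m1.symm, m2, m4, m3, m5⟩)

end Braid

end BarNatan

end

/-! ### Components at and away from the raised crossing -/

noncomputable section

namespace BarNatan

section Braid

variable {r : ℕ} {w : List (Fin r)}

/-- The corners of layer `l`. -/
def corners (l : Fin w.length) : Set (Point w) :=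
  {v | (v.1 = l.castSucc ∨ v.1 = l.succ) ∧ (v.2 = (w.get l).castSucc ∨ v.2 = (w.get l).succ)}

/-- The point `v` lies on a component that meets the corners of layer `l`. -/
def Near (s : Smoothing w) (l : Fin w.length) (v : Point w) : Prop :=
  ∃ c ∈ corners l, compAt w s v = compAt w s c

section raise

variable {s s' : Smoothing w} {l : Fin w.length}

theorem near_congr {u v : Point w} (h : compAt w s u = compAt w s v) :
    Near s l u ↔ Near s l v := by
  simp only [Near, h]

theorem segment_raise (h : Raises w s s' l) {u v : Point w} :
    (Segment w s u v → Segment w s' u v ∨ u ∈ corners l ∧ v ∈ corners l) ∧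
      (Segment w s' u v → Segment w s u v ∨ u ∈ corners l ∧ v ∈ corners l) := by
  obtain ⟨h0, rfl⟩ := h
  constructor
  · intro h
    cases h with
    | line m j hj =>
      left
      refine .line m j (hj.imp_left fun hm => ?_)
      by_cases hml : m = l
      · rw [hml, Function.update_self]
      · rwa [Function.update_of_ne hml]
    | cap m hm =>
      by_cases hml : m = l
      · subst hml; exact Or.inr ⟨⟨Or.inl rfl, Or.inl rfl⟩, ⟨Or.inl rfl, Or.inr rfl⟩⟩
      · exact Or.inl (.cap m (by rwa [Function.update_of_ne hml]))
    | cup m hm =>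
      by_cases hml : m = l
      · subst hml; exact Or.inr ⟨⟨Or.inr rfl, Or.inl rfl⟩, ⟨Or.inr rfl, Or.inr rfl⟩⟩
      · exact Or.inl (.cup m (by rwa [Function.update_of_ne hml]))
  · intro h
    cases h with
    | line m j hj =>
      by_cases hml : m = l
      · subst hml
        by_cases hj' : j ≠ (w.get m).castSucc ∧ j ≠ (w.get m).succ
        · exact Or.inl (.line m j (Or.inr hj'))
        · rw [not_and_or, not_not, not_not] at hj'
          exact Or.inr ⟨⟨Or.inl rfl, hj'⟩, ⟨Or.inr rfl, hj'⟩⟩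
      · exact Or.inl (.line m j (by rwa [Function.update_of_ne hml] at hj))
    | cap m hm =>
      by_cases hml : m = l
      · subst hml; rw [Function.update_self] at hm; cases hm
      · exact Or.inl (.cap m (by rwa [Function.update_of_ne hml] at hm))
    | cup m hm =>
      by_cases hml : m = l
      · subst hml; rw [Function.update_self] at hm; cases hm
      · exact Or.inl (.cup m (by rwa [Function.update_of_ne hml] at hm))

/-- A segment that is present in only one smoothing has both ends at corners, so the union of the
components meeting the corners is closed under the segments of either. -/
theorem near_of_segments {t t' : Smoothing w}
    (h : ∀ u v, Segment w t u v → Segment w t' u v ∨ u ∈ corners l ∧ v ∈ corners l)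
    {v : Point w} (hv : Near t l v) : Near t' l v := by
  obtain ⟨c, hc, hvc⟩ := hv
  refine (mem_iff_of_compAt_eq {v | Near t' l v} (fun u u' huu' => ?_) hvc).2 ⟨c, hc, rfl⟩
  rcases h u u' huu' with k | ⟨k, k'⟩
  · exact near_congr (compAt_eq_iff.2 (Relation.EqvGen.rel _ _ k))
  · exact ⟨fun _ => ⟨u', k', rfl⟩, fun _ => ⟨u, k, rfl⟩⟩

theorem near_raise (h : Raises w s s' l) {v : Point w} : Near s l v ↔ Near s' l v :=
  ⟨near_of_segments fun _ _ => (segment_raise h).1,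
    near_of_segments fun _ _ => (segment_raise h).2⟩

theorem compAt_eq_of_segments {t t' : Smoothing w}
    (h : ∀ u v, Segment w t u v → Segment w t' u v ∨ u ∈ corners l ∧ v ∈ corners l)
    {u v : Point w} (hv : ¬ Near t' l v) (huv : compAt w t u = compAt w t v) :
    compAt w t' u = compAt w t' v := by
  refine (mem_iff_of_compAt_eq {u | compAt w t' u = compAt w t' v} (fun x x' hx => ?_) huv).2 rfl
  rcases h x x' hx with k | ⟨k, k'⟩
  · rw [Set.mem_ofPred_eq, compAt_eq_iff.2 (Relation.EqvGen.rel _ _ k)]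
    rfl
  · exact ⟨fun e => absurd ⟨x, k, e.symm⟩ hv, fun e => absurd ⟨x', k', e.symm⟩ hv⟩

/-- The components away from the crossing are not changed. -/
theorem compAt_raise (h : Raises w s s' l) {u v : Point w} (hv : ¬ Near s l v) :
    compAt w s u = compAt w s v ↔ compAt w s' u = compAt w s' v :=
  ⟨compAt_eq_of_segments (fun _ _ => (segment_raise h).1) fun k => hv ((near_raise h).2 k),
    compAt_eq_of_segments (fun _ _ => (segment_raise h).2) hv⟩

theorem near_iff_zero (h : Raises w s s' l) {v : Point w} : Near s l v ↔
    compAt w s v = compAt w s (l.castSucc, (w.get l).castSucc) ∨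
      compAt w s v = compAt w s (l.succ, (w.get l).castSucc) := by
  constructor
  · rintro ⟨⟨k, j⟩, ⟨rfl | rfl, rfl | rfl⟩, hv⟩
    · exact Or.inl hv
    · exact Or.inl (hv.trans (compAt_cap h.1).symm)
    · exact Or.inr hv
    · exact Or.inr (hv.trans (compAt_cup h.1).symm)
  · rintro (hv | hv)
    · exact ⟨_, ⟨Or.inl rfl, Or.inl rfl⟩, hv⟩
    · exact ⟨_, ⟨Or.inr rfl, Or.inl rfl⟩, hv⟩

theorem Raises.bit (h : Raises w s s' l) : s' l = true := by
  rw [h.2, Function.update_self]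

theorem near_iff_one (h : Raises w s s' l) {v : Point w} : Near s l v ↔
    compAt w s' v = compAt w s' (l.castSucc, (w.get l).castSucc) ∨
      compAt w s' v = compAt w s' (l.castSucc, (w.get l).succ) := by
  rw [near_raise h]
  constructor
  · rintro ⟨⟨k, j⟩, ⟨rfl | rfl, rfl | rfl⟩, hv⟩
    · exact Or.inl hv
    · exact Or.inr hv
    · exact Or.inl (hv.trans (compAt_line (Or.inl h.bit)).symm)
    · exact Or.inr (hv.trans (compAt_line (Or.inl h.bit)).symm)
  · rintro (hv | hv)
    · exact ⟨_, ⟨Or.inl rfl, Or.inl rfl⟩, hv⟩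
    · exact ⟨_, ⟨Or.inl rfl, Or.inr rfl⟩, hv⟩

theorem saddle_conn_self (s s' : Smoothing w) (v : Point w) :
    (saddle w s s').conn (Sum.inl (compAt w s v)) (Sum.inr (compAt w s' v)) :=
  Relation.EqvGen.rel _ _ ⟨v, rfl, rfl⟩

theorem saddle_conn_corner (h : Raises w s s' l) {v : Point w} (hv : Near s l v) :
    (saddle w s s').conn (Sum.inl (compAt w s v))
      (Sum.inl (compAt w s (l.castSucc, (w.get l).castSucc))) := by
  rcases (near_iff_zero h).1 hv with h' | h'
  · rw [h']
  · rw [h']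
    have h1 := saddle_conn_self s s' (l.succ, (w.get l).castSucc)
    have h2 := saddle_conn_self s s' (l.castSucc, (w.get l).castSucc)
    rw [← compAt_line (Or.inl h.bit)] at h1
    exact Setoid.trans' _ h1 (Setoid.symm' _ h2)

/-- The components of the saddle: one at the crossing, and a cylinder over every component away
from it. -/
theorem saddle_conn_iff (h : Raises w s s' l) {u v : Point w} :
    (saddle w s s').conn (Sum.inl (compAt w s u)) (Sum.inl (compAt w s v)) ↔
      compAt w s u = compAt w s v ∨ Near s l u ∧ Near s l v := by
  constructor
  · intro huv
    have key : ∀ x y, (saddle w s s').conn x y →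
        ((∃ v, (x = Sum.inl (compAt w s v) ∨ x = Sum.inr (compAt w s' v)) ∧
          (compAt w s u = compAt w s v ∨ Near s l u ∧ Near s l v)) ↔
        ∃ v, (y = Sum.inl (compAt w s v) ∨ y = Sum.inr (compAt w s' v)) ∧
          (compAt w s u = compAt w s v ∨ Near s l u ∧ Near s l v)) := by
      intro x y hxy
      induction hxy with
      | rel x y hxy =>
        obtain ⟨t, rfl, rfl⟩ := hxy
        constructor
        · rintro ⟨v, hv | hv, k⟩
          · have hv := Sum.inl_injective hv
            exact ⟨t, Or.inr rfl, by rwa [hv, near_congr hv]⟩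
          · cases hv
        · rintro ⟨v, hv | hv, k⟩
          · cases hv
          · have hv := Sum.inr_injective hv
            refine ⟨t, Or.inl rfl, ?_⟩
            have hn : Near s l t ↔ Near s l v := by
              rw [near_raise h, near_raise h, near_congr hv]
            by_cases hnv : Near s l v
            · exact Or.inr ⟨k.elim (fun k => (near_congr k).2 hnv) And.left, hn.2 hnv⟩
            · exact Or.inl ((k.resolve_right fun k => hnv k.2).trans
                ((compAt_raise h hnv).2 hv).symm)
      | refl x => exact Iff.rfl
      | symm x y _ ih => exact ih.symm
      | trans x y z _ _ ih ih' => exact ih.trans ih'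
    obtain ⟨t, ht | ht, k⟩ := (key _ _ huv).1 ⟨u, Or.inl rfl, Or.inl rfl⟩
    · have ht := Sum.inl_injective ht
      rwa [ht, near_congr ht]
    · cases ht
  · rintro (k | ⟨k, k'⟩)
    · rw [k]
    · exact Setoid.trans' _ (saddle_conn_corner h k) (Setoid.symm' _ (saddle_conn_corner h k'))

theorem saddle_conn_iff_inr (h : Raises w s s' l) {u v : Point w} :
    (saddle w s s').conn (Sum.inr (compAt w s' u)) (Sum.inl (compAt w s v)) ↔
      compAt w s u = compAt w s v ∨ Near s l u ∧ Near s l v := by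
  rw [← saddle_conn_iff h]
  exact ⟨fun k => Setoid.trans' _ (saddle_conn_self s s' u) k,
    fun k => Setoid.trans' _ (Setoid.symm' _ (saddle_conn_self s s' u)) k⟩

theorem isLoop_raise (h : Raises w s s' l) {v : Point w} (hv : ¬ Near s l v) :
    (smooth w s).IsLoop (compAt w s v) ↔ (smooth w s').IsLoop (compAt w s' v) := by
  rw [isLoop_iff, isLoop_iff]
  exact forall_congr' fun p => not_congr (compAt_raise h hv)

end raise

theorem exists_point {s : Smoothing w} (c : (smooth w s).comp) : ∃ v, compAt w s v = c :=
  Quotient.exists_rep c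

/-- The highest layer of a component depends only on the points on it. -/
theorem maxLayer_eq_max {s s' : Smoothing w} {c : (smooth w s).comp} {d e : (smooth w s').comp}
    (h : ∀ v, c = compAt w s v ↔ d = compAt w s' v ∨ e = compAt w s' v) :
    maxLayer c = max (maxLayer d) (maxLayer e) := by
  classical
  rw [maxLayer, maxLayer, maxLayer]
  refine Eq.trans ?_ Finset.sup_union
  rw [← Finset.filter_or]
  congr 1
  refine Finset.filter_congr fun l _ => ?_
  rw [← exists_or]
  refine exists_congr fun j => ?_
  rw [h, h]
  tauto

theorem maxLayer_eq {s s' : Smoothing w} {c : (smooth w s).comp} {d : (smooth w s').comp}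
    (h : ∀ v, c = compAt w s v ↔ d = compAt w s' v) : maxLayer c = maxLayer d := by
  rw [maxLayer_eq_max (d := d) (e := d) fun v => by rw [h v, or_self], max_self]

section raise

variable {s s' : Smoothing w} {l : Fin w.length}

theorem maxLayer_raise (h : Raises w s s' l) {v : Point w} (hv : ¬ Near s l v) :
    maxLayer (compAt w s v) = maxLayer (compAt w s' v) :=
  maxLayer_eq fun u => by rw [eq_comm, compAt_raise h hv, eq_comm]

theorem maxLayer_merge (h : Raises w s s' l) (hm : compAt w s' (l.castSucc, (w.get l).castSucc) =
      compAt w s' (l.castSucc, (w.get l).succ)) :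
    maxLayer (compAt w s' (l.castSucc, (w.get l).castSucc)) =
      max (maxLayer (compAt w s (l.castSucc, (w.get l).castSucc)))
        (maxLayer (compAt w s (l.succ, (w.get l).castSucc))) :=
  maxLayer_eq_max fun v => by
    rw [eq_comm, eq_comm (b := compAt w s v), eq_comm (b := compAt w s v), ← near_iff_zero h,
      near_iff_one h, ← hm, or_self]

theorem maxLayer_split (h : Raises w s s' l) (hm : compAt w s (l.castSucc, (w.get l).castSucc) =
      compAt w s (l.succ, (w.get l).castSucc)) :
    maxLayer (compAt w s (l.castSucc, (w.get l).castSucc)) =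
      max (maxLayer (compAt w s' (l.castSucc, (w.get l).castSucc)))
        (maxLayer (compAt w s' (l.castSucc, (w.get l).succ))) :=
  maxLayer_eq_max fun v => by
    rw [eq_comm, eq_comm (b := compAt w s' v), eq_comm (b := compAt w s' v), ← near_iff_one h,
      near_iff_zero h, ← hm, or_self]

/-- The loops of the smoothings at the crossing. -/
theorem isLoop_near (h : Raises w s s' l) :
    ((smooth w s).IsLoop (compAt w s (l.castSucc, (w.get l).castSucc)) ∧
      (smooth w s).IsLoop (compAt w s (l.succ, (w.get l).castSucc))) ↔
    ((smooth w s').IsLoop (compAt w s' (l.castSucc, (w.get l).castSucc)) ∧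
      (smooth w s').IsLoop (compAt w s' (l.castSucc, (w.get l).succ))) := by
  -- Both sides say that no endpoint lies on a component meeting the crossing.
  have h1 : ((smooth w s).IsLoop (compAt w s (l.castSucc, (w.get l).castSucc)) ∧
      (smooth w s).IsLoop (compAt w s (l.succ, (w.get l).castSucc))) ↔
      ∀ p, ¬ Near s l (endPoint w p) := by
    rw [isLoop_iff, isLoop_iff, ← forall_and]
    exact forall_congr' fun p => by rw [near_iff_zero h, not_or]
  have h2 : ((smooth w s').IsLoop (compAt w s' (l.castSucc, (w.get l).castSucc)) ∧
      (smooth w s').IsLoop (compAt w s' (l.castSucc, (w.get l).succ))) ↔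
      ∀ p, ¬ Near s l (endPoint w p) := by
    rw [isLoop_iff, isLoop_iff, ← forall_and]
    exact forall_congr' fun p => by rw [near_iff_one h, not_or]
  rw [h1, h2]

end raise

end Braid

end BarNatan

end

/-! ### Loops of four-strand smoothings and their highest layers -/

noncomputable section

namespace BarNatan

namespace TopMatching

/-- The point to which a point is matched; an unmatched point is sent to itself. -/
def mate : TopMatching → Fin 4 → Fin 4
  | none => ![0, 1, 2, 3]
  | p01 => ![1, 0, 2, 3]
  | p12 => ![0, 2, 1, 3]
  | p23 => ![0, 1, 3, 2]
  | parallel => ![1, 0, 3, 2]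
  | nested => ![3, 2, 1, 0]

theorem mate_none : ∀ j : Fin 4, none.mate j = j := by decide

theorem joins_iff : ∀ (p : Fin 3) (t : TopMatching),
    t.joins p = true ↔ t.mate p.castSucc = p.succ := by decide

theorem mate_turn_self : ∀ (p : Fin 3) (t : TopMatching),
    (t.turn p).mate p.castSucc = p.succ ∧ (t.turn p).mate p.succ = p.castSucc := by decide

theorem mate_turn_of_ne : ∀ (p : Fin 3) (t : TopMatching) (j : Fin 4),
    (j ≠ p.castSucc ∧ j ≠ p.succ) → (t.mate j ≠ p.castSucc ∧ t.mate j ≠ p.succ) →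
      (t.turn p).mate j = t.mate j := by decide

theorem mate_turn_left : ∀ (p : Fin 3) (t : TopMatching) (j : Fin 4),
    (j ≠ p.castSucc ∧ j ≠ p.succ) → t.mate j = p.castSucc →
      (t.turn p).mate j = j ∧ t.mate p.succ = p.succ ∨
      (t.turn p).mate j = t.mate p.succ ∧ t.mate p.succ ≠ p.succ ∧ t.mate p.succ ≠ j ∧
        (t.mate p.succ ≠ p.castSucc ∧ t.mate p.succ ≠ p.succ) := by decide

theorem mate_turn_right : ∀ (p : Fin 3) (t : TopMatching) (j : Fin 4),
    (j ≠ p.castSucc ∧ j ≠ p.succ) → t.mate j = p.succ →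
      (t.turn p).mate j = j ∧ t.mate p.castSucc = p.castSucc ∨
      (t.turn p).mate j = t.mate p.castSucc ∧ t.mate p.castSucc ≠ p.castSucc ∧
        t.mate p.castSucc ≠ j ∧
        (t.mate p.castSucc ≠ p.castSucc ∧ t.mate p.castSucc ≠ p.succ) := by decide

end TopMatching

open TopMatching

section Braid

section bits

variable {r : ℕ} {w : List (Fin r)}

/-- The smoothing as a sequence, continued by `true`. -/
def bits (s : Smoothing w) (m : ℕ) : Bool := if h : m < w.length then s ⟨m, h⟩ else true

theorem bits_val (s : Smoothing w) (l : Fin w.length) : bits s l = s l := dif_pos l.2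

theorem bits_of_le (s : Smoothing w) {m : ℕ} (h : w.length ≤ m) : bits s m = true :=
  dif_neg (by omega)

theorem bits_injective : Function.Injective (bits (w := w)) := fun s s' h =>
  funext fun l => by rw [← bits_val s, h, bits_val]

theorem bits_update (s : Smoothing w) (l : Fin w.length) (b : Bool) :
    bits (Function.update s l b) = Function.update (bits s) l b := by
  funext m
  by_cases h : m < w.length
  · by_cases hm : (⟨m, h⟩ : Fin w.length) = l
    · subst hm
      rw [bits, dif_pos h, Function.update_self, Function.update_self]
    · rw [bits, dif_pos h, Function.update_of_ne hm,
        Function.update_of_ne (fun e => hm (Fin.ext e)), bits, dif_pos h]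
  · rw [bits_of_le _ (by omega), Function.update_of_ne (by omega), bits_of_le _ (by omega)]

/-- The strands in the layers below the level `k`. -/
def below (k : Fin (w.length + 1)) : Set (Fin w.length × Fin (r + 1)) := {x | x.1.castSucc < k}

theorem flowConn_mono (s : Smoothing w) {A B : Set (Fin w.length × Fin (r + 1))} (h : A ⊆ B)
    {u v : Point w} (huv : flowConn w s A u v) : flowConn w s B u v := by
  refine Relation.EqvGen.mono ?_ _ _ huv
  rintro u v ⟨l, j, hA, h'⟩
  exact ⟨l, j, h hA, h'⟩

theorem flowConn_below_succ (s : Smoothing w) {l : Fin w.length} {u v : Point w}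
    (h : flowConn w s (below l.castSucc) u v) : flowConn w s (below l.succ) u v :=
  flowConn_mono s (fun x (hx : x.1.castSucc < _) => hx.trans Fin.castSucc_lt_succ) h

/-- The points at and above the level `k` are ends of the strands below it. -/
theorem below_sink (s : Smoothing w) {k m : Fin (w.length + 1)} (h : k ≤ m) {j : Fin (r + 1)}
    (hj : Upwards j) (z) : ¬ Flow w s (below k) (m, j) z := by
  rintro ⟨l, i, hA, hm, -⟩
  obtain ⟨h1, rfl⟩ := Prod.ext_iff.1 hm
  simp only [entry, if_pos hj] at h1
  subst h1
  exact absurd hA h.not_gt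

theorem below_source (s : Smoothing w) {k m : Fin (w.length + 1)} (h : k ≤ m) {j : Fin (r + 1)}
    (hj : ¬ Upwards j) (z) : ¬ Flow w s (below k) z (m, j) := by
  rintro ⟨l, i, hA, -, hm⟩
  obtain ⟨h1, rfl⟩ := Prod.ext_iff.1 hm
  simp only [exit, if_neg hj] at h1
  subst h1
  exact absurd hA h.not_gt

theorem bottom_source (s : Smoothing w) (A) {j : Fin (r + 1)} (hj : Upwards j) (z) :
    ¬ Flow w s A z (0, j) := by
  rintro ⟨l, i, -, -, hm⟩
  obtain ⟨h1, rfl⟩ := Prod.ext_iff.1 hm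
  simp only [exit, if_pos hj] at h1
  exact Fin.succ_ne_zero l h1.symm

theorem bottom_sink (s : Smoothing w) (A) {j : Fin (r + 1)} (hj : ¬ Upwards j) (z) :
    ¬ Flow w s A (0, j) z := by
  rintro ⟨l, i, -, hm, -⟩
  obtain ⟨h1, rfl⟩ := Prod.ext_iff.1 hm
  simp only [entry, if_neg hj] at h1
  exact Fin.succ_ne_zero l h1.symm

section closing

variable {s : Smoothing w} {l : Fin w.length}

/-- The points at and above the level of a cap on the strand below it that it closes. -/
theorem eq_of_below (hc : flowConn w s (below l.castSucc) (l.castSucc, (w.get l).castSucc)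
      (l.castSucc, (w.get l).succ)) {m : Fin (w.length + 1)} (hm : l.castSucc ≤ m)
    {j : Fin (r + 1)}
    (h : flowConn w s (below l.castSucc) (l.castSucc, (w.get l).castSucc) (m, j)) :
    m = l.castSucc ∧ (j = (w.get l).castSucc ∨ j = (w.get l).succ) := by
  have hr := flow_rightUnique s (below l.castSucc)
  have hl := flow_leftUnique s (below l.castSucc)
  have h' := (flowConn w s _).trans ((flowConn w s _).symm hc) h
  by_cases hu : Upwards (w.get l).castSucc
  · have hu' : ¬ Upwards (w.get l).succ := fun k => (upwards_succ _).1 k hu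
    by_cases hj : Upwards j
    · have := eq_of_sinks hr hl h (below_sink s le_rfl hu) (below_sink s hm hj)
      obtain ⟨rfl, rfl⟩ := Prod.ext_iff.1 this
      exact ⟨rfl, Or.inl rfl⟩
    · have := eq_of_sources hr hl h' (below_source s le_rfl hu') (below_source s hm hj)
      obtain ⟨rfl, rfl⟩ := Prod.ext_iff.1 this
      exact ⟨rfl, Or.inr rfl⟩
  · have hu' : Upwards (w.get l).succ := (upwards_succ _).2 hu
    by_cases hj : Upwards j
    · have := eq_of_sinks hr hl h' (below_sink s le_rfl hu') (below_sink s hm hj)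
      obtain ⟨rfl, rfl⟩ := Prod.ext_iff.1 this
      exact ⟨rfl, Or.inr rfl⟩
    · have := eq_of_sources hr hl h (below_source s le_rfl hu) (below_source s hm hj)
      obtain ⟨rfl, rfl⟩ := Prod.ext_iff.1 this
      exact ⟨rfl, Or.inl rfl⟩

theorem not_below_bottom (hc : flowConn w s (below l.castSucc)
      (l.castSucc, (w.get l).castSucc) (l.castSucc, (w.get l).succ)) {j : Fin (r + 1)}
    (h : flowConn w s (below l.castSucc) (l.castSucc, (w.get l).castSucc) (0, j)) : False := by
  have hr := flow_rightUnique s (below l.castSucc)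
  have hl := flow_leftUnique s (below l.castSucc)
  have h' := (flowConn w s _).trans ((flowConn w s _).symm hc) h
  by_cases hu : Upwards (w.get l).castSucc
  · have hu' : ¬ Upwards (w.get l).succ := fun k => (upwards_succ _).1 k hu
    by_cases hj : Upwards j
    · have := eq_of_sources hr hl h' (below_source s le_rfl hu') (bottom_source s _ hj)
      obtain rfl : (w.get l).succ = j := congrArg Prod.snd this
      exact hu' hj
    · have := eq_of_sinks hr hl h (below_sink s le_rfl hu) (bottom_sink s _ hj)
      obtain rfl : (w.get l).castSucc = j := congrArg Prod.snd this
      exact hj hu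
  · have hu' : Upwards (w.get l).succ := (upwards_succ _).2 hu
    by_cases hj : Upwards j
    · have := eq_of_sources hr hl h (below_source s le_rfl hu) (bottom_source s _ hj)
      obtain rfl : (w.get l).castSucc = j := congrArg Prod.snd this
      exact hu hj
    · have := eq_of_sinks hr hl h' (below_sink s le_rfl hu') (bottom_sink s _ hj)
      obtain rfl : (w.get l).succ = j := congrArg Prod.snd this
      exact hj hu'

/-- A cap that joins the ends of a strand below it closes a loop. -/
theorem compAt_eq_iff_below (h0 : s l = false) (hc : flowConn w s (below l.castSucc)
      (l.castSucc, (w.get l).castSucc) (l.castSucc, (w.get l).succ)) {v : Point w} :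
    compAt w s (l.castSucc, (w.get l).castSucc) = compAt w s v ↔
      flowConn w s (below l.castSucc) (l.castSucc, (w.get l).castSucc) v := by
  refine ⟨fun h => ?_, compAt_eq_of_flowConn⟩
  have step : ∀ {x y}, flowConn w s (below l.castSucc) x y →
      (flowConn w s (below l.castSucc) (l.castSucc, (w.get l).castSucc) x ↔
        flowConn w s (below l.castSucc) (l.castSucc, (w.get l).castSucc) y) := fun k =>
    ⟨fun k' => (flowConn w s _).trans k' k,
      fun k' => (flowConn w s _).trans k' ((flowConn w s _).symm k)⟩
  refine (mem_iff_of_compAt_eq {v | flowConn w s (below l.castSucc)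
    (l.castSucc, (w.get l).castSucc) v} (fun u v huv => ?_) h).1 ((flowConn w s _).refl _)
  -- The strand closed by the cap has no point above the level of the cap.
  have top : ∀ {m : Fin w.length} {j}, l.castSucc ≤ m.castSucc →
      ¬ flowConn w s (below l.castSucc) (l.castSucc, (w.get l).castSucc) (m.succ, j) := by
    intro m j hm k
    have := (eq_of_below hc (hm.trans Fin.castSucc_lt_succ.le) k).1
    rw [← this] at hm
    exact absurd hm Fin.castSucc_lt_succ.not_ge
  cases huv with
  | line m j hj =>
    rcases lt_or_ge m.castSucc l.castSucc with hm | hm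
    · exact step (flowConn_line hj hm)
    · refine iff_of_false (fun k => ?_) (top hm)
      obtain ⟨h1, h2⟩ := eq_of_below hc hm k
      obtain rfl := Fin.castSucc_injective _ h1
      rcases hj with hj | hj
      · rw [h0] at hj; cases hj
      · exact h2.elim hj.1 hj.2
  | cap m hj =>
    rcases lt_or_ge m.castSucc l.castSucc with hm | hm
    · exact step (flowConn_turn hj hm hm).1
    · constructor <;> intro k <;>
      · obtain ⟨h1, -⟩ := eq_of_below hc hm k
        obtain rfl := Fin.castSucc_injective _ h1
        first | exact hc | exact (flowConn w s _).refl _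
  | cup m hj =>
    rcases lt_or_ge m.castSucc l.castSucc with hm | hm
    · exact step (flowConn_turn hj hm hm).2
    · exact iff_of_false (top hm) (top hm)

theorem isLoop_of_below (h0 : s l = false) (hc : flowConn w s (below l.castSucc)
      (l.castSucc, (w.get l).castSucc) (l.castSucc, (w.get l).succ)) :
    (smooth w s).IsLoop (compAt w s (l.castSucc, (w.get l).castSucc)) := by
  rw [isLoop_iff]
  rintro (j | j) hp <;> have hp := (compAt_eq_iff_below h0 hc).1 hp.symm
  · exact not_below_bottom hc hp
  · exact Fin.castSucc_ne_last l (eq_of_below hc (Fin.le_last _) hp).1.symm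

theorem maxLayer_of_below (h0 : s l = false) (hc : flowConn w s (below l.castSucc)
      (l.castSucc, (w.get l).castSucc) (l.castSucc, (w.get l).succ)) :
    maxLayer (compAt w s (l.castSucc, (w.get l).castSucc)) = l + 1 := by
  classical
  rw [maxLayer]
  apply le_antisymm
  · refine Finset.sup_le fun m hm => ?_
    rw [Finset.mem_filter] at hm
    obtain ⟨-, j, hm | hm⟩ := hm <;> rw [compAt_eq_iff_below h0 hc] at hm
    · by_contra! hlt
      have := (eq_of_below hc (by rw [Fin.le_def, Fin.val_castSucc, Fin.val_castSucc]; omega) hm).1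
      rw [Fin.castSucc_injective _ this] at hlt
      omega
    · by_contra! hlt
      have := (eq_of_below hc (by rw [Fin.le_def, Fin.val_castSucc, Fin.val_succ]; omega) hm).1
      rw [Fin.ext_iff, Fin.val_castSucc, Fin.val_succ] at this
      omega
  · refine Finset.le_sup (f := fun l : Fin w.length => (l : ℕ) + 1) (b := l) ?_
    rw [Finset.mem_filter]
    exact ⟨Finset.mem_univ _, _, Or.inl rfl⟩

end closing

theorem le_maxLayer {s : Smoothing w} {l : Fin w.length} {c : (smooth w s).comp} {j : Fin (r + 1)}
    (h : c = compAt w s (l.castSucc, j) ∨ c = compAt w s (l.succ, j)) : l + 1 ≤ maxLayer c := by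
  classical
  refine Finset.le_sup (f := fun l : Fin w.length => (l : ℕ) + 1) (b := l) ?_
  rw [Finset.mem_filter]
  exact ⟨Finset.mem_univ _, _, h⟩

theorem not_isLoop_endPoint {s : Smoothing w} (p) :
    ¬ (smooth w s).IsLoop (compAt w s (endPoint w p)) := by
  rw [isLoop_iff]
  push Not
  exact ⟨p, rfl⟩

/-- The highest layer of a loop. -/
theorem exists_top {s : Smoothing w} {c : (smooth w s).comp} (h : (smooth w s).IsLoop c) :
    ∃ l : Fin w.length, maxLayer c = l + 1 ∧ (∃ j, c = compAt w s (l.castSucc, j)) ∧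
      ∀ j, c ≠ compAt w s (l.succ, j) := by
  classical
  obtain ⟨⟨k, j⟩, rfl⟩ := exists_point c
  have hne : (Finset.univ.filter fun l : Fin w.length => ∃ i, compAt w s (k, j) =
      compAt w s (l.castSucc, i) ∨ compAt w s (k, j) = compAt w s (l.succ, i)).Nonempty := by
    rcases Fin.eq_zero_or_eq_succ k with rfl | ⟨m, rfl⟩
    · exact absurd h (not_isLoop_endPoint (Sum.inl j))
    · exact ⟨m, by simpa using ⟨j, Or.inr rfl⟩⟩
  obtain ⟨l, hl, hl'⟩ := Finset.exists_mem_eq_sup _ hne fun l : Fin w.length => (l : ℕ) + 1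
  have hmax : maxLayer (compAt w s (k, j)) = l + 1 := hl'
  -- A point at the upper level of layer `l` would lie in the next layer, against maximality, or be
  -- an endpoint.
  have htop : ∀ i, compAt w s (k, j) ≠ compAt w s (l.succ, i) := by
    intro i hi
    rcases Fin.eq_castSucc_or_eq_last l.succ with ⟨m, hm⟩ | hm
    · have := le_maxLayer (Or.inl (hm ▸ hi))
      rw [Fin.ext_iff, Fin.val_succ, Fin.val_castSucc] at hm
      omega
    · rw [hi, hm] at h
      exact not_isLoop_endPoint (Sum.inr i) h
  refine ⟨l, hmax, ?_, htop⟩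
  rw [Finset.mem_filter] at hl
  obtain ⟨-, i, hi | hi⟩ := hl
  · exact ⟨i, hi⟩
  · exact absurd hi (htop i)

end bits

/-! ### Loops and closings -/

variable {w : List (Fin 3)}

/-- Vertical layers carry the strands up; a 0-smoothing concatenates two strands along its cap and
starts a new pair at its cup, as `turn` records. This justifies reading `topMatching` as the
connectivity below a level. -/
theorem flowConn_mate (H : ∀ l : Fin w.length, w.get l = pos l) (s : Smoothing w)
    (k : Fin (w.length + 1)) : ∀ j,
    ((topMatching (bits s) k).mate j ≠ j ∧
      flowConn w s (below k) (k, j) (k, (topMatching (bits s) k).mate j)) ∨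
    ((topMatching (bits s) k).mate j = j ∧ ∃ i, flowConn w s (below k) (k, j) (0, i)) := by
  induction k using Fin.induction with
  | zero =>
    intro j
    exact Or.inr ⟨mate_none j, j, Setoid.refl' _ _⟩
  | succ l ih =>
    have hl : ∀ j, (l, j) ∈ below (w := w) l.succ := fun _ => Fin.castSucc_lt_succ
    have htop : topMatching (bits s) l.succ = if s l then topMatching (bits s) l.castSucc else
        (topMatching (bits s) l.castSucc).turn (w.get l) := by
      rw [H l, Fin.val_succ, Fin.val_castSucc, topMatching, bits_val]
    generalize topMatching (bits s) l.castSucc = t at *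
    rw [htop]
    have up : ∀ {u v}, flowConn w s (below l.castSucc) u v → flowConn w s (below l.succ) u v :=
      flowConn_below_succ s
    intro j
    cases h0 : s l with
    | true =>
      have line : ∀ j, flowConn w s (below l.succ) (l.castSucc, j) (l.succ, j) := fun j =>
        flowConn_line (Or.inl h0) (hl j)
      rw [if_pos rfl]
      refine (ih j).imp (fun ⟨h1, h2⟩ => ⟨h1, ?_⟩) (fun ⟨h1, i, h2⟩ => ⟨h1, i, ?_⟩)
      · exact Setoid.trans' _ (Setoid.symm' _ (line j)) (Setoid.trans' _ (up h2) (line _))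
      · exact Setoid.trans' _ (Setoid.symm' _ (line j)) (up h2)
    | false =>
      rw [if_neg Bool.false_ne_true]
      have line : ∀ {j}, j ≠ (w.get l).castSucc ∧ j ≠ (w.get l).succ →
          flowConn w s (below l.succ) (l.castSucc, j) (l.succ, j) := fun h =>
        flowConn_line (Or.inr h) (hl _)
      obtain ⟨cap, cup⟩ := flowConn_turn h0 (hl _) (hl _)
      obtain ⟨m1, m2⟩ := mate_turn_self (w.get l) t
      by_cases hj1 : j = (w.get l).castSucc
      · subst hj1
        exact Or.inl ⟨by rw [m1]; exact Fin.castSucc_lt_succ.ne', by rw [m1]; exact cup⟩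
      by_cases hj2 : j = (w.get l).succ
      · subst hj2
        exact Or.inl ⟨by rw [m2]; exact Fin.castSucc_lt_succ.ne,
          by rw [m2]; exact Setoid.symm' _ cup⟩
      have hj := And.intro hj1 hj2
      have start := Setoid.symm' _ (line hj)
      by_cases ha : t.mate j = (w.get l).castSucc
      · have c1 := Setoid.trans' _ start (up ((ih j).resolve_right fun k => hj1 (k.1 ▸ ha)).2)
        rw [ha] at c1
        have c1 := Setoid.trans' _ c1 cap
        rcases mate_turn_left _ _ _ hj ha with ⟨e, e'⟩ | ⟨e, e1, e2, e3⟩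
        · obtain ⟨i, hi⟩ := ((ih _).resolve_left fun k => k.1 e').2
          exact Or.inr ⟨e, i, Setoid.trans' _ c1 (up hi)⟩
        · rw [e]
          exact Or.inl ⟨e2, Setoid.trans' _ c1 (Setoid.trans' _
            (up ((ih _).resolve_right fun k => e1 k.1).2) (line e3))⟩
      by_cases hb : t.mate j = (w.get l).succ
      · have c1 := Setoid.trans' _ start (up ((ih j).resolve_right fun k => hj2 (k.1 ▸ hb)).2)
        rw [hb] at c1
        have c1 := Setoid.trans' _ c1 (Setoid.symm' _ cap)
        rcases mate_turn_right _ _ _ hj hb with ⟨e, e'⟩ | ⟨e, e1, e2, e3⟩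
        · obtain ⟨i, hi⟩ := ((ih _).resolve_left fun k => k.1 e').2
          exact Or.inr ⟨e, i, Setoid.trans' _ c1 (up hi)⟩
        · rw [e]
          exact Or.inl ⟨e2, Setoid.trans' _ c1 (Setoid.trans' _
            (up ((ih _).resolve_right fun k => e1 k.1).2) (line e3))⟩
      rw [mate_turn_of_ne _ _ _ hj ⟨ha, hb⟩]
      refine (ih j).imp (fun ⟨h1, h2⟩ => ⟨h1, ?_⟩) (fun ⟨h1, i, h2⟩ => ⟨h1, i, ?_⟩)
      · exact Setoid.trans' _ start (Setoid.trans' _ (up h2) (line ⟨ha, hb⟩))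
      · exact Setoid.trans' _ start (up h2)

theorem joinedBelow_iff (H : ∀ l : Fin w.length, w.get l = pos l) (s : Smoothing w)
    (l : Fin w.length) : JoinedBelow (bits s) l ↔
      (topMatching (bits s) l).mate (w.get l).castSucc = (w.get l).succ := by
  rw [JoinedBelow, joins_iff, H l]

/-- A closing is the highest layer of a loop. -/
theorem isLoop_of_mem_closings (H : ∀ l : Fin w.length, w.get l = pos l) {s : Smoothing w}
    {l : Fin w.length} (h : (l : ℕ) ∈ closings (bits s)) :
    (smooth w s).IsLoop (compAt w s (l.castSucc, (w.get l).castSucc)) ∧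
      maxLayer (compAt w s (l.castSucc, (w.get l).castSucc)) = l + 1 := by
  obtain ⟨h0, h1⟩ := h
  rw [bits_val] at h0
  rw [joinedBelow_iff H] at h1
  have hc : flowConn w s (below l.castSucc) (l.castSucc, (w.get l).castSucc)
      (l.castSucc, (w.get l).succ) := by
    rcases flowConn_mate H s l.castSucc (w.get l).castSucc with ⟨-, hc⟩ | ⟨hc, -⟩
    · rwa [Fin.val_castSucc, h1] at hc
    · rw [Fin.val_castSucc, h1] at hc
      exact absurd hc Fin.castSucc_lt_succ.ne'
  exact ⟨isLoop_of_below h0 hc, maxLayer_of_below h0 hc⟩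

/-- The highest layer of a loop is a closing. -/
theorem exists_closing (H : ∀ l : Fin w.length, w.get l = pos l) {s : Smoothing w}
    {c : (smooth w s).comp} (h : (smooth w s).IsLoop c) :
    ∃ l : Fin w.length, maxLayer c = l + 1 ∧ (l : ℕ) ∈ closings (bits s) ∧
      c = compAt w s (l.castSucc, (w.get l).castSucc) := by
  obtain ⟨l, hmax, ⟨j, hj⟩, htop⟩ := exists_top h
  have hline : ∀ i, c = compAt w s (l.castSucc, i) →
      s l = false ∧ (i = (w.get l).castSucc ∨ i = (w.get l).succ) := by
    intro i hi
    by_contra hne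
    have : s l = true ∨ (i ≠ (w.get l).castSucc ∧ i ≠ (w.get l).succ) := by
      rw [not_and_or, not_or] at hne
      exact hne.imp_left fun h => by simpa using h
    exact htop i (hi.trans (compAt_line this))
  obtain ⟨h0, hj'⟩ := hline j hj
  have hc : c = compAt w s (l.castSucc, (w.get l).castSucc) := by
    rcases hj' with rfl | rfl
    · exact hj
    · exact hj.trans (compAt_cap h0).symm
  refine ⟨l, hmax, ⟨by rwa [bits_val], ?_⟩, hc⟩
  rw [joinedBelow_iff H]
  rcases flowConn_mate H s l.castSucc (w.get l).castSucc with ⟨h1, h2⟩ | ⟨-, i, h2⟩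
  · exact ((hline _ (hc.trans (compAt_eq_of_flowConn h2))).2).resolve_left h1
  · rw [hc.trans (compAt_eq_of_flowConn h2)] at h
    exact absurd h (not_isLoop_endPoint (Sum.inl i))

/-- Both loops contain the cap of their highest layer. Sets of loops can therefore be encoded as
sets of layers. -/
theorem maxLayer_injective (H : ∀ l : Fin w.length, w.get l = pos l) {s : Smoothing w}
    {c d : (smooth w s).comp} (hc : (smooth w s).IsLoop c) (hd : (smooth w s).IsLoop d)
    (h : maxLayer c = maxLayer d) : c = d := by
  obtain ⟨l, h1, -, h2⟩ := exists_closing H hc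
  obtain ⟨m, h3, -, h4⟩ := exists_closing H hd
  have : l = m := Fin.ext (by omega)
  rw [h2, h4, this]

end Braid

end BarNatan

end

/-! ### Dots at the crossing and colours of loops -/

noncomputable section

namespace BarNatan

theorem ncard_sep_eq {α : Type} (B : Set α) (c : α) [Decidable (c ∈ B)] :
    {x | x ∈ B ∧ x = c}.ncard = if c ∈ B then 1 else 0 := by
  split_ifs with h
  · rw [Set.ncard_eq_one]
    exact ⟨c, Set.ext fun x => ⟨fun hx => hx.2, fun hx => ⟨(hx : x = c) ▸ h, hx⟩⟩⟩
  · have : {x | x ∈ B ∧ x = c} = ∅ := Set.eq_empty_of_forall_notMem fun x hx => h (hx.2 ▸ hx.1)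
    rw [this, Set.ncard_empty]

theorem ncard_sep_pair {α : Type} (B : Set α) {c d : α} [Decidable (c ∈ B)] [Decidable (d ∈ B)]
    (hcd : c ≠ d) : {x | x ∈ B ∧ (x = c ∨ x = d)}.ncard =
      (if c ∈ B then 1 else 0) + if d ∈ B then 1 else 0 := by
  have h : {x | x ∈ B ∧ (x = c ∨ x = d)} = {x | x ∈ B ∧ x = c} ∪ {x | x ∈ B ∧ x = d} := by
    ext x
    simp only [Set.mem_ofPred_eq, Set.mem_union]
    tauto
  rw [h, Set.ncard_union_eq (Set.disjoint_left.2 fun x hx hx' => hcd (hx.2.symm.trans hx'.2))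
    ((Set.finite_singleton c).subset fun x hx => hx.2)
    ((Set.finite_singleton d).subset fun x hx => hx.2), ncard_sep_eq, ncard_sep_eq]

section Braid

section general

variable {r : ℕ} {w : List (Fin r)}

/-- The component of the cap, or of the left line, in layer `l`. -/
abbrev leftComp (s : Smoothing w) (l : Fin w.length) : (smooth w s).comp :=
  compAt w s (l.castSucc, (w.get l).castSucc)

/-- The component of the cup in layer `l`. -/
abbrev cupComp (s : Smoothing w) (l : Fin w.length) : (smooth w s).comp :=
  compAt w s (l.succ, (w.get l).castSucc)

/-- The component of the right line in layer `l`. -/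
abbrev rightComp (s : Smoothing w) (l : Fin w.length) : (smooth w s).comp :=
  compAt w s (l.castSucc, (w.get l).succ)

theorem near_left (s : Smoothing w) (l) : Near s l (l.castSucc, (w.get l).castSucc) :=
  ⟨_, ⟨Or.inl rfl, Or.inl rfl⟩, rfl⟩

theorem near_cup (s : Smoothing w) (l) : Near s l (l.succ, (w.get l).castSucc) :=
  ⟨_, ⟨Or.inr rfl, Or.inl rfl⟩, rfl⟩

theorem near_right (s : Smoothing w) (l) : Near s l (l.castSucc, (w.get l).succ) :=
  ⟨_, ⟨Or.inl rfl, Or.inr rfl⟩, rfl⟩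

variable {a b : Cell w} {l : Fin w.length}

open Classical in
theorem dotCount_away (h : Raises w a.smoothing b.smoothing l) {v : Point w}
    (hv : ¬ Near a.smoothing l v) :
    dotCount a b (Sum.inl (compAt w a.smoothing v)) =
      (if compAt w a.smoothing v ∈ a.blue then 1 else 0) +
        if compAt w b.smoothing v ∈ b.red then 1 else 0 := by
  rw [dotCount, ← ncard_sep_eq, ← ncard_sep_eq]
  congr 2
  · ext x
    obtain ⟨u, rfl⟩ := exists_point x
    refine and_congr_right fun _ => (saddle_conn_iff h).trans ?_
    exact or_iff_left fun k => hv k.2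
  · ext x
    obtain ⟨u, rfl⟩ := exists_point x
    refine and_congr_right fun _ => (saddle_conn_iff_inr h).trans ?_
    exact (or_iff_left fun k => hv k.2).trans (compAt_raise h hv)

theorem dotCount_near (h : Raises w a.smoothing b.smoothing l) :
    dotCount a b (Sum.inl (leftComp a.smoothing l)) =
      {x | x ∈ a.blue ∧ (x = leftComp a.smoothing l ∨ x = cupComp a.smoothing l)}.ncard +
      {x | x ∈ b.red ∧ (x = leftComp b.smoothing l ∨ x = rightComp b.smoothing l)}.ncard := by
  rw [dotCount]
  congr 2
  · ext x
    obtain ⟨u, rfl⟩ := exists_point x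
    refine and_congr_right fun _ => (saddle_conn_iff h).trans ?_
    rw [← near_iff_zero h]
    exact ⟨fun k => k.elim (fun k => (near_congr k).2 (near_left _ _)) And.left,
      fun k => Or.inr ⟨k, near_left _ _⟩⟩
  · ext x
    obtain ⟨u, rfl⟩ := exists_point x
    refine and_congr_right fun _ => (saddle_conn_iff_inr h).trans ?_
    rw [← near_iff_one h]
    exact ⟨fun k => k.elim (fun k => (near_congr k).2 (near_left _ _)) And.left,
      fun k => Or.inr ⟨k, near_left _ _⟩⟩

open Classical in
theorem dotCount_merge (h : Raises w a.smoothing b.smoothing l)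
    (h1 : leftComp a.smoothing l ≠ cupComp a.smoothing l)
    (h2 : leftComp b.smoothing l = rightComp b.smoothing l) :
    dotCount a b (Sum.inl (leftComp a.smoothing l)) =
      ((if leftComp a.smoothing l ∈ a.blue then 1 else 0) +
        if cupComp a.smoothing l ∈ a.blue then 1 else 0) +
        if leftComp b.smoothing l ∈ b.red then 1 else 0 := by
  rw [dotCount_near h, ncard_sep_pair _ h1, ← h2]
  simp only [or_self]
  rw [ncard_sep_eq]

open Classical in
theorem dotCount_split (h : Raises w a.smoothing b.smoothing l)
    (h1 : leftComp a.smoothing l = cupComp a.smoothing l)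
    (h2 : leftComp b.smoothing l ≠ rightComp b.smoothing l) :
    dotCount a b (Sum.inl (leftComp a.smoothing l)) =
      (if leftComp a.smoothing l ∈ a.blue then 1 else 0) +
        ((if leftComp b.smoothing l ∈ b.red then 1 else 0) +
        if rightComp b.smoothing l ∈ b.red then 1 else 0) := by
  rw [dotCount_near h, ncard_sep_pair _ h2, ← h1]
  simp only [or_self]
  rw [ncard_sep_eq]

/-- The loops away from layer `l` have the same colours. -/
def SameAway (a b : Cell w) (l : Fin w.length) : Prop :=
  ∀ v, ¬ Near a.smoothing l v → (compAt w a.smoothing v ∈ a.red ↔ compAt w b.smoothing v ∈ b.red)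

theorem noArcs_of_isLoop (h : Raises w a.smoothing b.smoothing l) {v : Point w}
    (hv : ¬ Near a.smoothing l v) (hloop : (smooth w a.smoothing).IsLoop (compAt w a.smoothing v)) :
    NoArcs a b (Sum.inl (compAt w a.smoothing v)) := by
  intro p hp
  rw [endpt_eq] at hp
  rw [isLoop_iff] at hloop
  exact ((saddle_conn_iff h).1 hp).elim (hloop p) fun k => hv k.2

theorem noArcs_near_iff (h : Raises w a.smoothing b.smoothing l) :
    NoArcs a b (Sum.inl (leftComp a.smoothing l)) ↔
      (smooth w a.smoothing).IsLoop (leftComp a.smoothing l) ∧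
        (smooth w a.smoothing).IsLoop (cupComp a.smoothing l) := by
  rw [isLoop_iff, isLoop_iff, ← forall_and]
  refine forall_congr' fun p => ?_
  rw [endpt_eq, ← not_or, ← near_iff_zero h]
  refine not_congr ((saddle_conn_iff h).trans ⟨fun k => ?_, fun k => Or.inr ⟨k, near_left _ _⟩⟩)
  exact k.elim (fun k => (near_congr k).2 (near_left _ _)) And.left

/-- Over a loop away from the crossing lies a sphere, with one dot if the loop is blue in `a` and
another if it is red in `b`. Exactly one dot means equal colours. -/
theorem sameAway_of_isEdge (h : Raises w a.smoothing b.smoothing l) (he : IsEdge deloopedD a b) :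
    SameAway a b l := by
  classical
  intro v hv
  by_cases hloop : (smooth w a.smoothing).IsLoop (compAt w a.smoothing v)
  · have := dotCount_of_isEdge he (noArcs_of_isLoop h hv hloop)
    rw [dotCount_away h hv] at this
    simp only [Cell.blue, Set.mem_ofPred_eq, hloop, true_and] at this
    split_ifs at this <;> simp_all
  · exact iff_of_false (fun k => hloop (a.red_isLoop _ k))
      fun k => hloop ((isLoop_raise h hv).2 (b.red_isLoop _ k))

theorem not_isLoop_endpt (s : Smoothing w) (p) : ¬ (smooth w s).IsLoop ((smooth w s).endpt p) :=
  fun k => k ⟨p, rfl⟩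

-- Away from the crossing, equal colours give spheres with one dot and undotted strips. The
-- hypotheses make the component at the crossing a sphere with one dot or an undotted disc with a
-- single arc at either end.
open Classical in
theorem isIsomorphism_of_near (h : Raises w a.smoothing b.smoothing l) (hs : SameAway a b l)
    (hD : dotCount a b (Sum.inl (leftComp a.smoothing l)) =
      if (smooth w a.smoothing).IsLoop (leftComp a.smoothing l) ∧
        (smooth w a.smoothing).IsLoop (cupComp a.smoothing l) then 1 else 0)
    (hA : leftComp a.smoothing l ≠ cupComp a.smoothing l →
      (smooth w a.smoothing).IsLoop (leftComp a.smoothing l) ∨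
        (smooth w a.smoothing).IsLoop (cupComp a.smoothing l))
    (hB : leftComp b.smoothing l ≠ rightComp b.smoothing l →
      (smooth w b.smoothing).IsLoop (leftComp b.smoothing l) ∨
        (smooth w b.smoothing).IsLoop (rightComp b.smoothing l)) (m : ℤ) :
    IsEdge deloopedD a b ∧ (deloopedD a b).IsIsomorphism m m := by
  have hnear : ∀ {v}, Near a.smoothing l v → SaddleConn a b (Sum.inl (compAt w a.smoothing v))
      (Sum.inl (leftComp a.smoothing l)) := fun hv => saddle_conn_corner h hv
  refine isIsomorphism_of_arcs h (fun z hz => ?_) (fun p => ?_) (fun p q hpq => ?_)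
    (fun p q hpq => ?_) m
  · obtain ⟨v, hv⟩ : ∃ v, SaddleConn a b z (Sum.inl (compAt w a.smoothing v)) := by
      rcases z with z | z
      · obtain ⟨v, rfl⟩ := exists_point z
        exact ⟨v, Setoid.refl' _ _⟩
      · obtain ⟨v, rfl⟩ := exists_point z
        exact ⟨v, Setoid.symm' _ (saddle_conn_self _ _ v)⟩
    rw [dotCount_congr hv]
    have hz' : NoArcs a b (Sum.inl (compAt w a.smoothing v)) := fun p hp =>
      hz p (Setoid.trans' _ hp (Setoid.symm' _ hv))
    by_cases hn : Near a.smoothing l v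
    · rw [dotCount_congr (hnear hn), hD, if_pos]
      rw [← noArcs_near_iff h]
      exact fun p hp => hz' p (Setoid.trans' _ hp (Setoid.symm' _ (hnear hn)))
    · have hloop : (smooth w a.smoothing).IsLoop (compAt w a.smoothing v) := by
        rw [isLoop_iff]
        intro p hp
        refine hz' p ?_
        rw [endpt_eq, hp]
      rw [dotCount_away h hn]
      simp only [Cell.blue, Set.mem_ofPred_eq, hloop, true_and, hs v hn]
      split_ifs <;> rfl
  · rw [endpt_eq]
    have hp := not_isLoop_endpt a.smoothing p
    rw [endpt_eq] at hp
    by_cases hn : Near a.smoothing l (endPoint w p)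
    · rw [dotCount_congr (hnear hn), hD, if_neg]
      rcases (near_iff_zero h).1 hn with k | k
      · exact fun k' => hp (k ▸ k'.1)
      · exact fun k' => hp (k ▸ k'.2)
    · rw [dotCount_away h hn, if_neg fun k => hp k.1,
        if_neg fun k => hp ((isLoop_raise h hn).2 (b.red_isLoop _ k))]
  · have hp := not_isLoop_endpt a.smoothing p
    have hq := not_isLoop_endpt a.smoothing q
    rw [endpt_eq] at hp hq hpq ⊢
    rw [endpt_eq] at hpq ⊢
    rcases (saddle_conn_iff h).1 hpq with k | ⟨k, k'⟩
    · exact k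
    · rw [near_iff_zero h] at k k'
      by_contra hne
      rcases k with k | k <;> rcases k' with k' | k' <;> rw [k] at hp <;> rw [k'] at hq
      · exact hne (k.trans k'.symm)
      · exact (hA fun e => hne (k.trans (e.trans k'.symm))).elim hp hq
      · exact (hA fun e => hne (k.trans (e.symm.trans k'.symm))).elim hq hp
      · exact hne (k.trans k'.symm)
  · have hp := not_isLoop_endpt b.smoothing p
    have hq := not_isLoop_endpt b.smoothing q
    rw [endpt_eq] at hp hq hpq ⊢
    rw [endpt_eq] at hpq ⊢
    have hpq' := Setoid.trans' _ hpq (Setoid.symm' _ (saddle_conn_self _ _ (endPoint w q)))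
    by_cases hn : Near a.smoothing l (endPoint w q)
    · have k : Near a.smoothing l (endPoint w p) :=
        ((saddle_conn_iff_inr h).1 hpq').elim (fun k => (near_congr k).2 hn) And.left
      have k' := hn
      rw [near_iff_one h] at k k'
      by_contra hne
      rcases k with k | k <;> rcases k' with k' | k' <;> rw [k] at hp <;> rw [k'] at hq
      · exact hne (k.trans k'.symm)
      · exact (hB fun e => hne (k.trans (e.trans k'.symm))).elim hp hq
      · exact (hB fun e => hne (k.trans (e.symm.trans k'.symm))).elim hq hp
      · exact hne (k.trans k'.symm)
    · exact (compAt_raise h hn).1 (((saddle_conn_iff_inr h).1 hpq').resolve_right fun k => hn k.2)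

/-- The layers, counted from `0`, in which a red loop has its highest point. -/
def redLayers (a : Cell w) : Set ℕ := {m | ∃ c ∈ a.red, maxLayer c = m + 1}

/-- The highest layers of the loops away from layer `l`. -/
def awayTops (s : Smoothing w) (l : Fin w.length) : Set ℕ :=
  {m | ∃ v, ¬ Near s l v ∧ (smooth w s).IsLoop (compAt w s v) ∧ maxLayer (compAt w s v) = m + 1}

/-- The highest layers of the red loops away from layer `l`. -/
def awayRed (a : Cell w) (l : Fin w.length) : Set ℕ :=
  {m | ∃ v, ¬ Near a.smoothing l v ∧ compAt w a.smoothing v ∈ a.red ∧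
    maxLayer (compAt w a.smoothing v) = m + 1}

theorem awayTops_raise {s s' : Smoothing w} (h : Raises w s s' l) :
    awayTops s l = awayTops s' l := by
  ext m
  refine exists_congr fun v => ?_
  rw [← near_raise h]
  refine and_congr_right fun hv => ?_
  rw [isLoop_raise h hv, maxLayer_raise h hv]

theorem awayRed_raise (h : Raises w a.smoothing b.smoothing l) (hs : SameAway a b l) :
    awayRed a l = awayRed b l := by
  ext m
  refine exists_congr fun v => ?_
  rw [← near_raise h]
  refine and_congr_right fun hv => ?_
  rw [hs v hv, maxLayer_raise h hv]

theorem awayRed_subset (a : Cell w) (l : Fin w.length) : awayRed a l ⊆ awayTops a.smoothing l :=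
  fun _ ⟨v, hv, hr, hm⟩ => ⟨v, hv, a.red_isLoop _ hr, hm⟩

theorem exists_comp_iff {s : Smoothing w} {l : Fin w.length} {c d : (smooth w s).comp}
    (h : ∀ v, Near s l v ↔ compAt w s v = c ∨ compAt w s v = d) (Q : (smooth w s).comp → Prop) :
    (∃ c, Q c) ↔ (∃ v, ¬ Near s l v ∧ Q (compAt w s v)) ∨ Q c ∨ Q d := by
  constructor
  · rintro ⟨c', hc⟩
    obtain ⟨v, rfl⟩ := exists_point c'
    by_cases hv : Near s l v
    · rcases (h v).1 hv with e | e
      · exact Or.inr (Or.inl (e ▸ hc))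
      · exact Or.inr (Or.inr (e ▸ hc))
    · exact Or.inl ⟨v, hv, hc⟩
  · rintro (⟨v, -, hv⟩ | hc | hd)
    · exact ⟨_, hv⟩
    · exact ⟨_, hc⟩
    · exact ⟨_, hd⟩

theorem mem_redLayers_zero (h : Raises w a.smoothing b.smoothing l) {m : ℕ} :
    m ∈ redLayers a ↔ m ∈ awayRed a l ∨
      (leftComp a.smoothing l ∈ a.red ∧ maxLayer (leftComp a.smoothing l) = m + 1) ∨
      (cupComp a.smoothing l ∈ a.red ∧ maxLayer (cupComp a.smoothing l) = m + 1) :=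
  exists_comp_iff (fun _ => near_iff_zero h) fun c => c ∈ a.red ∧ maxLayer c = m + 1

theorem mem_redLayers_one (h : Raises w a.smoothing b.smoothing l) (hs : SameAway a b l) {m : ℕ} :
    m ∈ redLayers b ↔ m ∈ awayRed a l ∨
      (leftComp b.smoothing l ∈ b.red ∧ maxLayer (leftComp b.smoothing l) = m + 1) ∨
      (rightComp b.smoothing l ∈ b.red ∧ maxLayer (rightComp b.smoothing l) = m + 1) := by
  rw [awayRed_raise h hs]
  exact exists_comp_iff (fun _ => (near_raise h).symm.trans (near_iff_one h))
    fun c => c ∈ b.red ∧ maxLayer c = m + 1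

end general

variable {w : List (Fin 3)}

theorem mem_closings_iff (H : ∀ l : Fin w.length, w.get l = pos l) {s : Smoothing w} {m : ℕ} :
    m ∈ closings (bits s) ↔ ∃ c, (smooth w s).IsLoop c ∧ maxLayer c = m + 1 := by
  constructor
  · intro h
    have hm : m < w.length := by
      by_contra! hm
      have := h.1
      rw [bits_of_le s hm] at this
      cases this
    exact ⟨_, isLoop_of_mem_closings H (l := ⟨m, hm⟩) h⟩
  · rintro ⟨c, hc, hm⟩
    obtain ⟨l, hl, h, -⟩ := exists_closing H hc
    rwa [show m = l by omega]

theorem mem_closings_zero (H : ∀ l : Fin w.length, w.get l = pos l) {s s' : Smoothing w}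
    {l : Fin w.length} (h : Raises w s s' l) {m : ℕ} :
    m ∈ closings (bits s) ↔ m ∈ awayTops s l ∨
      ((smooth w s).IsLoop (leftComp s l) ∧ maxLayer (leftComp s l) = m + 1) ∨
      ((smooth w s).IsLoop (cupComp s l) ∧ maxLayer (cupComp s l) = m + 1) := by
  rw [mem_closings_iff H]
  exact exists_comp_iff (fun _ => near_iff_zero h) fun c =>
    (smooth w s).IsLoop c ∧ maxLayer c = m + 1

theorem mem_closings_one (H : ∀ l : Fin w.length, w.get l = pos l) {s s' : Smoothing w}
    {l : Fin w.length} (h : Raises w s s' l) {m : ℕ} :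
    m ∈ closings (bits s') ↔ m ∈ awayTops s l ∨
      ((smooth w s').IsLoop (leftComp s' l) ∧ maxLayer (leftComp s' l) = m + 1) ∨
      ((smooth w s').IsLoop (rightComp s' l) ∧ maxLayer (rightComp s' l) = m + 1) := by
  rw [mem_closings_iff H, awayTops_raise h]
  exact exists_comp_iff (fun _ => (near_raise h).symm.trans (near_iff_one h)) fun c =>
    (smooth w s').IsLoop c ∧ maxLayer c = m + 1

theorem notMem_awayTops (H : ∀ l : Fin w.length, w.get l = pos l) {s : Smoothing w}
    {l : Fin w.length} {v : Point w} (hv : Near s l v) (hloop : (smooth w s).IsLoop (compAt w s v))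
    {m : ℕ} (hm : maxLayer (compAt w s v) = m + 1) : m ∉ awayTops s l := by
  rintro ⟨u, hu, hu', hum⟩
  exact hu ((near_congr (maxLayer_injective H hu' hloop (hum.trans hm.symm))).2 hv)

theorem exists_maxLayer (H : ∀ l : Fin w.length, w.get l = pos l) {s : Smoothing w}
    {c : (smooth w s).comp} (hc : (smooth w s).IsLoop c) : ∃ m, maxLayer c = m + 1 :=
  let ⟨l, hl, _⟩ := exists_closing H hc
  ⟨l, hl⟩

theorem mem_redLayers (H : ∀ l : Fin w.length, w.get l = pos l) {a : Cell w}
    {c : (smooth w a.smoothing).comp} (hc : (smooth w a.smoothing).IsLoop c) {m : ℕ}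
    (hm : maxLayer c = m + 1) : m ∈ redLayers a ↔ c ∈ a.red := by
  refine ⟨?_, fun h => ⟨c, h, hm⟩⟩
  rintro ⟨d, hd, hdm⟩
  rwa [← maxLayer_injective H (a.red_isLoop _ hd) hc (hdm.trans hm.symm)]

theorem redLayers_subset (H : ∀ l : Fin w.length, w.get l = pos l) (a : Cell w) :
    redLayers a ⊆ closings (bits a.smoothing) := by
  rintro m ⟨c, hc, hm⟩
  exact (mem_closings_iff H).2 ⟨c, a.red_isLoop _ hc, hm⟩

theorem Cell.ext_of_layers (H : ∀ l : Fin w.length, w.get l = pos l) {a b : Cell w}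
    (h : bits a.smoothing = bits b.smoothing) (h' : redLayers a = redLayers b) : a = b := by
  have hs := bits_injective h
  have key : ∀ {s : Smoothing w} {R R' : Set (smooth w s).comp} (h1 h2),
      redLayers ⟨s, R, h1⟩ = redLayers ⟨s, R', h2⟩ → R ⊆ R' := by
    intro s R R' h1 h2 e c hc
    obtain ⟨m, hm⟩ := exists_maxLayer H (h1 c hc)
    rw [← mem_redLayers H (a := ⟨s, R', h2⟩) (h1 c hc) hm, ← e]
    exact ⟨c, hc, hm⟩
  obtain ⟨s, R, hR⟩ := a
  obtain ⟨s', R', hR'⟩ := b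
  obtain rfl : s = s' := hs
  obtain rfl : R = R' := (key hR hR' h').antisymm (key hR' hR h'.symm)
  rfl

theorem exists_cell_of_layers (H : ∀ l : Fin w.length, w.get l = pos l) {x : ℕ → Bool}
    {R : Set ℕ} (hx : ∀ m, w.length ≤ m → x m = true) (hR : R ⊆ closings x) :
    ∃ a : Cell w, bits a.smoothing = x ∧ redLayers a = R := by
  let s : Smoothing w := fun l => x l
  have hs : bits s = x := by
    funext m
    by_cases hm : m < w.length
    · exact dif_pos hm
    · rw [bits_of_le s (by omega), hx m (by omega)]
  refine ⟨⟨s, {c | (smooth w s).IsLoop c ∧ ∃ m ∈ R, maxLayer c = m + 1}, fun c hc => hc.1⟩, hs, ?_⟩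
  ext m
  constructor
  · rintro ⟨c, ⟨-, k, hk, hck⟩, hcm⟩
    rwa [show m = k by omega]
  · intro hm
    obtain ⟨c, hc, hcm⟩ := (mem_closings_iff H).1 (hs ▸ hR hm : m ∈ closings (bits s))
    exact ⟨c, ⟨hc, m, hm, hcm⟩, hcm⟩

/-- The shift of a cell in terms of the layers of its loops. -/
theorem shift_eq (H : ∀ l : Fin w.length, w.get l = pos l) (a : Cell w) :
    a.shift = ((Finset.univ.filter fun l => a.smoothing l = true).card : ℤ) -
      2 * (w.length : ℤ) + 2 * ((redLayers a).ncard : ℤ) -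
        ((closings (bits a.smoothing)).ncard : ℤ) := by
  have hinj : Set.InjOn (fun c : (smooth w a.smoothing).comp => maxLayer c - 1)
      {c | (smooth w a.smoothing).IsLoop c} := by
    intro c hc d hd hcd
    obtain ⟨m, hm⟩ := exists_maxLayer H hc
    obtain ⟨k, hk⟩ := exists_maxLayer H hd
    have hcd : maxLayer c - 1 = maxLayer d - 1 := hcd
    exact maxLayer_injective H hc hd (by omega)
  have h1 : redLayers a = (fun c : (smooth w a.smoothing).comp => maxLayer c - 1) '' a.red := by
    ext m
    refine exists_congr fun c => and_congr_right fun hc => ?_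
    obtain ⟨k, hk⟩ := exists_maxLayer H (a.red_isLoop c hc)
    rw [hk]
    constructor <;> intro h <;> dsimp only at * <;> omega
  have h2 : closings (bits a.smoothing) =
      (fun c : (smooth w a.smoothing).comp => maxLayer c - 1) ''
        {c | (smooth w a.smoothing).IsLoop c} := by
    ext m
    rw [mem_closings_iff H]
    refine exists_congr fun c => and_congr_right fun hc => ?_
    obtain ⟨k, hk⟩ := exists_maxLayer H hc
    rw [hk]
    constructor <;> intro h <;> dsimp only at * <;> omega
  have h3 : {c | (smooth w a.smoothing).IsLoop c}.ncard = a.red.ncard + a.blue.ncard := by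
    rw [← Set.ncard_union_eq _ (Set.toFinite _) (Set.toFinite _)]
    · congr 1
      ext c
      constructor
      · intro hc
        by_cases hr : c ∈ a.red
        · exact Or.inl hr
        · exact Or.inr ⟨hc, hr⟩
      · rintro (hc | hc)
        · exact a.red_isLoop c hc
        · exact hc.1
    · exact Set.disjoint_left.2 fun c hc hc' => hc'.2 hc
  rw [h1, h2, hinj.ncard_image,
    (hinj.mono fun c hc => a.red_isLoop c hc).ncard_image, h3, Cell.shift]
  push_cast
  ring

end Braid

end BarNatan

end

/-! ### Isomorphisms in terms of highest layers -/

noncomputable section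

namespace BarNatan

section layers

variable {x y : ℕ → Bool} {R S N RN : Set ℕ} {i m M k : ℕ}

/-- Loops with tops `m < M` merge into one with top `M`; `rm`, `rM`, `rL` tell which of the three
are red, and `hD` lists the colourings with exactly one dot. A red lower loop disappears and its top
gives `u`; otherwise the red loop at `M` absorbs a blue one and turns blue. -/
theorem IsoMove.of_merge (hx : x i = false) (hy : y = Function.update x i true) {rm rM rL : Prop}
    (hmM : m < M) (hN : RN ⊆ N) (hm : m ∉ N) (hM : M ∉ N)
    (hcx : ∀ j, j ∈ closings x ↔ j ∈ N ∨ m = j ∨ M = j)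
    (hR : ∀ j, j ∈ R ↔ j ∈ RN ∨ rm ∧ m = j ∨ rM ∧ M = j)
    (hcy : ∀ j, j ∈ closings y ↔ j ∈ N ∨ M = j) (hS : ∀ j, j ∈ S ↔ j ∈ RN ∨ rL ∧ M = j)
    (hD : rm ∧ (rM ↔ rL) ∨ ¬ rm ∧ rM ∧ ¬ rL) :
    ∃ k, sInf {j | rm ∧ j = m + 1 ∨ rM ∧ j = M + 1} = k + 1 ∧ IsoMove x y R S i k := by
  have hm' : m ∉ RN := fun h => hm (hN h)
  have hM' : M ∉ RN := fun h => hM (hN h)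
  rcases hD with ⟨h1, h2⟩ | ⟨h1, h2, h3⟩
  · refine ⟨m, IsLeast.csInf_eq ⟨Or.inl ⟨h1, rfl⟩, ?_⟩, hx, hy, Or.inr (Or.inl ⟨?_, ?_, ?_⟩)⟩
    · rintro j (⟨-, rfl⟩ | ⟨-, rfl⟩) <;> omega
    · rw [hR]; exact Or.inr (Or.inl ⟨h1, rfl⟩)
    · rw [hcy]; exact not_or.2 ⟨hm, hmM.ne'⟩
    · ext j
      rw [Set.mem_sdiff, hR, hS, Set.mem_singleton_iff]
      grind
  · refine ⟨M, IsLeast.csInf_eq ⟨Or.inr ⟨h2, rfl⟩, ?_⟩, hx, hy,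
      Or.inr (Or.inr (Or.inl ⟨?_, ?_, ?_, m, hmM, ?_, ?_, ?_⟩))⟩
    · rintro j (⟨h, -⟩ | ⟨-, rfl⟩)
      · exact absurd h h1
      · exact le_rfl
    · rw [hR]; exact Or.inr (Or.inr ⟨h2, rfl⟩)
    · rw [hcy]; exact Or.inr rfl
    · ext j
      rw [Set.mem_sdiff, hR, hS, Set.mem_singleton_iff]
      grind
    · rw [hcx]; exact Or.inr (Or.inl rfl)
    · rw [hR]; grind
    · rw [hcy]; exact not_or.2 ⟨hm, hmM.ne'⟩

/-- The reverse picture. A blue lower part is the new loop that gives `u`; if the lower part is red,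
the loop at `M` has passed its colour down and turned blue. -/
theorem IsoMove.of_split (hx : x i = false) (hy : y = Function.update x i true) {rm rM rL : Prop}
    (hmM : m < M) (hN : RN ⊆ N) (hm : m ∉ N) (hM : M ∉ N)
    (hcx : ∀ j, j ∈ closings x ↔ j ∈ N ∨ M = j) (hR : ∀ j, j ∈ R ↔ j ∈ RN ∨ rL ∧ M = j)
    (hcy : ∀ j, j ∈ closings y ↔ j ∈ N ∨ m = j ∨ M = j)
    (hS : ∀ j, j ∈ S ↔ j ∈ RN ∨ rm ∧ m = j ∨ rM ∧ M = j)
    (hD : ¬ rm ∧ (rM ↔ rL) ∨ rm ∧ ¬ rM ∧ rL) :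
    ∃ k, sInf {j | ¬ rm ∧ j = m + 1 ∨ ¬ rM ∧ j = M + 1} = k + 1 ∧ IsoMove x y R S i k := by
  have hm' : m ∉ RN := fun h => hm (hN h)
  have hM' : M ∉ RN := fun h => hM (hN h)
  rcases hD with ⟨h1, h2⟩ | ⟨h1, h2, h3⟩
  · refine ⟨m, IsLeast.csInf_eq ⟨Or.inl ⟨h1, rfl⟩, ?_⟩, hx, hy, Or.inl ⟨?_, ?_, ?_⟩⟩
    · rintro j (⟨-, rfl⟩ | ⟨-, rfl⟩) <;> omega
    · rw [hcx]; exact not_or.2 ⟨hm, hmM.ne'⟩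
    · rw [hcy]; exact Or.inr (Or.inl rfl)
    · ext j
      rw [hR, hS]
      grind
  · refine ⟨M, IsLeast.csInf_eq ⟨Or.inr ⟨h2, rfl⟩, ?_⟩, hx, hy,
      Or.inr (Or.inr (Or.inr ⟨?_, ?_, m, hmM, ?_, ?_, ?_⟩))⟩
    · rintro j (⟨h, -⟩ | ⟨-, rfl⟩)
      · exact absurd h1 h
      · exact le_rfl
    · rw [hR]; exact Or.inr ⟨h3, rfl⟩
    · rw [hcy]; exact Or.inr (Or.inr rfl)
    · rw [hcx]; exact not_or.2 ⟨hm, hmM.ne'⟩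
    · rw [hcy]; exact Or.inr (Or.inl rfl)
    · ext j
      rw [Set.mem_insert_iff, Set.mem_sdiff, hR, hS, Set.mem_singleton_iff]
      grind

theorem insert_eq_of_mem_iff {T U : Set ℕ} (hT : ∀ j, j ∈ T ↔ j ∈ N)
    (hU : ∀ j, j ∈ U ↔ j ∈ N ∨ k = j) : U = insert k T := by
  ext j
  rw [Set.mem_insert_iff, hU, hT, or_comm, eq_comm]

theorem IsoMove.of_remove (hx : x i = false) (hy : y = Function.update x i true)
    (hN : RN ⊆ N) (hk : k ∉ N) (hR : ∀ j, j ∈ R ↔ j ∈ RN ∨ k = j)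
    (hcy : ∀ j, j ∈ closings y ↔ j ∈ N) (hS : ∀ j, j ∈ S ↔ j ∈ RN) : IsoMove x y R S i k := by
  refine ⟨hx, hy, Or.inr (Or.inl ⟨?_, ?_, ?_⟩)⟩
  · rw [hR]; exact Or.inr rfl
  · rwa [hcy]
  · rw [insert_eq_of_mem_iff hS hR, Set.insert_sdiff_self_of_notMem]
    rw [hS]
    exact fun h => hk (hN h)

theorem IsoMove.of_add (hx : x i = false) (hy : y = Function.update x i true)
    (hk : k ∉ N) (hR : ∀ j, j ∈ R ↔ j ∈ RN) (hcx : ∀ j, j ∈ closings x ↔ j ∈ N)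
    (hcy : ∀ j, j ∈ closings y ↔ j ∈ N ∨ k = j) (hS : ∀ j, j ∈ S ↔ j ∈ RN) :
    IsoMove x y R S i k := by
  refine ⟨hx, hy, Or.inl ⟨?_, ?_, ?_⟩⟩
  · rwa [hcx]
  · rw [hcy]; exact Or.inr rfl
  · ext j; rw [hR, hS]

end layers

section Braid

section general

variable {r : ℕ} {w : List (Fin r)} {a b : Cell w} {l : Fin w.length}

theorem bits_raise {s s' : Smoothing w} (h : Raises w s s' l) :
    bits s l = false ∧ bits s' = Function.update (bits s) l true := by
  rw [h.2, bits_update, bits_val]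
  exact ⟨h.1, rfl⟩

theorem uValue_merge (h1 : leftComp a.smoothing l ≠ cupComp a.smoothing l)
    (h2 : leftComp b.smoothing l = rightComp b.smoothing l) :
    uValue a b l = sInf {j | leftComp a.smoothing l ∈ a.red ∧ j = maxLayer (leftComp a.smoothing l) ∨
      cupComp a.smoothing l ∈ a.red ∧ j = maxLayer (cupComp a.smoothing l)} := by
  rw [uValue]
  congr 1
  ext j
  constructor
  · rintro (⟨c, ⟨hc, -, rfl | rfl⟩, rfl⟩ | ⟨c, hc, -⟩)
    · exact Or.inl ⟨hc, rfl⟩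
    · exact Or.inr ⟨hc, rfl⟩
    · exact absurd h2 hc.2.1
  · rintro (⟨hc, rfl⟩ | ⟨hc, rfl⟩)
    · exact Or.inl ⟨_, ⟨hc, h1, Or.inl rfl⟩, rfl⟩
    · exact Or.inl ⟨_, ⟨hc, h1, Or.inr rfl⟩, rfl⟩

theorem uValue_split (h1 : leftComp a.smoothing l = cupComp a.smoothing l)
    (h2 : leftComp b.smoothing l ≠ rightComp b.smoothing l) :
    uValue a b l = sInf {j |
      leftComp b.smoothing l ∈ b.blue ∧ j = maxLayer (leftComp b.smoothing l) ∨
        rightComp b.smoothing l ∈ b.blue ∧ j = maxLayer (rightComp b.smoothing l)} := by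
  rw [uValue]
  congr 1
  ext j
  constructor
  · rintro (⟨c, hc, -⟩ | ⟨c, ⟨hc, -, rfl | rfl⟩, rfl⟩)
    · exact absurd h1 hc.2.1
    · exact Or.inl ⟨hc, rfl⟩
    · exact Or.inr ⟨hc, rfl⟩
  · rintro (⟨hc, rfl⟩ | ⟨hc, rfl⟩)
    · exact Or.inr ⟨_, ⟨hc, h2, Or.inl rfl⟩, rfl⟩
    · exact Or.inr ⟨_, ⟨hc, h2, Or.inr rfl⟩, rfl⟩

theorem not_isIsomorphism_of_dots (h : Raises w a.smoothing b.smoothing l)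
    (h1 : ¬ ((smooth w a.smoothing).IsLoop (leftComp a.smoothing l) ∧
        (smooth w a.smoothing).IsLoop (cupComp a.smoothing l)))
    (h2 : dotCount a b (Sum.inl (leftComp a.smoothing l)) ≠ 0) (m m' : ℤ) :
    ¬ (deloopedD a b).IsIsomorphism m m' := by
  intro hiso
  rw [← noArcs_near_iff h, NoArcs] at h1
  push Not at h1
  obtain ⟨p, hp⟩ := h1
  exact h2 ((dotCount_congr hp).symm.trans ((arcs_of_isIsomorphism h hiso).1 p))

theorem exists_endpt {s : Smoothing w} {c : (smooth w s).comp} (h : ¬ (smooth w s).IsLoop c) :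
    ∃ p, (smooth w s).endpt p = c :=
  not_not.1 h

theorem not_isIsomorphism_of_arcs (h : Raises w a.smoothing b.smoothing l)
    (h0 : leftComp a.smoothing l ≠ cupComp a.smoothing l)
    (h1 : ¬ (smooth w a.smoothing).IsLoop (leftComp a.smoothing l))
    (h2 : ¬ (smooth w a.smoothing).IsLoop (cupComp a.smoothing l)) (m m' : ℤ) :
    ¬ (deloopedD a b).IsIsomorphism m m' := by
  intro hiso
  obtain ⟨p, hp⟩ := exists_endpt h1
  obtain ⟨q, hq⟩ := exists_endpt h2
  refine h0 (hp.symm.trans (((arcs_of_isIsomorphism h hiso).2 p q ?_).trans hq))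
  rw [hp, hq]
  exact Setoid.symm' _ (saddle_conn_corner h (near_cup _ _))

theorem card_raise {s s' : Smoothing w} (h : Raises w s s' l) :
    (Finset.univ.filter fun l => s' l = true).card =
      (Finset.univ.filter fun l => s l = true).card + 1 := by
  classical
  have : (Finset.univ.filter fun l => s' l = true) =
      insert l (Finset.univ.filter fun l => s l = true) := by
    ext m
    rw [Finset.mem_insert, Finset.mem_filter, Finset.mem_filter, h.2, Function.update_apply]
    split_ifs with hm <;> simp [hm]
  rw [this, Finset.card_insert_of_notMem]
  simp [h.1]

theorem finite_closings (s : Smoothing w) : (closings (bits s)).Finite := by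
  refine (Set.finite_lt_nat w.length).subset fun m hm => ?_
  by_contra hlt
  have := hm.1
  rw [bits_of_le s (not_lt.1 hlt)] at this
  cases this

end general

variable {w : List (Fin 3)} {a b : Cell w} {l : Fin w.length}

theorem finite_redLayers (H : ∀ l : Fin w.length, w.get l = pos l) (a : Cell w) :
    (redLayers a).Finite := (finite_closings a.smoothing).subset (redLayers_subset H a)

theorem shift_raise (H : ∀ l : Fin w.length, w.get l = pos l)
    (h : Raises w a.smoothing b.smoothing l) :
    b.shift + (closings (bits b.smoothing)).ncard + 2 * (redLayers a).ncard =
      a.shift + 1 + (closings (bits a.smoothing)).ncard + 2 * (redLayers b).ncard := by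
  rw [shift_eq H a, shift_eq H b, card_raise h]
  push_cast
  ring

theorem ncard_remove {T : Set ℕ} (hT : T.Finite) {k : ℕ} (hk : k ∈ T) :
    (T.ncard : ℤ) = (T \ {k}).ncard + 1 := by
  rw [← Set.ncard_sdiff_singleton_add_one hk hT]
  push_cast
  rfl

theorem ncard_add {T : Set ℕ} (hT : T.Finite) {k : ℕ} (hk : k ∉ T) :
    ((insert k T).ncard : ℤ) = T.ncard + 1 := by
  rw [Set.ncard_insert_of_notMem hk hT]
  push_cast
  rfl

/-- The raise adds `1` to the shift. In the first and last forms a closing is gained while the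
number of red loops stays; in the other two a closing and a red loop are lost, which contributes `1
- 2`. -/
theorem shift_eq_of_isoMove (H : ∀ l : Fin w.length, w.get l = pos l)
    (h : Raises w a.smoothing b.smoothing l) {k : ℕ}
    (hm : IsoMove (bits a.smoothing) (bits b.smoothing) (redLayers a) (redLayers b) l k) :
    a.shift = b.shift := by
  have hs := shift_raise H h
  obtain ⟨h0, hy, hm⟩ := hm
  have ha := finite_closings a.smoothing
  have hra := finite_redLayers H a
  rcases hm with ⟨h1, h2, h3⟩ | ⟨h1, h2, h3⟩ | ⟨h1, h2, h3, m, hmk, h4, h5, h6⟩ |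
    ⟨h1, h2, m, hmk, h3, h4, h5⟩
  · rw [hy] at h2
    rw [hy, closings_raise_of_new h0 h2 h1, ncard_add ha h1, h3] at hs
    omega
  · rw [hy] at h2
    have h1' := redLayers_subset H a h1
    rw [hy, closings_raise_of_lost h0 h1' h2, ncard_remove ha h1', h3, ncard_remove hra h1] at hs
    omega
  · rw [hy] at h6
    rw [hy, closings_raise_of_lost h0 h4 h6, ncard_remove ha h4, h3, ncard_remove hra h1] at hs
    omega
  · rw [hy] at h4
    have hm' : m ∉ redLayers a \ {k} := fun h => h3 (redLayers_subset H a h.1)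
    rw [hy, closings_raise_of_new h0 h4 h3, ncard_add ha h3, h5, ncard_add hra.sdiff hm',
      ncard_remove hra h1] at hs
    omega

end Braid

end BarNatan

end

/-! ### Every edge is an isomorphism or raises the shift -/

noncomputable section

namespace BarNatan

section Braid

variable {w : List (Fin 3)} {a b : Cell w} {l : Fin w.length}

/-- The matrix element `a → b` is an isomorphism with the expected effect on the layers. -/
def IsoAt (a b : Cell w) (l : Fin w.length) : Prop :=
  (∃ k, uValue a b l = k + 1 ∧
    IsoMove (bits a.smoothing) (bits b.smoothing) (redLayers a) (redLayers b) l k) ∧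
  ∀ m, IsEdge deloopedD a b ∧ (deloopedD a b).IsIsomorphism m m

/-- Blue loops of the source and red loops of the target carry the dots, so the hypothesis is the
condition for a sphere with one dot when `A` and `B` merge into `C`. -/
theorem colours_of_merge {A B C : Prop} [Decidable A] [Decidable B] [Decidable C]
    (h : ((if ¬ A then 1 else 0) + if ¬ B then 1 else 0) + (if C then 1 else 0) = 1) :
    A ∧ (B ↔ C) ∨ ¬ A ∧ B ∧ ¬ C := by
  by_cases A <;> by_cases B <;> by_cases C <;> simp_all

theorem colours_of_split {A B C : Prop} [Decidable A] [Decidable B] [Decidable C]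
    (h : (if ¬ C then 1 else 0) + ((if A then 1 else 0) + (if B then 1 else 0)) = 1) :
    ¬ A ∧ (B ↔ C) ∨ A ∧ ¬ B ∧ C := by
  by_cases A <;> by_cases B <;> by_cases C <;> simp_all

theorem mem_blue_iff {c : (smooth w a.smoothing).comp} (hc : (smooth w a.smoothing).IsLoop c) :
    c ∈ a.blue ↔ c ∉ a.red := and_iff_right hc

theorem notMem_blue {c : (smooth w a.smoothing).comp} (hc : ¬ (smooth w a.smoothing).IsLoop c) :
    c ∉ a.blue := fun h => hc h.1

theorem notMem_red {c : (smooth w a.smoothing).comp} (hc : ¬ (smooth w a.smoothing).IsLoop c) :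
    c ∉ a.red := fun h => hc (a.red_isLoop _ h)

theorem isoAt_of_merge_loops (H : ∀ l : Fin w.length, w.get l = pos l)
    (h : Raises w a.smoothing b.smoothing l) (hs : SameAway a b l)
    (h1 : leftComp a.smoothing l ≠ cupComp a.smoothing l)
    (h2 : leftComp b.smoothing l = rightComp b.smoothing l)
    (hp : (smooth w a.smoothing).IsLoop (leftComp a.smoothing l))
    (hP : (smooth w a.smoothing).IsLoop (cupComp a.smoothing l))
    (hD : dotCount a b (Sum.inl (leftComp a.smoothing l)) = 1) : IsoAt a b l := by
  classical
  obtain ⟨m, hm⟩ := exists_maxLayer H hp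
  obtain ⟨M, hM⟩ := exists_maxLayer H hP
  have hne : m ≠ M := by
    rintro rfl
    exact h1 (maxLayer_injective H hp hP (hm.trans hM.symm))
  have hL := ((isLoop_near h).1 ⟨hp, hP⟩).1
  have hmax := maxLayer_merge h h2
  rw [hm, hM] at hmax
  refine ⟨?_, fun m => isIsomorphism_of_near h hs (by rw [hD, if_pos ⟨hp, hP⟩])
    (fun _ => Or.inl hp) (fun h => absurd h2 h) m⟩
  rw [dotCount_merge h h1 h2, if_congr (mem_blue_iff hp) rfl rfl,
    if_congr (mem_blue_iff hP) rfl rfl] at hD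
  have hcol := colours_of_merge hD
  rw [uValue_merge h1 h2, hm, hM]
  have c1 := fun j => mem_closings_zero H h (m := j)
  have c2 := fun j => mem_redLayers_zero h (m := j)
  have c3 := fun j => mem_closings_one H h (m := j)
  have c4 := fun j => mem_redLayers_one h hs (m := j)
  simp only [← h2, hp, hP, hL, hm, hM, hmax, true_and, add_left_inj, or_self] at c1 c2 c3 c4
  have n1 := notMem_awayTops H (near_left a.smoothing l) hp hm
  have n2 := notMem_awayTops H (near_cup a.smoothing l) hP hM
  have hb := bits_raise h
  rcases lt_or_gt_of_ne hne with hlt | hlt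
  · simp only [show max (m + 1) (M + 1) = M + 1 by omega, add_left_inj] at c3 c4
    refine IsoMove.of_merge hb.1 hb.2 hlt (awayRed_subset a l) n1 n2 c1 c2 c3 c4 hcol
  · simp only [show max (m + 1) (M + 1) = m + 1 by omega, add_left_inj] at c3 c4
    have := IsoMove.of_merge (rm := cupComp a.smoothing l ∈ a.red)
      (rM := leftComp a.smoothing l ∈ a.red) hb.1 hb.2 hlt (awayRed_subset a l) n2 n1
      (fun j => (c1 j).trans (or_congr_right or_comm))
      (fun j => (c2 j).trans (or_congr_right or_comm)) c3 c4 (by tauto)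
    simpa only [or_comm] using this

theorem isoAt_of_split_loops (H : ∀ l : Fin w.length, w.get l = pos l)
    (h : Raises w a.smoothing b.smoothing l) (hs : SameAway a b l)
    (h1 : leftComp a.smoothing l = cupComp a.smoothing l)
    (h2 : leftComp b.smoothing l ≠ rightComp b.smoothing l)
    (hp : (smooth w b.smoothing).IsLoop (leftComp b.smoothing l))
    (hP : (smooth w b.smoothing).IsLoop (rightComp b.smoothing l))
    (hD : dotCount a b (Sum.inl (leftComp a.smoothing l)) = 1) : IsoAt a b l := by
  classical
  obtain ⟨m, hm⟩ := exists_maxLayer H hp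
  obtain ⟨M, hM⟩ := exists_maxLayer H hP
  have hne : m ≠ M := by
    rintro rfl
    exact h2 (maxLayer_injective H hp hP (hm.trans hM.symm))
  obtain ⟨hL, hL'⟩ := (isLoop_near h).2 ⟨hp, hP⟩
  have hmax := maxLayer_split h h1
  rw [hm, hM] at hmax
  refine ⟨?_, fun m => isIsomorphism_of_near h hs (by rw [hD, if_pos ⟨hL, hL'⟩])
    (fun h => absurd h1 h) (fun _ => Or.inl hp) m⟩
  rw [dotCount_split h h1 h2, if_congr (mem_blue_iff hL) rfl rfl] at hD
  have hcol := colours_of_split hD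
  rw [uValue_split h1 h2, hm, hM, mem_blue_iff hp, mem_blue_iff hP]
  have c1 := fun j => mem_closings_zero H h (m := j)
  have c2 := fun j => mem_redLayers_zero h (m := j)
  have c3 := fun j => mem_closings_one H h (m := j)
  have c4 := fun j => mem_redLayers_one h hs (m := j)
  simp only [← h1, hp, hP, hL, hm, hM, hmax, true_and, add_left_inj, or_self] at c1 c2 c3 c4
  have n1 := notMem_awayTops H (near_left b.smoothing l) hp hm
  have n2 := notMem_awayTops H (near_right b.smoothing l) hP hM
  rw [← awayTops_raise h] at n1 n2
  have hb := bits_raise h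
  rcases lt_or_gt_of_ne hne with hlt | hlt
  · simp only [show max (m + 1) (M + 1) = M + 1 by omega, add_left_inj] at c1 c2
    refine IsoMove.of_split hb.1 hb.2 hlt (awayRed_subset a l) n1 n2 c1 c2 c3 c4 hcol
  · simp only [show max (m + 1) (M + 1) = m + 1 by omega, add_left_inj] at c1 c2
    have := IsoMove.of_split (rm := rightComp b.smoothing l ∈ b.red)
      (rM := leftComp b.smoothing l ∈ b.red) hb.1 hb.2 hlt (awayRed_subset a l) n2 n1 c1 c2
      (fun j => (c3 j).trans (or_congr_right or_comm))
      (fun j => (c4 j).trans (or_congr_right or_comm)) (by tauto)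
    simpa only [or_comm] using this

/-- The layers of the loops, if a loop is merged with an arc. -/
theorem layers_of_merge_arc (H : ∀ l : Fin w.length, w.get l = pos l)
    (h : Raises w a.smoothing b.smoothing l) (hs : SameAway a b l)
    (h1 : leftComp a.smoothing l ≠ cupComp a.smoothing l)
    (h2 : leftComp b.smoothing l = rightComp b.smoothing l)
    (hp : Xor ((smooth w a.smoothing).IsLoop (leftComp a.smoothing l))
      ((smooth w a.smoothing).IsLoop (cupComp a.smoothing l))) :
    ∃ k, k ∉ awayTops a.smoothing l ∧
      (∀ j, j ∈ closings (bits a.smoothing) ↔ j ∈ awayTops a.smoothing l ∨ k = j) ∧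
      (∀ j, j ∈ closings (bits b.smoothing) ↔ j ∈ awayTops a.smoothing l) ∧
      (∀ j, j ∈ redLayers b ↔ j ∈ awayRed a l) ∧
      (dotCount a b (Sum.inl (leftComp a.smoothing l)) = 0 ∧ uValue a b l = k + 1 ∧
          (∀ j, j ∈ redLayers a ↔ j ∈ awayRed a l ∨ k = j) ∨
        dotCount a b (Sum.inl (leftComp a.smoothing l)) ≠ 0 ∧
          (∀ j, j ∈ redLayers a ↔ j ∈ awayRed a l)) := by
  classical
  have hL : ¬ (smooth w b.smoothing).IsLoop (leftComp b.smoothing l) := by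
    intro hL
    have := (isLoop_near h).2 ⟨hL, (congrArg (smooth w _).IsLoop h2).mp hL⟩
    rcases hp with hp | hp
    · exact hp.2 this.2
    · exact hp.2 this.1
  have hR : ¬ (smooth w b.smoothing).IsLoop (rightComp b.smoothing l) := fun k => hL (h2 ▸ k)
  have c1 := fun j => mem_closings_zero H h (m := j)
  have c2 := fun j => mem_redLayers_zero h (m := j)
  have c3 := fun j => mem_closings_one H h (m := j)
  have c4 := fun j => mem_redLayers_one h hs (m := j)
  simp only [hL, hR, notMem_red hL, notMem_red hR, false_and, or_false] at c3 c4
  rw [dotCount_merge h h1 h2, uValue_merge h1 h2, if_neg (notMem_red hL)]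
  rcases hp with ⟨hp, hP⟩ | ⟨hp, hP⟩
  · obtain ⟨k, hk⟩ := exists_maxLayer H hp
    simp only [hp, hP, hk, notMem_red hP, true_and, false_and, or_false, add_left_inj] at c1 c2
    refine ⟨k, notMem_awayTops H (near_left _ _) hp hk, c1, c3, c4, ?_⟩
    by_cases hr : leftComp a.smoothing l ∈ a.red
    · simp only [hr, true_and] at c2
      refine Or.inl ⟨?_, ?_, c2⟩
      · rw [if_neg fun k => k.2 hr, if_neg (notMem_blue hP)]
      · simp [hr, notMem_red hP, hk]
    · simp only [hr, false_and, or_false] at c2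
      exact Or.inr ⟨by rw [if_pos ((mem_blue_iff hp).2 hr)]; omega, c2⟩
  · obtain ⟨k, hk⟩ := exists_maxLayer H hp
    simp only [hp, hP, hk, notMem_red hP, true_and, false_and, false_or, add_left_inj] at c1 c2
    refine ⟨k, notMem_awayTops H (near_cup _ _) hp hk, c1, c3, c4, ?_⟩
    by_cases hr : cupComp a.smoothing l ∈ a.red
    · simp only [hr, true_and] at c2
      refine Or.inl ⟨?_, ?_, c2⟩
      · rw [if_neg (notMem_blue hP), if_neg fun k => k.2 hr]
      · simp [hr, notMem_red hP, hk]
    · simp only [hr, false_and, or_false] at c2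
      exact Or.inr ⟨by rw [if_pos ((mem_blue_iff hp).2 hr)]; omega, c2⟩

/-- The layers of the loops, if a loop is split off from an arc. -/
theorem layers_of_split_arc (H : ∀ l : Fin w.length, w.get l = pos l)
    (h : Raises w a.smoothing b.smoothing l) (hs : SameAway a b l)
    (h1 : leftComp a.smoothing l = cupComp a.smoothing l)
    (h2 : leftComp b.smoothing l ≠ rightComp b.smoothing l)
    (hp : Xor ((smooth w b.smoothing).IsLoop (leftComp b.smoothing l))
      ((smooth w b.smoothing).IsLoop (rightComp b.smoothing l))) :
    ∃ k, k ∉ awayTops a.smoothing l ∧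
      (∀ j, j ∈ closings (bits a.smoothing) ↔ j ∈ awayTops a.smoothing l) ∧
      (∀ j, j ∈ closings (bits b.smoothing) ↔ j ∈ awayTops a.smoothing l ∨ k = j) ∧
      (∀ j, j ∈ redLayers a ↔ j ∈ awayRed a l) ∧
      (dotCount a b (Sum.inl (leftComp a.smoothing l)) = 0 ∧ uValue a b l = k + 1 ∧
          (∀ j, j ∈ redLayers b ↔ j ∈ awayRed a l) ∨
        dotCount a b (Sum.inl (leftComp a.smoothing l)) ≠ 0 ∧
          (∀ j, j ∈ redLayers b ↔ j ∈ awayRed a l ∨ k = j)) := by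
  classical
  have hL : ¬ (smooth w a.smoothing).IsLoop (leftComp a.smoothing l) := by
    intro hL
    have := (isLoop_near h).1 ⟨hL, (congrArg (smooth w _).IsLoop h1).mp hL⟩
    rcases hp with hp | hp
    · exact hp.2 this.2
    · exact hp.2 this.1
  have hR : ¬ (smooth w a.smoothing).IsLoop (cupComp a.smoothing l) := fun k => hL (h1 ▸ k)
  have c1 := fun j => mem_closings_zero H h (m := j)
  have c2 := fun j => mem_redLayers_zero h (m := j)
  have c3 := fun j => mem_closings_one H h (m := j)
  have c4 := fun j => mem_redLayers_one h hs (m := j)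
  simp only [hL, hR, notMem_red hL, notMem_red hR, false_and, or_false] at c1 c2
  rw [dotCount_split h h1 h2, uValue_split h1 h2, if_neg (notMem_blue hL), awayTops_raise h]
  rw [awayTops_raise h] at c1 c3
  rcases hp with ⟨hp, hP⟩ | ⟨hp, hP⟩
  · obtain ⟨k, hk⟩ := exists_maxLayer H hp
    simp only [hp, hP, hk, notMem_red hP, true_and, false_and, or_false, add_left_inj] at c3 c4
    refine ⟨k, notMem_awayTops H (near_left _ _) hp hk, c1, c3, c2, ?_⟩
    by_cases hr : leftComp b.smoothing l ∈ b.red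
    · simp only [hr, true_and] at c4
      exact Or.inr ⟨by rw [if_pos hr]; omega, c4⟩
    · simp only [hr, false_and, or_false] at c4
      refine Or.inl ⟨?_, ?_, c4⟩
      · rw [if_neg hr, if_neg (notMem_red hP)]
      · simp [mem_blue_iff hp, hr, notMem_blue hP, hk]
  · obtain ⟨k, hk⟩ := exists_maxLayer H hp
    simp only [hp, hP, hk, notMem_red hP, true_and, false_and, false_or, add_left_inj] at c3 c4
    refine ⟨k, notMem_awayTops H (near_right _ _) hp hk, c1, c3, c2, ?_⟩
    by_cases hr : rightComp b.smoothing l ∈ b.red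
    · simp only [hr, true_and] at c4
      exact Or.inr ⟨by rw [if_pos hr]; omega, c4⟩
    · simp only [hr, false_and, or_false] at c4
      refine Or.inl ⟨?_, ?_, c4⟩
      · rw [if_neg hr, if_neg (notMem_red hP)]
      · simp [mem_blue_iff hp, hr, notMem_blue hP, hk]

theorem isoAt_of_merge_arc (H : ∀ l : Fin w.length, w.get l = pos l)
    (h : Raises w a.smoothing b.smoothing l) (hs : SameAway a b l)
    (h1 : leftComp a.smoothing l ≠ cupComp a.smoothing l)
    (h2 : leftComp b.smoothing l = rightComp b.smoothing l)
    (hp : Xor ((smooth w a.smoothing).IsLoop (leftComp a.smoothing l))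
      ((smooth w a.smoothing).IsLoop (cupComp a.smoothing l)))
    (hD : dotCount a b (Sum.inl (leftComp a.smoothing l)) = 0) : IsoAt a b l := by
  obtain ⟨k, hk, c1, c2, c3, ⟨-, hu, c4⟩ | ⟨h', -⟩⟩ := layers_of_merge_arc H h hs h1 h2 hp
  · have hb := bits_raise h
    refine ⟨⟨k, hu, IsoMove.of_remove hb.1 hb.2 (awayRed_subset a l) hk c4 c2 c3⟩, ?_⟩
    refine isIsomorphism_of_near h hs ?_ (fun _ => Xor.or hp) fun h => absurd h2 h
    rw [hD, if_neg]
    exact fun k => hp.elim (fun h => h.2 k.2) fun h => h.2 k.1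
  · exact absurd hD h'

theorem isoAt_of_split_arc (H : ∀ l : Fin w.length, w.get l = pos l)
    (h : Raises w a.smoothing b.smoothing l) (hs : SameAway a b l)
    (h1 : leftComp a.smoothing l = cupComp a.smoothing l)
    (h2 : leftComp b.smoothing l ≠ rightComp b.smoothing l)
    (hp : Xor ((smooth w b.smoothing).IsLoop (leftComp b.smoothing l))
      ((smooth w b.smoothing).IsLoop (rightComp b.smoothing l)))
    (hD : dotCount a b (Sum.inl (leftComp a.smoothing l)) = 0) : IsoAt a b l := by
  obtain ⟨k, hk, c1, c2, c3, ⟨-, hu, c4⟩ | ⟨h', -⟩⟩ := layers_of_split_arc H h hs h1 h2 hp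
  · have hb := bits_raise h
    refine ⟨⟨k, hu, IsoMove.of_add hb.1 hb.2 hk c3 c1 c2 c4⟩, ?_⟩
    refine isIsomorphism_of_near h hs ?_ (fun h => absurd h1 h) fun _ => Xor.or hp
    rw [hD, if_neg]
    rw [isLoop_near h]
    exact fun k => hp.elim (fun h => h.2 k.2) fun h => h.2 k.1
  · exact absurd hD h'

/-- Every edge is an isomorphism or increases the shift. -/
theorem isoAt_or_of_isEdge (H : ∀ l : Fin w.length, w.get l = pos l)
    (h : Raises w a.smoothing b.smoothing l) (he : IsEdge deloopedD a b) :
    IsoAt a b l ∨ a.shift < b.shift ∧ ∀ m m', ¬ (deloopedD a b).IsIsomorphism m m' := by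
  have hs := sameAway_of_isEdge h he
  have hsh := shift_raise H h
  have fa := finite_closings a.smoothing
  have fr := finite_redLayers H a
  rcases raise_cases h with ⟨h1, h2, hloop⟩ | ⟨h1, h2, hloop⟩ | ⟨h1, h2, h3, h4, h5, h6⟩
  · by_cases hb : (smooth w a.smoothing).IsLoop (leftComp a.smoothing l) ∧
        (smooth w a.smoothing).IsLoop (cupComp a.smoothing l)
    · exact Or.inl (isoAt_of_merge_loops H h hs h1 h2 hb.1 hb.2
        (dotCount_of_isEdge he ((noArcs_near_iff h).2 hb)))
    have hx := (xor_iff_or_and_not_and _ _).2 ⟨hloop, hb⟩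
    by_cases hD : dotCount a b (Sum.inl (leftComp a.smoothing l)) = 0
    · exact Or.inl (isoAt_of_merge_arc H h hs h1 h2 hx hD)
    -- A blue loop is merged with an arc: one loop fewer and the same red loops, so the shift grows
    -- by `2`.
    refine Or.inr ⟨?_, not_isIsomorphism_of_dots h hb hD⟩
    obtain ⟨k, hk, c1, c2, c3, ⟨h', -⟩ | ⟨-, c4⟩⟩ := layers_of_merge_arc H h hs h1 h2 hx
    · exact absurd h' hD
    rw [show redLayers b = redLayers a from Set.ext fun j => (c3 j).trans (c4 j).symm,
      insert_eq_of_mem_iff c2 c1, ncard_add (finite_closings _) ((c2 k).not.2 hk)] at hsh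
    omega
  · by_cases hb : (smooth w b.smoothing).IsLoop (leftComp b.smoothing l) ∧
        (smooth w b.smoothing).IsLoop (rightComp b.smoothing l)
    · exact Or.inl (isoAt_of_split_loops H h hs h1 h2 hb.1 hb.2
        (dotCount_of_isEdge he ((noArcs_near_iff h).2 ((isLoop_near h).2 hb))))
    have hx := (xor_iff_or_and_not_and _ _).2 ⟨hloop, hb⟩
    by_cases hD : dotCount a b (Sum.inl (leftComp a.smoothing l)) = 0
    · exact Or.inl (isoAt_of_split_arc H h hs h1 h2 hx hD)
    -- A red loop is split off from an arc, which again raises the shift by `2`.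
    refine Or.inr ⟨?_, not_isIsomorphism_of_dots h ((isLoop_near h).not.2 hb) hD⟩
    obtain ⟨k, hk, c1, c2, c3, ⟨h', -⟩ | ⟨-, c4⟩⟩ := layers_of_split_arc H h hs h1 h2 hx
    · exact absurd h' hD
    rw [insert_eq_of_mem_iff c3 c4, ncard_add fr
      ((c3 k).not.2 fun k => hk (awayRed_subset a l k)), insert_eq_of_mem_iff c1 c2,
      ncard_add fa ((c1 k).not.2 hk)] at hsh
    omega
  -- Two arcs are exchanged for two arcs; only the 1-smoothing counts, and the shift grows by `1`.
  · refine Or.inr ⟨?_, not_isIsomorphism_of_arcs h h1 h3 h4⟩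
    have c1 : closings (bits b.smoothing) = closings (bits a.smoothing) := Set.ext fun j => by
      rw [mem_closings_zero H h, mem_closings_one H h]
      simp only [h3, h4, h5, h6, false_and]
    have c2 : redLayers b = redLayers a := Set.ext fun j => by
      rw [mem_redLayers_zero h, mem_redLayers_one h hs]
      simp only [notMem_red h3, notMem_red h4, notMem_red h5, notMem_red h6, false_and]
    rw [c1, c2] at hsh
    omega

end Braid

end BarNatan

end

/-! ### The delooped complex as an instance of the model -/

noncomputable section

namespace BarNatan

section Braid

variable {w : List (Fin 3)} {a b : Cell w} {l : Fin w.length}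

theorem sameAway_of_layers (H : ∀ l : Fin w.length, w.get l = pos l)
    (h : Raises w a.smoothing b.smoothing l)
    (hR : ∀ m ∈ awayTops a.smoothing l, (m ∈ redLayers a ↔ m ∈ redLayers b)) :
    SameAway a b l := by
  intro v hv
  by_cases hloop : (smooth w a.smoothing).IsLoop (compAt w a.smoothing v)
  · obtain ⟨m, hm⟩ := exists_maxLayer H hloop
    rw [← mem_redLayers H hloop hm,
      ← mem_redLayers H ((isLoop_raise h hv).1 hloop) ((maxLayer_raise h hv).symm.trans hm)]
    exact hR m ⟨v, hv, hloop, hm⟩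
  · exact iff_of_false (notMem_red hloop) (notMem_red fun k => hloop ((isLoop_raise h hv).2 k))

/-- A blue loop is split off. -/
theorem isoAt_of_add (H : ∀ l : Fin w.length, w.get l = pos l)
    (h : Raises w a.smoothing b.smoothing l) {k : ℕ} (hk : k ∉ closings (bits a.smoothing))
    (hk' : k ∈ closings (bits b.smoothing)) (hR : redLayers b = redLayers a) : IsoAt a b l := by
  classical
  have hs : SameAway a b l := sameAway_of_layers H h fun m _ => by rw [hR]
  have haway : k ∉ awayTops a.smoothing l := fun h' => hk ((mem_closings_zero H h).2 (Or.inl h'))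
  rcases raise_cases h with ⟨h1, h2, hloop⟩ | ⟨h1, h2, hloop⟩ | ⟨-, -, -, -, h5, h6⟩
  -- A merge creates no closing: a merged loop has the top of one of its parts.
  · exfalso
    by_cases hb : (smooth w a.smoothing).IsLoop (leftComp a.smoothing l) ∧
        (smooth w a.smoothing).IsLoop (cupComp a.smoothing l)
    · have hmax := maxLayer_merge h h2
      have hL : maxLayer (leftComp b.smoothing l) = k + 1 := by
        rcases (mem_closings_one H h).1 hk' with h' | ⟨-, h'⟩ | ⟨-, h'⟩
        · exact absurd h' haway
        · exact h'
        · exact (congrArg maxLayer h2).trans h'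
      rcases max_choice (maxLayer (leftComp a.smoothing l)) (maxLayer (cupComp a.smoothing l))
        with e | e
      · exact hk ((mem_closings_zero H h).2
          (Or.inr (Or.inl ⟨hb.1, e.symm.trans (hmax.symm.trans hL)⟩)))
      · exact hk ((mem_closings_zero H h).2
          (Or.inr (Or.inr ⟨hb.2, e.symm.trans (hmax.symm.trans hL)⟩)))
    · obtain ⟨m, -, -, c2, -⟩ :=
        layers_of_merge_arc H h hs h1 h2 ((xor_iff_or_and_not_and _ _).2 ⟨hloop, hb⟩)
      exact haway ((c2 k).1 hk')
  · by_cases hb : (smooth w b.smoothing).IsLoop (leftComp b.smoothing l) ∧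
        (smooth w b.smoothing).IsLoop (rightComp b.smoothing l)
    · refine isoAt_of_split_loops H h hs h1 h2 hb.1 hb.2 ?_
      obtain ⟨hL, -⟩ := (isLoop_near h).2 hb
      have hmax := maxLayer_split h h1
      -- The part with top `k` is blue because `k` is no closing of `a`; the other part inherits
      -- both top and colour of the loop that is split. So there is exactly one dot.
      have hkr : k ∉ redLayers b := fun h' => hk (redLayers_subset H a (hR ▸ h'))
      have hpk : maxLayer (leftComp a.smoothing l) ≠ k + 1 := fun e =>
        hk ((mem_closings_zero H h).2 (Or.inr (Or.inl ⟨hL, e⟩)))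
      obtain ⟨M, hM⟩ := exists_maxLayer H hL
      have hLM := mem_redLayers H (a := a) hL hM
      rw [← hR] at hLM
      rw [dotCount_split h h1 h2, if_congr (mem_blue_iff hL) rfl rfl]
      rcases (mem_closings_one H h).1 hk' with h' | ⟨-, h'⟩ | ⟨-, h'⟩
      · exact absurd h' haway
      · have hRM : maxLayer (rightComp b.smoothing l) = M + 1 := by
          rcases max_choice (maxLayer (leftComp b.smoothing l))
            (maxLayer (rightComp b.smoothing l)) with e | e
          · exact absurd (hmax.trans (e.trans h')) hpk
          · exact e.symm.trans (hmax.symm.trans hM)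
        rw [if_neg (fun k' => hkr ((mem_redLayers H hb.1 h').2 k')),
          if_congr ((mem_redLayers H hb.2 hRM).symm.trans hLM) rfl rfl]
        split_ifs <;> rfl
      · have hRM : maxLayer (leftComp b.smoothing l) = M + 1 := by
          rcases max_choice (maxLayer (leftComp b.smoothing l))
            (maxLayer (rightComp b.smoothing l)) with e | e
          · exact e.symm.trans (hmax.symm.trans hM)
          · exact absurd (hmax.trans (e.trans h')) hpk
        rw [if_neg (c := rightComp b.smoothing l ∈ b.red)
            (fun k' => hkr ((mem_redLayers H hb.2 h').2 k')),
          if_congr ((mem_redLayers H hb.1 hRM).symm.trans hLM) rfl rfl]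
        split_ifs <;> rfl
    · have hx := (xor_iff_or_and_not_and _ _).2 ⟨hloop, hb⟩
      obtain ⟨m, hm, -, -, c3, ⟨hD, -⟩ | ⟨-, c4⟩⟩ := layers_of_split_arc H h hs h1 h2 hx
      · exact isoAt_of_split_arc H h hs h1 h2 hx hD
      · have := (c4 m).2 (Or.inr rfl)
        rw [hR, c3] at this
        exact absurd (awayRed_subset a l this) hm
  · rcases (mem_closings_one H h).1 hk' with h' | ⟨h', -⟩ | ⟨h', -⟩
    · exact absurd h' haway
    · exact absurd h' h5
    · exact absurd h' h6

/-- A red loop is merged at its highest layer. -/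
theorem isoAt_of_remove (H : ∀ l : Fin w.length, w.get l = pos l)
    (h : Raises w a.smoothing b.smoothing l) (hk : (l : ℕ) ∈ redLayers a)
    (hR : redLayers b = redLayers a \ {(l : ℕ)}) : IsoAt a b l := by
  classical
  have hcl := redLayers_subset H a hk
  obtain ⟨hp, hpk⟩ := isLoop_of_mem_closings H hcl
  have hpr : leftComp a.smoothing l ∈ a.red := (mem_redLayers H hp hpk).1 hk
  have hkb : (l : ℕ) ∉ closings (bits b.smoothing) := by
    rw [(bits_raise h).2, closings_raise_of_mem hcl]
    exact fun k => k.2 rfl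
  have haway := notMem_awayTops H (near_left a.smoothing l) hp hpk
  have hs : SameAway a b l := sameAway_of_layers H h fun m hm => by
    rw [hR, Set.mem_sdiff, Set.mem_singleton_iff]
    exact (and_iff_left fun (e : m = l) => haway (e ▸ hm)).symm
  rcases raise_cases h with ⟨h1, h2, -⟩ | ⟨h1, h2, -⟩ | ⟨-, -, h3, -⟩
  · by_cases hP : (smooth w a.smoothing).IsLoop (cupComp a.smoothing l)
    · refine isoAt_of_merge_loops H h hs h1 h2 hp hP ?_
      obtain ⟨hL, -⟩ := (isLoop_near h).1 ⟨hp, hP⟩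
      obtain ⟨M, hM⟩ := exists_maxLayer H hP
      have hMk : M ≠ l := by
        rintro rfl
        exact h1 (maxLayer_injective H hp hP (hpk.trans hM.symm))
      have hLM : maxLayer (leftComp b.smoothing l) = M + 1 := by
        have hmax := maxLayer_merge h h2
        rcases max_choice (maxLayer (leftComp a.smoothing l)) (maxLayer (cupComp a.smoothing l))
          with e | e
        · exact absurd ((mem_closings_one H h).2
            (Or.inr (Or.inl ⟨hL, hmax.trans (e.trans hpk)⟩))) hkb
        · exact hmax.trans (e.trans hM)
      have hLr : leftComp b.smoothing l ∈ b.red ↔ cupComp a.smoothing l ∈ a.red := by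
        rw [← mem_redLayers H hL hLM, ← mem_redLayers H hP hM, hR, Set.mem_sdiff,
          Set.mem_singleton_iff]
        exact and_iff_left hMk
      rw [dotCount_merge h h1 h2, if_neg fun k => k.2 hpr, if_congr (mem_blue_iff hP) rfl rfl,
        if_congr hLr rfl rfl]
      split_ifs <;> rfl
    · have hx : Xor ((smooth w a.smoothing).IsLoop (leftComp a.smoothing l))
        ((smooth w a.smoothing).IsLoop (cupComp a.smoothing l)) := Or.inl ⟨hp, hP⟩
      obtain ⟨m, -, -, -, -, ⟨hD, -⟩ | ⟨-, c4⟩⟩ := layers_of_merge_arc H h hs h1 h2 hx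
      · exact isoAt_of_merge_arc H h hs h1 h2 hx hD
      · exact absurd (awayRed_subset a l ((c4 l).1 hk)) haway
  -- A split cannot lose the closing in layer `l`, since one of the parts keeps the top of the loop.
  · exfalso
    have hb := (isLoop_near h).1 ⟨hp, (congrArg (smooth w _).IsLoop h1).mp hp⟩
    have hmax := maxLayer_split h h1
    rcases max_choice (maxLayer (leftComp b.smoothing l)) (maxLayer (rightComp b.smoothing l))
      with e | e
    · exact hkb ((mem_closings_one H h).2
        (Or.inr (Or.inl ⟨hb.1, e.symm.trans (hmax.symm.trans hpk)⟩)))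
    · exact hkb ((mem_closings_one H h).2
        (Or.inr (Or.inr ⟨hb.2, e.symm.trans (hmax.symm.trans hpk)⟩)))
  · exact absurd hp h3

/-- The value of `u` is recovered from the effect of the edge on closings and red layers, so the
minimum need not be computed again to place the edge in its stage. -/
theorem IsoMove.eq_of_add {x y : ℕ → Bool} {R S : Set ℕ} {i k m : ℕ} (h : IsoMove x y R S i m)
    (hR : R ⊆ closings x) (hk : k ∉ closings x) (hk' : k ∈ closings y) (hS : S = R) : m = k := by
  obtain ⟨h0, rfl, ⟨h1, h2, -⟩ | ⟨h1, -, h3⟩ | ⟨h1, -, h3, -⟩ | ⟨-, -, j, -, h3, -, h5⟩⟩ := h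
  · rw [closings_raise_of_new h0 h2 h1] at hk'
    exact (hk'.resolve_right hk).symm
  · rw [← hS, h3] at h1
    exact absurd rfl h1.2
  · rw [← hS, h3] at h1
    exact absurd rfl h1.2
  · have : j ∈ S := h5 ▸ Set.mem_insert _ _
    exact absurd (hR (hS ▸ this)) h3

theorem IsoMove.eq_of_remove {x y : ℕ → Bool} {R S : Set ℕ} {k m : ℕ} (h : IsoMove x y R S k m)
    (hR : R ⊆ closings x) (hk : k ∈ R) (hS : S = R \ {k}) : m = k := by
  have hkS : k ∉ S := fun h => (hS ▸ h).2 rfl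
  obtain ⟨-, rfl, ⟨-, -, h3⟩ | ⟨-, -, h3⟩ | ⟨-, -, h3, -⟩ | ⟨-, -, j, -, h3, -, h5⟩⟩ := h
  · exact absurd (h3 ▸ hk) hkS
  · by_contra hne
    exact hkS (h3 ▸ ⟨hk, fun e => hne e.symm⟩)
  · by_contra hne
    exact hkS (h3 ▸ ⟨hk, fun e => hne e.symm⟩)
  · have : j ∈ S := h5 ▸ Set.mem_insert _ _
    exact absurd (hR (hS ▸ this).1) h3

theorem raises_of_bits {j : ℕ} (h0 : bits a.smoothing j = false)
    (h1 : bits b.smoothing = Function.update (bits a.smoothing) j true) :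
    ∃ l : Fin w.length, (l : ℕ) = j ∧ Raises w a.smoothing b.smoothing l := by
  have hj : j < w.length := by
    by_contra! hj
    rw [bits_of_le _ hj] at h0
    cases h0
  refine ⟨⟨j, hj⟩, rfl, (bits_val a.smoothing ⟨j, hj⟩).symm.trans h0, bits_injective ?_⟩
  rw [h1, bits_update]

theorem IsoAt.mem_isoEdges (H : ∀ l : Fin w.length, w.get l = pos l)
    (h : Raises w a.smoothing b.smoothing l) (hi : IsoAt a b l) :
    ∃ k, (a, b) ∈ isoEdges w (l + 1) (k + 1) ∧
      IsoMove (bits a.smoothing) (bits b.smoothing) (redLayers a) (redLayers b) l k := by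
  obtain ⟨⟨k, hu, hm⟩, hiso⟩ := hi
  obtain ⟨he, hiso⟩ := hiso a.shift
  refine ⟨k, ⟨he, ?_, l, h, rfl, hu⟩, hm⟩
  rwa [← shift_eq_of_isoMove H h hm]

/-- The layer and the value of `u` of an isomorphism, counted from `0`. -/
theorem isoMove_of_mem_isoEdges (H : ∀ l : Fin w.length, w.get l = pos l) {j k : ℕ}
    (h : (a, b) ∈ isoEdges w j k) : ∃ i m, j = i + 1 ∧ k = m + 1 ∧
      IsoMove (bits a.smoothing) (bits b.smoothing) (redLayers a) (redLayers b) i m := by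
  obtain ⟨he, hiso, l, hl, rfl, hu⟩ := h
  rcases isoAt_or_of_isEdge H hl he with ⟨⟨m, hm, hmove⟩, -⟩ | ⟨-, h'⟩
  · exact ⟨l, m, rfl, hu.symm.trans hm, hmove⟩
  · exact absurd hiso (h' _ _)

theorem greedyStage_def (j k : ℕ) : greedyStage w j k = {e | e ∈ isoEdges w j k ∧
    ∀ l m : ℕ, (m < k ∨ (m = k ∧ j < l ∧ l ≤ k)) → ∀ f ∈ greedyStage w l m, ¬ Adjacent e f} := by
  rw [greedyStage]

theorem exists_of_mem_greedyStage (H : ∀ l : Fin w.length, w.get l = pos l) {j k : ℕ}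
    {e : Cell w × Cell w} (h : e ∈ greedyStage w j k) : ∃ i m, j = i + 1 ∧ k = m + 1 := by
  rw [greedyStage_def] at h
  obtain ⟨i, m, hi, hm, -⟩ := isoMove_of_mem_isoEdges H h.1
  exact ⟨i, m, hi, hm⟩

variable (w) in
/-- The greedy matching on the delooped complex, in terms of the layers of the loops. -/
def greedyModel (H : ∀ l : Fin w.length, w.get l = pos l) : MatchingModel (Cell w) where
  bit a := bits a.smoothing
  red := redLayers
  len := w.length
  bit_of_le a _ h := bits_of_le a.smoothing h
  red_sub := redLayers_subset H
  ext _ _ := Cell.ext_of_layers H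
  exists_cell _ _ := exists_cell_of_layers H
  -- Layers and values of `u` are counted from `1` in `isoEdges` and `greedyStage`, but from `0` in
  -- the model.
  iso j k a b := (a, b) ∈ isoEdges w (j + 1) (k + 1)
  iso_move h := by
    obtain ⟨i, m, hi, hm, hmove⟩ := isoMove_of_mem_isoEdges H h
    obtain rfl := Nat.succ_injective hi
    obtain rfl := Nat.succ_injective hm
    exact hmove
  iso_add h0 h1 hk hk' hR := by
    obtain ⟨l, rfl, hl⟩ := raises_of_bits h0 h1
    obtain ⟨m, hm, hmove⟩ := (isoAt_of_add H hl hk hk' hR).mem_isoEdges H hl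
    obtain rfl := hmove.eq_of_add (redLayers_subset H _) hk hk' hR
    exact hm
  iso_remove {k a b} hk h1 hR := by
    obtain ⟨l, rfl, hl⟩ := raises_of_bits (redLayers_subset H a hk).1 h1
    obtain ⟨m, hm, hmove⟩ := (isoAt_of_remove H hl hk hR).mem_isoEdges H hl
    obtain rfl := hmove.eq_of_remove (redLayers_subset H a) hk hR
    exact hm
  mat j k a b := (a, b) ∈ greedyStage w (j + 1) (k + 1)
  mat_iso h := by
    rw [greedyStage_def] at h
    exact h.1
  mat_early {j k a b l m c d} h h' he := by
    rw [greedyStage_def] at h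
    refine h.2 (l + 1) (m + 1) ?_ _ h'
    rcases he with he | ⟨rfl, h1, h2⟩
    · exact Or.inl (by omega)
    · exact Or.inr ⟨rfl, by omega, by omega⟩
  iso_mat {j k a b} h := by
    by_contra! hn
    refine hn.1 ?_
    rw [greedyStage_def]
    refine ⟨h, fun l m he f hf hadj => ?_⟩
    obtain ⟨i, m, rfl, rfl⟩ := exists_of_mem_greedyStage H hf
    refine hn.2 i m f.1 f.2 ?_ hf hadj
    rcases he with he | ⟨e, h1, h2⟩
    · exact Or.inl (by omega)
    · exact Or.inr ⟨by omega, by omega, by omega⟩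

theorem finite_cell (H : ∀ l : Fin w.length, w.get l = pos l) : Finite (Cell w) := by
  refine Finite.of_injective (β := Smoothing w × Set (Fin w.length))
    (fun a => (a.smoothing, {l | (l : ℕ) ∈ redLayers a})) fun a b hab => ?_
  obtain ⟨h1, h2⟩ := Prod.ext_iff.1 hab
  dsimp only at h1 h2
  refine Cell.ext_of_layers H (by rw [h1]) (Set.ext fun m => ?_)
  by_cases hm : m < w.length
  · exact Set.ext_iff.1 h2 ⟨m, hm⟩
  · have key : ∀ c : Cell w, m ∉ redLayers c := fun c hc => by
      have := (redLayers_subset H c hc).1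
      rw [bits_of_le _ (not_lt.1 hm)] at this
      cases this
    exact iff_of_false (key a) (key b)

end Braid

end BarNatan

end

/-! ### The greedy matching is a Morse matching -/

noncomputable section

namespace BarNatan

section Braid

variable {w : List (Fin 3)}

theorem mem_greedyMatching_iff (H : ∀ l : Fin w.length, w.get l = pos l) {a b : Cell w} :
    (a, b) ∈ greedyMatching w ↔ ∃ j k, (greedyModel w H).mat j k a b := by
  rw [greedyMatching]
  simp only [Set.mem_iUnion]
  constructor
  · rintro ⟨j, k, h⟩
    obtain ⟨i, m, rfl, rfl⟩ := exists_of_mem_greedyStage H h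
    exact ⟨i, m, h⟩
  · rintro ⟨j, k, h⟩
    exact ⟨j + 1, k + 1, h⟩

theorem isMorseMatching_greedyMatching (H : ∀ l : Fin w.length, w.get l = pos l) :
    IsMorseMatching Cell.shift (deloopedD (w := w)) (greedyMatching w) where
  edges := by
    rintro ⟨a, b⟩ h
    obtain ⟨j, k, h⟩ := (mem_greedyMatching_iff H).1 h
    exact ((greedyModel w H).mat_iso h).1
  finite := by
    have := finite_cell H
    exact Set.toFinite _
  matching := by
    rintro ⟨a, b⟩ h ⟨c, d⟩ h' hne hadj
    obtain ⟨j, k, h⟩ := (mem_greedyMatching_iff H).1 h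
    obtain ⟨l, m, h'⟩ := (mem_greedyMatching_iff H).1 h'
    rcases hadj with hadj | hadj | hadj | hadj
    · obtain rfl : a = c := hadj
      obtain ⟨-, -, rfl⟩ := MatchingModel.source_unique h h'
      exact hne rfl
    · obtain rfl : a = d := hadj
      exact MatchingModel.not_source_of_target h' h
    · obtain rfl : b = c := hadj
      exact MatchingModel.not_source_of_target h h'
    · obtain rfl : b = d := hadj
      obtain ⟨-, -, rfl⟩ := MatchingModel.target_unique h h'
      exact hne rfl
  iso := by
    rintro ⟨a, b⟩ h
    obtain ⟨j, k, h⟩ := (mem_greedyMatching_iff H).1 h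
    exact ((greedyModel w H).mat_iso h).2.1
  acyclic := by
    intro a ha
    refine (greedyModel w H).acyclic Cell.shift (IsEdge deloopedD) ?_ ?_ ?_ a
      (Relation.TransGen.mono ?_ _ _ ha)
    · intro a b he
      obtain ⟨l, hl⟩ := exists_raises_of_isEdge he
      rcases isoAt_or_of_isEdge H hl he with hi | hi
      · obtain ⟨k, -, hm⟩ := hi.mem_isoEdges H hl
        exact (shift_eq_of_isoMove H hl hm).le
      · exact hi.1.le
    · intro a b he hs
      obtain ⟨l, hl⟩ := exists_raises_of_isEdge he
      rcases isoAt_or_of_isEdge H hl he with hi | hi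
      · obtain ⟨k, hm, -⟩ := hi.mem_isoEdges H hl
        exact ⟨l, k, hm⟩
      · exact absurd hs hi.1.ne
    · intro j k a b h
      have hm := (greedyModel w H).mat_iso h
      have hmove : IsoMove (bits a.smoothing) (bits b.smoothing) (redLayers a) (redLayers b) j k :=
        (greedyModel w H).iso_move hm
      obtain ⟨l', rfl, hl'⟩ := raises_of_bits hmove.1 hmove.2.1
      exact shift_eq_of_isoMove H hl' hmove
    · rintro a b (⟨he, hn⟩ | h)
      · exact Or.inl ⟨he, fun l m hm => hn ((mem_greedyMatching_iff H).2 ⟨l, m, hm⟩)⟩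
      · exact Or.inr ((mem_greedyMatching_iff H).1 h)

end Braid

/-- The periodicity of the letters is the only property of the word that the argument uses. -/
theorem torusWord_getElem (n m : ℕ) (h : m < (torusWord n).length) :
    (torusWord n)[m] = pos m := by
  induction n generalizing m with
  | zero => simp [torusWord] at h
  | succ n ih =>
    have he : torusWord (n + 1) = [0, 1, 2] ++ torusWord n := by
      simp [torusWord, List.replicate_succ]
    simp only [he] at h ⊢
    by_cases hm : m < 3
    · rw [List.getElem_append_left hm]
      interval_cases m <;> rfl
    · rw [List.getElem_append_right (not_lt.1 hm)]
      refine (ih _ _).trans (Fin.ext ?_)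
      simp only [pos, List.length_cons, List.length_nil]
      omega

end BarNatan

end

theorem mainTheorem7 (n : ℕ) :
    BarNatan.IsMorseMatching BarNatan.Cell.shift
      (BarNatan.deloopedD (w := BarNatan.torusWord n))
      (BarNatan.greedyMatching (BarNatan.torusWord n)) :=
  BarNatan.isMorseMatching_greedyMatching fun l => BarNatan.torusWord_getElem n l l.2
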